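/- **Theorem 3.1.** Knots are oriented and tame in $S^3$. Knot diagrams are considered on the oriented sphere $S^2$, up to orientation preserving homeomorphism of $S^2$. For a knot diagram $D$ let $c(D)$ be its number of crossings. If $c(D)\ge 1$, let $b(D)$ be its number of overpasses, that is, the unique $k$ such that the knot can be divided cyclically into arcs $o_1,u_1,\dots,o_k,u_k$ where every overpass $o_i$ contains at least one overcrossing and no undercrossing, and every underpass $u_i$ contains at least one undercrossing and no overcrossing; put $b(D)=0$ if $c(D)=0$. For coprime integers $p\ge 1$ and $q$, the standard diagram of the $(p,q)$-torus knot is the closure of the braid $(\sigma_1\sigma_2\cdots\sigma_{p-1})^{q}$ on $p$ strands if $q\ge 0$, and of $(\sigma_1^{-1}\sigma_2^{-1}\cdots\sigma_{p-1}^{-1})^{|q|}$ if $q<0$. Let $D$ be a diagram of a nontrivial knot $K$ such that no diagram of $K$ has fewer crossings than $D$, and suppose that $$c(D)=b(D)\,\bigl(b(D)-2\bigr).$$ Then $D$ is the standard diagram of the $(b(D)-1,\,b(D))$-torus knot or the standard diagram of the $(b(D)-1,\,-b(D))$-torus knot. Hence $K$ is the $(b(D)-1,\,b(D))$-torus knot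 or the $(b(D)-1,\,-b(D))$-torus knot. -/

import Mathlib

/-!
Oriented knot diagrams on the oriented 2-sphere, up to orientation preserving homeomorphism of the
sphere, are encoded by their signed Gauss codes: travel once along the oriented knot and record
cyclically each passage through a crossing, together with the name of the crossing, its sign, and
whether the passage is the overcrossing or the undercrossing.  A signed Gauss code comes from a
diagram on the sphere if and only if the surface obtained from it by gluing in the faces has Euler
characteristic two.  Knots (knot types) are classes of diagrams modulo the Reidemeister moves.
-/

namespace KnotTheory

/-- A crossing: its name and its sign. -/
abbrev Crossing := ℕ × ℤˣ

/-- A passage of the knot through a crossing: `(x, true)` is the overcrossing of `x` and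
`(x, false)` is the undercrossing of `x`. -/
abbrev Passage := Crossing × Bool

/-- A signed Gauss code: a cyclic word of passages without repetition, in which the overcrossing of
`x` occurs if and only if the undercrossing of `x` does. -/
structure GaussCode where
  word : Cycle Passage
  nodup : word.Nodup
  paired : ∀ (x : Crossing) (b : Bool), (x, b) ∈ word → (x, !b) ∈ word

namespace GaussCode

/-- The crossings of the diagram. -/
def crossings (D : GaussCode) : Finset Crossing := D.word.toFinset.image Prod.fst

/-- The number `c(D)` of crossings. -/
def crossingNumber (D : GaussCode) : ℕ := D.crossings.card

/-- The passage that comes next along the oriented knot. -/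
def succ (D : GaussCode) : Equiv.Perm Passage := D.word.formPerm D.nodup

/-- The directed edge `(m, d)` leaves the passage `m` along the orientation of the knot if `d = 1`
and against it if `d = -1`.  `D.turnLeft (m, d)` is the directed edge that follows it on the
boundary of the face to its left: run along the edge up to the next passage `m'`, then take the
leftmost turn onto the other strand of that crossing.  (At a positive crossing the understrand
crosses the overstrand from right to left, so that a left turn from the overstrand keeps the
direction along the knot and a left turn from the understrand reverses it; at a negative crossing
it is the other way round.) -/
def turnLeft (D : GaussCode) (e : Passage × ℤˣ) : Passage × ℤˣ :=
  let m' : Passage := (D.succ ^ (e.2 : ℤ)) e.1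
  ((m'.1, !m'.2), e.2 * m'.1.2 * (if m'.2 then 1 else -1))

/-- The faces of the diagram, each given as the set of directed edges on its boundary (the ones
that have the face on their left). -/
def faces (D : GaussCode) : Set (Set (Passage × ℤˣ)) :=
  {F | ∃ e : Passage × ℤˣ, e.1 ∈ D.word ∧ F = Set.range fun k : ℕ => D.turnLeft^[k] e}

/-- The code is realized by a diagram on the sphere: vertices minus edges plus faces is two, where
`c(D)` vertices of degree four have `2 c(D)` edges.  The code without crossings is the simple
closed curve. -/
def IsPlanar (D : GaussCode) : Prop :=
  D.word = Cycle.nil ∨ (D.crossingNumber : ℤ) - 2 * D.crossingNumber + D.faces.ncard = 2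

/-- `s = [(o₁, u₁), …, (o_k, u_k)]` is an over-underpass sequence of the diagram: the knot runs
cyclically through `o₁, u₁, …, o_k, u_k`, where every overpass `o_i` has at least one overcrossing
and no undercrossing, and every underpass `u_i` has at least one undercrossing and no
overcrossing. -/
def IsOverUnderpassSequence (D : GaussCode) (s : List (List Passage × List Passage)) : Prop :=
  (∀ a ∈ s, (a.1 ≠ [] ∧ ∀ m ∈ a.1, m.2 = true) ∧ (a.2 ≠ [] ∧ ∀ m ∈ a.2, m.2 = false)) ∧
    D.word = ((s.flatMap fun a => a.1 ++ a.2 : List Passage) : Cycle Passage)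

/-- The number `b(D)` of overpasses: the length of an over-underpass sequence.  All of them have
the same length; it is `0` when there is no crossing. -/
noncomputable def overpassNumber (D : GaussCode) : ℕ :=
  sInf {k | ∃ s, D.IsOverUnderpassSequence s ∧ s.length = k}

end GaussCode

/-- A knot diagram on the sphere. -/
structure KnotDiagram extends GaussCode where
  planar : toGaussCode.IsPlanar

/-- The same code up to the names of the crossings. -/
def SameCode (w w' : Cycle Passage) : Prop :=
  ∃ f : Crossing ≃ Crossing, (∀ x, (f x).2 = x.2) ∧ w.map (Prod.map f id) = w'

/-- `x, y` if `t = 1`, and `y, x` if `t = -1`. -/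
def inOrder (t : ℤˣ) (x y : Passage) : List Passage := if t = 1 then [x, y] else [y, x]

/-- The Reidemeister moves on codes, together with the renaming of crossings. -/
inductive Move : Cycle Passage → Cycle Passage → Prop
  | rename {w w' : Cycle Passage} (h : SameCode w w') : Move w w'
  /-- A kink is added. -/
  | r1 (x : Crossing) (b : Bool) (l : List Passage) :
      Move (l : Cycle Passage) (((x, b) :: (x, !b) :: l : List Passage) : Cycle Passage)
  /-- A strand is pushed over another strand with the same direction. -/
  | r2_parallel (x y : Crossing) (h : y.2 = -x.2) (b : Bool) (l₁ l₂ : List Passage) :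
      Move ((l₁ ++ l₂ : List Passage) : Cycle Passage)
        (([(x, b), (y, b)] ++ l₁ ++ [(x, !b), (y, !b)] ++ l₂ : List Passage) : Cycle Passage)
  /-- A strand is pushed over another strand with the opposite direction. -/
  | r2_antiparallel (x y : Crossing) (h : y.2 = -x.2) (b : Bool) (l₁ l₂ : List Passage) :
      Move ((l₁ ++ l₂ : List Passage) : Cycle Passage)
        (([(x, b), (y, b)] ++ l₁ ++ [(y, !b), (x, !b)] ++ l₂ : List Passage) : Cycle Passage)
  /-- Three strands bound a triangular face; the top one is moved across the crossing of the other
  two.  Here `x` is the crossing of the top and the middle strand, `y` of the top and the bottom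
  strand, `z` of the middle and the bottom strand; `t₁`, `t₂`, `t₃` tell the order in which the
  top, middle and bottom strand run through their two crossings, and `δ` is the orientation of the
  triangle `x y z`.  The knot runs through the strands in the cyclic order top, middle, bottom. -/
  | r3_tmb (δ t₁ t₂ t₃ : ℤˣ) (x y z : Crossing)
      (hx : x.2 = δ * t₁ * t₂) (hy : y.2 = δ * t₁ * t₃) (hz : z.2 = δ * t₂ * t₃)
      (l₁ l₂ l₃ : List Passage) :
      Move
        ((inOrder t₁ (x, true) (y, true) ++ l₁ ++ inOrder t₂ (x, false) (z, true) ++ l₂ ++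
          inOrder t₃ (y, false) (z, false) ++ l₃ : List Passage) : Cycle Passage)
        ((inOrder (-t₁) (x, true) (y, true) ++ l₁ ++ inOrder (-t₂) (x, false) (z, true) ++ l₂ ++
          inOrder (-t₃) (y, false) (z, false) ++ l₃ : List Passage) : Cycle Passage)
  /-- The same move when the cyclic order of the strands is top, bottom, middle. -/
  | r3_tbm (δ t₁ t₂ t₃ : ℤˣ) (x y z : Crossing)
      (hx : x.2 = δ * t₁ * t₂) (hy : y.2 = δ * t₁ * t₃) (hz : z.2 = δ * t₂ * t₃)
      (l₁ l₂ l₃ : List Passage) :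
      Move
        ((inOrder t₁ (x, true) (y, true) ++ l₁ ++ inOrder t₃ (y, false) (z, false) ++ l₂ ++
          inOrder t₂ (x, false) (z, true) ++ l₃ : List Passage) : Cycle Passage)
        ((inOrder (-t₁) (x, true) (y, true) ++ l₁ ++ inOrder (-t₃) (y, false) (z, false) ++ l₂ ++
          inOrder (-t₂) (x, false) (z, true) ++ l₃ : List Passage) : Cycle Passage)

namespace KnotDiagram

/-- Two diagrams are diagrams of the same knot if they are related by a finite sequence of
Reidemeister moves and inverses of such moves, through knot diagrams. -/
def SameKnot (D E : KnotDiagram) : Prop :=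
  Relation.EqvGen (fun D₁ D₂ : KnotDiagram => Move D₁.word D₂.word) D E

/-- The knot of `D` is nontrivial: it has no diagram without crossings. -/
def IsNontrivial (D : KnotDiagram) : Prop :=
  ¬ ∃ E : KnotDiagram, D.SameKnot E ∧ E.word = Cycle.nil

/-- `D` is minimal with respect to crossings among the diagrams of its knot. -/
def IsCrossingMinimal (D : KnotDiagram) : Prop :=
  ∀ E : KnotDiagram, D.SameKnot E → D.crossingNumber ≤ E.crossingNumber

end KnotDiagram

/-- Run once along the braid word, upwards from position `j`, and record the passages.  Positions
are numbered `0, 1, 2, …` from left to right; the letter `(i, ε)` is the crossing of sign `ε`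
between the strands at the positions `i` and `i + 1`, where the strand that goes from `i` to
`i + 1` is the upper one if `ε = 1` and the lower one if `ε = -1`.  The crossings are named by
`n, n + 1, n + 2, …` from bottom to top.  The second component is the position at the top. -/
def traverseBraid : List (ℕ × ℤˣ) → ℕ → ℕ → List Passage × ℕ
  | [], _, j => ([], j)
  | (i, ε) :: β, n, j =>
    if j = i then
      let r := traverseBraid β (n + 1) (i + 1)
      (((n, ε), decide (ε = 1)) :: r.1, r.2)
    else if j = i + 1 then
      let r := traverseBraid β (n + 1) i
      (((n, ε), decide (ε = -1)) :: r.1, r.2)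
    else traverseBraid β (n + 1) j

/-- Run `m` times along the closed braid, from position `j`. -/
def traverseClosedBraid (β : List (ℕ × ℤˣ)) : ℕ → ℕ → List Passage
  | 0, _ => []
  | m + 1, j => (traverseBraid β 0 j).1 ++ traverseClosedBraid β m (traverseBraid β 0 j).2

/-- The code of the closure of the braid `β` on `p` strands, in case it is a knot: starting at the
leftmost strand, the knot closes up after running `p` times along the braid. -/
def closedBraidCode (p : ℕ) (β : List (ℕ × ℤˣ)) : Cycle Passage :=
  (traverseClosedBraid β p 0 : Cycle Passage)

/-- The braid `(σ₁ σ₂ ⋯ σ_{p-1})^q` for `q ≥ 0` and `(σ₁⁻¹ σ₂⁻¹ ⋯ σ_{p-1}⁻¹)^|q|` for `q < 0`. -/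
def torusBraid (p : ℕ) (q : ℤ) : List (ℕ × ℤˣ) :=
  (List.replicate q.natAbs
    ((List.range (p - 1)).map fun i => (i, if 0 ≤ q then (1 : ℤˣ) else -1))).flatten

namespace KnotDiagram

/-- `D` is the standard diagram of the `(p, q)`-torus knot, where `p ≥ 1` and `q` are coprime: the
closure of the braid `(σ₁ ⋯ σ_{p-1})^q` on `p` strands. -/
def IsStandardTorusDiagram (D : KnotDiagram) (p : ℕ) (q : ℤ) : Prop :=
  SameCode D.word (closedBraidCode p (torusBraid p q))

/-- The knot of `D` is the `(p, q)`-torus knot. -/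
def IsTorusKnot (D : KnotDiagram) (p : ℕ) (q : ℤ) : Prop :=
  ∃ T : KnotDiagram, T.IsStandardTorusDiagram p q ∧ D.SameKnot T

end KnotDiagram

end KnotTheory

/-! Cut the diagram into b overpasses and b underpasses. In a diagram with the fewest crossings an
overpass crosses neither of the two underpasses next to it (`Minimal.not_cross_next`,
`Minimal.not_cross_prev`) and crosses any other underpass at most once (`Minimal.cross_unique`):
otherwise an over-arc and an under-arc would have common ends, and the one with more crossings could
be laid alongside the other, which saves a crossing. Hence c ≤ b(b - 2), and equality means that
every overpass crosses every underpass that is not its neighbour exactly once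
(`Minimal.exists_arcs`, `Arcs`).

The isotopies rest on one fact: a loop with only overcrossings can be pulled off the diagram
(`SK.remove_loop`). What lies inside the loop is pushed out, crossing by crossing, by a second and a
third Reidemeister move (`SK.push`); then the strands across the loop bound bigons that can be
removed one after the other, and a kink remains. The slides (`SK.slide_adjacent`,
`SK.slide_antiparallel`, `SK.slide_parallel`) first push crossings of an underpass through until
such a loop appears.

Planarity is used as homology over ℚ. The Euler characteristic is two if and only if every flow on
the edges is the jump of a labelling of the faces (`ncard_faces_eq_iff`,
`GaussCode.isPlanar_iff_isJordan`). So closed curves in the diagram have an inside and an outside,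
and a move keeps planarity because flows and labellings can be carried through the changed tangle
(`LocalExt`, `IsJordan.replace`).

The extremal diagram is rigid. Let O and U be the over- and underpasses. Among O 0, U 0, O 1, U 1
there is only the crossing of O 0 with U 1, so the part of the knot from this crossing back to
itself is a simple closed curve, and every other arc begins inside or outside of it
(`Arcs.exists_arcLabels`). This shows that the crossings of arcs with nearly equal indices all have
the same sign, which may be taken positive after a reflection. By induction on the distance of the
indices (`Rigid.succ`), these curves, the triangles of `Arcs.triangle_labels` and the symmetry
`Arcs.dual` determine all signs and the order of the crossings on every arc
(`Arcs.exists_sign_order`). The code is thus known up to the names of the crossings. Running along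
the closed torus braid gives the same pattern (`traverseClosedBraid_torus`), and `Arcs.sameCode`
compares the two. -/

namespace KnotTheory

/-! ### Euler characteristic two as a homological Jordan curve theorem -/

section FaceCount

variable {X : Type*} (ε : X → ℤˣ) (σ : Equiv.Perm (X × Bool))

/-- The face permutation of a signed chord diagram with successor permutation `σ`. -/
def faceTurn (e : (X × Bool) × ℤˣ) : (X × Bool) × ℤˣ :=
  let m' := (σ ^ (e.2 : ℤ)) e.1
  ((m'.1, !m'.2), e.2 * ε m'.1 * (if m'.2 then 1 else -1))

theorem faceTurn_injective : Function.Injective (faceTurn ε σ) := by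
  rintro ⟨m, d⟩ ⟨m', d'⟩ h
  simp only [faceTurn, Prod.mk.injEq] at h
  obtain ⟨⟨h1, h2⟩, h3⟩ := h
  have h2' : ((σ ^ (d : ℤ)) m).2 = ((σ ^ (d' : ℤ)) m').2 := by simpa using h2
  rw [h1, h2'] at h3
  have hd : d = d' := mul_right_cancel (mul_right_cancel h3)
  subst hd
  have : (σ ^ (d : ℤ)) m = (σ ^ (d : ℤ)) m' := Prod.ext h1 h2'
  rw [(σ ^ (d : ℤ)).injective this]

/-- The set of darts on the boundary of the face to the left of a dart. -/
def faceOf (e : (X × Bool) × ℤˣ) : Set ((X × Bool) × ℤˣ) :=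
  Set.range fun k : ℕ => (faceTurn ε σ)^[k] e

/-- An injective map of a finite set permutes it, so a forward orbit is a full cycle and does not
depend on where it starts. This is what makes the sets `faceOf` a partition into faces. -/
theorem faceOf_faceTurn [Finite X] (e : (X × Bool) × ℤˣ) :
    faceOf ε σ (faceTurn ε σ e) = faceOf ε σ e := by
  apply Set.Subset.antisymm
  · rintro _ ⟨k, rfl⟩
    exact ⟨k + 1, rfl⟩
  · rintro _ ⟨k, rfl⟩
    obtain ⟨n, hn, hp⟩ := (faceTurn_injective ε σ).mem_periodicPts e
    -- Here n ≥ 1 is a period of e: starting one step late, one goes around once more to arrive at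
    -- step k.
    refine ⟨k + n - 1, ?_⟩
    show (faceTurn ε σ)^[k + n - 1] (faceTurn ε σ e) = _
    rw [← Function.iterate_succ_apply, show (k + n - 1).succ = k + n by omega,
      Function.iterate_add_apply, hp.eq]

/-- The labellings of the faces, as functions on darts. -/
def faceLabels : Submodule ℚ ((X × Bool) × ℤˣ → ℚ) where
  carrier := {h | ∀ e, h (faceTurn ε σ e) = h e}
  add_mem' := fun ha hb e => by simp [ha e, hb e]
  zero_mem' := fun e => rfl
  smul_mem' := fun c h hh e => by simp [hh e]

theorem faceLabels_iterate {h : (X × Bool) × ℤˣ → ℚ} (hh : h ∈ faceLabels ε σ) (k : ℕ)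
    (e : (X × Bool) × ℤˣ) : h ((faceTurn ε σ)^[k] e) = h e := by
  induction k generalizing e with
  | zero => rfl
  | succ k ih => rw [Function.iterate_succ_apply, ih, hh e]

/-- An invariant function on darts is a function on the set of faces; a chosen dart of each face
gives the inverse map. -/
theorem finrank_faceLabels [Finite X] :
    Module.finrank ℚ (faceLabels ε σ) = (Set.range (faceOf ε σ)).ncard := by
  classical
  let f : (Set.range (faceOf ε σ) → ℚ) ≃ₗ[ℚ] faceLabels ε σ :=
    { toFun := fun g => ⟨fun e => g ⟨faceOf ε σ e, e, rfl⟩, fun e => by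
        simp only [faceOf_faceTurn]⟩
      map_add' := fun _ _ => rfl
      map_smul' := fun _ _ => rfl
      invFun := fun h F => h.1 F.2.choose
      left_inv := fun g => by
        funext F
        have := F.2.choose_spec
        simp only [this]
      right_inv := fun h => by
        ext e
        have hs : faceOf ε σ (Exists.choose (⟨e, rfl⟩ : ∃ y, faceOf ε σ y = faceOf ε σ e)) =
          faceOf ε σ e := Exists.choose_spec (⟨e, rfl⟩ : ∃ y, faceOf ε σ y = faceOf ε σ e)
        have he : e ∈ faceOf ε σ e := ⟨0, rfl⟩
        rw [← hs] at he
        obtain ⟨k, hk⟩ := he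
        show h.1 _ = h.1 e
        conv_rhs => rw [← hk]
        exact (faceLabels_iterate ε σ h.2 k _).symm }
  have : Fintype (Set.range (faceOf ε σ)) := Fintype.ofFinite _
  rw [← f.finrank_eq, Module.finrank_fintype_fun_eq_card, Set.ncard_eq_toFinset_card',
    Set.toFinset_card]

/-- The jump of a labelling across the edges, as a flow along the knot. -/
def edgeJump : faceLabels ε σ →ₗ[ℚ] (X × Bool → ℚ) where
  toFun h m := h.1 (m, 1) - h.1 (σ m, -1)
  map_add' a b := by funext m; simp; ring
  map_smul' c a := by funext m; simp; ring

/-- The boundary matrix of the graph of the diagram. -/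
def bdMatrix [DecidableEq X] : Matrix X (X × Bool) ℚ := fun x m =>
  (if (σ m).1 = x then 1 else 0) - (if m.1 = x then 1 else 0)

theorem bdMatrix_mulVec [Fintype X] [DecidableEq X] (z : X × Bool → ℚ) (x : X) :
    (bdMatrix σ).mulVec z x =
      z (σ.symm (x, true)) + z (σ.symm (x, false)) - (z (x, true) + z (x, false)) := by
  have h1 : ∑ m : X × Bool, (if m.1 = x then z m else 0) = z (x, true) + z (x, false) := by
    rw [Fintype.sum_prod_type]
    rw [Finset.sum_eq_single x] <;> simp +contextual
  have h2 : ∑ m : X × Bool, (if (σ m).1 = x then z m else 0) =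
      z (σ.symm (x, true)) + z (σ.symm (x, false)) := by
    rw [← Equiv.sum_comp σ.symm]
    simp only [Equiv.apply_symm_apply]
    rw [Fintype.sum_prod_type]
    rw [Finset.sum_eq_single x] <;> simp +contextual
  simp only [Matrix.mulVec, dotProduct, bdMatrix, sub_mul, Finset.sum_sub_distrib, ite_mul,
    one_mul, zero_mul, h1, h2]

theorem bdMatrix_transpose_mulVec [Fintype X] [DecidableEq X] (f : X → ℚ) (m : X × Bool) :
    (bdMatrix σ).transpose.mulVec f m = f (σ m).1 - f m.1 := by
  simp [Matrix.mulVec, dotProduct, bdMatrix, Matrix.transpose_apply, sub_mul,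
    Finset.sum_sub_distrib]

theorem const_of_step {α : Type*} {Y : Type*} (τ : Equiv.Perm α)
    (htr : ∀ a b, ∃ n : ℤ, (τ ^ n) a = b) (f : α → Y) (hf : ∀ a, f (τ a) = f a) (a b : α) :
    f a = f b := by
  obtain ⟨n, rfl⟩ := htr a b
  induction n with
  | zero => rfl
  | succ n ih => rw [ih, add_comm, zpow_add, zpow_one, Equiv.Perm.mul_apply, hf]
  | pred n ih =>
    rw [ih, sub_eq_add_neg, add_comm, zpow_add, zpow_neg_one, Equiv.Perm.mul_apply]
    rw [← hf (τ⁻¹ _)]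
    exact congrArg f (τ.apply_symm_apply _).symm

/-- Connectedness in the form used twice below: if only constants are killed, the kernel is a line.
The subspace `N` is everything in one application and `faceLabels` in the other. -/
theorem finrank_ker_of_const {α : Type*} [Nonempty α] {M : Type*} [AddCommGroup M] [Module ℚ M]
    (N : Submodule ℚ (α → ℚ)) (T : N →ₗ[ℚ] M) (h1 : (fun _ => (1 : ℚ)) ∈ N)
    (h2 : T ⟨_, h1⟩ = 0) (h3 : ∀ f : N, T f = 0 → ∀ a b, f.1 a = f.1 b) :
    Module.finrank ℚ (LinearMap.ker T) = 1 := by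
  obtain ⟨a⟩ := ‹Nonempty α›
  refine finrank_eq_one (⟨⟨_, h1⟩, h2⟩ : LinearMap.ker T) ?_ ?_
  · intro h
    have := congrFun (congrArg (fun t : LinearMap.ker T => t.1.1) h) a
    simp at this
  · rintro ⟨f, hf⟩
    refine ⟨f.1 a, ?_⟩
    ext b
    simpa using h3 f hf a b

/-- The cycle rank of a connected graph with c vertices and 2c edges is 2c - c + 1. The transposed
matrix kills exactly the functions that are constant along edges, hence the constants, and a matrix
has the rank of its transpose. -/
theorem finrank_flows [Fintype X] [DecidableEq X] [Nonempty X]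
    (htr : ∀ a b, ∃ n : ℤ, (σ ^ n) a = b) :
    Module.finrank ℚ (LinearMap.ker (bdMatrix σ).mulVecLin) = Fintype.card X + 1 := by
  have e1 := LinearMap.finrank_range_add_finrank_ker (bdMatrix σ).mulVecLin
  have e2 := LinearMap.finrank_range_add_finrank_ker (bdMatrix σ).transpose.mulVecLin
  have e3 := (bdMatrix σ).rank_transpose
  simp only [Matrix.rank] at e3
  have e4 : Module.finrank ℚ (LinearMap.ker (bdMatrix σ).transpose.mulVecLin) = 1 := by
    let T : (⊤ : Submodule ℚ (X → ℚ)) →ₗ[ℚ] (X × Bool → ℚ) :=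
      (bdMatrix σ).transpose.mulVecLin.comp (Submodule.subtype _)
    have hT : Module.finrank ℚ (LinearMap.ker T) = 1 := by
      refine finrank_ker_of_const _ T trivial ?_ ?_
      · funext m
        show (bdMatrix σ).transpose.mulVec _ m = 0
        rw [bdMatrix_transpose_mulVec]
        exact sub_self _
      · rintro ⟨f, hf'⟩ hf a b
        refine const_of_step σ htr (fun m => f m.1) (fun m => ?_) (a, true) (b, true)
        have := congrFun hf m
        change (bdMatrix σ).transpose.mulVec _ m = 0 at this
        rw [bdMatrix_transpose_mulVec] at this
        exact sub_eq_zero.1 this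
    rw [← hT]
    refine LinearEquiv.finrank_eq
      { toFun := fun f => ⟨⟨f.1, trivial⟩, f.2⟩
        invFun := fun f => ⟨f.1.1, f.2⟩
        map_add' := fun _ _ => rfl
        map_smul' := fun _ _ => rfl
        left_inv := fun _ => rfl
        right_inv := fun _ => rfl }
  simp only [Module.finrank_fintype_fun_eq_card, Fintype.card_prod, Fintype.card_bool] at e1 e2
  have : 0 < Fintype.card X := Fintype.card_pos
  omega

/-- What invariance under the face permutation means at a crossing. -/
theorem mem_faceLabels_iff (h : (X × Bool) × ℤˣ → ℚ) : h ∈ faceLabels ε σ ↔ ∀ x : X,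
    if ε x = 1 then
      h (σ.symm (x, true), 1) = h ((x, false), 1) ∧ h ((x, true), -1) = h (σ.symm (x, false), 1) ∧
      h (σ (x, true), -1) = h ((x, false), -1) ∧ h (σ (x, false), -1) = h ((x, true), 1)
    else
      h (σ.symm (x, true), 1) = h ((x, false), -1) ∧ h (σ.symm (x, false), 1) = h ((x, true), 1) ∧
      h (σ (x, true), -1) = h ((x, false), 1) ∧ h (σ (x, false), -1) = h ((x, true), -1) := by
  have key : h ∈ faceLabels ε σ ↔ ∀ (x : X) (b : Bool),
      h ((x, !b), ε x * (if b then 1 else -1)) = h (σ.symm (x, b), 1) ∧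
      h ((x, !b), -(ε x * (if b then 1 else -1))) = h (σ (x, b), -1) := by
    constructor
    · intro hh x b
      constructor
      · have h1 := hh (σ.symm (x, b), 1)
        rw [← h1]
        simp [faceTurn]
      · have h2 := hh (σ (x, b), -1)
        rw [← h2]
        cases b <;> simp [faceTurn]
    · rintro hh ⟨m, d⟩
      rcases Int.units_eq_one_or d with rfl | rfl
      · have h1 := (hh (σ m).1 (σ m).2).1
        rw [Prod.mk.eta, Equiv.symm_apply_apply] at h1
        rw [← h1]
        simp [faceTurn]
      · have h1 := (hh (σ.symm m).1 (σ.symm m).2).2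
        rw [Prod.mk.eta, Equiv.apply_symm_apply] at h1
        rw [← h1]
        have e : (σ⁻¹) m = σ.symm m := rfl
        cases hb : (σ.symm m).2 <;> simp [faceTurn, e, hb]
  rw [key]
  refine forall_congr' fun x => ?_
  rcases Int.units_eq_one_or (ε x) with hx | hx
  · simp only [hx, Bool.forall_bool, if_true, one_mul, neg_neg, Bool.not_true, Bool.not_false,
      Bool.false_eq_true, if_false]
    grind
  · have : ¬ ((-1 : ℤˣ) = 1) := by decide
    simp only [hx, Bool.forall_bool, if_true, neg_mul, one_mul, neg_neg, Bool.not_true,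
      Bool.not_false, Bool.false_eq_true, if_false, this]
    grind

/-- Going once around a crossing, the four jumps between its corners add up to zero; with the
orientations of the four edges this is Kirchhoff's law. -/
theorem edgeJump_mem_flows [Fintype X] [DecidableEq X] (h : faceLabels ε σ) :
    edgeJump ε σ h ∈ LinearMap.ker (bdMatrix σ).mulVecLin := by
  rw [LinearMap.mem_ker]
  funext x
  show (bdMatrix σ).mulVec _ x = 0
  rw [bdMatrix_mulVec]
  simp only [edgeJump, LinearMap.coe_mk, AddHom.coe_mk, Equiv.apply_symm_apply]
  have := (mem_faceLabels_iff ε σ h.1).1 h.2 x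
  split_ifs at this with hx
  · obtain ⟨a, b, c, d⟩ := this
    linarith
  · obtain ⟨a, b, c, d⟩ := this
    linarith

/-- Without jumps the two sides of every edge have the same label, and the label does not change at
a crossing; the knot runs through all edges. -/
theorem finrank_ker_edgeJump [Nonempty X] (htr : ∀ a b, ∃ n : ℤ, (σ ^ n) a = b) :
    Module.finrank ℚ (LinearMap.ker (edgeJump ε σ)) = 1 := by
  refine finrank_ker_of_const _ _ (fun e => rfl) ?_ ?_
  · funext m
    simp [edgeJump]
  · intro h h0
    have hz : ∀ m, h.1 (σ m, -1) = h.1 (m, 1) := fun m => by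
      have := congrFun h0 m
      change h.1 (m, 1) - h.1 (σ m, -1) = 0 at this
      linarith
    have hz' : ∀ m, h.1 (m, -1) = h.1 (σ.symm m, 1) := fun m => by
      simpa using hz (σ.symm m)
    have hstep : ∀ m, h.1 (m, 1) = h.1 (σ.symm m, 1) := by
      rintro ⟨x, b⟩
      have := (mem_faceLabels_iff ε σ h.1).1 h.2 x
      simp only [hz, hz'] at this
      split_ifs at this <;> cases b <;> grind
    have hstep' : ∀ m, h.1 (σ m, 1) = h.1 (m, 1) := fun m => by simpa using hstep (σ m)
    have hc := const_of_step σ htr (fun m => h.1 (m, 1)) hstep'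
    rintro ⟨m, d⟩ ⟨m', d'⟩
    rcases Int.units_eq_one_or d with rfl | rfl <;> rcases Int.units_eq_one_or d' with rfl | rfl <;>
      (try simp only [hz']) <;> exact hc _ _

/-- The Euler characteristic is two if and only if every flow is the jump of a labelling. -/
theorem ncard_faces_eq_iff [Fintype X] [DecidableEq X] [Nonempty X]
    (htr : ∀ a b, ∃ n : ℤ, (σ ^ n) a = b) :
    (Set.range (faceOf ε σ)).ncard = Fintype.card X + 2 ↔
      ∀ z ∈ LinearMap.ker (bdMatrix σ).mulVecLin, ∃ h : faceLabels ε σ, edgeJump ε σ h = z := by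
  have hle : LinearMap.range (edgeJump ε σ) ≤ LinearMap.ker (bdMatrix σ).mulVecLin := by
    rintro _ ⟨h, rfl⟩
    exact edgeJump_mem_flows ε σ h
  -- With F faces the jumps of labellings have dimension F - 1, inside the space of flows of
  -- dimension c + 1. So F = c + 2 says that the two spaces coincide.
  have e1 := LinearMap.finrank_range_add_finrank_ker (edgeJump ε σ)
  rw [finrank_ker_edgeJump ε σ htr, finrank_faceLabels] at e1
  have e2 := finrank_flows σ htr
  constructor
  · intro hF z hz
    have : LinearMap.range (edgeJump ε σ) = LinearMap.ker (bdMatrix σ).mulVecLin :=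
      Submodule.eq_of_le_of_finrank_eq hle (by omega)
    rw [← this] at hz
    exact hz
  · intro hall
    have : LinearMap.range (edgeJump ε σ) = LinearMap.ker (bdMatrix σ).mulVecLin :=
      le_antisymm hle fun z hz => hall z hz
    rw [this] at e1
    omega

end FaceCount
-- Flows and face labels along lists of passages
/-- `zi m` and `zo m` are the values on the edges before and after the passage `m`, along a list of
passages from an edge with value `s` to an edge with value `t`. -/
def Walk (zi zo : Passage → ℚ) : ℚ → List Passage → ℚ → Prop
  | s, [], t => s = t
  | s, m :: l, t => zi m = s ∧ Walk zi zo (zo m) l t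

/-- Kirchhoff's law at a crossing. -/
def FlowAt (zi zo : Passage → ℚ) (x : Crossing) : Prop :=
  zi (x, true) + zi (x, false) = zo (x, true) + zo (x, false)

/-- `Li`, `Lo` are the labels of the faces to the left of the edges before and after a passage, and
subtracting the flow gives the labels of the faces to the right: the four labels at the crossing
`x` fit together. -/
def LabelAt (zi zo Li Lo : Passage → ℚ) (x : Crossing) : Prop :=
  if x.2 = 1 then
    Li (x, true) = Lo (x, false) ∧ Li (x, true) - zi (x, true) = Li (x, false) ∧
      Lo (x, true) = Lo (x, false) - zo (x, false)
  else
    Lo (x, true) = Li (x, false) ∧ Li (x, true) = Li (x, false) - zi (x, false) ∧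
      Lo (x, true) - zo (x, true) = Lo (x, false)

/-- Every flow on a code is the jump of a labelling of the faces. -/
def IsJordan (w : List Passage) : Prop :=
  ∀ (zi zo : Passage → ℚ) (s : ℚ), Walk zi zo s w s →
    (∀ x : Crossing, (x, true) ∈ w → FlowAt zi zo x) →
    ∃ (Li Lo : Passage → ℚ) (t : ℚ), Walk Li Lo t w t ∧
      ∀ x : Crossing, (x, true) ∈ w → LabelAt zi zo Li Lo x

theorem walk_append (zi zo : Passage → ℚ) (s t : ℚ) (l l' : List Passage) :
    Walk zi zo s (l ++ l') t ↔ ∃ r, Walk zi zo s l r ∧ Walk zi zo r l' t := by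
  induction l generalizing s with
  | nil => simp [Walk]
  | cons m l ih => simp [Walk, ih, and_assoc]

theorem walk_cons_iff (zi zo : Passage → ℚ) (s t : ℚ) (a : Passage) (l : List Passage) :
    Walk zi zo s (a :: l) t ↔ zi a = s ∧ (a :: l).IsChain (fun m m' => zi m' = zo m) ∧
      zo ((a :: l).getLast (by simp)) = t := by
  induction l generalizing a s with
  | nil => simp [Walk]
  | cons b l ih =>
    have : Walk zi zo s (a :: b :: l) t ↔ zi a = s ∧ Walk zi zo (zo a) (b :: l) t := Iff.rfl
    rw [this, ih, List.isChain_cons_cons, List.getLast_cons (List.cons_ne_nil b l), and_assoc]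

/-- Translates between a word read from a base point and the cyclic successor permutation; the last
passage closes the cycle. -/
theorem closed_walk_iff {w : List Passage} (hw : w.Nodup) (hne : w ≠ []) (zi zo : Passage → ℚ) :
    (∃ s, Walk zi zo s w s) ↔ ∀ m ∈ w, zi (w.formPerm m) = zo m := by
  obtain ⟨a, l, rfl⟩ := List.exists_cons_of_ne_nil hne
  simp only [walk_cons_iff]
  have hlast : (a :: l).formPerm ((a :: l).getLast (by simp)) = a :=
    List.formPerm_apply_getLast a l
  constructor
  · rintro ⟨s, h1, h2, h3⟩ m hm
    obtain ⟨i, hi, rfl⟩ := List.getElem_of_mem hm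
    rw [List.isChain_iff_getElem] at h2
    by_cases hlt : i + 1 < (a :: l).length
    · rw [List.formPerm_apply_lt_getElem _ hw i hlt]
      exact h2 i hlt
    · have : (a :: l)[i] = (a :: l).getLast (by simp) := by
        rw [List.getLast_eq_getElem]
        congr 1
        omega
      rw [this, hlast, h1, h3]
  · intro h
    refine ⟨zi a, rfl, ?_, ?_⟩
    · rw [List.isChain_iff_getElem]
      intro i hi
      rw [← h _ (List.getElem_mem (by omega)), List.formPerm_apply_lt_getElem _ hw i hi]
    · rw [← h _ (List.getLast_mem _), hlast]

namespace GaussCode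

theorem mem_crossings_iff (D : GaussCode) (x : Crossing) (b : Bool) :
    x ∈ D.crossings ↔ (x, b) ∈ D.word := by
  have hmem : ∀ m, m ∈ D.word.toFinset ↔ m ∈ D.word := fun m => by
    induction D.word using Quotient.inductionOn
    exact List.mem_toFinset
  simp only [crossings, Finset.mem_image, hmem]
  constructor
  · rintro ⟨⟨y, b'⟩, hm, rfl⟩
    by_cases h : b' = b
    · subst h; exact hm
    · have := D.paired _ _ hm
      rwa [show (!b') = b by revert h; cases b <;> cases b' <;> simp] at this
  · intro h
    exact ⟨_, h, rfl⟩

/-- The names of the crossings of `D`, as a type. -/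
abbrev Node (D : GaussCode) : Type := {x : Crossing // x ∈ D.crossings}

/-- The passages of `D`. -/
def toPassage (D : GaussCode) (m : D.Node × Bool) : Passage := (m.1.1, m.2)

theorem toPassage_mem (D : GaussCode) (m : D.Node × Bool) : D.toPassage m ∈ D.word :=
  (D.mem_crossings_iff _ _).1 m.1.2

theorem toPassage_injective (D : GaussCode) : Function.Injective D.toPassage := by
  rintro ⟨⟨x, hx⟩, b⟩ ⟨⟨y, hy⟩, b'⟩ h
  simp only [toPassage, Prod.mk.injEq] at h
  obtain ⟨rfl, rfl⟩ := h
  rfl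

/-- The passages of `D` as a type. -/
def passageEquiv (D : GaussCode) : D.Node × Bool ≃ {m : Passage // m ∈ D.word} where
  toFun m := ⟨D.toPassage m, D.toPassage_mem m⟩
  invFun m := (⟨m.1.1, (D.mem_crossings_iff _ _).2 m.2⟩, m.1.2)
  left_inv _ := rfl
  right_inv _ := rfl

theorem succ_mem_iff (D : GaussCode) (m : Passage) : m ∈ D.word ↔ D.succ m ∈ D.word := by
  obtain ⟨w, hn, hp⟩ := D
  induction w using Quotient.inductionOn
  exact List.formPerm_mem_iff_mem.symm

/-- The successor permutation on the passages of `D`. -/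
def succNode (D : GaussCode) : Equiv.Perm (D.Node × Bool) :=
  D.passageEquiv.symm.permCongr (D.succ.subtypePerm fun m => (D.succ_mem_iff m).symm)

theorem toPassage_succNode (D : GaussCode) (m : D.Node × Bool) :
    D.toPassage (D.succNode m) = D.succ (D.toPassage m) := rfl

theorem toPassage_succNode_zpow (D : GaussCode) (n : ℤ) (m : D.Node × Bool) :
    D.toPassage ((D.succNode ^ n) m) = (D.succ ^ n) (D.toPassage m) := by
  induction n generalizing m with
  | zero => rfl
  | succ n ih =>
    rw [zpow_add, zpow_add, zpow_one, zpow_one, Equiv.Perm.mul_apply, Equiv.Perm.mul_apply, ih,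
      toPassage_succNode]
  | pred n ih =>
    rw [zpow_sub, zpow_sub, zpow_one, zpow_one, Equiv.Perm.mul_apply, Equiv.Perm.mul_apply, ih]
    congr 1

/-- The signs of the crossings of `D`. -/
def nodeSign (D : GaussCode) (x : D.Node) : ℤˣ := x.1.2

theorem turnLeft_toPassage (D : GaussCode) (e : (D.Node × Bool) × ℤˣ) :
    D.turnLeft (D.toPassage e.1, e.2) =
      (D.toPassage (faceTurn D.nodeSign D.succNode e).1, (faceTurn D.nodeSign D.succNode e).2) := by
  simp only [turnLeft, faceTurn, ← toPassage_succNode_zpow]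
  rfl

theorem ncard_faces (D : GaussCode) :
    D.faces.ncard = (Set.range (faceOf D.nodeSign D.succNode)).ncard := by
  let g : (D.Node × Bool) × ℤˣ → Passage × ℤˣ := fun e => (D.toPassage e.1, e.2)
  have hg : Function.Injective g := fun a b h => by
    simp only [g, Prod.mk.injEq] at h
    exact Prod.ext (D.toPassage_injective h.1) h.2
  have hit : ∀ (k : ℕ) e, D.turnLeft^[k] (g e) = g ((faceTurn D.nodeSign D.succNode)^[k] e) := by
    intro k
    induction k with
    | zero => intro e; rfl
    | succ k ih =>
      intro e
      rw [Function.iterate_succ_apply, Function.iterate_succ_apply, ← ih]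
      exact congrArg _ (D.turnLeft_toPassage e)
  have : D.faces = (Set.image g) '' (Set.range (faceOf D.nodeSign D.succNode)) := by
    ext F
    simp only [faces, Set.mem_ofPred_eq, Set.mem_image, Set.mem_range, exists_exists_eq_and]
    have him : ∀ e, g '' faceOf D.nodeSign D.succNode e =
        Set.range fun k : ℕ => D.turnLeft^[k] (g e) := fun e => by
      rw [faceOf, ← Set.range_comp]
      congr 1
      funext k
      exact (hit k e).symm
    constructor
    · rintro ⟨⟨m, d⟩, hm, rfl⟩
      exact ⟨((D.passageEquiv.symm ⟨m, hm⟩), d), him _⟩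
    · rintro ⟨e, rfl⟩
      exact ⟨g e, D.toPassage_mem _, him e⟩
  rw [this, Set.ncard_image_of_injective _ (Set.image_injective.2 hg)]

/-- A code is planar if and only if every flow on it is the jump of a labelling. -/
theorem isPlanar_iff_isJordan (D : GaussCode) (w : List Passage) (hw : D.word = w) :
    D.IsPlanar ↔ IsJordan w := by
  by_cases hne : w = []
  · subst hne
    refine iff_of_true (Or.inl hw) fun zi zo s _ _ => ⟨0, 0, 0, rfl, ?_⟩
    simp
  have hnil : D.word ≠ Cycle.nil := by
    rw [hw]
    simpa using hne
  have hnd : w.Nodup := by simpa [hw] using D.nodup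
  have hmem : ∀ m, m ∈ D.word ↔ m ∈ w := fun m => by rw [hw, Cycle.mem_coe_iff]
  have hsucc : ∀ m, D.succ m = w.formPerm m := by
    obtain ⟨c, h1, h2⟩ := D
    simp only at hw
    subst hw
    intro m
    rfl
  obtain ⟨a, ha⟩ := List.exists_mem_of_ne_nil _ hne
  have hX : Nonempty D.Node := ⟨⟨a.1, (D.mem_crossings_iff a.1 a.2).2 ((hmem _).2 ha)⟩⟩
  have htr : ∀ a b, ∃ n : ℤ, (D.succNode ^ n) a = b := by
    intro a b
    have ha := (hmem _).1 (D.toPassage_mem a)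
    have hb := (hmem _).1 (D.toPassage_mem b)
    obtain ⟨i, hi, hi'⟩ := List.getElem_of_mem ha
    obtain ⟨j, hj, hj'⟩ := List.getElem_of_mem hb
    refine ⟨((j + w.length - i : ℕ) : ℤ), D.toPassage_injective ?_⟩
    rw [toPassage_succNode_zpow, zpow_natCast]
    have : (D.succ ^ (j + w.length - i)) = w.formPerm ^ (j + w.length - i) := by
      congr 1
      ext1 m
      exact hsucc m
    rw [this, ← hi', List.formPerm_pow_apply_getElem _ hnd, ← hj']
    congr 1
    rw [show i + (j + w.length - i) = j + w.length by omega, Nat.add_mod_right,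
      Nat.mod_eq_of_lt hj]
  have hF : D.IsPlanar ↔ (Set.range (faceOf D.nodeSign D.succNode)).ncard =
      Fintype.card D.Node + 2 := by
    rw [IsPlanar, ← D.ncard_faces, Fintype.card_coe, crossingNumber]
    simp only [hnil, false_or]
    omega
  have hsymm : ∀ m : D.Node × Bool, w.formPerm (D.toPassage (D.succNode.symm m)) =
      D.toPassage m := fun m => by
    rw [← hsucc, ← toPassage_succNode, Equiv.apply_symm_apply]
  have hnode : ∀ x, (x, true) ∈ w → x ∈ D.crossings := fun x hx =>
    (D.mem_crossings_iff x true).2 ((hmem _).2 hx)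
  have hnode' : ∀ x : D.Node, (x.1, true) ∈ w := fun x =>
    (hmem _).1 ((D.mem_crossings_iff x.1 true).1 x.2)
  -- Functions on the passages of the diagram are extended by zero to all passages; only the values
  -- on the word matter.
  let L : ((D.Node × Bool) → ℚ) → Passage → ℚ := fun f m =>
    if hm : m ∈ D.word then f (D.passageEquiv.symm ⟨m, hm⟩) else 0
  have hL : ∀ f m, L f (D.toPassage m) = f m := fun f m => dif_pos (D.toPassage_mem m)
  have hLwalk : ∀ f : (D.Node × Bool) → ℚ, ∃ s, Walk (L fun m => f (D.succNode.symm m)) (L f) s w s := by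
    intro f
    rw [closed_walk_iff hnd hne]
    intro m hm
    obtain ⟨m, rfl⟩ : ∃ m', m = D.toPassage m' := ⟨D.passageEquiv.symm ⟨m, (hmem _).2 hm⟩, rfl⟩
    rw [← hsucc, ← toPassage_succNode, hL]
    have := hL (fun m => f (D.succNode.symm m)) (D.succNode m)
    rw [Equiv.symm_apply_apply] at this
    exact this
  rw [hF, ncard_faces_eq_iff _ _ htr]
  constructor
  · intro H zi zo s hs hfl
    have hst := (closed_walk_iff hnd hne zi zo).1 ⟨s, hs⟩
    have hzi : ∀ m : D.Node × Bool, zi (D.toPassage m) = zo (D.toPassage (D.succNode.symm m)) :=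
      fun m => by rw [← hst _ ((hmem _).1 (D.toPassage_mem _)), hsymm]
    obtain ⟨h, hh⟩ := H (fun m => zo (D.toPassage m)) (by
      rw [LinearMap.mem_ker]
      funext x
      show (bdMatrix _).mulVec _ x = 0
      rw [bdMatrix_mulVec, ← hzi, ← hzi]
      have := hfl x.1 (hnode' x)
      exact sub_eq_zero.2 this)
    have hh' : ∀ m, h.1 (m, 1) - h.1 (D.succNode m, -1) = zo (D.toPassage m) := congrFun hh
    have hh'' : ∀ m, h.1 (D.succNode.symm m, 1) - h.1 (m, -1) = zi (D.toPassage m) := fun m => by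
      rw [hzi, ← hh', Equiv.apply_symm_apply]
    obtain ⟨t, ht⟩ := hLwalk fun m => h.1 (m, 1)
    refine ⟨_, _, t, ht, ?_⟩
    intro x hx
    have hxx := (mem_faceLabels_iff _ _ h.1).1 h.2 ⟨x, hnode x hx⟩
    have e : ∀ b, (x, b) = D.toPassage (⟨x, hnode x hx⟩, b) := fun b => rfl
    rw [LabelAt, e, e]
    simp only [hL, ← hh', ← hh'']
    have hs : D.nodeSign ⟨x, hnode x hx⟩ = x.2 := rfl
    rw [hs] at hxx
    split_ifs at hxx ⊢ <;> obtain ⟨a, b, c, d⟩ := hxx <;>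
      refine ⟨?_, ?_, ?_⟩ <;> linarith
  · intro H z hz
    have hz' : ∀ x, z (D.succNode.symm (x, true)) + z (D.succNode.symm (x, false)) -
        (z (x, true) + z (x, false)) = 0 := fun x => by
      rw [← bdMatrix_mulVec]
      exact congrFun hz x
    obtain ⟨s, hs⟩ := hLwalk z
    obtain ⟨Li, Lo, t, ht, hlab⟩ := H _ _ s hs (by
      intro x hx
      have e : ∀ b, (x, b) = D.toPassage (⟨x, hnode x hx⟩, b) := fun b => rfl
      rw [FlowAt, e, e]
      simp only [hL]
      have := hz' ⟨x, hnode x hx⟩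
      linarith)
    have hst := (closed_walk_iff hnd hne Li Lo).1 ⟨t, ht⟩
    have hLi : ∀ m, Li (D.toPassage (D.succNode m)) = Lo (D.toPassage m) := fun m => by
      rw [toPassage_succNode, hsucc, hst _ ((hmem _).1 (D.toPassage_mem _))]
    have hLi' : ∀ m, Lo (D.toPassage (D.succNode.symm m)) = Li (D.toPassage m) := fun m => by
      rw [← hLi, Equiv.apply_symm_apply]
    -- A dart along the knot sees the left side of the edge after `m`. A dart against the knot sees
    -- the right side of the edge before `m`, and there the label is smaller by the flow on this
    -- edge.
    let h : (D.Node × Bool) × ℤˣ → ℚ := fun e =>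
      if e.2 = 1 then Lo (D.toPassage e.1)
      else Li (D.toPassage e.1) - z (D.succNode.symm e.1)
    have h1 : ∀ m, h (m, 1) = Lo (D.toPassage m) := fun m => if_pos rfl
    have h2 : ∀ m, h (m, -1) = Li (D.toPassage m) - z (D.succNode.symm m) := fun m =>
      if_neg (show ¬ (-1 : ℤˣ) = 1 by decide)
    have hh : h ∈ faceLabels D.nodeSign D.succNode := by
      rw [mem_faceLabels_iff]
      intro x
      have e : ∀ b, (x.1, b) = D.toPassage (x, b) := fun b => rfl
      have hl := hlab x.1 (hnode' x)
      rw [LabelAt, e, e] at hl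
      simp only [hL] at hl
      have hs : D.nodeSign x = x.1.2 := rfl
      have hf := hz' x
      rw [hs]
      simp only [h1, h2, Equiv.symm_apply_apply, hLi', hLi]
      split_ifs at hl ⊢ <;> obtain ⟨a, b, c⟩ := hl <;>
        refine ⟨?_, ?_, ?_, ?_⟩ <;> linarith
    refine ⟨⟨h, hh⟩, ?_⟩
    funext m
    show h (m, 1) - h (D.succNode m, -1) = z m
    rw [h1, h2, hLi, Equiv.symm_apply_apply]
    ring

end GaussCode
-- Local moves preserve planarity
theorem walk_congr {zi zo zi' zo' : Passage → ℚ} {l : List Passage} (s t : ℚ)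
    (h : ∀ m ∈ l, zi m = zi' m ∧ zo m = zo' m) (hw : Walk zi zo s l t) : Walk zi' zo' s l t := by
  induction l generalizing s with
  | nil => exact hw
  | cons m l ih =>
    obtain ⟨h1, h2⟩ := hw
    have hm := h m (by simp)
    refine ⟨hm.1 ▸ h1, hm.2 ▸ ih _ (fun m' h' => h m' (by simp [h'])) h2⟩

theorem walk_const {zi zo : Passage → ℚ} {l : List Passage} {s : ℚ}
    (h : ∀ m ∈ l, zi m = s ∧ zo m = s) : Walk zi zo s l s := by
  induction l with
  | nil => rfl
  | cons m l ih =>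
    refine ⟨(h m (by simp)).1, ?_⟩
    rw [(h m (by simp)).2]
    exact ih fun m' h' => h m' (by simp [h'])

theorem FlowAt.congr {zi zo zi' zo' : Passage → ℚ} {x : Crossing}
    (h : ∀ b, zi (x, b) = zi' (x, b) ∧ zo (x, b) = zo' (x, b)) (hf : FlowAt zi zo x) :
    FlowAt zi' zo' x := by
  simpa only [FlowAt, h] using hf

theorem LabelAt.congr {zi zo Li Lo zi' zo' Li' Lo' : Passage → ℚ} {x : Crossing}
    (h : ∀ b, zi (x, b) = zi' (x, b) ∧ zo (x, b) = zo' (x, b))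
    (h' : ∀ b, Li (x, b) = Li' (x, b) ∧ Lo (x, b) = Lo' (x, b)) (hf : LabelAt zi zo Li Lo x) :
    LabelAt zi' zo' Li' Lo' x := by
  simpa only [LabelAt, h, h'] using hf

/-- Whenever a flow through the tangle with strands `A₁'`, `A₂'`, `A₃'` is given, there is a flow
with the same boundary values through the tangle with strands `A₁`, `A₂`, `A₃` such that all
labellings of the latter can be replaced by labellings of the former. -/
def LocalExt (A₁ A₂ A₃ A₁' A₂' A₃' : List Passage) : Prop :=
  ∀ (zi' zo' : Passage → ℚ) (s₁ r₁ s₂ r₂ s₃ r₃ : ℚ),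
    Walk zi' zo' s₁ A₁' r₁ → Walk zi' zo' s₂ A₂' r₂ → Walk zi' zo' s₃ A₃' r₃ →
    (∀ x, (x, true) ∈ A₁' ++ A₂' ++ A₃' → FlowAt zi' zo' x) →
    ∃ zi zo : Passage → ℚ, Walk zi zo s₁ A₁ r₁ ∧ Walk zi zo s₂ A₂ r₂ ∧ Walk zi zo s₃ A₃ r₃ ∧
      (∀ x, (x, true) ∈ A₁ ++ A₂ ++ A₃ → FlowAt zi zo x) ∧
      ∀ (Li Lo : Passage → ℚ) (a₁ b₁ a₂ b₂ a₃ b₃ : ℚ),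
        Walk Li Lo a₁ A₁ b₁ → Walk Li Lo a₂ A₂ b₂ → Walk Li Lo a₃ A₃ b₃ →
        (∀ x, (x, true) ∈ A₁ ++ A₂ ++ A₃ → LabelAt zi zo Li Lo x) →
        ∃ Li' Lo' : Passage → ℚ, Walk Li' Lo' a₁ A₁' b₁ ∧ Walk Li' Lo' a₂ A₂' b₂ ∧
          Walk Li' Lo' a₃ A₃' b₃ ∧
          ∀ x, (x, true) ∈ A₁' ++ A₂' ++ A₃' → LabelAt zi' zo' Li' Lo' x

/-- The condition does not refer to the cyclic order in which the knot runs through the three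
strands, so one verification serves both orders. -/
theorem LocalExt.swap {A₁ A₂ A₃ A₁' A₂' A₃' : List Passage} (h : LocalExt A₁ A₂ A₃ A₁' A₂' A₃') :
    LocalExt A₁ A₃ A₂ A₁' A₃' A₂' := by
  intro zi' zo' s₁ r₁ s₂ r₂ s₃ r₃ h1 h2 h3 hx
  obtain ⟨zi, zo, g1, g2, g3, gx, hl⟩ := h zi' zo' s₁ r₁ s₃ r₃ s₂ r₂ h1 h3 h2 (fun x hm => hx x
    (by simp only [List.mem_append] at hm ⊢; tauto))
  refine ⟨zi, zo, g1, g3, g2, fun x hm => gx x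
    (by simp only [List.mem_append] at hm ⊢; tauto), ?_⟩
  intro Li Lo a₁ b₁ a₂ b₂ a₃ b₃ k1 k2 k3 kx
  obtain ⟨Li', Lo', j1, j2, j3, jx⟩ := hl Li Lo a₁ b₁ a₃ b₃ a₂ b₂ k1 k3 k2 (fun x hm => kx x
    (by simp only [List.mem_append] at hm ⊢; tauto))
  exact ⟨Li', Lo', j1, j3, j2, fun x hm => jx x
    (by simp only [List.mem_append] at hm ⊢; tauto)⟩

/-- A flow on the new diagram is changed inside the tangle to a flow on the old one, which has a
labelling; outside the tangle this labelling is kept, inside it is replaced by the one that `hloc`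
provides. The patches fit because both passages of a crossing lie on the same side of the boundary
of the tangle. -/
theorem IsJordan.replace {A₁ A₂ A₃ A₁' A₂' A₃' l₁ l₂ l₃ : List Passage}
    (hloc : LocalExt A₁ A₂ A₃ A₁' A₂' A₃')
    (hA : ∀ x, (x, true) ∈ A₁ ++ A₂ ++ A₃ ↔ (x, false) ∈ A₁ ++ A₂ ++ A₃)
    (hA' : ∀ x, (x, true) ∈ A₁' ++ A₂' ++ A₃' ↔ (x, false) ∈ A₁' ++ A₂' ++ A₃')
    (hd : ∀ m ∈ l₁ ++ l₂ ++ l₃, m ∉ A₁ ++ A₂ ++ A₃ ∧ m ∉ A₁' ++ A₂' ++ A₃')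
    (hJ : IsJordan (A₁ ++ l₁ ++ A₂ ++ l₂ ++ A₃ ++ l₃)) :
    IsJordan (A₁' ++ l₁ ++ A₂' ++ l₂ ++ A₃' ++ l₃) := by
  classical
  intro zi' zo' s hw hfl
  simp only [walk_append] at hw
  obtain ⟨s4, ⟨s3, ⟨s2, ⟨s1, ⟨s0, w1, w2⟩, w3⟩, w4⟩, w5⟩, w6⟩ := hw
  obtain ⟨zi, zo, v1, v3, v5, vf, hlab⟩ := hloc zi' zo' _ _ _ _ _ _ w1 w3 w5
    (fun x hx => hfl x (by simp only [List.mem_append] at hx ⊢; tauto))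
  let P : List Passage := A₁ ++ A₂ ++ A₃
  let P' : List Passage := A₁' ++ A₂' ++ A₃'
  have hP : ∀ x b, (x, b) ∈ P ↔ (x, true) ∈ P := fun x b => by
    cases b
    · exact (hA x).symm
    · rfl
  have hP' : ∀ x b, (x, b) ∈ P' ↔ (x, true) ∈ P' := fun x b => by
    cases b
    · exact (hA' x).symm
    · rfl
  let patch : List Passage → (Passage → ℚ) → (Passage → ℚ) → Passage → ℚ :=
    fun Q f g m => if m ∈ Q then f m else g m
  have hp1 : ∀ {Q f g m}, m ∈ Q → patch Q f g m = f m := fun h => if_pos h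
  have hp2 : ∀ {Q f g m}, m ∉ Q → patch Q f g m = g m := fun h => if_neg h
  have e1 : ∀ {l : List Passage} {f g f' g' : Passage → ℚ} {a b : ℚ} (Q : List Passage),
      (∀ m ∈ l, m ∈ Q) → Walk f g a l b → Walk (patch Q f f') (patch Q g g') a l b :=
    fun Q h hw => walk_congr _ _ (fun m hm => ⟨(hp1 (h m hm)).symm, (hp1 (h m hm)).symm⟩) hw
  have e2 : ∀ {l : List Passage} {f g f' g' : Passage → ℚ} {a b : ℚ} (Q : List Passage),
      (∀ m ∈ l, m ∉ Q) → Walk f' g' a l b → Walk (patch Q f f') (patch Q g g') a l b :=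
    fun Q h hw => walk_congr _ _ (fun m hm => ⟨(hp2 (h m hm)).symm, (hp2 (h m hm)).symm⟩) hw
  have hl1 : ∀ m ∈ l₁, m ∉ P ∧ m ∉ P' := fun m hm => hd m (by simp [hm])
  have hl2 : ∀ m ∈ l₂, m ∉ P ∧ m ∉ P' := fun m hm => hd m (by simp [hm])
  have hl3 : ∀ m ∈ l₃, m ∉ P ∧ m ∉ P' := fun m hm => hd m (by simp [hm])
  obtain ⟨Li, Lo, t, ht, hL⟩ := hJ (patch P zi zi') (patch P zo zo') s (by
    simp only [walk_append]
    exact ⟨s4, ⟨s3, ⟨s2, ⟨s1, ⟨s0, e1 P (by simp +contextual [P]) v1,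
      e2 P (fun m hm => (hl1 m hm).1) w2⟩, e1 P (by simp +contextual [P]) v3⟩,
      e2 P (fun m hm => (hl2 m hm).1) w4⟩, e1 P (by simp +contextual [P]) v5⟩,
      e2 P (fun m hm => (hl3 m hm).1) w6⟩) (by
    intro x hx
    by_cases hxP : (x, true) ∈ P
    · exact (vf x hxP).congr fun b =>
        ⟨(hp1 ((hP x b).2 hxP)).symm, (hp1 ((hP x b).2 hxP)).symm⟩
    · refine (hfl x ?_).congr fun b =>
        ⟨(hp2 (mt (hP x b).1 hxP)).symm, (hp2 (mt (hP x b).1 hxP)).symm⟩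
      simp only [P, List.mem_append] at hx hxP ⊢
      tauto)
  simp only [walk_append] at ht
  obtain ⟨t4, ⟨t3, ⟨t2, ⟨t1, ⟨t0, u1, u2⟩, u3⟩, u4⟩, u5⟩, u6⟩ := ht
  obtain ⟨Li', Lo', q1, q3, q5, qf⟩ := hlab Li Lo _ _ _ _ _ _ u1 u3 u5 (by
    intro x hx
    refine (hL x (by simp only [List.mem_append] at hx ⊢; tauto)).congr (fun b => ?_)
      (fun b => ⟨rfl, rfl⟩)
    exact ⟨hp1 ((hP x b).2 hx), hp1 ((hP x b).2 hx)⟩)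
  refine ⟨patch P' Li' Li, patch P' Lo' Lo, t, ?_, ?_⟩
  · simp only [walk_append]
    exact ⟨t4, ⟨t3, ⟨t2, ⟨t1, ⟨t0, e1 P' (by simp +contextual [P']) q1,
      e2 P' (fun m hm => (hl1 m hm).2) u2⟩, e1 P' (by simp +contextual [P']) q3⟩,
      e2 P' (fun m hm => (hl2 m hm).2) u4⟩, e1 P' (by simp +contextual [P']) q5⟩,
      e2 P' (fun m hm => (hl3 m hm).2) u6⟩
  · intro x hx
    by_cases hxP : (x, true) ∈ P'
    · exact (qf x hxP).congr (fun b => ⟨rfl, rfl⟩) fun b =>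
        ⟨(hp1 ((hP' x b).2 hxP)).symm, (hp1 ((hP' x b).2 hxP)).symm⟩
    · have hx' : (x, true) ∈ l₁ ++ l₂ ++ l₃ := by
        simp only [P', List.mem_append] at hx hxP ⊢
        tauto
      have hxP0 : (x, true) ∉ P := (hd _ hx').1
      refine (hL x ?_).congr (fun b => ⟨hp2 (mt (hP x b).1 hxP0), hp2 (mt (hP x b).1 hxP0)⟩)
        fun b => ⟨(hp2 (mt (hP' x b).1 hxP)).symm, (hp2 (mt (hP' x b).1 hxP)).symm⟩
      simp only [List.mem_append] at hx' ⊢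
      tauto

theorem exists_fun_map_eq (A : List Passage) (hA : A.Nodup) (v : List ℚ)
    (hl : A.length = v.length) : ∃ f : Passage → ℚ, A.map f = v := by
  classical
  induction A generalizing v with
  | nil => exact ⟨0, by simpa using hl.symm⟩
  | cons a A ih =>
    obtain _ | ⟨q, v⟩ := v
    · simp at hl
    obtain ⟨f, hf⟩ := ih (List.nodup_cons.1 hA).2 v (by simpa using hl)
    refine ⟨Function.update f a q, ?_⟩
    rw [List.map_cons, Function.update_self, ← hf]
    congr 1
    refine List.map_congr_left fun b hb => Function.update_of_ne ?_ _ _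
    rintro rfl
    exact (List.nodup_cons.1 hA).1 hb

/-- The flow on the bare strand is sent around the kink unchanged; then the labels at the corners of
`x` force equal labels at the two ends. -/
theorem localExt_kink (x : Crossing) (b : Bool) :
    LocalExt [(x, b), (x, !b)] [] [] [] [] [] := by
  classical
  intro zi' zo' s₁ r₁ s₂ r₂ s₃ r₃ h1 h2 h3 _
  obtain rfl : s₁ = r₁ := h1
  obtain ⟨f, hf⟩ := exists_fun_map_eq [(x, true), (x, false)] (by simp) [s₁, s₁] rfl
  simp at hf
  refine ⟨f, f, ?_, h2, h3, ?_, ?_⟩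
  · cases b <;> simp [Walk, hf]
  · intro y hy
    have : y = x := by cases b <;> simpa using hy
    subst this
    simp [FlowAt, hf]
  · intro Li Lo a₁ b₁ a₂ b₂ a₃ b₃ k1 k2 k3 kx
    -- The new strands have no passages, so the new label functions are arbitrary and only the
    -- equality of the end labels is in question.
    refine ⟨0, 0, ?_, k2, k3, by simp⟩
    have := kx x (by cases b <;> simp)
    simp only [LabelAt, hf] at this
    show a₁ = b₁
    cases b <;> simp [Walk] at k1 <;> split_ifs at this <;> grind

/-- Each flow goes straight through its strand of the bigon. As the signs are opposite, the change
of the label at `x` is undone at `y`. -/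
theorem localExt_bigon_parallel (x y : Crossing) (h : y.2 = -x.2) (b : Bool) :
    LocalExt [(x, b), (y, b)] [(x, !b), (y, !b)] [] [] [] [] := by
  classical
  intro zi' zo' s₁ r₁ s₂ r₂ s₃ r₃ h1 h2 h3 _
  obtain rfl : s₁ = r₁ := h1
  obtain rfl : s₂ = r₂ := h2
  have hxy : x ≠ y := by
    rintro rfl
    exact absurd h (by rcases Int.units_eq_one_or x.2 with h | h <;> rw [h] <;> decide)
  obtain ⟨f, hf⟩ := exists_fun_map_eq [(x, b), (y, b), (x, !b), (y, !b)] (by simp [hxy])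
    [s₁, s₁, s₂, s₂] rfl
  simp at hf
  refine ⟨f, f, ?_, ?_, h3, ?_, ?_⟩
  · simp [Walk, hf]
  · simp [Walk, hf]
  · intro z hz
    have : z = x ∨ z = y := by cases b <;> simpa using hz
    cases b <;> rcases this with rfl | rfl <;> simp at hf <;> simp [FlowAt, hf]
  · intro Li Lo a₁ b₁ a₂ b₂ a₃ b₃ k1 k2 k3 kx
    have h1 := kx x (by cases b <;> simp)
    have h2 := kx y (by cases b <;> simp)
    refine ⟨0, 0, ?_, ?_, k3, by simp⟩
    · show a₁ = b₁
      rcases Int.units_eq_one_or x.2 with hx | hx <;> cases b <;> simp at hf <;>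
        simp [LabelAt, h, hx, hf] at h1 h2 <;> simp [Walk] at k1 k2 <;> grind
    · show a₂ = b₂
      rcases Int.units_eq_one_or x.2 with hx | hx <;> cases b <;> simp at hf <;>
        simp [LabelAt, h, hx, hf] at h1 h2 <;> simp [Walk] at k1 k2 <;> grind

theorem localExt_bigon_antiparallel (x y : Crossing) (h : y.2 = -x.2) (b : Bool) :
    LocalExt [(x, b), (y, b)] [(y, !b), (x, !b)] [] [] [] [] := by
  classical
  intro zi' zo' s₁ r₁ s₂ r₂ s₃ r₃ h1 h2 h3 _
  obtain rfl : s₁ = r₁ := h1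
  obtain rfl : s₂ = r₂ := h2
  have hxy : x ≠ y := by
    rintro rfl
    exact absurd h (by rcases Int.units_eq_one_or x.2 with h | h <;> rw [h] <;> decide)
  obtain ⟨f, hf⟩ := exists_fun_map_eq [(x, b), (y, b), (x, !b), (y, !b)] (by simp [hxy])
    [s₁, s₁, s₂, s₂] rfl
  simp at hf
  refine ⟨f, f, ?_, ?_, h3, ?_, ?_⟩
  · simp [Walk, hf]
  · simp [Walk, hf]
  · intro z hz
    have : z = x ∨ z = y := by cases b <;> simp at hz <;> tauto
    cases b <;> rcases this with rfl | rfl <;> simp at hf <;> simp [FlowAt, hf]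
  · intro Li Lo a₁ b₁ a₂ b₂ a₃ b₃ k1 k2 k3 kx
    have h1 := kx x (by cases b <;> simp)
    have h2 := kx y (by cases b <;> simp)
    refine ⟨0, 0, ?_, ?_, k3, by simp⟩
    · show a₁ = b₁
      rcases Int.units_eq_one_or x.2 with hx | hx <;> cases b <;> simp at hf <;>
        simp [LabelAt, h, hx, hf] at h1 h2 <;> simp [Walk] at k1 k2 <;> grind
    · show a₂ = b₂
      rcases Int.units_eq_one_or x.2 with hx | hx <;> cases b <;> simp at hf <;>
        simp [LabelAt, h, hx, hf] at h1 h2 <;> simp [Walk] at k1 k2 <;> grind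

/-- The values before the passages of a strand with two passages `p`, `q` that are run through in
the order `inOrder t p q`, where `s`, `e`, `r` are the values on the edges; the first value belongs
to `p`. -/
def inVals (t : ℤˣ) (s e : ℚ) : List ℚ := if t = 1 then [s, e] else [e, s]

theorem walk_inOrder (zi zo : Passage → ℚ) (t : ℤˣ) (p q : Passage) (s r : ℚ) :
    Walk zi zo s (inOrder t p q) r ↔ ∃ e, [zi p, zi q] = inVals t s e ∧
      [zo p, zo q] = inVals t e r := by
  rcases Int.units_eq_one_or t with rfl | rfl <;>
    simp [inOrder, inVals, Walk] <;> grind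

theorem mem_inOrder (t : ℤˣ) (p q m : Passage) : m ∈ inOrder t p q ↔ m = p ∨ m = q := by
  rcases Int.units_eq_one_or t with rfl | rfl <;>
    simp [inOrder, or_comm]

/-- The change of the label along an overpassage. -/
def overJump (zi zo : Passage → ℚ) (x : Crossing) : ℚ :=
  if x.2 = 1 then -zo (x, false) else zi (x, false)

/-- The change of the label along an underpassage. -/
def underJump (zi zo : Passage → ℚ) (x : Crossing) : ℚ :=
  if x.2 = 1 then zi (x, true) else -zo (x, true)

set_option maxHeartbeats 4000000 in
-- The move reverses the order of the two crossings on each strand. If the change of the flow at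
-- each passage is kept, a middle value e on a strand from s to r turns into s + r - e. The
-- remaining relations are linear and are checked for all directions of the strands and both
-- orientations of the triangle.
theorem localExt_triangle (δ t₁ t₂ t₃ : ℤˣ) (x y z : Crossing) (hxy : x ≠ y) (hxz : x ≠ z)
    (hyz : y ≠ z) (hx : x.2 = δ * t₁ * t₂) (hy : y.2 = δ * t₁ * t₃) (hz : z.2 = δ * t₂ * t₃) :
    LocalExt (inOrder t₁ (x, true) (y, true)) (inOrder t₂ (x, false) (z, true))
      (inOrder t₃ (y, false) (z, false)) (inOrder (-t₁) (x, true) (y, true))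
      (inOrder (-t₂) (x, false) (z, true)) (inOrder (-t₃) (y, false) (z, false)) := by
  classical
  intro zi' zo' s₁ r₁ s₂ r₂ s₃ r₃ h1 h2 h3 hfl
  rw [walk_inOrder] at h1 h2 h3
  obtain ⟨e₁, i1, o1⟩ := h1
  obtain ⟨e₂, i2, o2⟩ := h2
  obtain ⟨e₃, i3, o3⟩ := h3
  have hfx := hfl x (by simp [mem_inOrder])
  have hfy := hfl y (by simp [mem_inOrder])
  have hfz := hfl z (by simp [mem_inOrder])
  have hnd : [(x, true), (y, true), (x, false), (z, true), (y, false), (z, false)].Nodup := by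
    simp [hxy, hxz, hyz, hxy.symm, hyz.symm]
  obtain ⟨zi, hzi⟩ := exists_fun_map_eq _ hnd (inVals t₁ s₁ (s₁ + r₁ - e₁) ++
    inVals t₂ s₂ (s₂ + r₂ - e₂) ++ inVals t₃ s₃ (s₃ + r₃ - e₃))
    (by simp [inVals]; split_ifs <;> rfl)
  obtain ⟨zo, hzo⟩ := exists_fun_map_eq _ hnd (inVals t₁ (s₁ + r₁ - e₁) r₁ ++
    inVals t₂ (s₂ + r₂ - e₂) r₂ ++ inVals t₃ (s₃ + r₃ - e₃) r₃)
    (by simp [inVals]; split_ifs <;> rfl)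
  simp only [FlowAt] at hfx hfy hfz
  refine ⟨zi, zo, ?_, ?_, ?_, ?_, ?_⟩
  · rw [walk_inOrder]
    refine ⟨s₁ + r₁ - e₁, ?_⟩
    rcases Int.units_eq_one_or t₁ with rfl | rfl <;> simp_all [inVals]
  · rw [walk_inOrder]
    refine ⟨s₂ + r₂ - e₂, ?_⟩
    rcases Int.units_eq_one_or t₁ with rfl | rfl <;>
    rcases Int.units_eq_one_or t₂ with rfl | rfl <;> simp_all [inVals]
  · rw [walk_inOrder]
    refine ⟨s₃ + r₃ - e₃, ?_⟩
    rcases Int.units_eq_one_or t₁ with rfl | rfl <;>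
    rcases Int.units_eq_one_or t₂ with rfl | rfl <;>
    rcases Int.units_eq_one_or t₃ with rfl | rfl <;> simp_all [inVals]
  · intro u hu
    have hu' : u = x ∨ u = y ∨ u = z := by
      simp [mem_inOrder] at hu
      tauto
    clear hu hx hy hz
    rcases Int.units_eq_one_or t₁ with rfl | rfl <;>
    rcases Int.units_eq_one_or t₂ with rfl | rfl <;>
    rcases Int.units_eq_one_or t₃ with rfl | rfl <;>
    simp [inVals] at hzi hzo i1 i2 i3 o1 o2 o3 <;>
    rcases hu' with rfl | rfl | rfl <;> simp only [FlowAt] <;> grind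
  · intro Li Lo a₁ b₁ a₂ b₂ a₃ b₃ k1 k2 k3 kx
    rw [walk_inOrder] at k1 k2 k3
    obtain ⟨d₁, j1, p1⟩ := k1
    obtain ⟨d₂, j2, p2⟩ := k2
    obtain ⟨d₃, j3, p3⟩ := k3
    have hlx := kx x (by simp [mem_inOrder])
    have hly := kx y (by simp [mem_inOrder])
    have hlz := kx z (by simp [mem_inOrder])
    -- The label on the middle edge of each strand is the label at its start, changed by the
    -- crossing that comes first after the move.
    let c₁ : ℚ := a₁ + if t₁ = 1 then overJump zi' zo' y else overJump zi' zo' x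
    let c₂ : ℚ := a₂ + if t₂ = 1 then overJump zi' zo' z else underJump zi' zo' x
    let c₃ : ℚ := a₃ + if t₃ = 1 then underJump zi' zo' z else underJump zi' zo' y
    obtain ⟨Li', hLi⟩ := exists_fun_map_eq _ hnd (inVals (-t₁) a₁ c₁ ++
      inVals (-t₂) a₂ c₂ ++ inVals (-t₃) a₃ c₃) (by simp [inVals]; split_ifs <;> rfl)
    obtain ⟨Lo', hLo⟩ := exists_fun_map_eq _ hnd (inVals (-t₁) c₁ b₁ ++
      inVals (-t₂) c₂ b₂ ++ inVals (-t₃) c₃ b₃) (by simp [inVals]; split_ifs <;> rfl)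
    have hgoal : ([Li' (x, true), Li' (y, true)] = inVals (-t₁) a₁ c₁ ∧
        [Lo' (x, true), Lo' (y, true)] = inVals (-t₁) c₁ b₁) ∧
        ([Li' (x, false), Li' (z, true)] = inVals (-t₂) a₂ c₂ ∧
        [Lo' (x, false), Lo' (z, true)] = inVals (-t₂) c₂ b₂) ∧
        ([Li' (y, false), Li' (z, false)] = inVals (-t₃) a₃ c₃ ∧
        [Lo' (y, false), Lo' (z, false)] = inVals (-t₃) c₃ b₃) := by
      clear_value c₁ c₂ c₃
      clear kx hlx hly hlz hfx hfy hfz i1 i2 i3 o1 o2 o3 hzi hzo j1 j2 j3 p1 p2 p3 hx hy hz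
      rcases Int.units_eq_one_or t₁ with rfl | rfl <;>
      rcases Int.units_eq_one_or t₂ with rfl | rfl <;>
      rcases Int.units_eq_one_or t₃ with rfl | rfl <;>
      simp_all [inVals]
    refine ⟨Li', Lo', ?_, ?_, ?_, ?_⟩
    · rw [walk_inOrder]; exact ⟨c₁, hgoal.1⟩
    · rw [walk_inOrder]; exact ⟨c₂, hgoal.2.1⟩
    · rw [walk_inOrder]; exact ⟨c₃, hgoal.2.2⟩
    · intro u hu
      have hu' : u = x ∨ u = y ∨ u = z := by
        simp [mem_inOrder] at hu
        tauto
      clear hu hgoal kx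
      simp only [LabelAt, hx, hy, hz] at hlx hly hlz
      simp only [c₁, c₂, c₃, overJump, underJump, hx, hy, hz] at hLi hLo
      rcases Int.units_eq_one_or t₁ with rfl | rfl <;>
      rcases Int.units_eq_one_or t₂ with rfl | rfl <;>
      rcases Int.units_eq_one_or t₃ with rfl | rfl <;>
      rcases Int.units_eq_one_or δ with rfl | rfl <;>
      simp [inVals] at hzi hzo i1 i2 i3 o1 o2 o3 j1 j2 j3 p1 p2 p3 hLi hLo hlx hly hlz <;>
      obtain ⟨hlx1, hlx2, hlx3⟩ := hlx <;> obtain ⟨hly1, hly2, hly3⟩ := hly <;>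
      obtain ⟨hlz1, hlz2, hlz3⟩ := hlz <;>
      obtain ⟨i1, i1'⟩ := i1 <;> obtain ⟨i2, i2'⟩ := i2 <;> obtain ⟨i3, i3'⟩ := i3 <;>
      obtain ⟨o1, o1'⟩ := o1 <;> obtain ⟨o2, o2'⟩ := o2 <;> obtain ⟨o3, o3'⟩ := o3 <;>
      obtain ⟨j1, j1'⟩ := j1 <;> obtain ⟨j2, j2'⟩ := j2 <;> obtain ⟨j3, j3'⟩ := j3 <;>
      obtain ⟨p1, p1'⟩ := p1 <;> obtain ⟨p2, p2'⟩ := p2 <;> obtain ⟨p3, p3'⟩ := p3 <;>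
      obtain ⟨g1, g2, g3, g4, g5, g6⟩ := hLi <;> obtain ⟨f1, f2, f3, f4, f5, f6⟩ := hLo <;>
      obtain ⟨q1, q2, q3, q4, q5, q6⟩ := hzi <;> obtain ⟨v1, v2, v3, v4, v5, v6⟩ := hzo <;>
      rcases hu' with rfl | rfl | rfl <;> simp [LabelAt, hx, hy, hz] <;>
      refine ⟨?_, ?_, ?_⟩ <;> linarith

/-- A strand through `m` after the top strand has been pushed
across it, with crossings `y` and `n`, parallel to its direction if `r = -1` and antiparallel if `r = 1`. -/
def pokeStrand (r : ℤˣ) (m : Passage) (y n : Crossing) : List Passage :=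
  if r = -1 then [m, (y, false), (n, false)] else [(n, false), (y, false), m]

/-- The sign of the strand that crosses `m`, seen from the strand of `m`. -/
def passageSign (m : Passage) : ℤˣ := m.1.2 * if m.2 then 1 else -1

set_option maxHeartbeats 4000000 in
-- The edge from `v` to `c` has on one side a face that also touches the overstrand after `c` and
-- the other strand of `v`. The overstrand is pushed through this face across that other strand. The
-- signs of `y`, `n` and the order in `pokeStrand` record on which side the face lies.
theorem localExt_poke (c v y n : Crossing) (b : Bool)
    (hnd : [c, v, y, n].Nodup) (hy : y.2 = -passageSign (v, b)) (hn : n.2 = passageSign (v, b)) :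
    LocalExt [(c, true)] [(v, b), (c, false)] [(v, !b)]
      [(c, true), (y, true), (n, true)] [(v, b), (c, false)]
      (pokeStrand (c.2 * passageSign (v, b)) (v, !b) y n) := by
  classical
  intro zi' zo' s₁ r₁ s₂ r₂ s₃ r₃ h1 h2 h3 hfl
  have hmem : ∀ u ∈ [c, v, y, n], (u, true) ∈ [(c, true), (y, true), (n, true)] ++
      [(v, b), (c, false)] ++ pokeStrand (c.2 * passageSign (v, b)) (v, !b) y n := by
    intro u hu
    have : (v, true) = (v, b) ∨ (v, true) = (v, !b) := by cases b <;> simp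
    have h' : (v, !b) ∈ pokeStrand (c.2 * passageSign (v, b)) (v, !b) y n := by
      unfold pokeStrand; split_ifs <;> simp
    simp only [List.mem_cons, List.not_mem_nil, or_false] at hu
    rcases hu with rfl | rfl | rfl | rfl
    · simp
    · rcases this with h | h <;> rw [h] <;> simp [h']
    · simp
    · simp
  have hfc := hfl c (hmem c (by simp))
  have hfv := hfl v (hmem v (by simp))
  have hfy := hfl y (hmem y (by simp))
  have hfn := hfl n (hmem n (by simp))
  have hmem' : ∀ u, (u, true) ∈ [(c, true), (y, true), (n, true)] ++
      [(v, b), (c, false)] ++ pokeStrand (c.2 * passageSign (v, b)) (v, !b) y n →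
      u = c ∨ u = v ∨ u = y ∨ u = n := by
    intro u hu
    unfold pokeStrand at hu
    cases b <;> split_ifs at hu <;> simp at hu <;> tauto
  clear hfl hmem
  simp only [List.nodup_cons, List.mem_cons, List.not_mem_nil, or_false, not_or] at hnd
  obtain ⟨⟨hcv, hcy, hcn⟩, ⟨hvy, hvn⟩, hyn, -⟩ := hnd
  -- Kirchhoff's law at `v` forces the value s₂ + s₃ - r₃ on the edge from `v` to `c`.
  obtain ⟨z, hz⟩ := exists_fun_map_eq [(c, true), (c, false), (v, b), (v, !b)]
    (by simp [hcv]) [s₁, s₂ - (r₃ - s₃), s₂, s₃] rfl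
  obtain ⟨z', hz'⟩ := exists_fun_map_eq [(c, true), (c, false), (v, b), (v, !b)]
    (by simp [hcv]) [r₁, r₂, s₂ - (r₃ - s₃), r₃] rfl
  simp only [FlowAt] at hfc hfv hfy hfn
  simp at hz hz'
  refine ⟨z, z', by simp [Walk, hz, hz'], by simp [Walk, hz, hz'], by simp [Walk, hz, hz'], ?_, ?_⟩
  · intro u hu
    have hu' : u = c ∨ u = v := by cases b <;> simp at hu <;> tauto
    clear hu
    rw [FlowAt]
    rcases Int.units_eq_one_or (c.2 * passageSign (v, b)) with hr | hr <;>
      simp [pokeStrand, hr, Walk] at h1 h2 h3 <;>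
      cases b <;> rcases hu' with rfl | rfl <;> simp at hz hz' <;> grind
  · intro Li Lo a₁ b₁ a₂ b₂ a₃ b₃ k1 k2 k3 kx
    have hlc := kx c (by simp)
    have hlv := kx v (by cases b <;> simp)
    simp only [Walk] at k1 k2 k3
    clear kx hmem'
    have hnd6 : [(c, true), (y, true), (n, true), (v, b), (c, false), (v, !b), (y, false),
        (n, false)].Nodup := by
      cases b <;> simp [hcv, hcy, hcn, hvy, hvn, hyn, Ne.symm hcv, Ne.symm hcy, Ne.symm hcn, Ne.symm hvy,
        Ne.symm hvn]
    let q₁ := a₁ + overJump zi' zo' c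
    let q₂ := q₁ + overJump zi' zo' y
    let d := a₂ + if b then overJump zi' zo' v else underJump zi' zo' v
    let e₁ := a₃ + if c.2 * passageSign (v, b) = -1 then
      (if b then underJump zi' zo' v else overJump zi' zo' v) else underJump zi' zo' n
    let e₂ := e₁ + underJump zi' zo' y
    obtain ⟨Li', hLi⟩ := exists_fun_map_eq _ hnd6 ([a₁, q₁, q₂, a₂, d] ++
      if c.2 * passageSign (v, b) = -1 then [a₃, e₁, e₂] else [e₂, e₁, a₃])
      (by split_ifs <;> rfl)
    obtain ⟨Lo', hLo⟩ := exists_fun_map_eq _ hnd6 ([q₁, q₂, b₁, d, b₂] ++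
      if c.2 * passageSign (v, b) = -1 then [e₁, e₂, b₃] else [b₃, e₂, e₁])
      (by split_ifs <;> rfl)
    refine ⟨Li', Lo', ?_, ?_, ?_, ?_⟩
    · clear_value q₁ q₂ d e₁ e₂
      simp at hLi hLo
      simp [Walk, hLi, hLo]
    · clear_value q₁ q₂ d e₁ e₂
      simp at hLi hLo
      simp [Walk, hLi, hLo]
    · clear_value q₁ q₂ d e₁ e₂
      unfold pokeStrand
      split_ifs at hLi hLo ⊢ <;> simp at hLi hLo <;> simp [Walk, hLi, hLo]
    · intro u hu
      have hu' : u = c ∨ u = v ∨ u = y ∨ u = n := by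
        unfold pokeStrand at hu
        cases b <;> split_ifs at hu <;> simp at hu <;> tauto
      clear hu hnd6 hcv hcy hcn hvy hvn hyn
      simp only [LabelAt] at hlc hlv ⊢
      simp only [q₁, q₂, d, e₁, e₂, overJump, underJump] at hLi hLo
      clear q₁ q₂ d e₁ e₂
      rcases Int.units_eq_one_or c.2 with hc | hc <;>
      rcases Int.units_eq_one_or v.2 with hv | hv <;> cases b <;>
      simp [passageSign, hv] at hy hn <;>
      simp [passageSign, hc, hv, hy, hn, pokeStrand, Walk] at h1 h2 h3 hLi hLo hlc hlv hz hz' k1 k2 k3 <;>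
      obtain ⟨hlc1, hlc2, hlc3⟩ := hlc <;> obtain ⟨hlv1, hlv2, hlv3⟩ := hlv <;>
      obtain ⟨z1, z2, z3, z4⟩ := hz <;> obtain ⟨x1, x2, x3, x4⟩ := hz' <;>
      obtain ⟨g1, g2, g3, g4, g5, g6, g7, g8⟩ := hLi <;>
      obtain ⟨f1, f2, f3, f4, f5, f6, f7, f8⟩ := hLo <;>
      obtain ⟨h11, h12, h13, h14⟩ := h1 <;> obtain ⟨h21, h22, h23⟩ := h2 <;>
      obtain ⟨h31, h32, h33, h34⟩ := h3 <;>
      obtain ⟨k11, k12⟩ := k1 <;> obtain ⟨k21, k22, k23⟩ := k2 <;> obtain ⟨k31, k32⟩ := k3 <;>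
      rcases hu' with rfl | rfl | rfl | rfl <;> simp [hc, hv, hy, hn] <;>
      refine ⟨?_, ?_, ?_⟩ <;> linarith

/-! ### Reidemeister moves on codes of diagrams -/

/-- The list `w` is the code of a knot diagram. -/
structure Good (w : List Passage) : Prop where
  nodup : w.Nodup
  paired : ∀ (x : Crossing) (b : Bool), (x, b) ∈ w → (x, !b) ∈ w
  jordan : IsJordan w

/-- The diagram with a given code. -/
def Good.toDiagram {w : List Passage} (h : Good w) : KnotDiagram where
  word := w
  nodup := Cycle.nodup_coe_iff.2 h.nodup
  paired := fun x b hx => h.paired x b hx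
  planar := (GaussCode.isPlanar_iff_isJordan _ w rfl).2 h.jordan

theorem KnotDiagram.good (D : KnotDiagram) {w : List Passage} (h : D.word = w) : Good w where
  nodup := by
    have := D.nodup
    rw [h] at this
    exact Cycle.nodup_coe_iff.1 this
  paired := fun x b hx => by
    have := D.paired x b
    rw [h] at this
    exact this hx
  jordan := (GaussCode.isPlanar_iff_isJordan _ w h).1 D.planar

theorem KnotDiagram.ext_word {D E : KnotDiagram} (h : D.word = E.word) : D = E := by
  obtain ⟨⟨w, h1, h2⟩, h3⟩ := D
  obtain ⟨⟨w', h1', h2'⟩, h3'⟩ := E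
  obtain rfl : w = w' := h
  rfl

theorem Good.of_isRotated {w w' : List Passage} (h : Good w) (hr : w ~r w') : Good w' :=
  h.toDiagram.good (w := w') (Cycle.coe_eq_coe.2 hr)

/-- `w` and `w'` are codes of diagrams of the same knot. -/
def SK (w w' : List Passage) : Prop :=
  ∃ (h : Good w) (h' : Good w'), h.toDiagram.SameKnot h'.toDiagram

namespace SK

variable {w w' w'' : List Passage}

theorem good_right (h : SK w w') : Good w' := h.2.1

theorem symm (h : SK w w') : SK w' w := by
  obtain ⟨a, b, c⟩ := h
  exact ⟨b, a, c.symm⟩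

theorem trans (h : SK w w') (h' : SK w' w'') : SK w w'' := by
  obtain ⟨a, b, c⟩ := h
  obtain ⟨a', b', c'⟩ := h'
  exact ⟨a, b', c.trans _ _ _ c'⟩

theorem of_isRotated (h : Good w) (hr : w ~r w') : SK w w' := by
  refine ⟨h, h.of_isRotated hr, ?_⟩
  have : h.toDiagram = (h.of_isRotated hr).toDiagram :=
    KnotDiagram.ext_word (Cycle.coe_eq_coe.2 hr)
  rw [this]
  exact Relation.EqvGen.refl _

theorem of_move (h : Good w) (h' : Good w') (hm : Move w w') : SK w w' :=
  ⟨h, h', Relation.EqvGen.rel _ _ hm⟩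

end SK

theorem perm_strands (B₁ B₂ B₃ l₁ l₂ l₃ : List Passage) :
    (B₁ ++ l₁ ++ B₂ ++ l₂ ++ B₃ ++ l₃).Perm ((B₁ ++ B₂ ++ B₃) ++ (l₁ ++ l₂ ++ l₃)) := by
  classical
  rw [List.perm_iff_count]
  intro a
  simp only [List.count_append]
  omega

/-- The common source of all moves on codes: the changed passages are closed under the exchange of
over and under, hence so are the unchanged ones, and planarity is `IsJordan.replace`. -/
theorem Good.replace {A₁ A₂ A₃ A₁' A₂' A₃' l₁ l₂ l₃ : List Passage}
    (hg : Good (A₁ ++ l₁ ++ A₂ ++ l₂ ++ A₃ ++ l₃))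
    (hloc : LocalExt A₁ A₂ A₃ A₁' A₂' A₃')
    (hA : ∀ x b, (x, b) ∈ A₁ ++ A₂ ++ A₃ → (x, !b) ∈ A₁ ++ A₂ ++ A₃)
    (hA' : ∀ x b, (x, b) ∈ A₁' ++ A₂' ++ A₃' → (x, !b) ∈ A₁' ++ A₂' ++ A₃')
    (hnd : (A₁' ++ A₂' ++ A₃').Nodup)
    (hd : ∀ m ∈ A₁' ++ A₂' ++ A₃', m ∉ l₁ ++ l₂ ++ l₃) :
    Good (A₁' ++ l₁ ++ A₂' ++ l₂ ++ A₃' ++ l₃) := by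
  have perm := fun B₁ B₂ B₃ => perm_strands B₁ B₂ B₃ l₁ l₂ l₃
  have hg' := (perm A₁ A₂ A₃).nodup_iff.1 hg.nodup
  rw [List.nodup_append'] at hg'
  obtain ⟨g1, g2, g3⟩ := hg'
  refine ⟨?_, ?_, ?_⟩
  · rw [(perm A₁' A₂' A₃').nodup_iff, List.nodup_append']
    exact ⟨hnd, g2, fun m hm => hd m hm⟩
  · intro x b hx
    rw [(perm A₁' A₂' A₃').mem_iff, List.mem_append] at hx ⊢
    rcases hx with hx | hx
    · exact Or.inl (hA' x b hx)
    · right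
      have := hg.paired x b ((perm A₁ A₂ A₃).mem_iff.2 (List.mem_append_right _ hx))
      rw [(perm A₁ A₂ A₃).mem_iff, List.mem_append] at this
      refine this.resolve_left fun h => ?_
      have h' := hA _ _ h
      rw [Bool.not_not] at h'
      exact g3 h' hx
  · refine hg.jordan.replace hloc (fun x => ⟨hA x true, hA x false⟩)
      (fun x => ⟨hA' x true, hA' x false⟩) fun m hm => ⟨fun h => g3 h hm, fun h => hd m h hm⟩

theorem SK.remove_kink {x : Crossing} {b : Bool} {l : List Passage}
    (h : Good ((x, b) :: (x, !b) :: l)) : SK ((x, b) :: (x, !b) :: l) l := by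
  have hl : Good l := by
    have := Good.replace (A₁ := [(x, b), (x, !b)]) (l₁ := l) (A₂ := []) (l₂ := []) (A₃ := [])
      (l₃ := []) (by simpa using h) (localExt_kink x b)
      (by intro y b' hy; cases b <;> cases b' <;> simp at hy ⊢ <;> exact hy)
      (by simp) (by simp) (by simp)
    simpa using this
  exact (SK.of_move hl h (Move.r1 x b l)).symm

theorem SK.remove_bigon_parallel {x y : Crossing} (hxy : y.2 = -x.2) {b : Bool}
    {l₁ l₂ : List Passage} (h : Good ([(x, b), (y, b)] ++ l₁ ++ [(x, !b), (y, !b)] ++ l₂)) :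
    SK ([(x, b), (y, b)] ++ l₁ ++ [(x, !b), (y, !b)] ++ l₂) (l₁ ++ l₂) := by
  have hl : Good (l₁ ++ l₂) := by
    have := Good.replace (A₁ := [(x, b), (y, b)]) (l₁ := l₁) (A₂ := [(x, !b), (y, !b)])
      (l₂ := l₂) (A₃ := [])
      (l₃ := []) (by simpa using h) (localExt_bigon_parallel x y hxy b)
      (by intro y b' hy; cases b <;> cases b' <;> simp at hy ⊢ <;> exact hy)
      (by simp) (by simp) (by simp)
    simpa using this
  exact (SK.of_move hl h (Move.r2_parallel x y hxy b l₁ l₂)).symm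

theorem SK.remove_bigon_antiparallel {x y : Crossing} (hxy : y.2 = -x.2) {b : Bool}
    {l₁ l₂ : List Passage} (h : Good ([(x, b), (y, b)] ++ l₁ ++ [(y, !b), (x, !b)] ++ l₂)) :
    SK ([(x, b), (y, b)] ++ l₁ ++ [(y, !b), (x, !b)] ++ l₂) (l₁ ++ l₂) := by
  have hl : Good (l₁ ++ l₂) := by
    have := Good.replace (A₁ := [(x, b), (y, b)]) (l₁ := l₁) (A₂ := [(y, !b), (x, !b)])
      (l₂ := l₂) (A₃ := [])
      (l₃ := []) (by simpa using h) (localExt_bigon_antiparallel x y hxy b)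
      (by intro y b' hy; cases b <;> cases b' <;> simp at hy ⊢ <;> tauto)
      (by simp) (by simp) (by simp)
    simpa using this
  exact (SK.of_move hl h (Move.r2_antiparallel x y hxy b l₁ l₂)).symm

theorem perm_inOrder (t : ℤˣ) (p q : Passage) : (inOrder t p q).Perm [p, q] := by
  rcases Int.units_eq_one_or t with rfl | rfl
  · simp [inOrder]
  · simpa [inOrder] using List.Perm.swap p q []

theorem perm_triangle (x y z : Crossing) (s₁ s₂ s₃ : ℤˣ) :
    (inOrder s₁ (x, true) (y, true) ++ inOrder s₂ (x, false) (z, true) ++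
      inOrder s₃ (y, false) (z, false)).Perm
      ([(x, true), (y, true)] ++ [(x, false), (z, true)] ++ [(y, false), (z, false)]) :=
  ((perm_inOrder _ _ _).append (perm_inOrder _ _ _)).append (perm_inOrder _ _ _)

theorem Good.triangle {δ t₁ t₂ t₃ : ℤˣ} {x y z : Crossing}
    (hx : x.2 = δ * t₁ * t₂) (hy : y.2 = δ * t₁ * t₃) (hz : z.2 = δ * t₂ * t₃)
    {l₁ l₂ l₃ : List Passage}
    (h : Good (inOrder t₁ (x, true) (y, true) ++ l₁ ++ inOrder t₂ (x, false) (z, true) ++ l₂ ++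
      inOrder t₃ (y, false) (z, false) ++ l₃)) :
    Good (inOrder (-t₁) (x, true) (y, true) ++ l₁ ++ inOrder (-t₂) (x, false) (z, true) ++ l₂ ++
      inOrder (-t₃) (y, false) (z, false) ++ l₃) := by
  have hp := perm_triangle x y z
  have hn := ((perm_strands _ _ _ _ _ _).trans ((hp _ _ _).append_right _)).nodup_iff.1 h.nodup
  rw [List.nodup_append'] at hn
  obtain ⟨n1, -, n2⟩ := hn
  have hcl : ∀ s₁ s₂ s₃ : ℤˣ, ∀ u b, (u, b) ∈ inOrder s₁ (x, true) (y, true) ++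
      inOrder s₂ (x, false) (z, true) ++ inOrder s₃ (y, false) (z, false) →
      (u, !b) ∈ inOrder s₁ (x, true) (y, true) ++
      inOrder s₂ (x, false) (z, true) ++ inOrder s₃ (y, false) (z, false) := by
    intro s₁ s₂ s₃ u b hu
    rw [(hp s₁ s₂ s₃).mem_iff] at hu ⊢
    cases b <;> simp at hu ⊢ <;> tauto
  have hne : x ≠ y ∧ x ≠ z ∧ y ≠ z := by
    refine ⟨?_, ?_, ?_⟩ <;> rintro rfl <;> simp at n1
  exact h.replace (localExt_triangle δ t₁ t₂ t₃ x y z hne.1 hne.2.1 hne.2.2 hx hy hz) (hcl _ _ _)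
    (hcl _ _ _) ((hp _ _ _).nodup_iff.2 n1) fun m hm => n2 ((hp _ _ _).mem_iff.1 hm)

theorem Good.triangle' {δ t₁ t₂ t₃ : ℤˣ} {x y z : Crossing}
    (hx : x.2 = δ * t₁ * t₂) (hy : y.2 = δ * t₁ * t₃) (hz : z.2 = δ * t₂ * t₃)
    {l₁ l₂ l₃ : List Passage}
    (h : Good (inOrder t₁ (x, true) (y, true) ++ l₁ ++ inOrder t₃ (y, false) (z, false) ++ l₂ ++
      inOrder t₂ (x, false) (z, true) ++ l₃)) :
    Good (inOrder (-t₁) (x, true) (y, true) ++ l₁ ++ inOrder (-t₃) (y, false) (z, false) ++ l₂ ++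
      inOrder (-t₂) (x, false) (z, true) ++ l₃) := by
  have hp : ∀ s₁ s₂ s₃ : ℤˣ, (inOrder s₁ (x, true) (y, true) ++
      inOrder s₃ (y, false) (z, false) ++ inOrder s₂ (x, false) (z, true)).Perm
      ([(x, true), (y, true)] ++ [(x, false), (z, true)] ++ [(y, false), (z, false)]) :=
    fun s₁ s₂ s₃ => by
      refine List.Perm.trans ?_ (perm_triangle x y z s₁ s₂ s₃)
      rw [List.append_assoc, List.append_assoc]
      exact List.perm_append_comm.append_left _
  have hn := ((perm_strands _ _ _ _ _ _).trans ((hp _ _ _).append_right _)).nodup_iff.1 h.nodup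
  rw [List.nodup_append'] at hn
  obtain ⟨n1, -, n2⟩ := hn
  have hcl : ∀ s₁ s₂ s₃ : ℤˣ, ∀ u b, (u, b) ∈ inOrder s₁ (x, true) (y, true) ++
      inOrder s₃ (y, false) (z, false) ++ inOrder s₂ (x, false) (z, true) →
      (u, !b) ∈ inOrder s₁ (x, true) (y, true) ++
      inOrder s₃ (y, false) (z, false) ++ inOrder s₂ (x, false) (z, true) := by
    intro s₁ s₂ s₃ u b hu
    rw [(hp s₁ s₂ s₃).mem_iff] at hu ⊢
    cases b <;> simp at hu ⊢ <;> tauto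
  have hne : x ≠ y ∧ x ≠ z ∧ y ≠ z := by
    refine ⟨?_, ?_, ?_⟩ <;> rintro rfl <;> simp at n1
  exact h.replace (localExt_triangle δ t₁ t₂ t₃ x y z hne.1 hne.2.1 hne.2.2 hx hy hz).swap
    (hcl _ _ _) (hcl _ _ _) ((hp _ _ _).nodup_iff.2 n1) fun m hm => n2 ((hp _ _ _).mem_iff.1 hm)

theorem SK.triangle_tmb {δ t₁ t₂ t₃ : ℤˣ} {x y z : Crossing}
    (hx : x.2 = δ * t₁ * t₂) (hy : y.2 = δ * t₁ * t₃) (hz : z.2 = δ * t₂ * t₃)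
    {l₁ l₂ l₃ : List Passage}
    (h : Good (inOrder t₁ (x, true) (y, true) ++ l₁ ++ inOrder t₂ (x, false) (z, true) ++ l₂ ++
      inOrder t₃ (y, false) (z, false) ++ l₃)) :
    SK (inOrder t₁ (x, true) (y, true) ++ l₁ ++ inOrder t₂ (x, false) (z, true) ++ l₂ ++
      inOrder t₃ (y, false) (z, false) ++ l₃)
      (inOrder (-t₁) (x, true) (y, true) ++ l₁ ++ inOrder (-t₂) (x, false) (z, true) ++ l₂ ++
      inOrder (-t₃) (y, false) (z, false) ++ l₃) :=
  SK.of_move h (h.triangle hx hy hz) (Move.r3_tmb δ t₁ t₂ t₃ x y z hx hy hz l₁ l₂ l₃)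

theorem SK.triangle_tbm {δ t₁ t₂ t₃ : ℤˣ} {x y z : Crossing}
    (hx : x.2 = δ * t₁ * t₂) (hy : y.2 = δ * t₁ * t₃) (hz : z.2 = δ * t₂ * t₃)
    {l₁ l₂ l₃ : List Passage}
    (h : Good (inOrder t₁ (x, true) (y, true) ++ l₁ ++ inOrder t₃ (y, false) (z, false) ++ l₂ ++
      inOrder t₂ (x, false) (z, true) ++ l₃)) :
    SK (inOrder t₁ (x, true) (y, true) ++ l₁ ++ inOrder t₃ (y, false) (z, false) ++ l₂ ++
      inOrder t₂ (x, false) (z, true) ++ l₃)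
      (inOrder (-t₁) (x, true) (y, true) ++ l₁ ++ inOrder (-t₃) (y, false) (z, false) ++ l₂ ++
      inOrder (-t₂) (x, false) (z, true) ++ l₃) :=
  SK.of_move h (h.triangle' hx hy hz) (Move.r3_tbm δ t₁ t₂ t₃ x y z hx hy hz l₁ l₂ l₃)

theorem exists_fresh (w : List Passage) (ε : ℤˣ) :
    ∃ x : Crossing, x.2 = ε ∧ ∀ b, (x, b) ∉ w := by
  obtain ⟨N, hN⟩ := Infinite.exists_notMem_finset (w.map fun m => m.1.1).toFinset
  refine ⟨(N, ε), rfl, fun b hb => hN ?_⟩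
  rw [List.mem_toFinset, List.mem_map]
  exact ⟨_, hb, rfl⟩

theorem SK.of_move_rotated {w w' a b : List Passage} (h : Good w) (h' : Good w') (hr : w ~r a)
    (hr' : w' ~r b) (hm : Move a b) : SK w w' := by
  refine SK.of_move h h' ?_
  rw [Cycle.coe_eq_coe.2 hr, Cycle.coe_eq_coe.2 hr']
  exact hm

/-! ### Pushing a crossing across an overstrand -/

theorem perm_pokeStrand (r : ℤˣ) (m : Passage) (y n : Crossing) :
    (pokeStrand r m y n).Perm [m, (y, false), (n, false)] := by
  classical
  unfold pokeStrand
  split_ifs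
  · rfl
  · rw [List.perm_iff_count]
    intro a
    simp only [List.count_cons]
    omega

/-- The strand through `m` after the crossing of `m` has been pushed across the top strand. -/
def pushStrand (r : ℤˣ) (m : Passage) (y n : Crossing) : List Passage :=
  if r = -1 then [(y, false), m, (n, false)] else [(n, false), m, (y, false)]

theorem good_poke {c v y n : Crossing} {b : Bool} {A₂ A₃ A₂' A₃' l₁ l₂ l₃ : List Passage}
    (hloc : LocalExt [(c, true)] A₂ A₃ [(c, true), (y, true), (n, true)] A₂' A₃')
    (hp : (A₂ ++ A₃).Perm [(v, b), (c, false), (v, !b)])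
    (hp' : (A₂' ++ A₃').Perm [(v, b), (c, false), (v, !b), (y, false), (n, false)])
    (h : Good ([(c, true)] ++ l₁ ++ A₂ ++ l₂ ++ A₃ ++ l₃)) (hyn : y ≠ n)
    (hy : ∀ b', (y, b') ∉ [(c, true)] ++ l₁ ++ A₂ ++ l₂ ++ A₃ ++ l₃)
    (hn : ∀ b', (n, b') ∉ [(c, true)] ++ l₁ ++ A₂ ++ l₂ ++ A₃ ++ l₃) :
    Good ([(c, true), (y, true), (n, true)] ++ l₁ ++ A₂' ++ l₂ ++ A₃' ++ l₃) := by
  have hq : ([(c, true)] ++ A₂ ++ A₃).Perm [(c, true), (v, b), (c, false), (v, !b)] := by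
    rw [List.append_assoc]; exact hp.append_left [(c, true)]
  have hq' : ([(c, true), (y, true), (n, true)] ++ A₂' ++ A₃').Perm [(c, true), (y, true),
      (n, true), (v, b), (c, false), (v, !b), (y, false), (n, false)] := by
    rw [List.append_assoc]; exact hp'.append_left [(c, true), (y, true), (n, true)]
  have hw := (perm_strands [(c, true)] A₂ A₃ l₁ l₂ l₃).trans (hq.append_right _)
  have hnd := hw.nodup_iff.1 h.nodup
  rw [List.nodup_append'] at hnd
  obtain ⟨n1, -, n2⟩ := hnd
  simp only [hw.mem_iff, List.mem_append] at hy hn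
  push Not at hy hn
  refine h.replace hloc (fun u b' hu => ?_) (fun u b' hu => ?_) ?_ fun m hm hm' => ?_
  · rw [hq.mem_iff] at hu ⊢
    cases b <;> cases b' <;> simp at hu ⊢ <;> tauto
  · rw [hq'.mem_iff] at hu ⊢
    cases b <;> cases b' <;> simp at hu ⊢ <;> tauto
  · rw [hq'.nodup_iff]
    have h1 := fun b' => (hy b').1
    have h2 := fun b' => (hn b').1
    have e1 := h1 true
    have e2 := h1 false
    have e3 := h2 true
    have e4 := h2 false
    cases b <;> simp at e1 e2 e3 e4 n1 ⊢ <;> grind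
  · rw [hq'.mem_iff] at hm
    simp only [List.mem_append] at hm'
    have h1 : ∀ b', ¬ (((y, b') ∈ l₁ ∨ (y, b') ∈ l₂) ∨ (y, b') ∈ l₃) := fun b' h => by
      have := (hy b').2
      tauto
    have h2 : ∀ b', ¬ (((n, b') ∈ l₁ ∨ (n, b') ∈ l₂) ∨ (n, b') ∈ l₃) := fun b' h => by
      have := (hn b').2
      tauto
    simp only [List.mem_cons, List.not_mem_nil, or_false] at hm
    have h3 : ∀ p ∈ [(c, true), (v, b), (c, false), (v, !b)], ¬ ((p ∈ l₁ ∨ p ∈ l₂) ∨ p ∈ l₃) :=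
      fun p hp h => n2 hp (by simpa only [List.mem_append] using h)
    rcases hm with rfl | rfl | rfl | rfl | rfl | rfl | rfl | rfl
    · exact h3 _ (by simp) hm'
    · exact h1 _ hm'
    · exact h2 _ hm'
    · exact h3 _ (by simp) hm'
    · exact h3 _ (by simp) hm'
    · exact h3 _ (by simp) hm'
    · exact h1 _ hm'
    · exact h2 _ hm'

theorem push_signs {c v y : Crossing} {b : Bool} {r : ℤˣ} (hr : c.2 * passageSign (v, b) = r)
    (sy : y.2 = -passageSign (v, b)) :
    y.2 = -(r * c.2) ∧ v.2 = r * c.2 * if b then 1 else -1 := by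
  subst hr
  rw [sy]
  rcases Int.units_eq_one_or c.2 with h | h <;> rw [h] <;> cases b <;> simp [passageSign]

theorem crossings_nodup {c v y n : Crossing} {b : Bool} {w : List Passage} 
    (hcv : c ≠ v) (hc : (c, true) ∈ w) (hv : (v, b) ∈ w) (hyn : y ≠ n) (hy : ∀ b', (y, b') ∉ w)
    (hn : ∀ b', (n, b') ∉ w) : [c, v, y, n].Nodup := by
  have h1 : c ≠ y := by rintro rfl; exact hy _ hc
  have h2 : c ≠ n := by rintro rfl; exact hn _ hc
  have h3 : v ≠ y := by rintro rfl; exact hy _ hv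
  have h4 : v ≠ n := by rintro rfl; exact hn _ hv
  simp [hcv, h1, h2, h3, h4, hyn]

/-- A second Reidemeister move creates `y` and `n` on the overstrand of `c`, so that `c`, `y`, `v`
bound a triangle; a third move on this triangle carries `v` to the other side of the overstrand. The
value of `b` decides which of the two lower strands is the middle one, and the sign `c.2 *
passageSign (v, b)` decides between the parallel and the antiparallel second move. -/
theorem SK.push_tmb {c v y n : Crossing} {b : Bool} {l₁ l₂ l₃ : List Passage}
    (h : Good ([(c, true)] ++ l₁ ++ [(v, b), (c, false)] ++ l₂ ++ [(v, !b)] ++ l₃))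
    (hyn : y ≠ n) (hcv : c ≠ v)
    (hy : ∀ b', (y, b') ∉ [(c, true)] ++ l₁ ++ [(v, b), (c, false)] ++ l₂ ++ [(v, !b)] ++ l₃)
    (hn : ∀ b', (n, b') ∉ [(c, true)] ++ l₁ ++ [(v, b), (c, false)] ++ l₂ ++ [(v, !b)] ++ l₃)
    (sy : y.2 = -passageSign (v, b)) (sn : n.2 = passageSign (v, b)) :
    SK ([(c, true)] ++ l₁ ++ [(v, b), (c, false)] ++ l₂ ++ [(v, !b)] ++ l₃)
      ([(y, true), (c, true), (n, true)] ++ l₁ ++ [(c, false), (v, b)] ++ l₂ ++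
        pushStrand (c.2 * passageSign (v, b)) (v, !b) y n ++ l₃) := by
  have hnd := crossings_nodup (v := v) (b := b) hcv (by simp) (by simp) hyn hy hn
  have hg := good_poke (localExt_poke c v y n b hnd sy sn) (List.Perm.refl _)
    ((perm_pokeStrand _ _ _ _).append_left [(v, b), (c, false)]) h hyn hy hn
  have hyn2 : n.2 = -y.2 := by rw [sy, sn, neg_neg]
  rcases Int.units_eq_one_or (c.2 * passageSign (v, b)) with hr | hr <;>
    obtain ⟨ey, ev⟩ := push_signs hr sy
  · rw [hr] at hg ⊢
    simp only [pokeStrand, pushStrand, show ¬ ((1 : ℤˣ) = -1) by decide, if_false] at hg ⊢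
    refine SK.trans (SK.of_move_rotated h hg (a := (l₁ ++ [(v, b), (c, false)] ++ l₂) ++
      ([(v, !b)] ++ l₃ ++ [(c, true)])) ?_ ?_
      (Move.r2_antiparallel y n hyn2 true (l₁ ++ [(v, b), (c, false)] ++ l₂)
        ([(v, !b)] ++ l₃ ++ [(c, true)]))) ?_
    · simpa using List.isRotated_append (l := [(c, true)])
        (l' := (l₁ ++ [(v, b), (c, false)] ++ l₂ ++ [(v, !b)] ++ l₃))
    · simpa using List.isRotated_append (l := [(c, true)])
        (l' := ([(y, true), (n, true)] ++ l₁ ++ [(v, b), (c, false)] ++ l₂ ++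
          [(n, false), (y, false), (v, !b)] ++ l₃))
    · cases b
      · simpa [inOrder] using SK.triangle_tbm (δ := c.2) (t₁ := -1) (t₂ := 1) (t₃ := -1) (x := y)
          (y := c) (z := v) (l₁ := (n, true) :: l₁) (l₂ := l₂ ++ [(n, false)]) (l₃ := l₃)
          (by simp [ey]) (by simp)
          (by simp [ev]) (by simpa [inOrder] using hg)
      · simpa [inOrder] using SK.triangle_tmb (δ := -c.2) (t₁ := 1) (t₂ := -1) (t₃ := 1) (x := c)
          (y := y) (z := v) (l₁ := (n, true) :: l₁) (l₂ := l₂ ++ [(n, false)]) (l₃ := l₃)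
          (by simp) (by simp [ey])
          (by simp [ev]) (by simpa [inOrder] using hg)
  · rw [hr] at hg ⊢
    simp only [pokeStrand, pushStrand, if_true] at hg ⊢
    refine SK.trans (SK.of_move_rotated h hg (a := (l₁ ++ [(v, b), (c, false)] ++ l₂ ++
      [(v, !b)]) ++ (l₃ ++ [(c, true)])) ?_ ?_
      (Move.r2_parallel y n hyn2 true (l₁ ++ [(v, b), (c, false)] ++ l₂ ++ [(v, !b)])
        (l₃ ++ [(c, true)]))) ?_
    · simpa using List.isRotated_append (l := [(c, true)])
        (l' := (l₁ ++ [(v, b), (c, false)] ++ l₂ ++ [(v, !b)] ++ l₃))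
    · simpa using List.isRotated_append (l := [(c, true)])
        (l' := ([(y, true), (n, true)] ++ l₁ ++ [(v, b), (c, false)] ++ l₂ ++
          [(v, !b), (y, false), (n, false)] ++ l₃))
    · cases b
      · simpa [inOrder] using SK.triangle_tbm (δ := c.2) (t₁ := -1) (t₂ := -1) (t₃ := -1) (x := y)
          (y := c) (z := v) (l₁ := (n, true) :: l₁) (l₂ := l₂) (l₃ := (n, false) :: l₃)
          (by simp [ey]) (by simp)
          (by simp [ev]) (by simpa [inOrder] using hg)
      · simpa [inOrder] using SK.triangle_tmb (δ := -c.2) (t₁ := 1) (t₂ := -1) (t₃ := -1) (x := c)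
          (y := y) (z := v) (l₁ := (n, true) :: l₁) (l₂ := l₂) (l₃ := (n, false) :: l₃)
          (by simp) (by simp [ey])
          (by simp [ev]) (by simpa [inOrder] using hg)

theorem SK.push_tbm {c v y n : Crossing} {b : Bool} {l₁ l₂ l₃ : List Passage}
    (h : Good ([(c, true)] ++ l₁ ++ [(v, !b)] ++ l₂ ++ [(v, b), (c, false)] ++ l₃))
    (hyn : y ≠ n) (hcv : c ≠ v)
    (hy : ∀ b', (y, b') ∉ [(c, true)] ++ l₁ ++ [(v, !b)] ++ l₂ ++ [(v, b), (c, false)] ++ l₃)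
    (hn : ∀ b', (n, b') ∉ [(c, true)] ++ l₁ ++ [(v, !b)] ++ l₂ ++ [(v, b), (c, false)] ++ l₃)
    (sy : y.2 = -passageSign (v, b)) (sn : n.2 = passageSign (v, b)) :
    SK ([(c, true)] ++ l₁ ++ [(v, !b)] ++ l₂ ++ [(v, b), (c, false)] ++ l₃)
      ([(y, true), (c, true), (n, true)] ++ l₁ ++
        pushStrand (c.2 * passageSign (v, b)) (v, !b) y n ++ l₂ ++ [(c, false), (v, b)] ++ l₃) := by
  have hnd := crossings_nodup (v := v) (b := b) hcv (by simp) (by simp) hyn hy hn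
  have hg := good_poke (localExt_poke c v y n b hnd sy sn).swap
    (List.perm_append_comm (l₁ := [(v, !b)]) (l₂ := [(v, b), (c, false)]))
    (List.perm_append_comm.trans
      ((perm_pokeStrand _ _ _ _).append_left [(v, b), (c, false)])) h hyn hy hn
  have hyn2 : n.2 = -y.2 := by rw [sy, sn, neg_neg]
  rcases Int.units_eq_one_or (c.2 * passageSign (v, b)) with hr | hr <;>
    obtain ⟨ey, ev⟩ := push_signs hr sy
  · rw [hr] at hg ⊢
    simp only [pokeStrand, pushStrand, show ¬ ((1 : ℤˣ) = -1) by decide, if_false] at hg ⊢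
    refine SK.trans (SK.of_move_rotated h hg (a := l₁ ++
      ([(v, !b)] ++ l₂ ++ [(v, b), (c, false)] ++ l₃ ++ [(c, true)])) ?_ ?_
      (Move.r2_antiparallel y n hyn2 true l₁
        ([(v, !b)] ++ l₂ ++ [(v, b), (c, false)] ++ l₃ ++ [(c, true)]))) ?_
    · simpa using List.isRotated_append (l := [(c, true)])
        (l' := (l₁ ++ [(v, !b)] ++ l₂ ++ [(v, b), (c, false)] ++ l₃))
    · simpa using List.isRotated_append (l := [(c, true)])
        (l' := ([(y, true), (n, true)] ++ l₁ ++ [(n, false), (y, false), (v, !b)] ++ l₂ ++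
          [(v, b), (c, false)] ++ l₃))
    · cases b
      · simpa [inOrder] using SK.triangle_tmb (δ := c.2) (t₁ := -1) (t₂ := 1) (t₃ := -1) (x := y)
          (y := c) (z := v) (l₁ := (n, true) :: l₁ ++ [(n, false)]) (l₂ := l₂) (l₃ := l₃)
          (by simp [ey]) (by simp)
          (by simp [ev]) (by simpa [inOrder] using hg)
      · simpa [inOrder] using SK.triangle_tbm (δ := -c.2) (t₁ := 1) (t₂ := -1) (t₃ := 1) (x := c)
          (y := y) (z := v) (l₁ := (n, true) :: l₁ ++ [(n, false)]) (l₂ := l₂) (l₃ := l₃)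
          (by simp) (by simp [ey])
          (by simp [ev]) (by simpa [inOrder] using hg)
  · rw [hr] at hg ⊢
    simp only [pokeStrand, pushStrand, if_true] at hg ⊢
    refine SK.trans (SK.of_move_rotated h hg (a := (l₁ ++ [(v, !b)]) ++
      (l₂ ++ [(v, b), (c, false)] ++ l₃ ++ [(c, true)])) ?_ ?_
      (Move.r2_parallel y n hyn2 true (l₁ ++ [(v, !b)])
        (l₂ ++ [(v, b), (c, false)] ++ l₃ ++ [(c, true)]))) ?_
    · simpa using List.isRotated_append (l := [(c, true)])
        (l' := (l₁ ++ [(v, !b)] ++ l₂ ++ [(v, b), (c, false)] ++ l₃))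
    · simpa using List.isRotated_append (l := [(c, true)])
        (l' := ([(y, true), (n, true)] ++ l₁ ++ [(v, !b), (y, false), (n, false)] ++ l₂ ++
          [(v, b), (c, false)] ++ l₃))
    · cases b
      · simpa [inOrder] using SK.triangle_tmb (δ := c.2) (t₁ := -1) (t₂ := -1) (t₃ := -1) (x := y)
          (y := c) (z := v) (l₁ := (n, true) :: l₁) (l₂ := (n, false) :: l₂) (l₃ := l₃)
          (by simp [ey]) (by simp)
          (by simp [ev]) (by simpa [inOrder] using hg)
      · simpa [inOrder] using SK.triangle_tbm (δ := -c.2) (t₁ := 1) (t₂ := -1) (t₃ := -1) (x := c)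
          (y := y) (z := v) (l₁ := (n, true) :: l₁) (l₂ := (n, false) :: l₂) (l₃ := l₃)
          (by simp) (by simp [ey])
          (by simp [ev]) (by simpa [inOrder] using hg)

/-- How the passages change when the crossing of `m`, which comes just before the undercrossing of
`c`, is pushed across the overstrand at `c`. -/
def pushSub (c : Crossing) (m : Passage) (y n : Crossing) (B : List Passage) (p : Passage) :
    List Passage :=
  if p = (c, true) then [(y, true), (c, true), (n, true)]
  else if p = (c, false) then [m]
  else if p = m then [(c, false)]
  else if p = (m.1, !m.2) then B
  else [p]

theorem flatMap_eq_self {f : Passage → List Passage} {l : List Passage} (h : ∀ p ∈ l, f p = [p]) :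
    l.flatMap f = l := by
  induction l with
  | nil => rfl
  | cons a l ih =>
    rw [List.flatMap_cons, h a (by simp), ih fun p hp => h p (by simp [hp])]
    rfl

theorem pushSub_top (c : Crossing) (m : Passage) (y n : Crossing) (B : List Passage) :
    pushSub c m y n B (c, true) = [(y, true), (c, true), (n, true)] := if_pos rfl

theorem pushSub_bottom (c : Crossing) (m : Passage) (y n : Crossing) (B : List Passage) :
    pushSub c m y n B (c, false) = [m] := by simp [pushSub]

theorem pushSub_self {c : Crossing} {m : Passage} (h : c ≠ m.1) (y n : Crossing)
    (B : List Passage) : pushSub c m y n B m = [(c, false)] := by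
  have : ∀ b, m ≠ (c, b) := by rintro b rfl; exact h rfl
  simp [pushSub, this]

theorem pushSub_partner {c : Crossing} {m : Passage} (h : c ≠ m.1) (y n : Crossing)
    (B : List Passage) : pushSub c m y n B (m.1, !m.2) = B := by
  have h1 : (m.1, !m.2) ≠ m := fun h => by simpa using congrArg Prod.snd h
  simp [pushSub, h.symm, h1]

theorem pushSub_of_ne {c : Crossing} {m p : Passage} (h : p.1 ≠ c) (h' : p.1 ≠ m.1) (y n : Crossing)
    (B : List Passage) : pushSub c m y n B p = [p] := by
  have h1 : ∀ b, p ≠ (c, b) := by rintro b rfl; exact h rfl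
  have h2 : p ≠ m := by rintro rfl; exact h' rfl
  have h3 : p ≠ (m.1, !m.2) := by rintro rfl; exact h' rfl
  simp [pushSub, h1, h2, h3]

theorem Good.ne_of_adjacent {w P Q : List Passage} {c : Crossing} {m : Passage} (h : Good w)
    (hw : w = P ++ m :: (c, false) :: Q) (hm : m ≠ (c, true)) : c ≠ m.1 := by
  rintro rfl
  have h2 : m = (m.1, false) := by
    obtain ⟨x, b⟩ := m
    cases b
    · rfl
    · exact absurd rfl hm
  have := h.nodup
  rw [hw, ← h2] at this
  simp [List.nodup_append] at this

/-- Pushing a crossing across an overstrand. -/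
theorem SK.push {w P Q : List Passage} {c : Crossing} {m : Passage} (h : Good w)
    (hw : w = P ++ m :: (c, false) :: Q) (hm : m ≠ (c, true)) :
    ∃ (y n : Crossing) (B : List Passage), (∀ b, (y, b) ∉ w) ∧ (∀ b, (n, b) ∉ w) ∧ y ≠ n ∧
      (B = [(y, false), (m.1, !m.2), (n, false)] ∨ B = [(n, false), (m.1, !m.2), (y, false)]) ∧
      SK w (w.flatMap (pushSub c m y n B)) := by
  have hcv : c ≠ m.1 := h.ne_of_adjacent hw hm
  obtain ⟨v, b⟩ := m
  obtain ⟨y, sy, hy⟩ := exists_fresh w (-passageSign (v, b))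
  obtain ⟨n, sn, hn'⟩ := exists_fresh ((y, true) :: w) (passageSign (v, b))
  have hn : ∀ b, (n, b) ∉ w := fun b hb => hn' b (by simp [hb])
  have hyn : y ≠ n := by rintro rfl; exact hn' true (by simp)
  refine ⟨y, n, pushStrand (c.2 * passageSign (v, b)) (v, !b) y n, hy, hn, hyn, ?_, ?_⟩
  · unfold pushStrand; split_ifs <;> simp
  set B := pushStrand (c.2 * passageSign (v, b)) (v, !b) y n with hB
  set φ := pushSub c (v, b) y n B with hφ
  have f1 : φ (c, true) = [(y, true), (c, true), (n, true)] := pushSub_top _ _ _ _ _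
  have f2 : φ (c, false) = [(v, b)] := pushSub_bottom _ _ _ _ _
  have f3 : φ (v, b) = [(c, false)] := pushSub_self hcv _ _ _
  have f4 : φ (v, !b) = B := pushSub_partner (m := (v, b)) hcv _ _ _
  have hmap : ∀ w', w ~r w' → SK w' (w'.flatMap φ) → SK w (w.flatMap φ) := by
    rintro w' hr hs
    -- The substitution acts passage by passage, so it commutes with rotations and the base point
    -- may be chosen freely.
    refine ((SK.of_isRotated h hr).trans hs).trans (SK.of_isRotated hs.good_right ?_)
    obtain ⟨k, rfl⟩ := hr
    rw [List.rotate_eq_drop_append_take_mod, List.flatMap_append]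
    refine (List.isRotated_append).trans ?_
    rw [← List.flatMap_append, List.take_append_drop]
  have hr : w ~r ((v, b) :: (c, false) :: (Q ++ P)) := by
    rw [hw]
    simpa using List.isRotated_append (l := P) (l' := (v, b) :: (c, false) :: Q)
  have hg := h.of_isRotated hr
  have hct : (c, true) ∈ Q ++ P := by
    have : (c, true) ∈ (v, b) :: (c, false) :: (Q ++ P) := hg.paired c false (by simp)
    simpa [hcv] using this
  have hvt : (v, !b) ∈ Q ++ P := by
    have : (v, !b) ∈ (v, b) :: (c, false) :: (Q ++ P) := hg.paired v b (by simp)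
    have h' : (!b) ≠ b := by cases b <;> simp
    simpa [Ne.symm hcv, h'] using this
  obtain ⟨R₁, R₂, hR⟩ := List.append_of_mem hct
  rw [hR] at hr hg hvt
  have hnd := hg.nodup
  have hid : ∀ R : List Passage, (∀ p ∈ R, p ∈ (v, b) :: (c, false) :: (R₁ ++ (c, true) :: R₂)) →
      (v, b) ∉ R → (v, !b) ∉ R → (c, true) ∉ R → (c, false) ∉ R → R.flatMap φ = R := by
    intro R hR' a1 a2 a3 a4
    refine flatMap_eq_self fun p hp => pushSub_of_ne ?_ ?_ _ _ _
    · rintro rfl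
      obtain ⟨x, b'⟩ := p
      cases b'
      · exact a4 hp
      · exact a3 hp
    · intro hpv
      obtain ⟨x, b'⟩ := p
      obtain rfl : x = v := hpv
      by_cases hb : b' = b
      · exact a1 (hb ▸ hp)
      · have : b' = !b := by revert hb; cases b <;> cases b' <;> simp
        exact a2 (this ▸ hp)
  rw [List.mem_append, List.mem_cons] at hvt
  have hne : (v, !b) ≠ (c, true) := fun e => hcv (congrArg Prod.fst e).symm
  simp only [hne, false_or] at hvt
  -- Whether the second passage of `v` comes before or after the overcrossing of `c` decides between
  -- the two cyclic orders of the three strands.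
  rcases hvt with hvt | hvt
  · obtain ⟨S₁, S₂, rfl⟩ := List.append_of_mem hvt
    have hr' : w ~r ([(c, true)] ++ R₂ ++ [(v, b), (c, false)] ++ S₁ ++ [(v, !b)] ++ S₂) := by
      refine hr.trans ?_
      simpa using List.isRotated_append (l := [(v, b), (c, false)] ++ S₁ ++ [(v, !b)] ++ S₂)
        (l' := [(c, true)] ++ R₂)
    have hg' := h.of_isRotated hr'
    refine hmap _ hr' ?_
    have := SK.push_tmb hg' hyn hcv (fun b' hb => hy b' (hr'.mem_iff.2 hb))
      (fun b' hb => hn b' (hr'.mem_iff.2 hb)) sy sn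
    convert this using 1
    simp only [List.nodup_cons, List.nodup_append', List.mem_append, List.mem_cons, not_or,
      List.disjoint_cons_right] at hnd
    simp only [List.flatMap_append, List.flatMap_cons, List.flatMap_nil, f1, f2, f3, f4]
    rw [hid R₂ (by simp +contextual) (by tauto) (by tauto) (by tauto) (by tauto),
      hid S₁ (by simp +contextual) (by tauto) (by tauto) (by tauto) (by tauto),
      hid S₂ (by simp +contextual) (by tauto) (by tauto) (by tauto) (by tauto)]
    simp
    exact hB
  · obtain ⟨S₁, S₂, rfl⟩ := List.append_of_mem hvt
    have hr' : w ~r ([(c, true)] ++ S₁ ++ [(v, !b)] ++ S₂ ++ [(v, b), (c, false)] ++ R₁) := by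
      refine hr.trans ?_
      simpa using List.isRotated_append (l := [(v, b), (c, false)] ++ R₁)
        (l' := [(c, true)] ++ S₁ ++ [(v, !b)] ++ S₂)
    have hg' := h.of_isRotated hr'
    refine hmap _ hr' ?_
    have := SK.push_tbm hg' hyn hcv (fun b' hb => hy b' (hr'.mem_iff.2 hb))
      (fun b' hb => hn b' (hr'.mem_iff.2 hb)) sy sn
    convert this using 1
    simp only [List.nodup_cons, List.nodup_append', List.mem_append, List.mem_cons, not_or,
      List.disjoint_cons_right] at hnd
    simp only [List.flatMap_append, List.flatMap_cons, List.flatMap_nil, f1, f2, f3, f4]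
    rw [hid R₁ (by simp +contextual) (by tauto) (by tauto) (by tauto) (by tauto),
      hid S₁ (by simp +contextual) (by tauto) (by tauto) (by tauto) (by tauto),
      hid S₂ (by simp +contextual) (by tauto) (by tauto) (by tauto) (by tauto)]
    simp
    exact hB

/-! ### Removing a loop that has only overcrossings -/

theorem walk_eq_of_eq {zi zo : Passage → ℚ} {s t : ℚ} {l : List Passage}
    (h : ∀ m ∈ l, zi m = zo m) (hw : Walk zi zo s l t) :
    s = t ∧ ∀ m ∈ l, zi m = s ∧ zo m = s := by
  induction l generalizing s with
  | nil => exact ⟨hw, by simp⟩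
  | cons a l ih =>
    obtain ⟨h1, h2⟩ := hw
    have ha := h a (by simp)
    obtain ⟨h3, h4⟩ := ih (fun m hm => h m (by simp [hm])) h2
    rw [← ha, h1] at h3 h4
    refine ⟨h3, fun m hm => ?_⟩
    rcases List.mem_cons.1 hm with rfl | hm
    · exact ⟨h1, by rw [← ha, h1]⟩
    · exact h4 m hm

/-- The names of the crossings that are passed. -/
abbrev names (l : List Passage) : List Crossing := l.map Prod.fst

theorem mem_names_of_over {C : List Passage} (hC : ∀ m ∈ C, m.2 = true) (x : Crossing) :
    x ∈ names C ↔ (x, true) ∈ C := by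
  constructor
  · intro h
    obtain ⟨⟨y, b⟩, hm, rfl⟩ := List.mem_map.1 h
    obtain rfl : b = true := hC _ hm
    exact hm
  · intro h
    exact List.mem_map.2 ⟨_, h, rfl⟩

/-- The data of the labelling of the faces for a loop all of whose crossings with the rest of the
knot are overcrossings: `v` is the label to the left of the loop, and `e` is the label outside. -/
structure LoopLabels (C L : List Passage) (Li Lo : Passage → ℚ) (v e : ℚ) : Prop where
  outside : e = v ∨ e = v - 1
  walk : Walk Li Lo e L e
  cross : ∀ c : Crossing, (c, true) ∈ C →
    (c.2 = 1 ∧ Li (c, false) = v - 1 ∧ Lo (c, false) = v) ∨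
    (c.2 = -1 ∧ Li (c, false) = v ∧ Lo (c, false) = v - 1)
  off : ∀ x : Crossing, (x, true) ∈ L → (x, false) ∈ L →
    Li (x, true) = Lo (x, true) ∧ Li (x, false) = Li (x, true) ∧ Lo (x, false) = Li (x, true)

/-- Send a unit flow around the loop. The strands below it carry no flow, so the label on its left
is a constant v and on its right v - 1; a strand that passes below goes from one to the other, in
the direction given by the sign. The corners at `z` show that the knot leaves the loop with one of
the two labels, the outside one. -/
theorem Good.loopLabels {z : Crossing} {b : Bool} {C L : List Passage}
    (h : Good ((z, b) :: C ++ (z, !b) :: L)) (hC : ∀ m ∈ C, m.2 = true) :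
    ∃ (Li Lo : Passage → ℚ) (v e : ℚ), LoopLabels C L Li Lo v e := by
  classical
  have hnd := h.nodup
  simp only [List.cons_append, List.nodup_cons, List.nodup_append', List.mem_append, List.mem_cons,
    not_or, List.disjoint_cons_right] at hnd
  obtain ⟨⟨hz1, -, hz2⟩, hCn, ⟨hz3, hLn⟩, hz4, hd⟩ := hnd
  let zi : Passage → ℚ := fun m => if m ∈ C ∨ m = (z, !b) then 1 else 0
  let zo : Passage → ℚ := fun m => if m ∈ C ∨ m = (z, b) then 1 else 0
  have hbb : (z, b) ≠ (z, !b) := by simp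
  have hziC : ∀ m ∈ C, zi m = 1 ∧ zo m = 1 := fun m hm => ⟨if_pos (Or.inl hm), if_pos (Or.inl hm)⟩
  have hziL : ∀ m ∈ L, zi m = 0 ∧ zo m = 0 := fun m hm =>
    ⟨if_neg (by rintro (h | rfl); exacts [hd h hm, hz3 hm]),
      if_neg (by rintro (h | rfl); exacts [hd h hm, hz2 hm])⟩
  have hz5 : zi (z, b) = 0 ∧ zo (z, b) = 1 :=
    ⟨if_neg (by rintro (h | h); exacts [hz1 h, hbb h]), if_pos (Or.inr rfl)⟩
  have hz6 : zi (z, !b) = 1 ∧ zo (z, !b) = 0 :=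
    ⟨if_pos (Or.inr rfl), if_neg (by rintro (h | h); exacts [hz4 h, hbb h.symm])⟩
  have hmem : ∀ x, (x, true) ∈ (z, b) :: C ++ (z, !b) :: L →
      x = z ∨ ((x, true) ∈ C ∧ (x, false) ∈ L) ∨ ((x, true) ∈ L ∧ (x, false) ∈ L) := by
    intro x hx
    have hx' := h.paired _ _ hx
    simp only [List.cons_append, List.mem_cons, List.mem_append, Bool.not_true,
      Prod.mk.injEq] at hx hx'
    have := fun hh => hC (x, false) hh
    simp only [Bool.false_eq_true, imp_false] at this
    tauto
  obtain ⟨Li, Lo, t, ht, hlab⟩ := h.jordan zi zo 0 (by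
    rw [walk_append]
    exact ⟨1, ⟨hz5.1, by rw [hz5.2]; exact walk_const hziC⟩, hz6.1,
      by rw [hz6.2]; exact walk_const hziL⟩) (by
    intro x hx
    rcases hmem x hx with rfl | ⟨h1, h2⟩ | ⟨h1, h2⟩
    · cases b <;> simp at hz5 hz6 <;> simp [FlowAt, hz5, hz6]
    · simp [FlowAt, hziC _ h1, hziL _ h2]
    · simp [FlowAt, hziL _ h1, hziL _ h2])
  rw [walk_append] at ht
  obtain ⟨r, ⟨t1, t2⟩, t3, t4⟩ := ht
  have hzlab := hlab z (by cases b <;> simp)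
  have hcross : ∀ c, (c, true) ∈ C → (c, false) ∈ L := fun c hc => by
    rcases hmem c (by simp [hc]) with rfl | h | h
    · cases b
      · exact absurd hc hz4
      · exact absurd hc hz1
    · exact h.2
    · exact h.2
  have hconst := walk_eq_of_eq (fun m hm => by
    obtain ⟨c, b'⟩ := m
    obtain rfl : b' = true := hC _ hm
    have hl := hlab c (by simp [hm])
    simp only [LabelAt, hziC _ hm, hziL _ (hcross c hm)] at hl
    split_ifs at hl <;> linarith) t2
  have he : Li (z, b) = Lo (z, !b) ∧ (Lo (z, !b) = r ∨ Lo (z, !b) = r - 1) := by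
    rw [← hconst.1] at t3 ⊢
    unfold LabelAt at hzlab
    cases b <;> simp at hz5 hz6 t3 <;> simp only [hz5, hz6, Bool.not_true, Bool.not_false] at hzlab ⊢ <;>
      split_ifs at hzlab <;> obtain ⟨a1, a2, a3⟩ := hzlab <;>
      refine ⟨by linarith, ?_⟩ <;> first | (left; linarith) | (right; linarith)
  refine ⟨Li, Lo, r, Lo (z, !b), he.2, ?_, ?_, ?_⟩
  · rw [← t1, he.1] at t4
    exact t4
  · intro c hc
    have hl := hlab c (by simp [hc])
    simp only [LabelAt, hziC _ hc, hziL _ (hcross c hc)] at hl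
    have h1 := hconst.2 _ hc
    have h2 := hconst.1
    split_ifs at hl with hs
    · left
      refine ⟨hs, ?_, ?_⟩ <;> linarith
    · right
      refine ⟨(Int.units_eq_one_or c.2).resolve_left hs, ?_, ?_⟩ <;> linarith
  · intro x h1 h2
    have hl := hlab x (by simp [h1])
    simp only [LabelAt, hziL _ h1, hziL _ h2] at hl
    split_ifs at hl with hs <;> refine ⟨?_, ?_, ?_⟩ <;> linarith

/-- Whether one is inside a loop after the passages `l`; `N` are the crossings with the loop. -/
def stateAfter (N : List Crossing) (st : Bool) : List Passage → Bool
  | [] => st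
  | m :: l => stateAfter N (if m.1 ∈ N then !st else st) l

/-- The number of passages inside a loop. -/
def insideCount (N : List Crossing) (st : Bool) : List Passage → ℕ
  | [] => 0
  | m :: l => (if m.1 ∈ N then 0 else if st then 1 else 0) +
      insideCount N (if m.1 ∈ N then !st else st) l

theorem stateAfter_append (N : List Crossing) (st : Bool) (l l' : List Passage) :
    stateAfter N st (l ++ l') = stateAfter N (stateAfter N st l) l' := by
  induction l generalizing st with
  | nil => rfl
  | cons m l ih => simp only [List.cons_append, stateAfter, ih]

theorem insideCount_append (N : List Crossing) (st : Bool) (l l' : List Passage) :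
    insideCount N st (l ++ l') = insideCount N st l + insideCount N (stateAfter N st l) l' := by
  induction l generalizing st with
  | nil => simp [insideCount, stateAfter]
  | cons m l ih => simp only [List.cons_append, stateAfter, insideCount, ih, add_assoc]

theorem stateAfter_congr {N N' : List Crossing} {l : List Passage}
    (h : ∀ m ∈ l, m.1 ∈ N' ↔ m.1 ∈ N) (st : Bool) : stateAfter N' st l = stateAfter N st l := by
  induction l generalizing st with
  | nil => rfl
  | cons m l ih =>
    simp only [stateAfter, h m (by simp)]
    exact ih (fun p hp => h p (by simp [hp])) _

theorem insideCount_congr {N N' : List Crossing} {l : List Passage}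
    (h : ∀ m ∈ l, m.1 ∈ N' ↔ m.1 ∈ N) (st : Bool) : insideCount N' st l = insideCount N st l := by
  induction l generalizing st with
  | nil => rfl
  | cons m l ih =>
    simp only [insideCount, h m (by simp)]
    rw [ih (fun p hp => h p (by simp [hp]))]

/-- The parity count `stateAfter` agrees with the geometry: the label changes only below the loop,
where it switches between v and v - 1, and one of these is the outside label `e`. -/
theorem LoopLabels.state {C L P Q : List Passage} {Li Lo : Passage → ℚ} {v e : ℚ}
    (hl : LoopLabels C L Li Lo v e) (hC : ∀ m ∈ C, m.2 = true)
    (hL : ∀ m ∈ L, m.1 ∈ names C → m.2 = false)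
    (hL' : ∀ m ∈ L, m.1 ∉ names C → (m.1, !m.2) ∈ L) (hPQ : L = P ++ Q) :
    ∃ r, Walk Li Lo e P r ∧ Walk Li Lo r Q e ∧ stateAfter (names C) false P = decide (r ≠ e) := by
  have hw := hl.walk
  rw [hPQ, walk_append] at hw
  obtain ⟨r, h1, h2⟩ := hw
  refine ⟨r, h1, h2, ?_⟩
  have key : ∀ (R : List Passage) (s : ℚ), (∀ m ∈ R, m ∈ L) → Walk Li Lo s R r →
      stateAfter (names C) (decide (s ≠ e)) R = decide (r ≠ e) := by
    intro R
    induction R with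
    | nil =>
      rintro s - h
      obtain rfl : s = r := h
      rfl
    | cons m R ih =>
      rintro s hR ⟨h3, h4⟩
      have hm := hR m (by simp)
      rw [stateAfter, ← ih _ (fun p hp => hR p (by simp [hp])) h4]
      congr 1
      obtain ⟨x, b⟩ := m
      split_ifs with hN
      · obtain rfl : b = false := hL _ hm hN
        have ho := hl.outside
        rw [← h3]
        have hv : v ≠ v - 1 := by linarith
        rcases hl.cross x ((mem_names_of_over hC x).1 hN) with ⟨-, h5, h6⟩ | ⟨-, h5, h6⟩ <;>
          rw [h5, h6] <;> rcases ho with rfl | rfl <;> simp [hv]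
      · have hp := hL' _ hm hN
        rw [← h3]
        cases b
        · have := hl.off x hp hm
          rw [this.2.1, this.2.2]
        · have := hl.off x hm hp
          rw [this.1]
  simpa using key P e (by simp +contextual [hPQ]) h1

/-- As the list ends outside, the last passage inside is followed at once by a crossing with the
loop. There it can be pushed out. -/
theorem exists_last_inside {N : List Crossing} {l : List Passage} {st : Bool}
    (h : 0 < insideCount N st l) (hst : stateAfter N st l = false) :
    ∃ P m c Q, l = P ++ m :: c :: Q ∧ stateAfter N st P = true ∧ m.1 ∉ N ∧ c.1 ∈ N := by
  induction l generalizing st with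
  | nil => simp [insideCount] at h
  | cons m l ih =>
    rw [insideCount] at h
    rw [stateAfter] at hst
    by_cases hpos : 0 < insideCount N (if m.1 ∈ N then !st else st) l
    · obtain ⟨P, m', c, Q, rfl, h2, h3, h4⟩ := ih hpos hst
      exact ⟨m :: P, m', c, Q, rfl, h2, h3, h4⟩
    · have h0 : insideCount N (if m.1 ∈ N then !st else st) l = 0 := by omega
      rw [h0, add_zero] at h
      split_ifs at h hst h0 with h1 h2
      · simp at h
      · subst h2
        obtain _ | ⟨c, Q⟩ := l
        · simp [stateAfter] at hst
        · refine ⟨[], m, c, Q, rfl, rfl, h1, ?_⟩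
          by_contra hc
          simp [insideCount, hc] at h0
      · simp at h

/-- The undercrossings of `p` and `q` come one after the other along `L`, and the knot is inside the
loop between them. -/
def IsChord (N : List Crossing) (L : List Passage) (p q : Crossing) : Prop :=
  p ∈ N ∧ q ∈ N ∧ ∃ P Q, L = P ++ (p, false) :: (q, false) :: Q ∧ stateAfter N false P = false

theorem IsChord.unique_right {N : List Crossing} {L : List Passage} {p q q' : Crossing}
    (hL : L.Nodup) (h : IsChord N L p q) (h' : IsChord N L p q') : q = q' := by
  obtain ⟨-, -, P, Q, hPQ, -⟩ := h
  obtain ⟨-, -, P', Q', hPQ', -⟩ := h'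
  have hn := hL
  have hn' := hL
  rw [hPQ] at hn
  rw [hPQ'] at hn'
  simp only [List.nodup_append', List.nodup_cons, List.disjoint_cons_right] at hn hn'
  have := (List.append_cons_inj_of_notMem (by tauto) (by tauto)).1 (hPQ.symm.trans hPQ')
  simpa using (List.cons.inj this.2.2).1

theorem IsChord.unique_left {N : List Crossing} {L : List Passage} {p p' q : Crossing}
    (hL : L.Nodup) (h : IsChord N L p q) (h' : IsChord N L p' q) : p = p' := by
  obtain ⟨-, -, P, Q, hPQ, -⟩ := h
  obtain ⟨-, -, P', Q', hPQ', -⟩ := h'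
  have hn := hL
  have hn' := hL
  rw [hPQ] at hn
  rw [hPQ'] at hn'
  simp only [List.nodup_append', List.nodup_cons, List.disjoint_cons_right, List.mem_cons,
    not_or] at hn hn'
  have e : (P ++ [(p, false)]) ++ (q, false) :: Q = (P' ++ [(p', false)]) ++ (q, false) :: Q' := by
    simpa using hPQ.symm.trans hPQ'
  have h1 : (q, false) ∉ P' ++ [(p', false)] ∧ (q, false) ∉ Q' := by
    simp only [List.mem_append, List.mem_cons, List.not_mem_nil, or_false, not_or]
    tauto
  have h2 : (q, false) ∉ P ++ [(p, false)] ∧ (q, false) ∉ Q := by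
    simp only [List.mem_append, List.mem_cons, List.not_mem_nil, or_false, not_or]
    tauto
  have := (List.append_cons_inj_of_notMem (by tauto) (by tauto)).1 e
  simpa using (List.append_inj' this.1 rfl).2

/-- The elementary facts about a loop with only overcrossings. -/
structure LoopFacts (z : Crossing) (b : Bool) (C L : List Passage) : Prop where
  all_over : ∀ m ∈ C, m.2 = true
  all_under : ∀ m ∈ L, m.1 ∈ names C → m.2 = false
  partner : ∀ m ∈ L, m.1 ∉ names C → (m.1, !m.2) ∈ L
  cross : ∀ c ∈ names C, (c, false) ∈ L
  nodup_loop : C.Nodup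
  nodup_rest : L.Nodup
  base_loop : z ∉ names C
  base_rest : ∀ b', (z, b') ∉ L

theorem Good.loopFacts {z : Crossing} {b : Bool} {C L : List Passage}
    (h : Good ((z, b) :: C ++ (z, !b) :: L)) (hC : ∀ m ∈ C, m.2 = true) : LoopFacts z b C L := by
  have hnd := h.nodup
  simp only [List.cons_append, List.nodup_cons, List.nodup_append', List.mem_append, List.mem_cons,
    not_or, List.disjoint_cons_right] at hnd
  obtain ⟨⟨hz1, -, hz2⟩, hCn, ⟨hz3, hLn⟩, hz4, hd⟩ := hnd
  have hzz : ∀ b', (z, b') ∉ C ∧ (z, b') ∉ L := fun b' => by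
    by_cases hb : b' = b
    · subst hb; exact ⟨hz1, hz2⟩
    · have : b' = !b := by revert hb; cases b <;> cases b' <;> simp
      subst this; exact ⟨hz4, hz3⟩
  have hp : ∀ m, m ∈ C ∨ m ∈ L → (m.1, !m.2) ∈ C ∨ (m.1, !m.2) ∈ L := by
    intro m hm
    have := h.paired m.1 m.2 (by
      simp only [List.cons_append, List.mem_cons, List.mem_append]
      tauto)
    simp only [List.cons_append, List.mem_cons, List.mem_append] at this
    have hmz : m.1 ≠ z := by
      obtain ⟨x, b'⟩ := m
      rintro rfl
      have := hzz b'
      tauto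
    have h1 : (m.1, !m.2) ≠ (z, b) := fun e => hmz (congrArg Prod.fst e)
    have h2 : (m.1, !m.2) ≠ (z, !b) := fun e => hmz (congrArg Prod.fst e)
    tauto
  refine ⟨hC, ?_, ?_, ?_, hCn, hLn, ?_, fun b' => (hzz b').2⟩
  · rintro ⟨x, b'⟩ hm hx
    rw [mem_names_of_over hC] at hx
    cases b'
    · rfl
    · exact absurd hm (hd hx)
  · rintro ⟨x, b'⟩ hm hx
    refine (hp _ (Or.inr hm)).resolve_left fun h => hx ?_
    exact List.mem_map.2 ⟨_, h, rfl⟩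
  · intro c hc
    rw [mem_names_of_over hC] at hc
    refine (hp _ (Or.inl hc)).resolve_left fun h => ?_
    exact absurd (hC _ h) (by simp)
  · rw [mem_names_of_over hC]
    exact (hzz _).1

/-- Entering and leaving the loop have opposite signs, and which sign belongs to entering depends
only on the side of the loop that is outside. So all chords have the same pattern of signs. -/
theorem IsChord.labels {z : Crossing} {b : Bool} {C L : List Passage} {Li Lo : Passage → ℚ}
    {v e : ℚ} (hf : LoopFacts z b C L) (hl : LoopLabels C L Li Lo v e) {p q : Crossing}
    (h : IsChord (names C) L p q) :
    (e = v - 1 ∧ p.2 = 1 ∧ q.2 = -1) ∨ (e = v ∧ p.2 = -1 ∧ q.2 = 1) := by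
  obtain ⟨hp, hq, P, Q, hPQ, hst⟩ := h
  obtain ⟨r, -, h2, h3⟩ := hl.state hf.all_over hf.all_under hf.partner hPQ
  rw [hst] at h3
  have hr : r = e := by simpa using h3
  obtain ⟨h4, h5, -⟩ := h2
  rw [mem_names_of_over hf.all_over] at hp hq
  rcases hl.cross p hp with ⟨p1, p2, p3⟩ | ⟨p1, p2, p3⟩ <;>
    rcases hl.cross q hq with ⟨q1, q2, q3⟩ | ⟨q1, q2, q3⟩
  · exfalso; linarith
  · left; exact ⟨by linarith, p1, q1⟩
  · right; exact ⟨by linarith, p1, q1⟩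
  · exfalso; linarith

/-- If no passage lies inside, a strand that enters the loop leaves it at its next passage. -/
theorem exists_chord {z : Crossing} {b : Bool} {C L : List Passage} {Li Lo : Passage → ℚ}
    {v e : ℚ} (hf : LoopFacts z b C L) (hl : LoopLabels C L Li Lo v e)
    (h0 : insideCount (names C) false L = 0) {c : Crossing} (hc : c ∈ names C) :
    ∃ d, IsChord (names C) L c d ∨ IsChord (names C) L d c := by
  obtain ⟨P, Q, hPQ⟩ := List.append_of_mem (hf.cross c hc)
  have hend : stateAfter (names C) false L = false := by
    obtain ⟨r, -, h2, h3⟩ := hl.state hf.all_over hf.all_under hf.partner (List.append_nil L).symm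
    rw [h3, show r = e from h2]
    simp
  have hu : ∀ m ∈ P ++ (c, false) :: Q, m.1 ∈ names C → m.2 = false := fun m hm => by
    rw [← hPQ] at hm; exact hf.all_under m hm
  rw [hPQ, insideCount_append, insideCount, if_pos hc] at h0
  rw [hPQ, stateAfter_append, stateAfter, if_pos hc] at hend
  -- If the knot is outside just before `c`, it enters there and the next passage is the other end
  -- of the chord; otherwise it leaves at `c` and the previous passage is the other end.
  cases hst : stateAfter (names C) false P
  · rw [hst] at h0 hend
    obtain _ | ⟨m, Q'⟩ := Q
    · simp [stateAfter] at hend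
    · by_cases hm : m.1 ∈ names C
      · obtain ⟨d, b'⟩ := m
        obtain rfl : b' = false := hu _ (by simp) hm
        exact ⟨d, Or.inl ⟨hc, hm, P, Q', hPQ, hst⟩⟩
      · simp only [insideCount, if_neg hm, if_pos hc, Bool.not_false, if_true] at h0
        omega
  · obtain rfl | ⟨P', m, rfl⟩ := List.eq_nil_or_concat P
    · simp [stateAfter] at hst
    · rw [List.concat_eq_append] at *
      rw [stateAfter_append, stateAfter] at hst
      rw [insideCount_append, insideCount] at h0
      simp only [stateAfter] at hst
      by_cases hm : m.1 ∈ names C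
      · rw [if_pos hm] at hst
        obtain ⟨d, b'⟩ := m
        obtain rfl : b' = false := hu _ (by simp) hm
        exact ⟨d, Or.inr ⟨hm, hc, P', Q, by simpa using hPQ, by simpa using hst⟩⟩
      · rw [if_neg hm] at hst
        simp [hm, hst] at h0

set_option maxHeartbeats 1000000 in
-- The part `X` of the loop from `c` to `d` and the chord of `c` and `d` form a closed curve. By
-- planarity a chord inside the loop cannot lead from `X` to the rest of the loop, since it does not
-- cross this curve.
theorem Good.chords_noncrossing {z : Crossing} {b : Bool} {C₁ X C₃ L : List Passage}
    {c d g k p q p' q' : Crossing} {Li Lo : Passage → ℚ} {v e κ : ℚ}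
    (h : Good ((z, b) :: (C₁ ++ (c, true) :: X ++ (d, true) :: C₃) ++ (z, !b) :: L))
    (hC : ∀ m ∈ C₁ ++ (c, true) :: X ++ (d, true) :: C₃, m.2 = true)
    (hl : LoopLabels (C₁ ++ (c, true) :: X ++ (d, true) :: C₃) L Li Lo v e)
    (hpq : IsChord (names (C₁ ++ (c, true) :: X ++ (d, true) :: C₃)) L p q)
    (hcd : (p = c ∧ q = d ∧ κ = -1) ∨ (p = d ∧ q = c ∧ κ = 1))
    (hpq' : IsChord (names (C₁ ++ (c, true) :: X ++ (d, true) :: C₃)) L p' q')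
    (hgk : (p' = g ∧ q' = k) ∨ (p' = k ∧ q' = g))
    (hg : (g, true) ∈ X) (hk : (k, true) ∈ C₁ ∨ (k, true) ∈ C₃) : False := by
  classical
  have hf := h.loopFacts hC
  have hs := hpq.labels hf hl
  have hs' := hpq'.labels hf hl
  have hss : (p.2 = 1 ∧ q.2 = -1 ∧ p'.2 = 1 ∧ q'.2 = -1) ∨
      (p.2 = -1 ∧ q.2 = 1 ∧ p'.2 = -1 ∧ q'.2 = 1) := by
    rcases hs with ⟨h1, h2, h3⟩ | ⟨h1, h2, h3⟩ <;>
      rcases hs' with ⟨h1', h2', h3'⟩ | ⟨h1', h2', h3'⟩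
    · exact Or.inl ⟨h2, h3, h2', h3'⟩
    · exfalso; linarith
    · exfalso; linarith
    · exact Or.inr ⟨h2, h3, h2', h3'⟩
  obtain ⟨hpN, hqN, P, Q, hPQ, -⟩ := hpq
  obtain ⟨hpN', hqN', P', Q', hPQ', -⟩ := hpq'
  have hnd := h.nodup
  have hXover : ∀ x, (x, false) ∉ X := fun x hx => by simpa using hC (x, false) (by simp [hx])
  -- Unit flow along `X` from `c` to `d`, returning along the chord; κ is -1 if the chord is
  -- directed from `c` to `d` and has to be run backwards.
  let zi : Passage → ℚ := fun m => if m ∈ X ∨ m = (d, true) then 1 else if m = (q, false) then κ else 0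
  let zo : Passage → ℚ := fun m => if m ∈ X ∨ m = (c, true) then 1 else if m = (p, false) then κ else 0
  rw [hPQ] at hnd
  simp only [List.cons_append, List.append_assoc, List.nodup_cons, List.nodup_append',
    List.mem_append, List.mem_cons, not_or, List.disjoint_cons_right,
    List.disjoint_append_right] at hnd
  simp only [List.Disjoint] at hnd
  have hzX : ∀ m ∈ X, zi m = 1 ∧ zo m = 1 := fun m hm => ⟨if_pos (Or.inl hm), if_pos (Or.inl hm)⟩
  have hoff : ∀ m, m ∉ X → m ≠ (d, true) → m ≠ (c, true) → m ≠ (p, false) → m ≠ (q, false) →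
      zi m = 0 ∧ zo m = 0 := fun m h1 h2 h3 h4 h5 => by simp [zi, zo, h1, h2, h3, h4, h5]
  have hz1 : ∀ m ∈ C₁, zi m = 0 ∧ zo m = 0 := fun m hm => by
    clear h hC hl hf hs hs' hpN hqN hpN' hqN' hPQ hPQ'
    apply hoff <;> grind
  have hz3 : ∀ m ∈ C₃, zi m = 0 ∧ zo m = 0 := fun m hm => by
    clear h hC hl hf hs hs' hpN hqN hpN' hqN' hPQ hPQ'
    apply hoff <;> grind
  have hzP : ∀ m ∈ P, zi m = 0 ∧ zo m = 0 := fun m hm => by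
    clear h hC hl hf hs hs' hpN hqN hpN' hqN' hPQ hPQ'
    apply hoff <;> grind
  have hzQ : ∀ m ∈ Q, zi m = 0 ∧ zo m = 0 := fun m hm => by
    clear h hC hl hf hs hs' hpN hqN hpN' hqN' hPQ hPQ'
    apply hoff <;> grind
  have hzz : ∀ b', zi (z, b') = 0 ∧ zo (z, b') = 0 := fun b' => by
    have hb : b' = b ∨ b' = !b := by cases b <;> cases b' <;> simp
    clear h hC hl hf hs hs' hpN hqN hpN' hqN' hPQ hPQ'
    rcases hb with rfl | rfl <;> apply hoff <;> grind
  have hzc : zi (c, true) = 0 ∧ zo (c, true) = 1 := by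
    have h1 : (c, true) ∉ X := by clear h hC hl hf; grind
    have h2 : c ≠ d := by clear h hC hl hf; grind
    simp [zi, zo, h1, h2]
  have hzd : zi (d, true) = 1 ∧ zo (d, true) = 0 := by
    have h1 : (d, true) ∉ X := by clear h hC hl hf; grind
    have h2 : c ≠ d := by clear h hC hl hf; grind
    simp [zi, zo, h2.symm, h1]
  have hzp : zi (p, false) = 0 ∧ zo (p, false) = κ := by
    have h1 : (p, false) ∉ X := by clear h hC hl hf; grind
    have h2 : p ≠ q := by clear h hC hl hf; grind
    simp [zi, zo, h2, h1]
  have hzq : zi (q, false) = κ ∧ zo (q, false) = 0 := by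
    have h1 : (q, false) ∉ X := by clear h hC hl hf; grind
    have h2 : p ≠ q := by clear h hC hl hf; grind
    simp [zi, zo, h2.symm, h1]
  clear_value zi zo
  have hxf : ∀ x, (x, true) ∈ C₁ ∨ (x, true) ∈ X ∨ (x, true) ∈ C₃ →
      zi (x, false) = 0 ∧ zo (x, false) = 0 := fun x hx => by
    clear h hC hl hf hs hs' hpN hqN hpN' hqN' hPQ hPQ'
    apply hoff <;> grind
  obtain ⟨Mi, Mo, t, ht, hlab⟩ := h.jordan zi zo 0 (by
    rw [hPQ, walk_append]
    refine ⟨0, ⟨(hzz b).1, ?_⟩, (hzz _).1, ?_⟩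
    · rw [(hzz b).2, walk_append]
      refine ⟨1, ?_, hzd.1, ?_⟩
      · rw [walk_append]
        refine ⟨0, walk_const hz1, hzc.1, ?_⟩
        rw [hzc.2]; exact walk_const hzX
      · rw [hzd.2]; exact walk_const hz3
    · rw [(hzz _).2, walk_append]
      refine ⟨0, walk_const hzP, hzp.1, ?_⟩
      rw [hzp.2]
      refine ⟨hzq.1, ?_⟩
      rw [hzq.2]
      exact walk_const hzQ) (by
    intro x hx
    by_cases hxc : x = c
    · subst hxc
      rcases hcd with ⟨rfl, rfl, rfl⟩ | ⟨rfl, rfl, rfl⟩ <;> simp [FlowAt, *]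
    by_cases hxd : x = d
    · subst hxd
      rcases hcd with ⟨rfl, rfl, rfl⟩ | ⟨rfl, rfl, rfl⟩ <;> simp [FlowAt, *]
    have hxpq : x ≠ p ∧ x ≠ q := by
      rcases hcd with ⟨rfl, rfl, rfl⟩ | ⟨rfl, rfl, rfl⟩
      exacts [⟨hxc, hxd⟩, ⟨hxd, hxc⟩]
    have h0 : zi (x, false) = 0 ∧ zo (x, false) = 0 := by
      clear h hC hl hf hs hs' hpN hqN hpN' hqN' hPQ hPQ' hcd hgk
      apply hoff <;> grind
    by_cases hxX : (x, true) ∈ X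
    · simp [FlowAt, h0, hzX _ hxX]
    · have : zi (x, true) = 0 ∧ zo (x, true) = 0 := by
        clear h hC hl hf hs hs' hpN hqN hpN' hqN' hPQ hPQ' hcd hgk
        apply hoff <;> grind
      simp [FlowAt, h0, this])
  rw [hPQ', walk_append] at ht
  obtain ⟨r0, ⟨-, ht⟩, -, ht'⟩ := ht
  simp only [walk_append] at ht ht'
  obtain ⟨r1, ⟨r2, ht1, ht2, ht3⟩, ht4, ht5⟩ := ht
  obtain ⟨r4, -, ht6, ht7, -⟩ := ht'
  have hmemC : ∀ x, (x, true) ∈ C₁ ∨ (x, true) ∈ X ∨ (x, true) ∈ C₃ ∨ x = c ∨ x = d →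
      LabelAt zi zo Mi Mo x := fun x hx => hlab x (by
    simp only [List.cons_append, List.mem_cons, List.mem_append, Prod.mk.injEq]
    revert hx
    clear * -
    tauto)
  have hXconst := walk_eq_of_eq (fun m hm => by
    obtain ⟨x, b'⟩ := m
    obtain rfl : b' = true := hC (x, b') (by simp [hm])
    have hl := hmemC x (Or.inr (Or.inl hm))
    simp only [LabelAt, hzX _ hm, hxf x (Or.inr (Or.inl hm))] at hl
    split_ifs at hl <;> linarith) ht3
  have h1const := walk_eq_of_eq (fun m hm => by
    obtain ⟨x, b'⟩ := m
    obtain rfl : b' = true := hC (x, b') (by simp [hm])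
    have hl := hmemC x (Or.inl hm)
    simp only [LabelAt, hz1 _ hm, hxf x (Or.inl hm)] at hl
    split_ifs at hl <;> linarith) ht1
  have h3const := walk_eq_of_eq (fun m hm => by
    obtain ⟨x, b'⟩ := m
    obtain rfl : b' = true := hC (x, b') (by simp [hm])
    have hl := hmemC x (Or.inr (Or.inr (Or.inl hm)))
    simp only [LabelAt, hz3 _ hm, hxf x (Or.inr (Or.inr hm))] at hl
    split_ifs at hl <;> linarith) ht5
  have hlc := hmemC c (Or.inr (Or.inr (Or.inr (Or.inl rfl))))
  have hld := hmemC d (Or.inr (Or.inr (Or.inr (Or.inr rfl))))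
  have hlg := hmemC g (Or.inr (Or.inl hg))
  have hlk := hmemC k (hk.imp_right fun h => Or.inr (Or.inl h))
  have hgX := hXconst.2 _ hg
  -- Off `X` the loop carries no flow, so near `k` there is a single label, the one with which the
  -- loop reaches `c` or leaves `d`.
  have hkeq : ∃ μ, (μ = Mi (c, true) ∨ μ = Mo (d, true)) ∧ Mi (k, false) = μ ∧ Mo (k, false) = μ := by
    rcases hk with hk | hk
    · refine ⟨Mi (c, true), Or.inl rfl, ?_⟩
      have h1 := h1const.2 _ hk
      have h2 := h1const.1
      simp only [LabelAt, hz1 _ hk, hxf k (Or.inl hk)] at hlk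
      split_ifs at hlk <;> constructor <;> linarith
    · refine ⟨Mo (d, true), Or.inr rfl, ?_⟩
      have h1 := h3const.2 _ hk
      have h2 := h3const.1
      simp only [LabelAt, hz3 _ hk, hxf k (Or.inr (Or.inr hk))] at hlk
      split_ifs at hlk <;> constructor <;> linarith
  obtain ⟨μ, hμ, hk1, hk2⟩ := hkeq
  simp only [LabelAt, hzX _ hg, hxf g (Or.inr (Or.inl hg))] at hlg
  have hX1 := hXconst.1
  have hn1 : ¬ ((-1 : ℤˣ) = 1) := by decide
  have hzc' := hzc
  simp only [LabelAt] at hlc hld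
  clear hlab hmemC hXconst h1const h3const hnd hoff hz1 hz3 hzP hzQ hzz hxf hzX hlk hl hPQ hPQ' h hC hf
  -- The chord of `g` and `k` has one label from end to end. At `g` it is the label on one side of
  -- `X`, with the side given by the sign, and at `k` it is μ; the corners `c` and `d` make these
  -- different.
  rcases hcd with ⟨rfl, rfl, rfl⟩ | ⟨rfl, rfl, rfl⟩ <;>
    rcases hgk with ⟨rfl, rfl⟩ | ⟨rfl, rfl⟩ <;>
    rcases hss with ⟨s1, s2, s1', s2'⟩ | ⟨s1, s2, s1', s2'⟩ <;>
    simp only [s1, s2, s1', s2', hn1, if_true, if_false, hzc, hzd, hzp, hzq] at hlc hld hlg <;>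
    obtain ⟨c1, c2, c3⟩ := hlc <;>
    obtain ⟨d1, d2, d3⟩ := hld <;>
    obtain ⟨g1, g2, g3⟩ := hlg <;>
    obtain ⟨x1, x2⟩ := hgX <;>
    rcases hμ with hμ | hμ <;> linarith

/-- A passage between the ends of a chord belongs to a chord whose other end also lies between them,
as chords do not interleave. Descending, one finds a chord with adjacent ends; it bounds a bigon
with the loop. -/
theorem exists_innermost_chord {z : Crossing} {b : Bool} {C L : List Passage}
    (h : Good ((z, b) :: C ++ (z, !b) :: L)) (hC : ∀ m ∈ C, m.2 = true) (hne : C ≠ [])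
    (h0 : insideCount (names C) false L = 0) :
    ∃ C₁ C₃ c d, C = C₁ ++ (c, true) :: (d, true) :: C₃ ∧ d.2 = -c.2 ∧
      (IsChord (names C) L c d ∨ IsChord (names C) L d c) := by
  obtain ⟨Li, Lo, v, e, hl⟩ := h.loopLabels hC
  have hf := h.loopFacts hC
  -- Induction on a bound for the number of passages between the two ends.
  have key : ∀ (k : ℕ) (C₁ X C₃ : List Passage) (c d : Crossing), X.length ≤ k →
      C = C₁ ++ (c, true) :: X ++ (d, true) :: C₃ →
      (IsChord (names C) L c d ∨ IsChord (names C) L d c) →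
      ∃ C₁ C₃ c d, C = C₁ ++ (c, true) :: (d, true) :: C₃ ∧
        (IsChord (names C) L c d ∨ IsChord (names C) L d c) := by
    intro k
    induction k with
    | zero =>
      intro C₁ X C₃ c d hX hCe hcd
      obtain rfl : X = [] := List.length_eq_zero_iff.1 (by omega)
      exact ⟨C₁, C₃, c, d, by simpa using hCe, hcd⟩
    | succ k ih =>
      intro C₁ X C₃ c d hX hCe hcd
      obtain _ | ⟨⟨g, b'⟩, X'⟩ := X
      · exact ⟨C₁, C₃, c, d, by simpa using hCe, hcd⟩
      obtain rfl : b' = true := hC (g, b') (by simp [hCe])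
      have hgN : g ∈ names C := (mem_names_of_over hC g).2 (by simp [hCe])
      obtain ⟨f, hgf⟩ := exists_chord hf hl h0 hgN
      have hfN : f ∈ names C := by
        rcases hgf with h | h
        exacts [h.2.1, h.1]
      have hnd := hf.nodup_loop
      rw [hCe] at hnd
      simp only [List.cons_append, List.append_assoc, List.nodup_append', List.nodup_cons,
        List.mem_append, List.mem_cons, not_or, Prod.mk.injEq, and_true] at hnd
      obtain ⟨-, ⟨⟨hcg, -, hcd', -⟩, ⟨-, hgd, -⟩, -⟩, -⟩ := hnd
      -- By its sign a crossing with the loop is either an entrance or an exit. This and the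
      -- uniqueness of the other end separate `f` from `g`, `c` and `d`.
      have hlab : ∀ {p q r : Crossing}, IsChord (names C) L p q → IsChord (names C) L q r → False :=
        fun h1 h2 => by
          rcases h1.labels hf hl with ⟨e1, e2, e3⟩ | ⟨e1, e2, e3⟩ <;>
            rcases h2.labels hf hl with ⟨e4, e5, e6⟩ | ⟨e4, e5, e6⟩
          · rw [e3] at e5
            exact absurd e5 (by decide)
          · exfalso
            linarith
          · exfalso
            linarith
          · rw [e3] at e5
            exact absurd e5 (by decide)
      have hfg : f ≠ g := by
        rintro rfl
        rcases hgf with h | h <;> exact hlab h h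
      have hfc : f ≠ c := by
        rintro rfl
        rcases hgf with h1 | h1 <;> rcases hcd with h2 | h2
        · exact hlab h1 h2
        · exact hgd (IsChord.unique_left hf.nodup_rest h1 h2)
        · exact hgd (IsChord.unique_right hf.nodup_rest h1 h2)
        · exact hlab h2 h1
      have hfd : f ≠ d := by
        rintro rfl
        rcases hgf with h1 | h1 <;> rcases hcd with h2 | h2
        · exact hcg (IsChord.unique_left hf.nodup_rest h2 h1)
        · exact hlab h1 h2
        · exact hlab h2 h1
        · exact hcg (IsChord.unique_right hf.nodup_rest h2 h1)
      have hfC := (mem_names_of_over hC f).1 hfN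
      rw [hCe] at hfC
      simp only [List.cons_append, List.append_assoc, List.mem_append, List.mem_cons, Prod.mk.injEq,
        hfg, hfc, hfd, false_and, false_or] at hfC
      have hcross : (f, true) ∈ C₁ ∨ (f, true) ∈ C₃ → False := by
        intro hf13
        obtain ⟨p, q, κ, hpq, hκ⟩ : ∃ (p q : Crossing) (κ : ℚ), IsChord (names C) L p q ∧
            ((p = c ∧ q = d ∧ κ = -1) ∨ (p = d ∧ q = c ∧ κ = 1)) := by
          rcases hcd with h | h
          · exact ⟨_, _, -1, h, Or.inl ⟨rfl, rfl, rfl⟩⟩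
          · exact ⟨_, _, 1, h, Or.inr ⟨rfl, rfl, rfl⟩⟩
        obtain ⟨p', q', hpq', hgk⟩ : ∃ p' q' : Crossing, IsChord (names C) L p' q' ∧
            ((p' = g ∧ q' = f) ∨ (p' = f ∧ q' = g)) := by
          rcases hgf with h | h
          · exact ⟨_, _, h, Or.inl ⟨rfl, rfl⟩⟩
          · exact ⟨_, _, h, Or.inr ⟨rfl, rfl⟩⟩
        subst hCe
        exact h.chords_noncrossing hC hl hpq hκ hpq' hgk (by simp) hf13
      rcases hfC with h1 | h1 | h1
      · exact (hcross (Or.inl h1)).elim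
      · obtain ⟨X₁, X₂, rfl⟩ := List.append_of_mem h1
        refine ih (C₁ ++ [(c, true)]) X₁ (X₂ ++ (d, true) :: C₃) g f ?_ ?_ hgf
        · simp at hX; omega
        · simp [hCe]
      · exact (hcross (Or.inr h1)).elim
  obtain ⟨⟨c, b'⟩, C', rfl⟩ := List.exists_cons_of_ne_nil hne
  obtain rfl : b' = true := hC (c, b') (by simp)
  obtain ⟨d, hd⟩ := exists_chord hf hl h0 (c := c) (by simp)
  have hdN : d ∈ names ((c, true) :: C') := by
    rcases hd with h | h
    exacts [h.2.1, h.1]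
  have hdc : d ≠ c := by
    rintro rfl
    rcases hd with h | h <;>
    · rcases h.labels hf hl with ⟨e1, e2, e3⟩ | ⟨e1, e2, e3⟩ <;> rw [e2] at e3 <;>
        exact absurd e3 (by decide)
  have hdC := (mem_names_of_over hC d).1 hdN
  simp only [List.mem_cons, Prod.mk.injEq, hdc, false_and, false_or] at hdC
  obtain ⟨X, C₃, rfl⟩ := List.append_of_mem hdC
  obtain ⟨C₁, C₃', c', d', he, hcd⟩ := key X.length [] X C₃ c d le_rfl rfl hd
  refine ⟨C₁, C₃', c', d', he, ?_, hcd⟩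
  rcases hcd with h | h <;> rcases h.labels hf hl with ⟨e1, e2, e3⟩ | ⟨e1, e2, e3⟩ <;>
    rw [e2, e3] <;> rfl

theorem names_insert (C₁ C₂ : List Passage) (c y n x : Crossing) :
    x ∈ names (C₁ ++ [(y, true), (c, true), (n, true)] ++ C₂) ↔
      x = y ∨ x = n ∨ x ∈ names (C₁ ++ (c, true) :: C₂) := by
  simp
  tauto

/-- The measure drops when a crossing is pushed out of the loop. -/
theorem insideCount_push {N N' : List Crossing} {S₁ S₂ Q : List Passage} {c y n : Crossing}
    {m m' : Passage} {B : List Passage} (hm : m.1 ∉ N) (hm' : m'.1 ∉ N) (hc : c ∈ N)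
    (hN' : ∀ x, x ∈ N' ↔ x = y ∨ x = n ∨ x ∈ N)
    (hfresh : ∀ p ∈ S₁ ++ S₂ ++ [m, m'] ++ Q, p.1 ≠ y ∧ p.1 ≠ n)
    (hB : B = [(y, false), m', (n, false)] ∨ B = [(n, false), m', (y, false)]) :
    (stateAfter N false S₁ = true → stateAfter N false (S₁ ++ m' :: S₂) = true →
      insideCount N' false (S₁ ++ B ++ S₂ ++ (c, false) :: m :: Q) <
        insideCount N false (S₁ ++ m' :: S₂ ++ m :: (c, false) :: Q)) ∧
    (stateAfter N false S₁ = true → stateAfter N false (S₁ ++ m :: (c, false) :: S₂) = true →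
      insideCount N' false (S₁ ++ (c, false) :: m :: S₂ ++ B ++ Q) <
        insideCount N false (S₁ ++ m :: (c, false) :: S₂ ++ m' :: Q)) ∧
    (∀ R : List Passage, (∀ p ∈ R, p ∈ S₁ ++ S₂ ++ [m, m'] ++ Q) →
      R.filter (fun p => p.1 ∉ N') = R.filter (fun p => p.1 ∉ N)) ∧
    B.filter (fun p => p.1 ∉ N') = [m'] := by
  have hiff : ∀ p ∈ S₁ ++ S₂ ++ [m, m'] ++ Q, p.1 ∈ N' ↔ p.1 ∈ N := fun p hp => by
    have := hfresh p hp
    rw [hN']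
    tauto
  have h1 : ∀ p ∈ S₁, p.1 ∈ N' ↔ p.1 ∈ N := fun p hp => hiff p (by simp [hp])
  have h2 : ∀ p ∈ S₂, p.1 ∈ N' ↔ p.1 ∈ N := fun p hp => hiff p (by simp [hp])
  have h3 : ∀ p ∈ Q, p.1 ∈ N' ↔ p.1 ∈ N := fun p hp => hiff p (by simp [hp])
  have hmN : m.1 ∉ N' := fun h => hm ((hiff m (by simp)).1 h)
  have hmN' : m'.1 ∉ N' := fun h => hm' ((hiff m' (by simp)).1 h)
  have hcN : c ∈ N' := (hN' c).2 (by tauto)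
  have hyN : y ∈ N' := (hN' y).2 (by tauto)
  have hnN : n ∈ N' := (hN' n).2 (by tauto)
  refine ⟨?_, ?_, ?_, ?_⟩
  · intro s1 s2
    simp only [stateAfter_append, stateAfter, s1, if_neg hm'] at s2
    rcases hB with rfl | rfl <;>
    simp only [insideCount_append, stateAfter_append, stateAfter, insideCount,
      stateAfter_congr h1, stateAfter_congr h2, insideCount_congr h1, insideCount_congr h2,
      insideCount_congr h3, s1, s2, if_neg hm', if_neg hm, if_neg hmN, if_neg hmN', if_pos hc,
      if_pos hcN, if_pos hyN, if_pos hnN, Bool.not_true, Bool.not_false, Bool.false_eq_true,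
      if_true, if_false] <;> omega
  · intro s1 s2
    simp only [stateAfter_append, stateAfter, s1, if_neg hm, if_pos hc, Bool.not_true] at s2
    rcases hB with rfl | rfl <;>
    simp only [insideCount_append, stateAfter_append, stateAfter, insideCount,
      stateAfter_congr h1, stateAfter_congr h2, insideCount_congr h1, insideCount_congr h2,
      insideCount_congr h3, s1, s2, if_neg hm', if_neg hm, if_neg hmN, if_neg hmN', if_pos hc,
      if_pos hcN, if_pos hyN, if_pos hnN, Bool.not_true, Bool.not_false, Bool.false_eq_true,
      if_true, if_false] <;> omega
  · intro R hR
    refine List.filter_congr fun p hp => ?_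
    rw [decide_eq_decide, hiff p (hR p hp)]
  · rcases hB with rfl | rfl <;> simp [hyN, hnN, hmN']

set_option maxHeartbeats 8000000 in
-- If something lies inside the loop, its last crossing is pushed out; the loop then gains two
-- crossings but the number of passages inside drops, whence the weight 3. If nothing lies inside,
-- an innermost chord is removed by a second Reidemeister move. A loop without crossings is a kink.
theorem SK.remove_loop (k : ℕ) : ∀ (C L : List Passage) (z : Crossing) (b : Bool),
    3 * insideCount (names C) false L + C.length ≤ k → Good ((z, b) :: C ++ (z, !b) :: L) →
    (∀ m ∈ C, m.2 = true) →
    SK ((z, b) :: C ++ (z, !b) :: L) (L.filter fun m => m.1 ∉ names C) := by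
  induction k using Nat.strong_induction_on with
  | _ k ih =>
  intro C L z b hk h hC
  have hf := h.loopFacts hC
  obtain ⟨Li, Lo, v, e, hl⟩ := h.loopLabels hC
  by_cases h0 : insideCount (names C) false L = 0
  · by_cases hne : C = []
    · subst hne
      simpa using SK.remove_kink h
    obtain ⟨C₁, C₃, c, d, rfl, hcd, hch⟩ := exists_innermost_chord h hC hne h0
    -- The induction step after the removal of a bigon, for both directions of the chord at once.
    have hend : ∀ P Q : List Passage, ∀ p q : Crossing,
        ((p = c ∧ q = d) ∨ (p = d ∧ q = c)) → L = P ++ (p, false) :: (q, false) :: Q →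
        stateAfter (names (C₁ ++ (c, true) :: (d, true) :: C₃)) false P = false →
        SK ((z, b) :: (C₁ ++ (c, true) :: (d, true) :: C₃) ++ (z, !b) :: L)
          ((z, b) :: (C₁ ++ C₃) ++ (z, !b) :: (P ++ Q)) →
        SK ((z, b) :: (C₁ ++ (c, true) :: (d, true) :: C₃) ++ (z, !b) :: L)
          (L.filter fun m => m.1 ∉ names (C₁ ++ (c, true) :: (d, true) :: C₃)) := by
      intro P Q p q hpq hPQ hst hsk
      have hndL := hf.nodup_rest
      rw [hPQ] at hndL
      have hPQiff : ∀ m ∈ P ++ Q, m.1 ∈ names (C₁ ++ C₃) ↔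
          m.1 ∈ names (C₁ ++ (c, true) :: (d, true) :: C₃) := by
        rintro ⟨x, b'⟩ hm
        have h1 : x ∈ names (C₁ ++ (c, true) :: (d, true) :: C₃) ↔
            x ∈ names (C₁ ++ C₃) ∨ x = c ∨ x = d := by simp; tauto
        rw [h1]
        refine ⟨Or.inl, fun h2 => h2.resolve_right fun h3 => ?_⟩
        have hb : b' = false := hf.all_under (x, b') (by
          rw [hPQ]; simp at hm ⊢; tauto) (h1.2 h2)
        subst hb
        simp only [List.nodup_append', List.nodup_cons, List.mem_cons, not_or,
          List.disjoint_cons_right] at hndL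
        simp only [List.mem_append] at hm
        rcases hpq with ⟨rfl, rfl⟩ | ⟨rfl, rfl⟩ <;> rcases h3 with rfl | rfl <;> tauto
      have hP : ∀ m ∈ P, m.1 ∈ names (C₁ ++ C₃) ↔
          m.1 ∈ names (C₁ ++ (c, true) :: (d, true) :: C₃) := fun m hm => hPQiff m (by simp [hm])
      have hQ : ∀ m ∈ Q, m.1 ∈ names (C₁ ++ C₃) ↔
          m.1 ∈ names (C₁ ++ (c, true) :: (d, true) :: C₃) := fun m hm => hPQiff m (by simp [hm])
      have hcN : c ∈ names (C₁ ++ (c, true) :: (d, true) :: C₃) := by simp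
      have hdN : d ∈ names (C₁ ++ (c, true) :: (d, true) :: C₃) := by simp
      have hpN : p ∈ names (C₁ ++ (c, true) :: (d, true) :: C₃) := by
        rcases hpq with ⟨rfl, rfl⟩ | ⟨rfl, rfl⟩ <;> assumption
      have hqN : q ∈ names (C₁ ++ (c, true) :: (d, true) :: C₃) := by
        rcases hpq with ⟨rfl, rfl⟩ | ⟨rfl, rfl⟩ <;> assumption
      have hcount : insideCount (names (C₁ ++ C₃)) false (P ++ Q) = 0 := by
        rw [hPQ] at h0
        simp only [insideCount_append, insideCount, hst, if_pos hpN, if_pos hqN,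
          Bool.not_false, Bool.not_true] at h0
        rw [insideCount_append, stateAfter_congr hP, hst, insideCount_congr hP,
          insideCount_congr hQ]
        omega
      have := ih (k - 1) (by simp at hk; omega) (C₁ ++ C₃) (P ++ Q) z b
        (by rw [hcount]; simp at hk ⊢; omega) hsk.good_right
        (fun m hm => hC m (by simp at hm ⊢; tauto))
      refine hsk.trans ?_
      convert this using 1
      rw [hPQ, List.filter_append, List.filter_append, List.filter_cons_of_neg (by rwa [decide_eq_true_eq, not_not]),
        List.filter_cons_of_neg (by rwa [decide_eq_true_eq, not_not])]
      congr 1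
      · exact List.filter_congr fun m hm => by rw [decide_eq_decide, hP m hm]
      · exact List.filter_congr fun m hm => by rw [decide_eq_decide, hQ m hm]
    rcases hch with ⟨-, -, P, Q, hPQ, hst⟩ | ⟨-, -, P, Q, hPQ, hst⟩
    · refine hend P Q c d (Or.inl ⟨rfl, rfl⟩) hPQ hst ?_
      subst hPQ
      have hr : ((z, b) :: (C₁ ++ (c, true) :: (d, true) :: C₃) ++
          (z, !b) :: (P ++ (c, false) :: (d, false) :: Q)) ~r ([(c, true), (d, true)] ++
          (C₃ ++ (z, !b) :: P) ++ [(c, false), (d, false)] ++ (Q ++ (z, b) :: C₁)) := by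
        simpa using List.isRotated_append (l := (z, b) :: C₁)
          (l' := (c, true) :: (d, true) :: C₃ ++ (z, !b) :: (P ++ (c, false) :: (d, false) :: Q))
      have h1 := SK.remove_bigon_parallel hcd (b := true) (h.of_isRotated hr)
      refine ((SK.of_isRotated h hr).trans h1).trans (SK.of_isRotated h1.good_right ?_)
      simpa using List.isRotated_append (l := C₃ ++ (z, !b) :: P ++ Q) (l' := (z, b) :: C₁)
    · refine hend P Q d c (Or.inr ⟨rfl, rfl⟩) hPQ hst ?_
      subst hPQ
      have hr : ((z, b) :: (C₁ ++ (c, true) :: (d, true) :: C₃) ++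
          (z, !b) :: (P ++ (d, false) :: (c, false) :: Q)) ~r ([(c, true), (d, true)] ++
          (C₃ ++ (z, !b) :: P) ++ [(d, false), (c, false)] ++ (Q ++ (z, b) :: C₁)) := by
        simpa using List.isRotated_append (l := (z, b) :: C₁)
          (l' := (c, true) :: (d, true) :: C₃ ++ (z, !b) :: (P ++ (d, false) :: (c, false) :: Q))
      have h1 := SK.remove_bigon_antiparallel hcd (b := true) (h.of_isRotated hr)
      refine ((SK.of_isRotated h hr).trans h1).trans (SK.of_isRotated h1.good_right ?_)
      simpa using List.isRotated_append (l := C₃ ++ (z, !b) :: P ++ Q) (l' := (z, b) :: C₁)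
  · have hend : stateAfter (names C) false L = false := by
      obtain ⟨r, -, h2, h3⟩ := hl.state hf.all_over hf.all_under hf.partner
        (List.append_nil L).symm
      rw [h3, show r = e from h2]
      simp
    obtain ⟨P, m, ⟨c, b'⟩, Q, hPQ, hstP, hmN, hcN⟩ := exists_last_inside (by omega) hend
    obtain rfl : b' = false := hf.all_under (c, b') (by simp [hPQ]) hcN
    have hcN' : c ∈ names C := hcN
    have hw : (z, b) :: C ++ (z, !b) :: L =
        ((z, b) :: C ++ (z, !b) :: P) ++ m :: (c, false) :: Q := by simp [hPQ]
    have hmc : m ≠ (c, true) := by rintro rfl; exact hmN hcN'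
    obtain ⟨y, n, B, hy, hn, hyn, hB, hsk⟩ := SK.push h hw hmc
    have hcC := (mem_names_of_over hC c).1 hcN'
    obtain ⟨C₁, C₂, rfl⟩ := List.append_of_mem hcC
    have hmz : m.1 ≠ z := by
      rintro rfl
      exact hf.base_rest m.2 (by simp [hPQ])
    have hcz : c ≠ z := by
      rintro rfl
      exact hf.base_loop hcN'
    have hndC := hf.nodup_loop
    have hndL := hf.nodup_rest
    have hCfix : ∀ p ∈ C₁ ++ C₂, pushSub c m y n B p = [p] := by
      intro p hp
      have hp' : p ∈ C₁ ++ (c, true) :: C₂ := by simp at hp ⊢; tauto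
      refine pushSub_of_ne ?_ ?_ _ _ _
      · rintro rfl
        have : p = (p.1, true) := Prod.ext rfl (hC p hp')
        rw [this] at hp
        simp only [List.nodup_append', List.nodup_cons, List.disjoint_cons_right] at hndC
        simp only [List.mem_append] at hp
        tauto
      · intro e
        exact hmN (e ▸ List.mem_map.2 ⟨p, hp', rfl⟩)
    have hm' : (m.1, !m.2) ∈ L := hf.partner m (by simp [hPQ]) hmN
    have hLfix : ∀ p ∈ L, p ≠ m → p ≠ (c, false) → p ≠ (m.1, !m.2) →
        pushSub c m y n B p = [p] := by
      intro p hp h1 h2 h3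
      have h4 : p ≠ (c, true) := by
        rintro rfl
        exact absurd (hf.all_under _ hp hcN') (by simp)
      simp [pushSub, h1, h2, h3, h4]
    have hzfix : ∀ b', pushSub c m y n B (z, b') = [(z, b')] := fun b' =>
      pushSub_of_ne hcz.symm hmz.symm _ _ _
    have hmfix : pushSub c m y n B m = [(c, false)] :=
      pushSub_self (fun e => hmN (by rw [← e]; exact hcN')) _ _ _
    have hmfix' : pushSub c m y n B (m.1, !m.2) = B :=
      pushSub_partner (fun e => hmN (by rw [← e]; exact hcN')) _ _ _
    have hform : ((z, b) :: (C₁ ++ (c, true) :: C₂) ++ (z, !b) :: L).flatMap (pushSub c m y n B) =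
        (z, b) :: (C₁ ++ [(y, true), (c, true), (n, true)] ++ C₂) ++
          (z, !b) :: L.flatMap (pushSub c m y n B) := by
      simp only [List.cons_append, List.flatMap_cons, List.flatMap_append, hzfix, pushSub_top,
        flatMap_eq_self (fun p hp => hCfix p (List.mem_append_left _ hp)),
        flatMap_eq_self (fun p hp => hCfix p (List.mem_append_right _ hp))]
      simp
    rw [hform] at hsk
    have hfreshL : ∀ p ∈ L, p.1 ≠ y ∧ p.1 ≠ n := fun p hp =>
      ⟨fun e => hy p.2 (by rw [← e]; simp [hp]), fun e => hn p.2 (by rw [← e]; simp [hp])⟩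
    have hCnew : ∀ p ∈ C₁ ++ [(y, true), (c, true), (n, true)] ++ C₂, p.2 = true := by
      intro p hp
      simp only [List.mem_append, List.mem_cons, List.not_mem_nil, or_false] at hp
      rcases hp with (hp | rfl | rfl | rfl) | hp
      · exact hC p (by simp [hp])
      · rfl
      · rfl
      · rfl
      · exact hC p (by simp [hp])
    have hN' := names_insert C₁ C₂ c y n
    have hfin : insideCount (names (C₁ ++ [(y, true), (c, true), (n, true)] ++ C₂)) false
          (L.flatMap (pushSub c m y n B)) <
          insideCount (names (C₁ ++ (c, true) :: C₂)) false L ∧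
        (L.flatMap (pushSub c m y n B)).filter (fun m => m.1 ∉
          names (C₁ ++ [(y, true), (c, true), (n, true)] ++ C₂)) =
        L.filter (fun m => m.1 ∉ names (C₁ ++ (c, true) :: C₂)) := by
      have hmm : m ≠ (m.1, !m.2) := fun e => by simpa using congrArg Prod.snd e
      have hmc' : (m.1, !m.2) ≠ (c, false) := fun e =>
        hmN (by rw [show m.1 = c from congrArg Prod.fst e]; exact hcN')
      have hcP : c ∈ names (C₁ ++ [(y, true), (c, true), (n, true)] ++ C₂) := by simp
      have hmN2 : m.1 ∉ names (C₁ ++ [(y, true), (c, true), (n, true)] ++ C₂) := by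
        rw [hN']
        have := hfreshL m (by simp [hPQ])
        tauto
      obtain ⟨r, -, hQw, hr⟩ := hl.state hf.all_over hf.all_under hf.partner hPQ
      have hrm : r = Li m := hQw.1.symm
      have hre : Li m ≠ e := by
        rw [← hrm]
        rw [hstP] at hr
        simpa using hr.symm
      -- Both strands of a crossing off the loop see the same label, so the partner of `m` is inside
      -- as well. It leaves together with `m`, which makes the count drop.
      have hLim : Li (m.1, !m.2) = Li m := by
        have hmL : m ∈ L := by simp [hPQ]
        obtain ⟨x, b'⟩ := m
        cases b'
        · exact (hl.off x hm' hmL).2.1.symm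
        · exact (hl.off x hmL hm').2.1
      have hst' : ∀ S T, L = S ++ (m.1, !m.2) :: T →
          stateAfter (names (C₁ ++ (c, true) :: C₂)) false S = true := by
        intro S T hST
        obtain ⟨r', -, hTw, hr'⟩ := hl.state hf.all_over hf.all_under hf.partner hST
        rw [hr', ← hTw.1, hLim]
        simpa using hre
      have hm'PQ : (m.1, !m.2) ∈ P ∨ (m.1, !m.2) ∈ Q := by
        rw [hPQ] at hm'
        simp only [List.mem_append, List.mem_cons, hmm.symm, hmc', false_or] at hm'
        exact hm'
      rcases hm'PQ with hmP | hmQ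
      · obtain ⟨S₁, S₂, rfl⟩ := List.append_of_mem hmP
        have hs1 := hst' S₁ (S₂ ++ m :: (c, false) :: Q) (by simp [hPQ])
        obtain ⟨i1, -, i3, i4⟩ := insideCount_push (S₁ := S₁) (S₂ := S₂) (Q := Q) (m := m)
          (m' := (m.1, !m.2)) hmN hmN hcN' hN' (fun p hp => hfreshL p (by
            rw [hPQ]; simp at hp ⊢; tauto)) hB
        rw [hPQ] at hndL
        simp only [List.nodup_append', List.nodup_cons, List.mem_append, List.mem_cons, not_or,
          List.disjoint_cons_right, List.disjoint_cons_left, List.disjoint_append_left] at hndL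
        have hfm : L.flatMap (pushSub c m y n B) = S₁ ++ B ++ S₂ ++ (c, false) :: m :: Q := by
          rw [hPQ]
          simp only [List.flatMap_append, List.flatMap_cons, hmfix, hmfix', pushSub_bottom]
          rw [flatMap_eq_self (l := S₁) fun p hp => hLfix p (by simp [hPQ, hp])
              (by rintro rfl; tauto) (by rintro rfl; tauto) (by rintro rfl; tauto),
            flatMap_eq_self (l := S₂) fun p hp => hLfix p (by simp [hPQ, hp])
              (by rintro rfl; tauto) (by rintro rfl; tauto) (by rintro rfl; tauto),
            flatMap_eq_self (l := Q) fun p hp => hLfix p (by simp [hPQ, hp])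
              (by rintro rfl; tauto) (by rintro rfl; tauto) (by rintro rfl; tauto)]
          simp
        rw [hfm, hPQ]
        refine ⟨i1 hs1 hstP, ?_⟩
        simp only [List.filter_append, i4]
        rw [i3 S₁ (by simp +contextual), i3 S₂ (by simp +contextual),
          List.filter_cons_of_neg (by simp), List.filter_cons_of_pos (by simpa using hmN2),
          List.filter_cons_of_pos (a := (m.1, !m.2)) (by simpa using hmN),
          List.filter_cons_of_pos (a := m) (by simpa using hmN),
          List.filter_cons_of_neg (a := (c, false)) (by simp),
          i3 Q (by simp +contextual)]
        simp
      · obtain ⟨S₁, S₂, rfl⟩ := List.append_of_mem hmQ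
        have hs1 := hst' (P ++ m :: (c, false) :: S₁) S₂ (by simp [hPQ])
        obtain ⟨-, i1, i3, i4⟩ := insideCount_push (S₁ := P) (S₂ := S₁) (Q := S₂) (m := m)
          (m' := (m.1, !m.2)) hmN hmN hcN' hN' (fun p hp => hfreshL p (by
            rw [hPQ]; simp at hp ⊢; tauto)) hB
        rw [hPQ] at hndL
        simp only [List.nodup_append', List.nodup_cons, List.mem_append, List.mem_cons, not_or,
          List.disjoint_cons_right, List.disjoint_append_right] at hndL
        have hfm : L.flatMap (pushSub c m y n B) = P ++ (c, false) :: m :: S₁ ++ B ++ S₂ := by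
          rw [hPQ]
          simp only [List.flatMap_append, List.flatMap_cons, hmfix, hmfix', pushSub_bottom]
          rw [flatMap_eq_self (l := S₁) fun p hp => hLfix p (by simp [hPQ, hp])
              (by rintro rfl; tauto) (by rintro rfl; tauto) (by rintro rfl; tauto),
            flatMap_eq_self (l := S₂) fun p hp => hLfix p (by simp [hPQ, hp])
              (by rintro rfl; tauto) (by rintro rfl; tauto) (by rintro rfl; tauto),
            flatMap_eq_self (l := P) fun p hp => hLfix p (by simp [hPQ, hp])
              (by rintro rfl; tauto) (by rintro rfl; tauto) (by rintro rfl; tauto)]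
          simp
        rw [hfm]
        have hLe : L = P ++ m :: (c, false) :: S₁ ++ (m.1, !m.2) :: S₂ := by simp [hPQ]
        rw [hLe]
        refine ⟨i1 hstP hs1, ?_⟩
        simp only [List.filter_append, i4]
        rw [i3 P (by simp +contextual), i3 S₂ (by simp +contextual),
          List.filter_cons_of_neg (by simp), List.filter_cons_of_pos (by simpa using hmN2),
          List.filter_cons_of_pos (a := (m.1, !m.2)) (by simpa using hmN),
          List.filter_cons_of_pos (a := m) (by simpa using hmN),
          List.filter_cons_of_neg (a := (c, false)) (by simp),
          i3 S₁ (by simp +contextual)]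
        simp
    have := ih (k - 1) (by omega) _ _ z b (by
      have := hfin.1
      simp only [List.length_append, List.length_cons, List.length_nil] at hk ⊢
      omega) hsk.good_right hCnew
    rw [hfin.2] at this
    exact hsk.trans this

/-! ### Crossing counts, and sliding an overstrand along an understrand -/

theorem length_flatMap_pushSub {w : List Passage} {c : Crossing} {m : Passage} (hcm : c ≠ m.1)
    {y n : Crossing} {B : List Passage} (hB : B.length = 3) :
    (w.flatMap (pushSub c m y n B)).length =
      w.length + 2 * w.count (c, true) + 2 * w.count (m.1, !m.2) := by
  induction w with
  | nil => rfl
  | cons p w ih =>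
    have key : (pushSub c m y n B p).length =
        1 + 2 * (if p = (c, true) then 1 else 0) + 2 * (if p = (m.1, !m.2) then 1 else 0) := by
      by_cases h1 : p = (c, true)
      · subst h1
        have : (c, true) ≠ (m.1, !m.2) := fun e => hcm (congrArg Prod.fst e)
        rw [pushSub_top, if_pos rfl, if_neg this]
        rfl
      · by_cases h2 : p = (m.1, !m.2)
        · subst h2
          rw [pushSub_partner hcm, if_pos rfl, if_neg h1, hB]
        · rw [if_neg h1, if_neg h2]
          by_cases h3 : p = m
          · subst h3
            rw [pushSub_self hcm]
            rfl
          · by_cases h4 : p = (c, false)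
            · subst h4
              rw [pushSub_bottom]
              rfl
            · simp [pushSub, h1, h2, h3, h4]
    rw [List.flatMap_cons, List.length_append, ih, key, List.length_cons, List.count_cons,
      List.count_cons]
    simp only [beq_iff_eq]
    omega

theorem Good.length_push {w P Q : List Passage} {c : Crossing} {m : Passage} (h : Good w)
    (hw : w = P ++ m :: (c, false) :: Q) (hm : m ≠ (c, true)) {y n : Crossing} {B : List Passage}
    (hB : B = [(y, false), (m.1, !m.2), (n, false)] ∨ B = [(n, false), (m.1, !m.2), (y, false)]) :
    (w.flatMap (pushSub c m y n B)).length = w.length + 4 := by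
  rw [length_flatMap_pushSub (h.ne_of_adjacent hw hm) (by rcases hB with rfl | rfl <;> rfl),
    List.count_eq_one_of_mem h.nodup (show (c, true) ∈ w from h.paired c false (by simp [hw])),
    List.count_eq_one_of_mem h.nodup (h.paired m.1 m.2 (by simp [hw]))]

/-- The loop removal with the number of crossings it removes. -/
theorem SK.remove_loop_length {C L : List Passage} {z : Crossing} {b : Bool}
    (h : Good ((z, b) :: C ++ (z, !b) :: L)) (hC : ∀ m ∈ C, m.2 = true) :
    SK ((z, b) :: C ++ (z, !b) :: L) (L.filter fun m => m.1 ∉ names C) ∧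
      (L.filter fun m => m.1 ∉ names C).length + 2 + 2 * C.length =
        ((z, b) :: C ++ (z, !b) :: L).length := by
  refine ⟨SK.remove_loop _ C L z b le_rfl h hC, ?_⟩
  have hf := h.loopFacts hC
  have h1 : (L.filter fun m => m.1 ∈ names C).Perm (C.map fun m => (m.1, false)) := by
    rw [List.perm_ext_iff_of_nodup (hf.nodup_rest.filter _)]
    · rintro ⟨x, b'⟩
      rw [List.mem_filter, decide_eq_true_eq]
      constructor
      · rintro ⟨hx, hxN⟩
        exact List.mem_map.2 ⟨(x, true), (mem_names_of_over hC x).1 hxN,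
          Prod.ext rfl (hf.all_under (x, b') hx hxN).symm⟩
      · intro hx
        obtain ⟨m, hm, e⟩ := List.mem_map.1 hx
        obtain ⟨rfl, rfl⟩ := Prod.mk.inj e
        have hxN : m.1 ∈ names C := List.mem_map.2 ⟨m, hm, rfl⟩
        exact ⟨hf.cross m.1 hxN, hxN⟩
    · refine hf.nodup_loop.map_on fun p hp q hq e => ?_
      exact Prod.ext (Prod.mk.inj e).1 ((hC p hp).trans (hC q hq).symm)
  have h2 := h1.length_eq
  have h3 := List.length_eq_length_filter_add (l := L) (fun m => decide (m.1 ∈ names C))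
  rw [List.length_map] at h2
  simp only [List.length_append, List.length_cons]
  have h4 : (L.filter fun m => m.1 ∉ names C) = L.filter fun m => !decide (m.1 ∈ names C) :=
    List.filter_congr fun m _ => by simp only [decide_not]
  rw [h4]
  omega

/-- The push for two successive undercrossings. The substitution is hidden behind the properties
that the slides need, together with the two crossings it adds. -/
theorem SK.push_spec {w P Q : List Passage} {c : Crossing} {m : Passage} (h : Good w)
    (hw : w = P ++ m :: (c, false) :: Q) (hm : m.2 = false) :
    ∃ (φ : Passage → List Passage) (y n : Crossing) (B : List Passage),
      (∀ b, (y, b) ∉ w) ∧ (∀ b, (n, b) ∉ w) ∧ y ≠ n ∧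
      (B = [(y, false), (m.1, true), (n, false)] ∨ B = [(n, false), (m.1, true), (y, false)]) ∧
      φ (c, true) = [(y, true), (c, true), (n, true)] ∧ φ (c, false) = [m] ∧ φ m = [(c, false)] ∧
      φ (m.1, true) = B ∧ (∀ p : Passage, p.1 ≠ c → p.1 ≠ m.1 → φ p = [p]) ∧
      SK w (w.flatMap φ) ∧ (w.flatMap φ).length = w.length + 4 := by
  have hmc : m ≠ (c, true) := by rintro rfl; simp at hm
  have hne := h.ne_of_adjacent hw hmc
  obtain ⟨y, n, B, hy, hn, hyn, hB, hsk⟩ := SK.push h hw hmc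
  have hlen := h.length_push hw hmc hB
  have hpart := pushSub_partner hne y n B
  rw [hm, Bool.not_false] at hB hpart
  exact ⟨pushSub c m y n B, y, n, B, hy, hn, hyn, hB, pushSub_top .., pushSub_bottom ..,
    pushSub_self hne .., hpart, fun p h1 h2 => pushSub_of_ne h1 h2 .., hsk, hlen⟩

theorem fst_ne_of_nodup {l P Q : List Passage} {a p : Passage} (hl : l.Nodup)
    (hw : l = P ++ a :: Q) (hp : p ∈ P ++ Q) (hb : p.2 = a.2) : p.1 ≠ a.1 := by
  intro e
  obtain rfl : p = a := Prod.ext e hb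
  rw [hw] at hl
  exact (List.nodup_cons.1 (List.perm_middle.nodup_iff.1 hl)).1 hp

/-- A crossing between two consecutive strands can be removed by sliding the overstrand back along
the understrand. -/
theorem SK.slide_adjacent (β : List Passage) : ∀ (α L : List Passage) (x : Crossing),
    Good ((x, true) :: α ++ β ++ (x, false) :: L) → (∀ p ∈ α, p.2 = true) →
    (∀ p ∈ β, p.2 = false) → (∀ p ∈ α, ∀ q ∈ β, p.1 ≠ q.1) →
    ∃ w', SK ((x, true) :: α ++ β ++ (x, false) :: L) w' ∧
      w'.length + 2 + 2 * α.length = (α.length + β.length + L.length + 2) + 2 * β.length := by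
  induction β using List.reverseRecOn with
  | nil =>
    intro α L x h hα _ _
    simp only [List.append_nil] at h ⊢
    -- Between the two passages of `x` only overcrossings are left, so `x` is the base of a
    -- removable loop.
    obtain ⟨h1, h2⟩ := SK.remove_loop_length (b := true) h hα
    refine ⟨_, h1, ?_⟩
    simp only [List.length_append, List.length_cons, List.length_nil] at h2 ⊢
    omega
  | append_singleton β m ih =>
    intro α L x h hα hβ hd
    obtain ⟨φ, y, n, B, hy, hn, hyn, hB, f1, f2, f3, f4, f5, hsk, hlen⟩ :=
      SK.push_spec (P := (x, true) :: α ++ β) (m := m) (c := x) (Q := L) h (by simp)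
        (hβ m (by simp))
    have hnd := h.nodup
    have eα : α.flatMap φ = α := flatMap_eq_self fun p hp => f5 p
      (fst_ne_of_nodup (a := (x, true)) hnd (P := []) rfl (by simp [hp]) (hα p hp))
      (hd p hp m (by simp))
    have eβ : β.flatMap φ = β := flatMap_eq_self fun p hp => f5 p
      (fst_ne_of_nodup (a := (x, false)) hnd rfl (by simp [hp]) (hβ p (by simp [hp])))
      (fst_ne_of_nodup (a := m) (P := (x, true) :: α ++ β) (Q := (x, false) :: L) hnd (by simp)
        (by simp [hp]) (by rw [hβ p (by simp [hp]), hβ m (by simp)]))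
    -- After the push `m` comes behind the undercrossing of `x`. The new overcrossing `n` joins the
    -- loop and will disappear with it, while `y` stays, so each passage of `β` costs one crossing
    -- in the end.
    have e : ((x, true) :: α ++ (β ++ [m]) ++ (x, false) :: L).flatMap φ =
        (y, true) :: ((x, true) :: ((n, true) :: α) ++ β ++ (x, false) :: (m :: L.flatMap φ)) := by
      simp [f1, f2, f3, eα, eβ]
    rw [e] at hsk hlen
    have hr : ((y, true) :: ((x, true) :: ((n, true) :: α) ++ β ++ (x, false) ::
        (m :: L.flatMap φ))) ~r ((x, true) :: ((n, true) :: α) ++ β ++ (x, false) ::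
        (m :: L.flatMap φ ++ [(y, true)])) := by
      simpa using List.isRotated_append (l := [(y, true)]) (l' := (x, true) :: ((n, true) :: α) ++
        β ++ (x, false) :: (m :: L.flatMap φ))
    have h2 := SK.of_isRotated hsk.good_right hr
    obtain ⟨w', h3, h4⟩ := ih _ _ x h2.good_right (by
      intro p hp
      rcases List.mem_cons.1 hp with rfl | hp
      exacts [rfl, hα p hp]) (fun p hp => hβ p (by simp [hp])) (by
      intro p hp q hq
      rcases List.mem_cons.1 hp with rfl | hp
      · rintro rfl
        exact hn q.2 (by simp [hq])
      · exact hd p hp q (by simp [hq]))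
    refine ⟨w', (hsk.trans h2).trans h3, ?_⟩
    simp only [List.length_append, List.length_cons, List.length_nil] at h4 hlen ⊢
    omega

/-- Two crossings of an overstrand with an understrand, which the strands meet in opposite
orders. -/
theorem SK.slide_antiparallel (β : List Passage) : ∀ (C l L : List Passage) (c d : Crossing),
    Good ((c, true) :: C ++ (d, true) :: l ++ (d, false) :: β ++ (c, false) :: L) →
    (∀ p ∈ C, p.2 = true) → (∀ p ∈ β, p.2 = false) → (∀ p ∈ C, ∀ q ∈ β, p.1 ≠ q.1) →
    ∃ w', SK ((c, true) :: C ++ (d, true) :: l ++ (d, false) :: β ++ (c, false) :: L) w' ∧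
      w'.length + 2 + 2 * C.length ≤
        (C.length + l.length + β.length + L.length + 4) + 2 * β.length := by
  induction β using List.reverseRecOn with
  | nil =>
    intro C l L c d h hC _ _
    obtain ⟨φ, y, n, B, hy, hn, hyn, hB, f1, f2, f3, f4, f5, hsk, hlen⟩ :=
      SK.push_spec (P := (c, true) :: C ++ (d, true) :: l) (m := (d, false)) (c := c) (Q := L) h
        (by simp) rfl
    have hnd := h.nodup
    have eC : C.flatMap φ = C := flatMap_eq_self fun p hp => f5 p
      (fst_ne_of_nodup (a := (c, true)) hnd (P := []) rfl (by simp [hp]) (hC p hp))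
      (fst_ne_of_nodup (a := (d, true)) hnd (P := (c, true) :: C)
        (Q := l ++ [(d, false)] ++ (c, false) :: L) (by simp) (by simp [hp]) (hC p hp))
    have e : ((c, true) :: C ++ (d, true) :: l ++ [(d, false)] ++ (c, false) :: L).flatMap φ =
        (y, true) :: (c, true) :: (n, true) :: C ++ B ++ l.flatMap φ ++ (c, false) :: (d, false) ::
          L.flatMap φ := by
      simp [f1, f2, f3, f4, eC]
    rw [e] at hsk hlen
    -- Having been pushed, `d` lies on a part of the overpass that dips below the part around `c`,
    -- at `y` and `n`. If it dips first at `y`, all of `c`, `n`, `C` lie on one loop based at `y`.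
    -- If it dips first at `n`, the loop at `n` consists of `C`, and after its removal `c` and `d`
    -- form a loop at `y`; this saves one crossing more.
    rcases hB with rfl | rfl
    · have e2 : (y, true) :: (c, true) :: (n, true) :: C ++ [(y, false), (d, true), (n, false)] ++
          l.flatMap φ ++ (c, false) :: (d, false) :: L.flatMap φ =
          (y, true) :: ([(c, true), (n, true)] ++ C) ++ (y, !true) :: ([(d, true), (n, false)] ++
          l.flatMap φ ++ (c, false) :: (d, false) :: L.flatMap φ) := by simp
      rw [e2] at hsk hlen
      obtain ⟨h1, h2⟩ := SK.remove_loop_length hsk.good_right (by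
        intro p hp
        simp only [List.cons_append, List.nil_append, List.mem_cons] at hp
        rcases hp with rfl | rfl | hp
        exacts [rfl, rfl, hC p hp])
      refine ⟨_, hsk.trans h1, ?_⟩
      rw [hlen] at h2
      simp only [List.length_append, List.length_cons, List.length_nil] at h2 ⊢
      omega
    · have hr : ((y, true) :: (c, true) :: (n, true) :: C ++ [(n, false), (d, true), (y, false)] ++
          l.flatMap φ ++ (c, false) :: (d, false) :: L.flatMap φ) ~r
          ((n, true) :: C ++ (n, !true) :: ((d, true) :: (y, false) :: (l.flatMap φ ++
            (c, false) :: (d, false) :: L.flatMap φ ++ [(y, true), (c, true)]))) := by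
        simpa using List.isRotated_append (l := [(y, true), (c, true)])
          (l' := (n, true) :: C ++ [(n, false), (d, true), (y, false)] ++
          l.flatMap φ ++ (c, false) :: (d, false) :: L.flatMap φ)
      have h0 := SK.of_isRotated hsk.good_right hr
      obtain ⟨h1, h2⟩ := SK.remove_loop_length h0.good_right hC
      have hyC : y ∉ names C := fun hm => by
        obtain ⟨p, hp, rfl⟩ := List.mem_map.1 hm
        exact hy p.2 (by simp [hp])
      have hcC : c ∉ names C := fun hm => by
        have := (mem_names_of_over hC c).1 hm
        simp [this] at hnd
      have hdC : d ∉ names C := fun hm => by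
        have := (mem_names_of_over hC d).1 hm
        simp [this, List.nodup_append'] at hnd
      obtain ⟨X, hX⟩ : ∃ X, X = (l.flatMap φ).filter fun m => m.1 ∉ names C := ⟨_, rfl⟩
      obtain ⟨Y, hY⟩ : ∃ Y, Y = (L.flatMap φ).filter fun m => m.1 ∉ names C := ⟨_, rfl⟩
      have hkeep : ∀ (x : Crossing) (b : Bool) (l : List Passage), x ∉ names C →
          ((x, b) :: l).filter (fun m => m.1 ∉ names C) =
            (x, b) :: l.filter fun m => m.1 ∉ names C :=
        fun x b l hx => List.filter_cons_of_pos (by rwa [decide_eq_true_eq])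
      have e2 : ((d, true) :: (y, false) :: (l.flatMap φ ++
            (c, false) :: (d, false) :: L.flatMap φ ++ [(y, true), (c, true)])).filter
            (fun m => m.1 ∉ names C) = ((d, true) :: (y, false) :: (X ++
            (c, false) :: (d, false) :: Y)) ++ [(y, true), (c, true)] := by
        rw [hkeep d _ _ hdC, hkeep y _ _ hyC, List.filter_append, List.filter_append,
          hkeep c _ _ hcC, hkeep d _ _ hdC, hkeep y _ _ hyC, hkeep c _ _ hcC, ← hX, ← hY]
        rfl
      rw [e2] at h1 h2
      have hr2 : ((d, true) :: (y, false) :: (X ++ (c, false) :: (d, false) :: Y)) ++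
          [(y, true), (c, true)] ~r ((y, true) :: [(c, true), (d, true)] ++ (y, !true) ::
            (X ++ (c, false) :: (d, false) :: Y)) := by
        simpa using List.isRotated_append
          (l := (d, true) :: (y, false) :: (X ++ (c, false) :: (d, false) :: Y))
          (l' := [(y, true), (c, true)])
      have h3 := SK.of_isRotated h1.good_right hr2
      obtain ⟨h4, h5⟩ := SK.remove_loop_length h3.good_right (by simp)
      refine ⟨_, (((hsk.trans h0).trans h1).trans h3).trans h4, ?_⟩
      have hl := hr.perm.length_eq
      have hl2 := hr2.perm.length_eq
      rw [hlen] at hl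
      rw [← hl] at h2
      rw [← hl2] at h5
      simp only [List.length_append, List.length_cons, List.length_nil] at h2 h5 ⊢
      omega
  | append_singleton β m ih =>
    intro C l L c d h hC hβ hd
    obtain ⟨φ, y, n, B, hy, hn, hyn, hB, f1, f2, f3, f4, f5, hsk, hlen⟩ :=
      SK.push_spec (P := (c, true) :: C ++ (d, true) :: l ++ (d, false) :: β) (m := m) (c := c)
        (Q := L) h (by simp) (hβ m (by simp))
    have hnd := h.nodup
    have hm := hβ m (by simp)
    have eC : C.flatMap φ = C := flatMap_eq_self fun p hp => f5 p
      (fst_ne_of_nodup (a := (c, true)) hnd (P := []) rfl (by simp [hp]) (hC p hp))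
      (hd p hp m (by simp))
    have eβ : β.flatMap φ = β := flatMap_eq_self fun p hp => f5 p
      (fst_ne_of_nodup (a := (c, false)) hnd rfl (by simp [hp]) (hβ p (by simp [hp])))
      (fst_ne_of_nodup (a := m) (P := (c, true) :: C ++ (d, true) :: l ++ (d, false) :: β)
        (Q := (c, false) :: L) hnd (by simp)
        (by simp [hp]) (by rw [hβ p (by simp [hp]), hm]))
    have hdc : d ≠ c := fst_ne_of_nodup (a := (c, false)) (p := (d, false)) hnd rfl (by simp) rfl
    have hdm : d ≠ m.1 := fst_ne_of_nodup (a := m)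
      (P := (c, true) :: C ++ (d, true) :: l ++ (d, false) :: β) (p := (d, false))
      (Q := (c, false) :: L) hnd (by simp) (by simp) hm.symm
    have ed : ∀ b, φ (d, b) = [(d, b)] := fun b => f5 (d, b) hdc hdm
    have e : ((c, true) :: C ++ (d, true) :: l ++ (d, false) :: (β ++ [m]) ++
        (c, false) :: L).flatMap φ =
        (y, true) :: ((c, true) :: ((n, true) :: C) ++ (d, true) :: l.flatMap φ ++ (d, false) :: β ++
          (c, false) :: (m :: L.flatMap φ)) := by
      simp [f1, f2, f3, ed, eC, eβ]
    rw [e] at hsk hlen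
    have hr : ((y, true) :: ((c, true) :: ((n, true) :: C) ++ (d, true) :: l.flatMap φ ++
        (d, false) :: β ++ (c, false) :: (m :: L.flatMap φ))) ~r
        ((c, true) :: ((n, true) :: C) ++ (d, true) :: l.flatMap φ ++
        (d, false) :: β ++ (c, false) :: (m :: L.flatMap φ ++ [(y, true)])) := by
      simpa using List.isRotated_append (l := [(y, true)]) (l' := (c, true) :: ((n, true) :: C) ++
        (d, true) :: l.flatMap φ ++ (d, false) :: β ++ (c, false) :: (m :: L.flatMap φ))
    have h2 := SK.of_isRotated hsk.good_right hr
    obtain ⟨w', h3, h4⟩ := ih _ _ _ c d h2.good_right (by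
      intro p hp
      rcases List.mem_cons.1 hp with rfl | hp
      exacts [rfl, hC p hp]) (fun p hp => hβ p (by simp [hp])) (by
      intro p hp q hq
      rcases List.mem_cons.1 hp with rfl | hp
      · rintro rfl
        exact hn q.2 (by simp [hq])
      · exact hd p hp q (by simp [hq]))
    refine ⟨w', (hsk.trans h2).trans h3, ?_⟩
    simp only [List.length_append, List.length_cons, List.length_nil] at h4 hlen ⊢
    omega

/-- Two crossings of an overstrand with an understrand, which the strands meet in the same
order. -/
theorem SK.slide_parallel (β : List Passage) : ∀ (C l L : List Passage) (c d : Crossing),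
    Good ((d, true) :: C ++ (c, true) :: l ++ (d, false) :: β ++ (c, false) :: L) →
    (∀ p ∈ C, p.2 = true) → (∀ p ∈ β, p.2 = false) → (∀ p ∈ C, ∀ q ∈ β, p.1 ≠ q.1) →
    ∃ w', SK ((d, true) :: C ++ (c, true) :: l ++ (d, false) :: β ++ (c, false) :: L) w' ∧
      w'.length + 2 + 2 * C.length ≤
        (C.length + l.length + β.length + L.length + 4) + 2 * β.length := by
  induction β using List.reverseRecOn with
  | nil =>
    intro C l L c d h hC _ _
    obtain ⟨φ, y, n, B, hy, hn, hyn, hB, f1, f2, f3, f4, f5, hsk, hlen⟩ :=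
      SK.push_spec (P := (d, true) :: C ++ (c, true) :: l) (m := (d, false)) (c := c) (Q := L) h
        (by simp) rfl
    have hnd := h.nodup
    have eC : C.flatMap φ = C := flatMap_eq_self fun p hp => f5 p
      (fst_ne_of_nodup (a := (c, true)) (P := (d, true) :: C)
        (Q := l ++ [(d, false)] ++ (c, false) :: L) hnd (by simp) (by simp [hp]) (hC p hp))
      (fst_ne_of_nodup (a := (d, true)) hnd (P := []) rfl (by simp [hp]) (hC p hp))
    have e : ((d, true) :: C ++ (c, true) :: l ++ [(d, false)] ++ (c, false) :: L).flatMap φ =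
        B ++ C ++ (y, true) :: (c, true) :: (n, true) :: l.flatMap φ ++ (c, false) :: (d, false) ::
          L.flatMap φ := by
      simp [f1, f2, f3, f4, eC]
    rw [e] at hsk hlen
    -- As in the antiparallel case, but the overpass dips at `d` before it reaches `c`: either one
    -- loop based at `n` contains `C`, `y` and `c`, or a loop at `y` with `C` is removed before one
    -- at `n` with `d` and `c`.
    rcases hB with rfl | rfl
    · have hr : ([(y, false), (d, true), (n, false)] ++ C ++ (y, true) :: (c, true) :: (n, true) ::
          l.flatMap φ ++ (c, false) :: (d, false) :: L.flatMap φ) ~r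
          ((n, false) :: (C ++ [(y, true), (c, true)]) ++ (n, !false) :: (l.flatMap φ ++
          (c, false) :: (d, false) :: L.flatMap φ ++ [(y, false), (d, true)])) := by
        simpa using List.isRotated_append (l := [(y, false), (d, true)])
          (l' := (n, false) :: C ++ (y, true) :: (c, true) :: (n, true) ::
          l.flatMap φ ++ (c, false) :: (d, false) :: L.flatMap φ)
      have h0 := SK.of_isRotated hsk.good_right hr
      obtain ⟨h1, h2⟩ := SK.remove_loop_length h0.good_right (by
        intro p hp
        simp only [List.mem_append, List.mem_cons, List.not_mem_nil, or_false] at hp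
        rcases hp with hp | rfl | rfl
        exacts [hC p hp, rfl, rfl])
      refine ⟨_, (hsk.trans h0).trans h1, ?_⟩
      rw [← hr.perm.length_eq, hlen] at h2
      simp only [List.length_append, List.length_cons, List.length_nil] at h2 ⊢
      omega
    · have hr : ([(n, false), (d, true), (y, false)] ++ C ++ (y, true) :: (c, true) :: (n, true) ::
          l.flatMap φ ++ (c, false) :: (d, false) :: L.flatMap φ) ~r
          ((y, false) :: C ++ (y, !false) :: ((c, true) :: (n, true) :: (l.flatMap φ ++
          (c, false) :: (d, false) :: L.flatMap φ ++ [(n, false), (d, true)]))) := by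
        simpa using List.isRotated_append (l := [(n, false), (d, true)])
          (l' := (y, false) :: C ++ (y, true) :: (c, true) :: (n, true) ::
          l.flatMap φ ++ (c, false) :: (d, false) :: L.flatMap φ)
      have h0 := SK.of_isRotated hsk.good_right hr
      obtain ⟨h1, h2⟩ := SK.remove_loop_length h0.good_right hC
      have hnC : n ∉ names C := fun hm => by
        obtain ⟨p, hp, rfl⟩ := List.mem_map.1 hm
        exact hn p.2 (by simp [hp])
      have hcC : c ∉ names C := fun hm => by
        have := (mem_names_of_over hC c).1 hm
        simp [this, List.nodup_append'] at hnd
      have hdC : d ∉ names C := fun hm => by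
        have := (mem_names_of_over hC d).1 hm
        simp [this] at hnd
      obtain ⟨X, hX⟩ : ∃ X, X = (l.flatMap φ).filter fun m => m.1 ∉ names C := ⟨_, rfl⟩
      obtain ⟨Y, hY⟩ : ∃ Y, Y = (L.flatMap φ).filter fun m => m.1 ∉ names C := ⟨_, rfl⟩
      have hkeep : ∀ (x : Crossing) (b : Bool) (l : List Passage), x ∉ names C →
          ((x, b) :: l).filter (fun m => m.1 ∉ names C) =
            (x, b) :: l.filter fun m => m.1 ∉ names C :=
        fun x b l hx => List.filter_cons_of_pos (by rwa [decide_eq_true_eq])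
      have e2 : ((c, true) :: (n, true) :: (l.flatMap φ ++
            (c, false) :: (d, false) :: L.flatMap φ ++ [(n, false), (d, true)])).filter
            (fun m => m.1 ∉ names C) = ((c, true) :: (n, true) :: (X ++
            (c, false) :: (d, false) :: Y)) ++ [(n, false), (d, true)] := by
        rw [hkeep c _ _ hcC, hkeep n _ _ hnC, List.filter_append, List.filter_append,
          hkeep c _ _ hcC, hkeep d _ _ hdC, hkeep n _ _ hnC, hkeep d _ _ hdC, ← hX, ← hY]
        rfl
      rw [e2] at h1 h2
      have hr2 : ((c, true) :: (n, true) :: (X ++ (c, false) :: (d, false) :: Y)) ++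
          [(n, false), (d, true)] ~r ((n, false) :: [(d, true), (c, true)] ++ (n, !false) ::
            (X ++ (c, false) :: (d, false) :: Y)) := by
        simpa using List.isRotated_append
          (l := (c, true) :: (n, true) :: (X ++ (c, false) :: (d, false) :: Y))
          (l' := [(n, false), (d, true)])
      have h3 := SK.of_isRotated h1.good_right hr2
      obtain ⟨h4, h5⟩ := SK.remove_loop_length h3.good_right (by simp)
      refine ⟨_, (((hsk.trans h0).trans h1).trans h3).trans h4, ?_⟩
      have hl := hr.perm.length_eq
      have hl2 := hr2.perm.length_eq
      rw [hlen] at hl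
      rw [← hl] at h2
      rw [← hl2] at h5
      simp only [List.length_append, List.length_cons, List.length_nil] at h2 h5 ⊢
      omega
  | append_singleton β m ih =>
    intro C l L c d h hC hβ hd
    obtain ⟨φ, y, n, B, hy, hn, hyn, hB, f1, f2, f3, f4, f5, hsk, hlen⟩ :=
      SK.push_spec (P := (d, true) :: C ++ (c, true) :: l ++ (d, false) :: β) (m := m) (c := c)
        (Q := L) h (by simp) (hβ m (by simp))
    have hnd := h.nodup
    have hm := hβ m (by simp)
    have eC : C.flatMap φ = C := flatMap_eq_self fun p hp => f5 p
      (fst_ne_of_nodup (a := (c, true)) (P := (d, true) :: C)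
        (Q := l ++ (d, false) :: (β ++ [m]) ++ (c, false) :: L) hnd (by simp) (by simp [hp])
        (hC p hp))
      (hd p hp m (by simp))
    have eβ : β.flatMap φ = β := flatMap_eq_self fun p hp => f5 p
      (fst_ne_of_nodup (a := (c, false)) hnd rfl (by simp [hp]) (hβ p (by simp [hp])))
      (fst_ne_of_nodup (a := m) (P := (d, true) :: C ++ (c, true) :: l ++ (d, false) :: β)
        (Q := (c, false) :: L) hnd (by simp)
        (by simp [hp]) (by rw [hβ p (by simp [hp]), hm]))
    have hdc : d ≠ c := fst_ne_of_nodup (a := (c, false)) (p := (d, false)) hnd rfl (by simp) rfl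
    have hdm : d ≠ m.1 := fst_ne_of_nodup (a := m)
      (P := (d, true) :: C ++ (c, true) :: l ++ (d, false) :: β) (p := (d, false))
      (Q := (c, false) :: L) hnd (by simp) (by simp) hm.symm
    have ed : ∀ b, φ (d, b) = [(d, b)] := fun b => f5 (d, b) hdc hdm
    have e : ((d, true) :: C ++ (c, true) :: l ++ (d, false) :: (β ++ [m]) ++
        (c, false) :: L).flatMap φ =
        (d, true) :: (C ++ [(y, true)]) ++ (c, true) :: ((n, true) :: l.flatMap φ) ++
          (d, false) :: β ++ (c, false) :: (m :: L.flatMap φ) := by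
      simp [f1, f2, f3, ed, eC, eβ]
    rw [e] at hsk hlen
    obtain ⟨w', h3, h4⟩ := ih _ _ _ c d hsk.good_right (by
      intro p hp
      rcases List.mem_append.1 hp with hp | hp
      · exact hC p hp
      · rw [List.mem_singleton.1 hp]) (fun p hp => hβ p (by simp [hp])) (by
      intro p hp q hq
      rcases List.mem_append.1 hp with hp | hp
      · exact hd p hp q (by simp [hq])
      · rw [List.mem_singleton.1 hp]
        rintro rfl
        exact hy q.2 (by simp [hq]))
    refine ⟨w', hsk.trans h3, ?_⟩
    simp only [List.length_append, List.length_cons, List.length_nil] at h4 hlen ⊢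
    omega

/-! ### Turning over, reflecting and reversing diagrams -/

/-- The other passage of the same crossing. -/
def flipPassage (m : Passage) : Passage := (m.1, !m.2)

/-- The passage of the mirror image in a line of the plane. -/
def mirrorPassage (m : Passage) : Passage := ((m.1.1, -m.1.2), m.2)

theorem flipPassage_involutive : Function.Involutive flipPassage := fun m => by
  simp [flipPassage]

theorem mirrorPassage_involutive : Function.Involutive mirrorPassage := fun m => by
  simp [mirrorPassage]

theorem mem_map_of_involutive {f : Passage → Passage} (hf : Function.Involutive f)
    (l : List Passage) (a : Passage) : a ∈ l.map f ↔ f a ∈ l := by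
  constructor
  · intro h
    obtain ⟨m, hm, rfl⟩ := List.mem_map.1 h
    rwa [hf]
  · exact fun h => List.mem_map.2 ⟨_, h, hf a⟩

theorem walk_map (f : Passage → Passage) (zi zo : Passage → ℚ) (l : List Passage) (s t : ℚ) :
    Walk zi zo s (l.map f) t ↔ Walk (zi ∘ f) (zo ∘ f) s l t := by
  induction l generalizing s with
  | nil => rfl
  | cons m l ih => exact and_congr Iff.rfl (ih _)

theorem walk_neg {zi zo : Passage → ℚ} {l : List Passage} {s t : ℚ} (h : Walk zi zo s l t) :
    Walk (fun m => -zi m) (fun m => -zo m) (-s) l (-t) := by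
  induction l generalizing s with
  | nil => exact congrArg Neg.neg h
  | cons m l ih => exact ⟨congrArg Neg.neg h.1, ih h.2⟩

theorem walk_sub {zi zo zi' zo' : Passage → ℚ} {l : List Passage} {s t s' t' : ℚ}
    (h : Walk zi zo s l t) (h' : Walk zi' zo' s' l t') :
    Walk (fun m => zi m - zi' m) (fun m => zo m - zo' m) (s - s') l (t - t') := by
  induction l generalizing s s' with
  | nil => exact congrArg₂ _ h h'
  | cons m l ih => exact ⟨congrArg₂ _ h.1 h'.1, ih h.2 h'.2⟩

theorem walk_reverse (zi zo : Passage → ℚ) (l : List Passage) (s t : ℚ) :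
    Walk zi zo s l.reverse t ↔ Walk zo zi t l s := by
  induction l generalizing t with
  | nil => exact eq_comm
  | cons m l ih =>
    rw [List.reverse_cons, walk_append]
    constructor
    · rintro ⟨r, h1, rfl, h2⟩
      exact ⟨h2, (ih _).1 h1⟩
    · rintro ⟨h1, h2⟩
      exact ⟨_, (ih _).2 h2, rfl, h1⟩

/-- `LabelAt` records three of the four coincidences at the corners of a crossing. The fourth
follows from Kirchhoff's law, and the symmetries need it because they exchange left and right. -/
theorem LabelAt.flow_sub {zi zo Li Lo : Passage → ℚ} {x : Crossing} (hz : FlowAt zi zo x)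
    (h : LabelAt zi zo Li Lo x) :
    if x.2 = 1 then
      Lo (x, true) - zo (x, true) = Li (x, false) - zi (x, false)
    else
      Li (x, true) - zi (x, true) = Lo (x, false) - zo (x, false) := by
  unfold FlowAt at hz
  unfold LabelAt at h
  split_ifs at h ⊢ <;> linarith [h.1, h.2.1, h.2.2]

/-- The diagram is seen from behind: over and under are exchanged, signs stay, and left and right
are exchanged. So the new left label is minus the old right label, which is the flow minus the old
left label. -/
theorem IsJordan.flip {w : List Passage} (h : IsJordan w) (hp : Good w) :
    IsJordan (w.map flipPassage) := by
  intro zi zo s hw hf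
  have hmem : ∀ x, (x, true) ∈ w.map flipPassage ↔ (x, true) ∈ w := fun x => by
    constructor
    · intro hx
      obtain ⟨m, hm, e⟩ := List.mem_map.1 hx
      have := hp.paired m.1 m.2 hm
      rwa [show (m.1, !m.2) = (x, true) from e] at this
    · intro hx
      exact List.mem_map.2 ⟨_, hp.paired x true hx, rfl⟩
  have hf' : ∀ x, (x, true) ∈ w → FlowAt (zi ∘ flipPassage) (zo ∘ flipPassage) x := fun x hx => by
    have := hf x ((hmem x).2 hx)
    simp only [FlowAt, Function.comp, flipPassage, Bool.not_true, Bool.not_false] at this ⊢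
    linarith
  obtain ⟨Li, Lo, t, hL, hl⟩ := h _ _ s ((walk_map _ _ _ _ _ _).1 hw) hf'
  have hz := (walk_map _ _ _ _ _ _).1 hw
  refine ⟨fun m => zi m - Li (flipPassage m), fun m => zo m - Lo (flipPassage m), s - t, ?_, ?_⟩
  · rw [walk_map]
    have := walk_sub hz hL
    refine walk_congr _ _ (fun m _ => ?_) this
    simp [flipPassage_involutive m]
  · intro x hx
    have h1 := hl x ((hmem x).1 hx)
    have h2 := h1.flow_sub (hf' x ((hmem x).1 hx))
    have h3 := hf' x ((hmem x).1 hx)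
    simp only [LabelAt, FlowAt, Function.comp, flipPassage, Bool.not_true, Bool.not_false]
      at h1 h2 h3 ⊢
    split_ifs at h1 h2 ⊢ <;> obtain ⟨h4, h5, h6⟩ := h1 <;> refine ⟨?_, ?_, ?_⟩ <;> linarith

/-- A reflection in a line of the plane changes the signs and exchanges left and right, so the
labels change as for `IsJordan.flip`. -/
theorem IsJordan.mirror {w : List Passage} (h : IsJordan w) : IsJordan (w.map mirrorPassage) := by
  intro zi zo s hw hf
  have hmem : ∀ (x : Crossing) b, (x, b) ∈ w.map mirrorPassage ↔ ((x.1, -x.2), b) ∈ w := fun x b => by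
    exact mem_map_of_involutive mirrorPassage_involutive _ _
  have hf' : ∀ x, (x, true) ∈ w → FlowAt (zi ∘ mirrorPassage) (zo ∘ mirrorPassage) x := fun x hx => by
    have := hf (x.1, -x.2) ((hmem _ _).2 (by simpa using hx))
    simpa only [FlowAt, Function.comp, mirrorPassage] using this
  have hz := (walk_map _ _ _ _ _ _).1 hw
  obtain ⟨Li, Lo, t, hL, hl⟩ := h _ _ s hz hf'
  refine ⟨fun m => zi m - Li (mirrorPassage m), fun m => zo m - Lo (mirrorPassage m), s - t, ?_, ?_⟩
  · rw [walk_map]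
    have := walk_sub hz hL
    refine walk_congr _ _ (fun m _ => ?_) this
    simp [mirrorPassage_involutive m]
  · intro x hx
    have h1 := hl _ ((hmem x _).1 hx)
    have h2 := h1.flow_sub (hf' _ ((hmem x _).1 hx))
    have h3 := hf' _ ((hmem x _).1 hx)
    obtain ⟨n, ε⟩ := x
    rcases Int.units_eq_one_or ε with rfl | rfl <;>
    · simp [LabelAt, FlowAt, Function.comp, mirrorPassage] at h1 h2 h3 ⊢
      obtain ⟨h4, h5, h6⟩ := h1
      refine ⟨?_, ?_, ?_⟩ <;> linarith

/-- Along the reversed knot the flow is negated, and the left side is the former right side; hence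
the flow is added to the old labels. -/
theorem IsJordan.reverse {w : List Passage} (h : IsJordan w) : IsJordan w.reverse := by
  intro zi zo s hw hf
  have hf' : ∀ x, (x, true) ∈ w → FlowAt (fun m => -zo m) (fun m => -zi m) x := fun x hx => by
    have := hf x (List.mem_reverse.2 hx)
    simp only [FlowAt] at this ⊢
    linarith
  have hz := walk_neg ((walk_reverse _ _ _ _ _).1 hw)
  obtain ⟨Li, Lo, t, hL, hl⟩ := h _ _ _ hz hf'
  refine ⟨fun m => Lo m + zi m, fun m => Li m + zo m, t + s, ?_, ?_⟩
  · rw [walk_reverse]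
    have := walk_sub hL hz
    simpa using this
  · intro x hx
    have h1 := hl x (List.mem_reverse.1 hx)
    have h3 := hf' x (List.mem_reverse.1 hx)
    have h2 := h1.flow_sub h3
    simp only [LabelAt, FlowAt] at h1 h2 h3 ⊢
    split_ifs at h1 h2 ⊢ <;> obtain ⟨h4, h5, h6⟩ := h1 <;> refine ⟨?_, ?_, ?_⟩ <;> linarith

theorem Good.flip {w : List Passage} (h : Good w) : Good (w.map flipPassage) where
  nodup := h.nodup.map flipPassage_involutive.injective
  paired x b hx := by
    rw [mem_map_of_involutive flipPassage_involutive] at hx ⊢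
    exact h.paired _ _ hx
  jordan := h.jordan.flip h

theorem Good.mirror {w : List Passage} (h : Good w) : Good (w.map mirrorPassage) where
  nodup := h.nodup.map mirrorPassage_involutive.injective
  paired x b hx := by
    rw [mem_map_of_involutive mirrorPassage_involutive] at hx ⊢
    exact h.paired _ _ hx
  jordan := h.jordan.mirror

theorem Good.reverse {w : List Passage} (h : Good w) : Good w.reverse where
  nodup := List.nodup_reverse.2 h.nodup
  paired x b hx := by
    rw [List.mem_reverse] at hx ⊢
    exact h.paired _ _ hx
  jordan := h.jordan.reverse

theorem map_flip_inOrder (t : ℤˣ) (p q : Passage) :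
    (inOrder t p q).map flipPassage = inOrder t (flipPassage p) (flipPassage q) := by
  unfold inOrder
  split_ifs <;> rfl

theorem inOrder_neg (t : ℤˣ) (p q : Passage) : inOrder (-t) p q = inOrder t q p := by
  rcases Int.units_eq_one_or t with rfl | rfl <;> simp [inOrder]

theorem reverse_inOrder (t : ℤˣ) (p q : Passage) : (inOrder t p q).reverse = inOrder (-t) p q := by
  rcases Int.units_eq_one_or t with rfl | rfl <;> simp [inOrder]

theorem sign_neg_neg (δ s t : ℤˣ) : δ * -s * -t = δ * s * t := by simp

theorem cycle_append_comm (l l' : List Passage) :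
    ((l ++ l' : List Passage) : Cycle Passage) = ((l' ++ l : List Passage) : Cycle Passage) :=
  Cycle.coe_eq_coe.2 List.isRotated_append

theorem SameCode.flip {w w' : Cycle Passage} (h : SameCode w w') :
    SameCode (w.map flipPassage) (w'.map flipPassage) := by
  obtain ⟨f, hf, rfl⟩ := h
  refine ⟨f, hf, ?_⟩
  induction w using Quotient.inductionOn with
  | _ w =>
  change ((List.map _ (List.map _ w) : List Passage) : Cycle Passage) =
    ((List.map _ (List.map _ w) : List Passage) : Cycle Passage)
  rw [List.map_map, List.map_map]
  rfl

theorem SameCode.reverse {w w' : Cycle Passage} (h : SameCode w w') :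
    SameCode w.reverse w'.reverse := by
  obtain ⟨f, hf, rfl⟩ := h
  refine ⟨f, hf, ?_⟩
  induction w using Quotient.inductionOn with
  | _ w =>
  change ((List.map _ (List.reverse w) : List Passage) : Cycle Passage) =
    ((List.reverse (List.map _ w) : List Passage) : Cycle Passage)
  rw [List.map_reverse]

/-- In a triangle move the top and the bottom strand change places, so `x` and `z` trade their roles
and the cyclic order top, middle, bottom turns into top, bottom, middle. -/
theorem Move.flip {w w' : Cycle Passage} (h : Move w w') :
    Move (w.map flipPassage) (w'.map flipPassage) := by
  cases h with
  | rename h => exact Move.rename h.flip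
  | r1 x b l => simpa [flipPassage] using Move.r1 x (!b) (l.map flipPassage)
  | r2_parallel x y h b l₁ l₂ =>
    simpa [flipPassage] using
      Move.r2_parallel x y h (!b) (l₁.map flipPassage) (l₂.map flipPassage)
  | r2_antiparallel x y h b l₁ l₂ =>
    simpa [flipPassage] using
      Move.r2_antiparallel x y h (!b) (l₁.map flipPassage) (l₂.map flipPassage)
  | r3_tmb δ t₁ t₂ t₃ x y z hx hy hz l₁ l₂ l₃ =>
    have := Move.r3_tbm δ (-t₃) (-t₂) (-t₁) z y x (by rw [hz, sign_neg_neg, mul_right_comm]) (by rw [hy, sign_neg_neg, mul_right_comm])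
      (by rw [hx, sign_neg_neg, mul_right_comm]) (l₃.map flipPassage) (l₁.map flipPassage) (l₂.map flipPassage)
    simp only [Cycle.map_coe, List.map_append, map_flip_inOrder, flipPassage, Bool.not_true,
      Bool.not_false]
    simp only [inOrder_neg, neg_neg] at this ⊢
    convert this using 1 <;>
    · rw [List.append_assoc _ _ (List.map flipPassage l₃), cycle_append_comm]
      simp only [List.append_assoc]
  | r3_tbm δ t₁ t₂ t₃ x y z hx hy hz l₁ l₂ l₃ =>
    have := Move.r3_tmb δ (-t₃) (-t₂) (-t₁) z y x (by rw [hz, sign_neg_neg, mul_right_comm]) (by rw [hy, sign_neg_neg, mul_right_comm])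
      (by rw [hx, sign_neg_neg, mul_right_comm]) (l₂.map flipPassage) (l₃.map flipPassage) (l₁.map flipPassage)
    simp only [Cycle.map_coe, List.map_append, map_flip_inOrder, flipPassage, Bool.not_true,
      Bool.not_false]
    simp only [inOrder_neg, neg_neg] at this ⊢
    convert this using 1 <;>
    · simp only [List.append_assoc]
      rw [← List.append_assoc, cycle_append_comm]
      simp only [List.append_assoc]

theorem Move.reverse {w w' : Cycle Passage} (h : Move w w') : Move w.reverse w'.reverse := by
  cases h with
  | rename h => exact Move.rename h.reverse
  | r1 x b l =>
    have := Move.r1 x (!b) l.reverse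
    convert this using 1
    · simp
    · simp only [Cycle.reverse_coe, List.reverse_cons, List.append_assoc, Bool.not_not]
      rw [cycle_append_comm]
      simp
  | r2_parallel x y h b l₁ l₂ =>
    have := Move.r2_parallel y x (by rw [h, neg_neg]) (!b) l₁.reverse l₂.reverse
    convert this using 1
    · simp only [Cycle.reverse_coe, List.reverse_append]
      rw [cycle_append_comm]
    · simp only [Cycle.reverse_coe, List.reverse_append, Bool.not_not]
      rw [cycle_append_comm]
      simp
  | r2_antiparallel x y h b l₁ l₂ =>
    have := Move.r2_antiparallel x y h (!b) l₁.reverse l₂.reverse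
    convert this using 1
    · simp only [Cycle.reverse_coe, List.reverse_append]
      rw [cycle_append_comm]
    · simp only [Cycle.reverse_coe, List.reverse_append, Bool.not_not]
      rw [cycle_append_comm]
      simp
  | r3_tmb δ t₁ t₂ t₃ x y z hx hy hz l₁ l₂ l₃ =>
    have := Move.r3_tbm δ (-t₁) (-t₂) (-t₃) x y z (by rw [hx, sign_neg_neg]) (by rw [hy, sign_neg_neg])
      (by rw [hz, sign_neg_neg]) l₃.reverse l₂.reverse l₁.reverse
    simp only [Cycle.reverse_coe, List.reverse_append, reverse_inOrder]
    convert this using 1 <;>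
    · simp only [← List.append_assoc]
      rw [cycle_append_comm _ (inOrder _ (x, true) (y, true))]
      simp only [List.append_assoc]
  | r3_tbm δ t₁ t₂ t₃ x y z hx hy hz l₁ l₂ l₃ =>
    have := Move.r3_tmb δ (-t₁) (-t₂) (-t₃) x y z (by rw [hx, sign_neg_neg]) (by rw [hy, sign_neg_neg])
      (by rw [hz, sign_neg_neg]) l₃.reverse l₂.reverse l₁.reverse
    simp only [Cycle.reverse_coe, List.reverse_append, reverse_inOrder]
    convert this using 1 <;>
    · simp only [← List.append_assoc]
      rw [cycle_append_comm _ (inOrder _ (x, true) (y, true))]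
      simp only [List.append_assoc]

/-- An operation on codes that respects the Reidemeister moves respects knots. -/
theorem SK.of_equivariant {F : List Passage → List Passage} (hF : ∀ w, Good w → Good (F w))
    (hr : ∀ w w', w ~r w' → F w ~r F w')
    (hm : ∀ w w' : List Passage, Move w w' → Move (F w) (F w')) {w w' : List Passage}
    (h : SK w w') : SK (F w) (F w') := by
  obtain ⟨hw, hw', hs⟩ := h
  have key : ∀ D E : KnotDiagram, D.SameKnot E → ∀ u v : List Passage, D.word = u → E.word = v →
      SK (F u) (F v) := by
    intro D E hDE
    induction hDE with
    | rel D E h =>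
      rintro u v hu hv
      rw [hu, hv] at h
      exact SK.of_move (hF _ (D.good hu)) (hF _ (E.good hv)) (hm _ _ h)
    | refl D =>
      rintro u v hu hv
      exact SK.of_isRotated (hF _ (D.good hu)) (hr _ _ (Cycle.coe_eq_coe.1 (hu.symm.trans hv)))
    | symm D E _ ih => exact fun u v hu hv => (ih v u hv hu).symm
    | trans D E G _ _ ih1 ih2 =>
      intro u v hu hv
      obtain ⟨e, he⟩ := Quotient.exists_rep E.word
      exact (ih1 u e hu he.symm).trans (ih2 e v he.symm hv)
  exact key _ _ hs w w' rfl rfl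

theorem SK.flip {w w' : List Passage} (h : SK w w') :
    SK (w.map flipPassage) (w'.map flipPassage) :=
  SK.of_equivariant (fun _ h => h.flip) (fun _ _ h => h.map _) (fun _ _ h => h.flip) h

theorem SK.reverse {w w' : List Passage} (h : SK w w') : SK w.reverse w'.reverse :=
  SK.of_equivariant (fun _ h => h.reverse) (fun _ _ h => h.reverse) (fun _ _ h => h.reverse) h

/-! ### Minimal diagrams: how often arcs can cross -/

theorem two_mul_crossingNumber (D : GaussCode) {w : List Passage} (h : D.word = w) :
    2 * D.crossingNumber = w.length := by
  have hnd : w.Nodup := by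
    have := D.nodup
    rw [h] at this
    exact Cycle.nodup_coe_iff.1 this
  have h1 : w.toFinset = D.crossings ×ˢ (Finset.univ : Finset Bool) := by
    ext ⟨x, b⟩
    simp only [Finset.mem_product, Finset.mem_univ, and_true, D.mem_crossings_iff x b, h,
      List.mem_toFinset, Cycle.mem_coe_iff]
  rw [← List.toFinset_card_of_nodup hnd, h1, Finset.card_product, GaussCode.crossingNumber,
    Finset.card_univ, Fintype.card_bool, mul_comm]

/-- A code of a diagram that has the least number of crossings among the diagrams of its knot. -/
structure Minimal (w : List Passage) : Prop where
  good : Good w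
  le : ∀ w', SK w w' → w.length ≤ w'.length

theorem KnotDiagram.IsCrossingMinimal.minimal {D : KnotDiagram} (h : D.IsCrossingMinimal)
    {w : List Passage} (hw : D.word = w) : Minimal w where
  good := D.good hw
  le w' := by
    rintro ⟨h1, h2, h3⟩
    have hD : h1.toDiagram = D := KnotDiagram.ext_word hw.symm
    rw [hD] at h3
    have := h _ h3
    have e1 := two_mul_crossingNumber D.toGaussCode hw
    have e2 := two_mul_crossingNumber h2.toDiagram.toGaussCode (w := w') rfl
    omega

namespace Minimal

variable {w w' : List Passage}

theorem of_isRotated (h : Minimal w) (hr : w ~r w') : Minimal w' where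
  good := h.good.of_isRotated hr
  le v hv := by
    rw [← hr.perm.length_eq]
    exact h.le v ((SK.of_isRotated h.good hr).trans hv)

theorem flip (h : Minimal w) : Minimal (w.map flipPassage) where
  good := h.good.flip
  le v hv := by
    have := hv.flip
    rw [List.map_map, flipPassage_involutive.comp_self, List.map_id] at this
    simpa using h.le _ this

theorem reverse (h : Minimal w) : Minimal w.reverse where
  good := h.good.reverse
  le v hv := by
    have := hv.reverse
    rw [List.reverse_reverse] at this
    simpa using h.le _ this

end Minimal

theorem exists_first {P : Passage → Prop} {l : List Passage} (h : ∃ m ∈ l, P m) :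
    ∃ l₁ m l₂, l = l₁ ++ m :: l₂ ∧ P m ∧ ∀ p ∈ l₁, ¬ P p := by
  classical
  induction l with
  | nil => simp at h
  | cons a l ih =>
    by_cases ha : P a
    · exact ⟨[], a, l, rfl, ha, by simp⟩
    · obtain ⟨l₁, m, l₂, rfl, hm, hl⟩ := ih (by
        obtain ⟨m, hm, hPm⟩ := h
        rcases List.mem_cons.1 hm with rfl | hm
        exacts [absurd hPm ha, ⟨m, hm, hPm⟩])
      refine ⟨a :: l₁, m, l₂, rfl, hm, fun p hp => ?_⟩
      rcases List.mem_cons.1 hp with rfl | hp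
      exacts [ha, hl p hp]

theorem exists_consecutive {P : Passage → Prop} {l : List Passage} {a b : Passage} (ha : a ∈ l)
    (hb : b ∈ l) (hPa : P a) (hPb : P b) (hab : a ≠ b) :
    ∃ l₁ d β c l₂, l = l₁ ++ d :: β ++ c :: l₂ ∧ P d ∧ P c ∧ ∀ p ∈ β, ¬ P p := by
  obtain ⟨l₁, d, l₂, rfl, hd, hl⟩ := exists_first ⟨a, ha, hPa⟩
  have hmem : ∀ m ∈ l₁ ++ d :: l₂, P m → m ≠ d → m ∈ l₂ := fun m hm hPm hmd => by
    rcases List.mem_append.1 hm with h | h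
    · exact absurd hPm (hl m h)
    · exact (List.mem_cons.1 h).resolve_left hmd
  have : ∃ m ∈ l₂, P m := by
    by_cases h : a = d
    · exact ⟨b, hmem b hb hPb (h ▸ hab.symm), hPb⟩
    · exact ⟨a, hmem a ha hPa h, hPa⟩
  obtain ⟨β, c, l₃, rfl, hc, hβ⟩ := exists_first this
  exact ⟨l₁, d, β, c, l₃, by simp, hd, hc, hβ⟩

theorem map_flip_snd {l : List Passage} {b : Bool} (h : ∀ p ∈ l, p.2 = b) :
    ∀ p ∈ l.map flipPassage, p.2 = !b := by
  intro p hp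
  obtain ⟨m, hm, rfl⟩ := List.mem_map.1 hp
  simp [flipPassage, h m hm]

theorem map_flip_fst_ne {α β : List Passage} (h : ∀ p ∈ α, ∀ q ∈ β, p.1 ≠ q.1) :
    ∀ p ∈ β.map flipPassage, ∀ q ∈ α.map flipPassage, p.1 ≠ q.1 := by
  intro p hp q hq
  obtain ⟨m, hm, rfl⟩ := List.mem_map.1 hp
  obtain ⟨m', hm', rfl⟩ := List.mem_map.1 hq
  exact (h m' hm' m hm).symm

/-- In a minimal diagram an overpass does not cross the next underpass. -/
theorem Minimal.not_cross_next {o u R : List Passage} (h : Minimal (o ++ u ++ R))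
    (ho : ∀ p ∈ o, p.2 = true) (hu : ∀ p ∈ u, p.2 = false) (y : Crossing) (hy : (y, true) ∈ o)
    (hy' : (y, false) ∈ u) : False := by
  -- Taking the first undercrossing of `u` that lies below `o` ensures that the part `β` before it
  -- does not cross `o`, as the slide requires.
  obtain ⟨β, ⟨x, b⟩, u', rfl, hx, hβ⟩ := exists_first (P := fun m => (m.1, true) ∈ o)
    ⟨(y, false), hy', hy⟩
  obtain rfl : b = false := hu (x, b) (by simp)
  obtain ⟨o', α, rfl⟩ := List.append_of_mem hx
  have hα : ∀ p ∈ α, p.2 = true := fun p hp => ho p (by simp [hp])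
  have hβ' : ∀ p ∈ β, p.2 = false := fun p hp => hu p (by simp [hp])
  have hd : ∀ p ∈ α, ∀ q ∈ β, p.1 ≠ q.1 := by
    intro p hp q hq e
    refine hβ q hq ?_
    rw [← e, ← hα p hp]
    simp [hp]
  have hr : (o' ++ (x, true) :: α ++ (β ++ (x, false) :: u') ++ R) ~r
      ((x, true) :: α ++ β ++ (x, false) :: (u' ++ R ++ o')) := by
    simpa using List.isRotated_append (l := o')
      (l' := (x, true) :: α ++ (β ++ (x, false) :: u') ++ R)
  have hm := h.of_isRotated hr
  -- Of the two arcs that lead from `x` back to `x`, the one with more crossings is laid along the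
  -- other. If it is the under-arc, the diagram is turned over and reversed first.
  by_cases hle : β.length ≤ α.length
  · obtain ⟨w', h1, h2⟩ := SK.slide_adjacent β α _ x hm.good hα hβ' hd
    have := hm.le _ h1
    simp only [List.length_append, List.length_cons] at this h2
    omega
  · have hm2 := hm.flip.reverse
    have hr2 : (((x, true) :: α ++ β ++ (x, false) :: (u' ++ R ++ o')).map flipPassage).reverse ~r
        ((x, true) :: (β.map flipPassage).reverse ++ (α.map flipPassage).reverse ++
          (x, false) :: ((u' ++ R ++ o').map flipPassage).reverse) := by
      simpa [flipPassage] using List.isRotated_append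
        (l := ((u' ++ R ++ o').map flipPassage).reverse)
        (l' := (x, true) :: (β.map flipPassage).reverse ++ (α.map flipPassage).reverse ++
          [(x, false)])
    have hm3 := hm2.of_isRotated hr2
    obtain ⟨w', h1, h2⟩ := SK.slide_adjacent _ _ _ x hm3.good
      (fun p hp => map_flip_snd hβ' p (List.mem_reverse.1 hp))
      (fun p hp => map_flip_snd hα p (List.mem_reverse.1 hp))
      (fun p hp q hq => map_flip_fst_ne hd p (List.mem_reverse.1 hp) q (List.mem_reverse.1 hq))
    have := hm3.le _ h1
    simp only [List.length_append, List.length_cons, List.length_reverse, List.length_map]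
      at this h2
    omega

/-- In a minimal diagram an underpass does not cross the next overpass. -/
theorem Minimal.not_cross_prev {o u R : List Passage} (h : Minimal (u ++ o ++ R))
    (ho : ∀ p ∈ o, p.2 = true) (hu : ∀ p ∈ u, p.2 = false) (y : Crossing) (hy : (y, true) ∈ o)
    (hy' : (y, false) ∈ u) : False := by
  have h1 := h.flip
  rw [List.map_append, List.map_append] at h1
  exact h1.not_cross_next (map_flip_snd hu) (map_flip_snd ho) y
    (List.mem_map.2 ⟨_, hy', rfl⟩) (List.mem_map.2 ⟨_, hy, rfl⟩)

/-- The arcs `C` and `β` have common ends, and laying the one with more crossings along the other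
saves at least one crossing. Turning the diagram over exchanges their roles. -/
theorem Minimal.not_antiparallel {C β l L : List Passage} {c d : Crossing}
    (h : Minimal ((c, true) :: C ++ (d, true) :: l ++ (d, false) :: β ++ (c, false) :: L))
    (hC : ∀ p ∈ C, p.2 = true) (hβ : ∀ p ∈ β, p.2 = false) (hd : ∀ p ∈ C, ∀ q ∈ β, p.1 ≠ q.1) :
    False := by
  by_cases hle : β.length ≤ C.length
  · obtain ⟨w', h1, h2⟩ := SK.slide_antiparallel β C l L c d h.good hC hβ hd
    have := h.le _ h1
    simp only [List.length_append, List.length_cons] at this h2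
    omega
  · have hr : ((c, true) :: C ++ (d, true) :: l ++ (d, false) :: β ++ (c, false) :: L).map
        flipPassage ~r ((d, true) :: β.map flipPassage ++ (c, true) :: L.map flipPassage ++
          (c, false) :: C.map flipPassage ++ (d, false) :: l.map flipPassage) := by
      simpa [flipPassage] using List.isRotated_append
        (l := (c, false) :: C.map flipPassage ++ (d, false) :: l.map flipPassage)
        (l' := (d, true) :: β.map flipPassage ++ (c, true) :: L.map flipPassage)
    have hm := h.flip.of_isRotated hr
    obtain ⟨w', h1, h2⟩ := SK.slide_antiparallel _ _ _ _ d c hm.good (map_flip_snd hβ)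
      (map_flip_snd hC) (map_flip_fst_ne hd)
    have := hm.le _ h1
    simp only [List.length_append, List.length_cons, List.length_map] at this h2
    omega

theorem Minimal.not_parallel {C β l L : List Passage} {c d : Crossing}
    (h : Minimal ((d, true) :: C ++ (c, true) :: l ++ (d, false) :: β ++ (c, false) :: L))
    (hC : ∀ p ∈ C, p.2 = true) (hβ : ∀ p ∈ β, p.2 = false) (hd : ∀ p ∈ C, ∀ q ∈ β, p.1 ≠ q.1) :
    False := by
  by_cases hle : β.length ≤ C.length
  · obtain ⟨w', h1, h2⟩ := SK.slide_parallel β C l L c d h.good hC hβ hd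
    have := h.le _ h1
    simp only [List.length_append, List.length_cons] at this h2
    omega
  · have hr : ((d, true) :: C ++ (c, true) :: l ++ (d, false) :: β ++ (c, false) :: L).map
        flipPassage ~r ((d, true) :: β.map flipPassage ++ (c, true) :: L.map flipPassage ++
          (d, false) :: C.map flipPassage ++ (c, false) :: l.map flipPassage) := by
      simpa [flipPassage] using List.isRotated_append
        (l := (d, false) :: C.map flipPassage ++ (c, false) :: l.map flipPassage)
        (l' := (d, true) :: β.map flipPassage ++ (c, true) :: L.map flipPassage)
    have hm := h.flip.of_isRotated hr
    obtain ⟨w', h1, h2⟩ := SK.slide_parallel _ _ _ _ c d hm.good (map_flip_snd hβ)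
      (map_flip_snd hC) (map_flip_fst_ne hd)
    have := hm.le _ h1
    simp only [List.length_append, List.length_cons, List.length_map] at this h2
    omega

/-- In a minimal diagram an overpass and an underpass cross at most once. -/
theorem Minimal.cross_unique {o u R₁ R₂ : List Passage} (h : Minimal (o ++ R₁ ++ u ++ R₂))
    (ho : ∀ p ∈ o, p.2 = true) (hu : ∀ p ∈ u, p.2 = false) {y z : Crossing} (hy : (y, true) ∈ o)
    (hy' : (y, false) ∈ u) (hz : (z, true) ∈ o) (hz' : (z, false) ∈ u) : y = z := by
  by_contra hyz
  -- Of all crossings of `o` and `u` two are chosen that follow each other on `u`, so that `β` does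
  -- not cross `o` and hence not its part between `c` and `d`.
  obtain ⟨u₁, ⟨d, b⟩, β, ⟨c, b'⟩, u₂, rfl, hd, hc, hβ⟩ :=
    exists_consecutive (P := fun m => (m.1, true) ∈ o) hy' hz' hy hz (by simpa using hyz)
  obtain rfl : b = false := hu (d, b) (by simp)
  obtain rfl : b' = false := hu (c, b') (by simp)
  have hβ' : ∀ p ∈ β, p.2 = false := fun p hp => hu p (by simp [hp])
  have hdisj : ∀ {C : List Passage}, (∀ p ∈ C, p ∈ o) → ∀ p ∈ C, ∀ q ∈ β, p.1 ≠ q.1 := by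
    intro C hC p hp q hq e
    refine hβ q hq ?_
    rw [← e, ← ho p (hC p hp)]
    exact hC p hp
  have hcd : c ≠ d := by
    rintro rfl
    have := h.good.nodup
    simp [List.nodup_append'] at this
  change (d, true) ∈ o at hd
  obtain ⟨o₁, o₂, rfl⟩ := List.append_of_mem hd
  have hc' : (c, true) ∈ o₁ ∨ (c, true) ∈ o₂ := by
    simpa [hcd] using hc
  rcases hc' with hc' | hc'
  · obtain ⟨o₃, C, rfl⟩ := List.append_of_mem hc'
    have hr : (o₃ ++ (c, true) :: C ++ (d, true) :: o₂ ++ R₁ ++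
        (u₁ ++ (d, false) :: β ++ (c, false) :: u₂) ++ R₂) ~r
        ((c, true) :: C ++ (d, true) :: (o₂ ++ R₁ ++ u₁) ++ (d, false) :: β ++
          (c, false) :: (u₂ ++ R₂ ++ o₃)) := by
      simpa using List.isRotated_append (l := o₃) (l' := (c, true) :: C ++ (d, true) :: o₂ ++ R₁ ++
        (u₁ ++ (d, false) :: β ++ (c, false) :: u₂) ++ R₂)
    exact (h.of_isRotated hr).not_antiparallel (fun p hp => ho p (by simp [hp])) hβ'
      (hdisj fun p hp => by simp [hp])
  · obtain ⟨C, o₃, rfl⟩ := List.append_of_mem hc'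
    have hr : (o₁ ++ (d, true) :: (C ++ (c, true) :: o₃) ++ R₁ ++
        (u₁ ++ (d, false) :: β ++ (c, false) :: u₂) ++ R₂) ~r
        ((d, true) :: C ++ (c, true) :: (o₃ ++ R₁ ++ u₁) ++ (d, false) :: β ++
          (c, false) :: (u₂ ++ R₂ ++ o₁)) := by
      simpa using List.isRotated_append (l := o₁)
        (l' := (d, true) :: (C ++ (c, true) :: o₃) ++ R₁ ++
        (u₁ ++ (d, false) :: β ++ (c, false) :: u₂) ++ R₂)
    exact (h.of_isRotated hr).not_parallel (fun p hp => ho p (by simp [hp])) hβ'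
      (hdisj fun p hp => by simp [hp])

/-! ### Cutting an extremal diagram into arcs -/

/-- The concatenation of `k` consecutive members of a sequence of words. -/
def segment (k : ℕ) (a : ℤ → List Passage) (i : ℤ) : List Passage :=
  (List.range k).flatMap fun l : ℕ => a (i + (l : ℤ))

theorem segment_succ (k : ℕ) (a : ℤ → List Passage) (i : ℤ) :
    segment (k + 1) a i = segment k a i ++ a (i + k) := by
  simp [segment, List.range_succ]

theorem segment_succ' (k : ℕ) (a : ℤ → List Passage) (i : ℤ) :
    segment (k + 1) a i = a i ++ segment k a (i + 1) := by
  simp only [segment, List.range_succ_eq_map, List.flatMap_cons, List.flatMap_map]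
  congr 1
  · simp
  · congr 1
    funext l
    push_cast
    rw [add_assoc, add_comm 1]

theorem segment_add (k l : ℕ) (a : ℤ → List Passage) (i : ℤ) :
    segment (k + l) a i = segment k a i ++ segment l a (i + k) := by
  induction l with
  | zero => simp [segment]
  | succ l ih =>
    rw [← Nat.add_assoc, segment_succ, ih, segment_succ]
    simp [add_assoc]

theorem mem_segment {k : ℕ} {a : ℤ → List Passage} {i : ℤ} {m : Passage} :
    m ∈ segment k a i ↔ ∃ l : ℤ, i ≤ l ∧ l < i + k ∧ m ∈ a l := by
  simp only [segment, List.mem_flatMap, List.mem_range]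
  constructor
  · rintro ⟨l, hl, hm⟩
    exact ⟨i + l, by omega, by omega, hm⟩
  · rintro ⟨l, h1, h2, hm⟩
    refine ⟨(l - i).toNat, by omega, ?_⟩
    rwa [Int.toNat_of_nonneg (by omega), add_sub_cancel]

theorem not_mem_of_segment_nodup {k : ℕ} {a : ℤ → List Passage} {i l l' : ℤ}
    (h : (segment k a i).Nodup) (h1 : i ≤ l) (h2 : l < l') (h3 : l' < i + k) {m : Passage}
    (hm : m ∈ a l) : m ∉ a l' := by
  intro hm'
  obtain ⟨n, rfl⟩ := Int.le.dest (h1.trans h2.le)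
  obtain ⟨e, rfl⟩ : ∃ e, k = n + e := ⟨k - n, by omega⟩
  rw [segment_add, List.nodup_append'] at h
  exact h.2.2 (mem_segment.2 ⟨l, h1, h2, hm⟩) (mem_segment.2 ⟨i + n, le_rfl, by omega, hm'⟩)

theorem periodic_mul {α : Type*} {a : ℤ → α} {k : ℤ} (ha : ∀ i, a (i + k) = a i) (i n : ℤ) :
    a (i + n * k) = a i := by
  induction n using Int.induction_on with
  | zero => simp
  | succ n ih => rw [add_mul, one_mul, ← add_assoc, ha, ih]
  | pred n ih => rw [← ha, sub_mul, one_mul, ← ih]; congr 1; ring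

theorem exists_window {k : ℤ} (hk : 0 < k) (i j : ℤ) :
    ∃ n : ℤ, i ≤ j + n * k ∧ j + n * k < i + k := by
  refine ⟨-((j - i) / k), ?_, ?_⟩
  · have := Int.emod_nonneg (j - i) hk.ne'
    have h2 := Int.emod_add_mul_ediv (j - i) k
    nlinarith
  · have := Int.emod_lt_of_pos (j - i) hk
    have h2 := Int.emod_add_mul_ediv (j - i) k
    nlinarith

theorem segment_isRotated {k : ℕ} {a : ℤ → List Passage} (ha : ∀ i, a (i + k) = a i) (i j : ℤ) :
    segment k a i ~r segment k a j := by
  have step : ∀ i, segment k a i ~r segment k a (i + 1) := fun i => by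
    obtain _ | k := k
    · rfl
    · rw [segment_succ', segment_succ]
      have : a (i + 1 + k) = a i := by
        rw [← ha i]; congr 1; push_cast; ring
      rw [this]
      exact List.isRotated_append
  have key : ∀ n : ℕ, ∀ i, segment k a i ~r segment k a (i + n) := fun n => by
    induction n with
    | zero =>
      intro i
      rw [Nat.cast_zero, add_zero]
    | succ n ih =>
      intro i
      have := (ih i).trans (step _)
      simpa [add_assoc] using this
  rcases le_total i j with h | h
  · obtain ⟨n, rfl⟩ := Int.le.dest h
    exact key n i
  · obtain ⟨n, rfl⟩ := Int.le.dest h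
    exact (key n j).symm

/-- A diagram cut into `k` overpasses `O i` and `k` underpasses `U i`, in the cyclic order
`O 0, U 0, O 1, U 1, …`, such that every overpass crosses every underpass that is not next to it
exactly once, and crosses no other one; `x i j` is the crossing of `O i` and `U j`. -/
structure Arcs (k : ℕ) (O U : ℤ → List Passage) (x : ℤ → ℤ → Crossing) : Prop where
  three_le : 3 ≤ k
  over_add : ∀ i, O (i + k) = O i
  under_add : ∀ i, U (i + k) = U i
  crossing_add_left : ∀ i j, x (i + k) j = x i j
  crossing_add_right : ∀ i j, x i (j + k) = x i j
  mem_over : ∀ i m, m ∈ O i ↔ ∃ j, i + 1 ≤ j ∧ j ≤ i + k - 2 ∧ m = (x i j, true)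
  mem_under : ∀ j m, m ∈ U j ↔ ∃ i, i + 1 ≤ j ∧ j ≤ i + k - 2 ∧ m = (x i j, false)
  good : Good (segment k (fun l => O l ++ U l) 0)

/-- A counting argument. A crossing gives the index of its overpass and the distance from there to
its underpass. The distance is between 1 and k - 2 as neighbours do not cross, and the map is
injective as arcs cross at most once. There are k(k - 2) crossings and as many pairs, so every pair
occurs. -/
theorem Minimal.exists_arcs {k : ℕ} (hk : 3 ≤ k) {O U : ℤ → List Passage}
    (hO : ∀ i, O (i + k) = O i) (hU : ∀ i, U (i + k) = U i)
    (hO' : ∀ i, ∀ p ∈ O i, p.2 = true) (hU' : ∀ i, ∀ p ∈ U i, p.2 = false)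
    (h : Minimal (segment k (fun l => O l ++ U l) 0))
    (hc : (segment k (fun l => O l ++ U l) 0).length = 2 * (k * (k - 2))) :
    ∃ x, Arcs k O U x := by
  classical
  have hA : ∀ i, (fun l => O l ++ U l) (i + k) = (fun l => O l ++ U l) i := fun i => by
    simp only [hO, hU]
  have hw : ∀ i, Minimal (segment k (fun l => O l ++ U l) i) := fun i =>
    h.of_isRotated (segment_isRotated hA _ _)
  have hmem : ∀ m i, m ∈ segment k (fun l => O l ++ U l) i ↔
      m ∈ segment k (fun l => O l ++ U l) 0 := fun m i => (segment_isRotated hA i 0).mem_iff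
  have hsplit : ∀ (i : ℤ) (d : ℕ), d < k → ∃ R₁ R₂, segment k (fun l => O l ++ U l) i =
      O i ++ R₁ ++ U (i + d) ++ R₂ := by
    intro i d hd
    obtain ⟨e, rfl⟩ : ∃ e, k = d + (1 + e) := ⟨k - d - 1, by omega⟩
    rw [segment_add, segment_add]
    obtain _ | d := d
    · exact ⟨[], segment e (fun l => O l ++ U l) (i + 1), by simp [segment]⟩
    · exact ⟨U i ++ segment d (fun l => O l ++ U l) (i + 1) ++ O (i + ↑(d + 1)), segment e (fun l => O l ++ U l) (i + ↑(d + 1) + 1), by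
        rw [segment_succ']; simp [segment]⟩
  have huniq : ∀ (i : ℤ) (d : ℕ), d < k → ∀ y z, (y, true) ∈ O i → (y, false) ∈ U (i + d) →
      (z, true) ∈ O i → (z, false) ∈ U (i + d) → y = z := by
    intro i d hd y z h1 h2 h3 h4
    obtain ⟨R₁, R₂, e⟩ := hsplit i d hd
    have := hw i
    rw [e] at this
    exact this.cross_unique (hO' _) (hU' _) h1 h2 h3 h4
  have hfind : ∀ i y, (y, true) ∈ O i → ∃ d : ℕ, 1 ≤ d ∧ d ≤ k - 2 ∧ (y, false) ∈ U (i + d) := by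
    intro i y hy
    have h1 : (y, true) ∈ segment k (fun l => O l ++ U l) i :=
      mem_segment.2 ⟨i, le_rfl, by omega, by simp [hy]⟩
    have h2 := (hw i).good.paired y true h1
    obtain ⟨l, h3, h4, h5⟩ := mem_segment.1 h2
    have h6 : (y, false) ∈ U l := by
      rcases List.mem_append.1 h5 with h | h
      · exact absurd (hO' _ _ h) (by simp)
      · exact h
    obtain ⟨d, rfl⟩ := Int.le.dest h3
    refine ⟨d, ?_, ?_, h6⟩
    · by_contra hd
      obtain rfl : d = 0 := by omega
      obtain ⟨e, he⟩ : ∃ e, k = e + 1 := ⟨k - 1, by omega⟩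
      have h7 := hw i
      rw [he, segment_succ'] at h7
      exact h7.not_cross_next (hO' _) (hU' _) y hy (by simpa using h6)
    -- Distance k - 1 means the underpass just before `O i`, so the word is read from the index i -
    -- 1.
    · by_contra hd
      obtain ⟨e, he⟩ : ∃ e, k = e + 2 := ⟨k - 2, by omega⟩
      have h7 := hw (i - 1)
      rw [he, segment_succ', segment_succ'] at h7
      have h8 : O (i - 1) ++ U (i - 1) ++ (O (i - 1 + 1) ++ U (i - 1 + 1) ++
          segment e (fun l => O l ++ U l) (i - 1 + 1 + 1)) ~r U (i - 1) ++ O i ++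
          (U i ++ segment e (fun l => O l ++ U l) (i + 1) ++ O (i - 1)) := by
        simpa using List.isRotated_append (l := O (i - 1)) (l' := U (i - 1) ++ O i ++
          (U i ++ segment e (fun l => O l ++ U l) (i + 1)))
      refine (h7.of_isRotated h8).not_cross_prev (hO' _) (hU' _) y hy ?_
      rw [← hU]
      convert h6 using 2
      omega
  have hdisj : ∀ (i : ℤ) (d d' : ℕ), d < k → d' < k → ∀ m, m ∈ U (i + d) → m ∈ U (i + d') →
      d = d' := by
    intro i d d' hd hd' m hm hm'
    have hnd := (hw i).good.nodup
    by_contra hne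
    rcases lt_or_gt_of_ne hne with hlt | hlt
    · exact not_mem_of_segment_nodup hnd (l := i + d) (l' := i + d') (by omega) (by omega)
        (by omega) (List.mem_append_right _ hm) (List.mem_append_right _ hm')
    · exact not_mem_of_segment_nodup hnd (l := i + d') (l' := i + d) (by omega) (by omega)
        (by omega) (List.mem_append_right _ hm') (List.mem_append_right _ hm)
  have hsurj : ∀ (i : ℤ) (d : ℕ), 1 ≤ d → d ≤ k - 2 →
      ∃ y, (y, true) ∈ O i ∧ (y, false) ∈ U (i + d) := by
    let E := h.good.toDiagram
    have hE : E.crossings.card = k * (k - 2) := by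
      have := two_mul_crossingNumber E.toGaussCode (w := segment k (fun l => O l ++ U l) 0) rfl
      have h2 : E.crossingNumber = E.crossings.card := rfl
      omega
    have hf : ∀ y ∈ E.crossings, ∃ p ∈ Finset.range k ×ˢ Finset.Icc 1 (k - 2),
        (y, true) ∈ O p.1 ∧ (y, false) ∈ U (p.1 + p.2) := by
      intro y hy
      have h1 : (y, true) ∈ segment k (fun l => O l ++ U l) 0 :=
        (E.toGaussCode.mem_crossings_iff y true).1 hy
      obtain ⟨l, h3, h4, h5⟩ := mem_segment.1 h1
      have h6 : (y, true) ∈ O l := by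
        rcases List.mem_append.1 h5 with h | h
        · exact h
        · exact absurd (hU' _ _ h) (by simp)
      obtain ⟨n, rfl⟩ := Int.le.dest h3
      rw [zero_add] at h6 h4
      obtain ⟨d, h7, h8, h9⟩ := hfind _ y h6
      exact ⟨(n, d), by simp; omega, h6, h9⟩
    choose! f hf1 hf2 hf3 using hf
    have hinj : Set.InjOn f E.crossings := by
      intro y hy z hz e
      have h1 := hf1 y hy
      simp only [Finset.mem_product, Finset.mem_range, Finset.mem_Icc] at h1
      refine huniq (f y).1 (f y).2 (by omega) y z (hf2 y hy) (hf3 y hy) ?_ ?_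
      · rw [e]; exact hf2 z hz
      · rw [e]; exact hf3 z hz
    have hcard : (Finset.range k ×ˢ Finset.Icc 1 (k - 2)).card ≤ E.crossings.card := by
      rw [hE, Finset.card_product, Finset.card_range, Nat.card_Icc]
      simp
    have hs := Finset.surjOn_of_injOn_of_card_le f (fun y hy => hf1 y hy) hinj hcard
    intro i d hd hd'
    obtain ⟨n, h1, h2⟩ := exists_window (k := k) (by omega) 0 i
    have e1 := periodic_mul hO i n
    have e2 := periodic_mul hU (i + d) n
    obtain ⟨m, hm⟩ := Int.le.dest h1
    have hmem : (m, d) ∈ Finset.range k ×ˢ Finset.Icc 1 (k - 2) := by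
      simp; omega
    obtain ⟨y, hy, hfy⟩ := hs hmem
    refine ⟨y, ?_, ?_⟩
    · have := hf2 y hy
      rw [hfy] at this
      rw [← e1]
      convert this using 2
      simp at hm ⊢; omega
    · have := hf3 y hy
      rw [hfy] at this
      rw [← e2]
      convert this using 2
      simp at hm ⊢; omega
  -- The choice depends on the two arcs only, which makes `x` periodic in both indices. The default
  -- value is taken only for arcs that do not cross.
  let x : ℤ → ℤ → Crossing := fun i j =>
    if h : ∃ y, (y, true) ∈ O i ∧ (y, false) ∈ U j then h.choose else (0, 1)
  have hx : ∀ (i : ℤ) (d : ℕ), 1 ≤ d → d ≤ k - 2 →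
      (x i (i + d), true) ∈ O i ∧ (x i (i + d), false) ∈ U (i + d) := by
    intro i d h1 h2
    have := hsurj i d h1 h2
    simp only [x, dif_pos this]
    exact this.choose_spec
  refine ⟨x, hk, hO, hU, fun i j => by simp only [x, hO], fun i j => by simp only [x, hU], ?_, ?_,
    h.good⟩
  · intro i m
    constructor
    · intro hm
      obtain ⟨y, b⟩ := m
      obtain rfl : b = true := hO' _ _ hm
      obtain ⟨d, h1, h2, h3⟩ := hfind i y hm
      obtain ⟨h4, h5⟩ := hx i d h1 h2
      exact ⟨i + d, by omega, by omega, by rw [huniq i d (by omega) _ _ hm h3 h4 h5]⟩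
    · rintro ⟨j, h1, h2, rfl⟩
      obtain ⟨d, rfl⟩ := Int.le.dest (show i ≤ j by omega)
      exact (hx i d (by omega) (by omega)).1
  · intro j m
    constructor
    · intro hm
      obtain ⟨y, b⟩ := m
      obtain rfl : b = false := hU' _ _ hm
      have h1 : (y, false) ∈ segment k (fun l => O l ++ U l) (j + 1 - k) :=
        mem_segment.2 ⟨j, by omega, by omega, by simp [hm]⟩
      have h2 := (hw _).good.paired y false h1
      obtain ⟨i, h3, h4, h5⟩ := mem_segment.1 h2
      have h6 : (y, true) ∈ O i := by
        rcases List.mem_append.1 h5 with h | h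
        · exact h
        · exact absurd (hU' _ _ h) (by simp)
      obtain ⟨d, h7, h8, h9⟩ := hfind i y h6
      obtain ⟨d', rfl⟩ := Int.le.dest (show i ≤ j by omega)
      obtain rfl := hdisj i d d' (by omega) (by omega) _ h9 hm
      obtain ⟨h10, h11⟩ := hx i d h7 h8
      exact ⟨i, by omega, by omega, by rw [huniq i d (by omega) _ _ h6 h9 h10 h11]⟩
    · rintro ⟨i, h1, h2, rfl⟩
      obtain ⟨d, rfl⟩ := Int.le.dest (show i ≤ j by omega)
      exact (hx i d (by omega) (by omega)).2

/-- The diagrams of the theorem are cut into arcs in this way. -/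
theorem KnotDiagram.exists_arcs (D : KnotDiagram) (hmin : D.IsCrossingMinimal)
    (hnontrivial : D.IsNontrivial)
    (hcb : (D.crossingNumber : ℤ) = (D.overpassNumber : ℤ) * ((D.overpassNumber : ℤ) - 2)) :
    ∃ O U x, Arcs D.overpassNumber O U x ∧
      D.word = (segment D.overpassNumber (fun l => O l ++ U l) 0 : List Passage) := by
  obtain ⟨w, hw⟩ : ∃ w : List Passage, D.word = w := by
    obtain ⟨w, hw⟩ := Quotient.exists_rep D.word
    exact ⟨w, hw.symm⟩
  have hlen := two_mul_crossingNumber D.toGaussCode hw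
  have hc0 : D.crossingNumber ≠ 0 := by
    intro h0
    refine hnontrivial ⟨D, Relation.EqvGen.refl _, ?_⟩
    obtain rfl : w = [] := List.length_eq_zero_iff.1 (by omega)
    exact hw
  -- For b = 0, 1, 2 the product b(b - 2) is not positive, but a nontrivial knot has a crossing.
  have hk : 3 ≤ D.overpassNumber := by
    by_contra hlt
    have : D.overpassNumber = 0 ∨ D.overpassNumber = 1 ∨ D.overpassNumber = 2 := by omega
    rcases this with h | h | h <;> rw [h] at hcb <;> norm_num at hcb <;> omega
  -- The infimum of the empty set is 0, so a positive number of overpasses is attained by a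
  -- sequence.
  have hne : {k | ∃ s, D.IsOverUnderpassSequence s ∧ s.length = k}.Nonempty := by
    by_contra h
    rw [Set.not_nonempty_iff_eq_empty] at h
    have : D.overpassNumber = 0 := by rw [GaussCode.overpassNumber, h, Nat.sInf_empty]
    omega
  obtain ⟨s, hs, hsl⟩ := Nat.sInf_mem hne
  change s.length = D.overpassNumber at hsl
  generalize D.overpassNumber = k at hk hsl hcb ⊢
  have hpos : (0 : ℤ) < k := by omega
  have hlt : ∀ i : ℤ, (i % k).toNat < s.length := fun i => by
    have h1 := Int.emod_nonneg i hpos.ne'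
    have h2 := Int.emod_lt_of_pos i hpos
    omega
  let O : ℤ → List Passage := fun i => (s[(i % k).toNat]'(hlt i)).1
  let U : ℤ → List Passage := fun i => (s[(i % k).toNat]'(hlt i)).2
  have hO : ∀ i, O (i + k) = O i := fun i => by simp only [O, Int.add_emod_right]
  have hU : ∀ i, U (i + k) = U i := fun i => by simp only [U, Int.add_emod_right]
  have hseg : segment k (fun l => O l ++ U l) 0 = s.flatMap fun a => a.1 ++ a.2 := by
    have e : s = (List.range k).attach.map fun l => s[l.1]'(by
        have := List.mem_range.1 l.2; omega) := by
      apply List.ext_getElem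
      · simp [hsl]
      · intro n h1 h2
        simp
    conv_rhs => rw [e]
    rw [List.flatMap_map, segment]
    conv_lhs => rw [← List.attach_map_subtype_val (List.range k)]
    rw [List.flatMap_map]
    refine List.flatMap_congr fun l hl => ?_
    have hlk := List.mem_range.1 l.2
    have : ((0 + (l.1 : ℤ)) % k).toNat = l.1 := by
      rw [zero_add, Int.emod_eq_of_lt (by omega) (by omega), Int.toNat_natCast]
    simp only [O, U, this]
  have hw2 : D.word = (segment k (fun l => O l ++ U l) 0 : List Passage) := by rw [hseg]; exact hs.2
  have hm := hmin.minimal hw2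
  have hl2 := two_mul_crossingNumber D.toGaussCode hw2
  obtain ⟨x, hx⟩ := hm.exists_arcs hk hO hU (fun i p hp => (hs.1 _ (List.getElem_mem _)).1.2 p hp)
    (fun i p hp => (hs.1 _ (List.getElem_mem _)).2.2 p hp) (by
      rw [← hl2]
      congr 1
      zify
      rw [hcb]
      push_cast [show 2 ≤ k by omega]
      rfl)
  exact ⟨O, U, x, hx, hw2⟩

namespace Arcs

variable {k : ℕ} {O U : ℤ → List Passage} {x : ℤ → ℤ → Crossing}

theorem segment_good (A : Arcs k O U x) (i : ℤ) : Good (segment k (fun l => O l ++ U l) i) :=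
  A.good.of_isRotated (segment_isRotated (fun i => by simp only [A.over_add, A.under_add]) _ _)

theorem shift (A : Arcs k O U x) (n : ℤ) :
    Arcs k (fun i => O (n + i)) (fun i => U (n + i)) (fun i j => x (n + i) (n + j)) where
  three_le := A.three_le
  over_add i := by rw [← add_assoc, A.over_add]
  under_add i := by rw [← add_assoc, A.under_add]
  crossing_add_left i j := by rw [← add_assoc, A.crossing_add_left]
  crossing_add_right i j := by rw [← add_assoc, A.crossing_add_right]
  mem_over i m := by
    rw [A.mem_over]
    constructor
    · rintro ⟨j, h1, h2, rfl⟩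
      exact ⟨j - n, by omega, by omega, by rw [add_sub_cancel]⟩
    · rintro ⟨j, h1, h2, rfl⟩
      exact ⟨n + j, by omega, by omega, rfl⟩
  mem_under j m := by
    rw [A.mem_under]
    constructor
    · rintro ⟨i, h1, h2, rfl⟩
      exact ⟨i - n, by omega, by omega, by rw [add_sub_cancel]⟩
    · rintro ⟨i, h1, h2, rfl⟩
      exact ⟨n + i, by omega, by omega, rfl⟩
  good := by
    have := A.segment_good n
    simpa [segment] using this

/-- The diagram with the orientation reversed, seen from the other side. -/
theorem dual (A : Arcs k O U x) :
    Arcs k (fun i => ((U (-i)).map flipPassage).reverse)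
      (fun i => ((O (-i)).map flipPassage).reverse) (fun i j => x (-j) (-i)) where
  three_le := A.three_le
  over_add i := by rw [← A.under_add (-(i + k)), neg_add, neg_add_cancel_right]
  under_add i := by rw [← A.over_add (-(i + k)), neg_add, neg_add_cancel_right]
  crossing_add_left i j := by rw [← A.crossing_add_right _ (-(i + k)), neg_add, neg_add_cancel_right]
  crossing_add_right i j := by rw [← A.crossing_add_left (-(j + k)), neg_add, neg_add_cancel_right]
  mem_over i m := by
    rw [List.mem_reverse, mem_map_of_involutive flipPassage_involutive, A.mem_under]
    constructor
    · rintro ⟨a, h1, h2, h3⟩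
      refine ⟨-a, by omega, by omega, ?_⟩
      rw [← flipPassage_involutive m, h3, neg_neg]
      rfl
    · rintro ⟨j, h1, h2, rfl⟩
      exact ⟨-j, by omega, by omega, rfl⟩
  mem_under j m := by
    rw [List.mem_reverse, mem_map_of_involutive flipPassage_involutive, A.mem_over]
    constructor
    · rintro ⟨a, h1, h2, h3⟩
      refine ⟨-a, by omega, by omega, ?_⟩
      rw [← flipPassage_involutive m, h3, neg_neg]
      rfl
    · rintro ⟨j, h1, h2, rfl⟩
      exact ⟨-j, by omega, by omega, rfl⟩
  good := by
    have key : ∀ (n : ℕ) (i : ℤ), segment n (fun l => ((U (-l)).map flipPassage).reverse ++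
        ((O (-l)).map flipPassage).reverse) i =
        ((segment n (fun l => O l ++ U l) (1 - i - n)).map flipPassage).reverse := by
      intro n
      induction n with
      | zero => intro i; rfl
      | succ n ih =>
        intro i
        rw [segment_succ', ih, segment_succ]
        have e1 : (1 - i - ((n + 1 : ℕ) : ℤ) + n) = -i := by push_cast; ring
        have e2 : 1 - (i + 1) - (n : ℤ) = 1 - i - ((n + 1 : ℕ) : ℤ) := by push_cast; ring
        rw [e1, e2]
        simp
    rw [key]
    exact (A.segment_good _).flip.reverse

/-- The arcs with indices in a fundamental domain that cross. -/
def Crosses (k : ℕ) (a b : ℤ) : Prop :=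
  0 ≤ a ∧ a < k ∧ 0 ≤ b ∧ b < k ∧ (a + 1 ≤ b ∧ b ≤ a + k - 2 ∨ b + 2 ≤ a)

theorem mem_over_iff (A : Arcs k O U x) {l : ℤ} (h0 : 0 ≤ l) (hl : l < k) (m : Passage) :
    m ∈ O l ↔ ∃ b, Crosses k l b ∧ m = (x l b, true) := by
  rw [A.mem_over]
  constructor
  · rintro ⟨j, h1, h2, rfl⟩
    by_cases hj : j < k
    · exact ⟨j, ⟨h0, hl, by omega, hj, by omega⟩, rfl⟩
    · refine ⟨j - k, ⟨h0, hl, by omega, by omega, by omega⟩, ?_⟩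
      rw [← A.crossing_add_right l (j - k), sub_add_cancel]
  · rintro ⟨b, ⟨-, -, h1, h2, h3 | h3⟩, rfl⟩
    · exact ⟨b, h3.1, h3.2, rfl⟩
    · exact ⟨b + k, by omega, by omega, by rw [A.crossing_add_right]⟩

theorem mem_under_iff (A : Arcs k O U x) {l : ℤ} (h0 : 0 ≤ l) (hl : l < k) (m : Passage) :
    m ∈ U l ↔ ∃ a, Crosses k a l ∧ m = (x a l, false) := by
  rw [A.mem_under]
  constructor
  · rintro ⟨i, h1, h2, rfl⟩
    by_cases hi : 0 ≤ i
    · exact ⟨i, ⟨hi, by omega, h0, hl, by omega⟩, rfl⟩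
    · refine ⟨i + k, ⟨by omega, by omega, by omega, by omega, by omega⟩, ?_⟩
      rw [A.crossing_add_left]
  · rintro ⟨b, ⟨h1, h2, -, -, h3 | h3⟩, rfl⟩
    · exact ⟨b, h3.1, h3.2, rfl⟩
    · exact ⟨b - k, by omega, by omega, by
        rw [← A.crossing_add_left (b - k), sub_add_cancel]⟩

theorem over_mem (A : Arcs k O U x) {a b : ℤ} (h : Crosses k a b) : (x a b, true) ∈ O a :=
  (A.mem_over_iff h.1 h.2.1 _).2 ⟨b, h, rfl⟩

theorem under_mem (A : Arcs k O U x) {a b : ℤ} (h : Crosses k a b) : (x a b, false) ∈ U b :=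
  (A.mem_under_iff h.2.2.1 h.2.2.2.1 _).2 ⟨a, h, rfl⟩

theorem eq_of_mem_over (A : Arcs k O U x) {l l' : ℤ} (h0 : 0 ≤ l) (hl : l < k) (h0' : 0 ≤ l')
    (hl' : l' < k) {m : Passage} (hm : m ∈ O l) (hm' : m ∈ O l') : l = l' := by
  by_contra hne
  rcases lt_or_gt_of_ne hne with h | h
  · exact not_mem_of_segment_nodup A.good.nodup h0 h (by omega) (List.mem_append_left _ hm)
      (List.mem_append_left _ hm')
  · exact not_mem_of_segment_nodup A.good.nodup h0' h (by omega) (List.mem_append_left _ hm')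
      (List.mem_append_left _ hm)

theorem eq_of_mem_under (A : Arcs k O U x) {l l' : ℤ} (h0 : 0 ≤ l) (hl : l < k) (h0' : 0 ≤ l')
    (hl' : l' < k) {m : Passage} (hm : m ∈ U l) (hm' : m ∈ U l') : l = l' := by
  by_contra hne
  rcases lt_or_gt_of_ne hne with h | h
  · exact not_mem_of_segment_nodup A.good.nodup h0 h (by omega) (List.mem_append_right _ hm)
      (List.mem_append_right _ hm')
  · exact not_mem_of_segment_nodup A.good.nodup h0' h (by omega) (List.mem_append_right _ hm')
      (List.mem_append_right _ hm)

theorem crossing_inj (A : Arcs k O U x) {a b a' b' : ℤ} (h : Crosses k a b) (h' : Crosses k a' b') :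
    x a b = x a' b' ↔ a = a' ∧ b = b' := by
  constructor
  · intro e
    have h1 := A.over_mem h'
    have h2 := A.under_mem h'
    rw [← e] at h1 h2
    exact ⟨A.eq_of_mem_over h.1 h.2.1 h'.1 h'.2.1 (A.over_mem h) h1,
      A.eq_of_mem_under h.2.2.1 h.2.2.2.1 h'.2.2.1 h'.2.2.2.1 (A.under_mem h) h2⟩
  · rintro ⟨rfl, rfl⟩
    rfl

theorem over_snd (A : Arcs k O U x) (l : ℤ) : ∀ m ∈ O l, m.2 = true := by
  intro m hm
  obtain ⟨j, -, -, rfl⟩ := (A.mem_over l m).1 hm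
  rfl

theorem under_snd (A : Arcs k O U x) (l : ℤ) : ∀ m ∈ U l, m.2 = false := by
  intro m hm
  obtain ⟨j, -, -, rfl⟩ := (A.mem_under l m).1 hm
  rfl

theorem arc_sublist (A : Arcs k O U x) (l : ℤ) :
    (O l ++ U l).Sublist (segment k (fun l => O l ++ U l) l) := by
  have := A.three_le
  obtain ⟨e, he⟩ : ∃ e, k = e + 1 := ⟨k - 1, by omega⟩
  conv_rhs => rw [he, segment_succ']
  exact List.sublist_append_left _ _

theorem over_nodup (A : Arcs k O U x) (l : ℤ) : (O l).Nodup :=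
  ((A.segment_good l).nodup.sublist (A.arc_sublist l)).of_append_left

theorem under_nodup (A : Arcs k O U x) (l : ℤ) : (U l).Nodup :=
  ((A.segment_good l).nodup.sublist (A.arc_sublist l)).of_append_right

end Arcs

/-! ### Positions of the crossings on the arcs -/

/-- The position of the crossing with `U j` on the overpass `O i`. -/
def overPos (O : ℤ → List Passage) (x : ℤ → ℤ → Crossing) (i j : ℤ) : ℕ :=
  (O i).idxOf (x i j, true)

/-- The position of the crossing with `O i` on the underpass `U j`. -/
def underPos (U : ℤ → List Passage) (x : ℤ → ℤ → Crossing) (i j : ℤ) : ℕ :=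
  (U j).idxOf (x i j, false)

/-- The sign of a crossing as a number. -/
def sgn (y : Crossing) : ℚ := ((y.2 : ℤ) : ℚ)

theorem sgn_eq (y : Crossing) : y.2 = 1 ∧ sgn y = 1 ∨ y.2 = -1 ∧ sgn y = -1 := by
  rcases Int.units_eq_one_or y.2 with h | h <;> simp [sgn, h]

namespace Arcs

variable {k : ℕ} {O U : ℤ → List Passage} {x : ℤ → ℤ → Crossing}

theorem mem_over' (A : Arcs k O U x) {i j : ℤ} (h1 : i + 1 ≤ j) (h2 : j ≤ i + k - 2) :
    (x i j, true) ∈ O i := (A.mem_over i _).2 ⟨j, h1, h2, rfl⟩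

theorem mem_under' (A : Arcs k O U x) {i j : ℤ} (h1 : i + 1 ≤ j) (h2 : j ≤ i + k - 2) :
    (x i j, false) ∈ U j := (A.mem_under j _).2 ⟨i, h1, h2, rfl⟩

theorem overPos_inj (A : Arcs k O U x) {i j j' : ℤ} (h1 : i + 1 ≤ j) (h2 : j < j')
    (h3 : j' ≤ i + k - 2) : overPos O x i j ≠ overPos O x i j' := by
  intro e
  have e2 := (List.idxOf_inj (A.mem_over' h1 (h2.le.trans h3))).1 e
  have e3 : x i j = x i j' := congrArg Prod.fst e2
  have h4 := A.mem_under' h1 (h2.le.trans h3)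
  have h5 := A.mem_under' (h1.trans h2.le) h3
  rw [← e3] at h5
  exact not_mem_of_segment_nodup (A.segment_good j).nodup le_rfl h2 (by omega)
    (List.mem_append_right _ h4) (List.mem_append_right _ h5)

theorem underPos_inj (A : Arcs k O U x) {i i' j : ℤ} (h1 : i' + 1 ≤ j) (h2 : i < i')
    (h3 : j ≤ i + k - 2) : underPos U x i j ≠ underPos U x i' j := by
  intro e
  have e2 := (List.idxOf_inj (A.mem_under' (by omega) h3)).1 e
  have e3 : x i j = x i' j := congrArg Prod.fst e2
  have h4 := A.mem_over' (by omega) h3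
  have h5 := A.mem_over' h1 (by omega)
  rw [← e3] at h5
  exact not_mem_of_segment_nodup (A.segment_good i).nodup le_rfl h2 (by omega)
    (List.mem_append_left _ h4) (List.mem_append_left _ h5)

theorem overPos_add_right (A : Arcs k O U x) (i j : ℤ) :
    overPos O x i (j + k) = overPos O x i j := by
  simp only [overPos, A.crossing_add_right]

theorem underPos_add_left (A : Arcs k O U x) (i j : ℤ) :
    underPos U x (i + k) j = underPos U x i j := by
  simp only [underPos, A.crossing_add_left]

end Arcs

theorem idxOf_map_flip (l : List Passage) (m : Passage) :
    (l.map flipPassage).idxOf (flipPassage m) = l.idxOf m := by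
  induction l with
  | nil => rfl
  | cons a l ih =>
    rw [List.map_cons, List.idxOf_cons, List.idxOf_cons, ih]
    simp only [beq_iff_eq, flipPassage_involutive.injective.eq_iff, Bool.cond_eq_ite]

theorem idxOf_reverse_lt {l : List Passage} (hl : l.Nodup) {a b : Passage} (ha : a ∈ l)
    (hb : b ∈ l) : l.reverse.idxOf a < l.reverse.idxOf b ↔ l.idxOf b < l.idxOf a := by
  have key : ∀ c ∈ l, l.reverse.idxOf c + l.idxOf c + 1 = l.length := fun c hc => by
    have h1 := List.idxOf_lt_length_of_mem hc
    have h2 : l.reverse[l.length - 1 - l.idxOf c]'(by simp; omega) = c := by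
      rw [List.getElem_reverse]
      simp only [show l.length - 1 - (l.length - 1 - l.idxOf c) = l.idxOf c by omega]
      exact List.getElem_idxOf h1
    have h3 := (List.nodup_reverse.2 hl).idxOf_getElem (l.length - 1 - l.idxOf c)
      (by simp; omega)
    rw [h2] at h3
    omega
  have h1 := key a ha
  have h2 := key b hb
  omega

namespace Arcs

variable {k : ℕ} {O U : ℤ → List Passage} {x : ℤ → ℤ → Crossing}

/-- Duality turns underpasses into overpasses and reverses the direction, so every fact on the order
along overpasses yields one along underpasses. -/
theorem overPos_dual_lt (A : Arcs k O U x) {i j j' : ℤ} (h1 : i + 1 ≤ j) (h2 : j ≤ i + k - 2)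
    (h1' : i + 1 ≤ j') (h2' : j' ≤ i + k - 2) :
    overPos (fun i => ((U (-i)).map flipPassage).reverse) (fun i j => x (-j) (-i)) i j <
      overPos (fun i => ((U (-i)).map flipPassage).reverse) (fun i j => x (-j) (-i)) i j' ↔
    underPos U x (-j') (-i) < underPos U x (-j) (-i) := by
  have e : ∀ j, (x (-j) (-i), true) = flipPassage (x (-j) (-i), false) := fun j => rfl
  simp only [overPos, underPos, ← List.map_reverse, e, idxOf_map_flip]
  exact idxOf_reverse_lt (A.under_nodup _) (A.mem_under' (by omega) (by omega))
    (A.mem_under' (by omega) (by omega))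

theorem underPos_dual_lt (A : Arcs k O U x) {i i' j : ℤ} (h1 : i + 1 ≤ j) (h2 : j ≤ i + k - 2)
    (h1' : i' + 1 ≤ j) (h2' : j ≤ i' + k - 2) :
    underPos (fun i => ((O (-i)).map flipPassage).reverse) (fun i j => x (-j) (-i)) i j <
      underPos (fun i => ((O (-i)).map flipPassage).reverse) (fun i j => x (-j) (-i)) i' j ↔
    overPos O x (-j) (-i') < overPos O x (-j) (-i) := by
  have e : ∀ i, (x (-j) (-i), false) = flipPassage (x (-j) (-i), true) := fun j => rfl
  simp only [overPos, underPos, ← List.map_reverse, e, idxOf_map_flip]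
  exact idxOf_reverse_lt (A.over_nodup _) (A.mem_over' (by omega) (by omega))
    (A.mem_over' (by omega) (by omega))

end Arcs

theorem idxOf_lt_iff_mem_right {P Q : List Passage} {y m : Passage} (h : (P ++ y :: Q).Nodup)
    (hm : m ∈ P ++ y :: Q) :
    m ∈ Q ↔ (P ++ y :: Q).idxOf y < (P ++ y :: Q).idxOf m := by
  simp only [List.nodup_append', List.nodup_cons, List.disjoint_cons_right] at h
  obtain ⟨hP, ⟨hyQ, hQ⟩, hyP, hd⟩ := h
  rw [List.idxOf_append_of_notMem hyP, List.idxOf_cons_self]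
  rcases List.mem_append.1 hm with h1 | h1
  · rw [List.idxOf_append_of_mem h1]
    have := List.idxOf_lt_length_of_mem h1
    exact ⟨fun h2 => (hd h1 h2).elim, fun h2 => by omega⟩
  · rcases List.mem_cons.1 h1 with rfl | h2
    · rw [List.idxOf_append_of_notMem hyP, List.idxOf_cons_self]
      exact ⟨fun h => absurd h hyQ, fun h => absurd h (lt_irrefl _)⟩
    · have h3 : m ∉ P := fun h4 => hd h4 h2
      have h4 : y ≠ m := by rintro rfl; exact hyQ h2
      rw [List.idxOf_append_of_notMem h3, List.idxOf_cons_ne _ h4]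
      exact ⟨fun _ => by omega, fun _ => h2⟩

theorem idxOf_lt_iff_mem_left {P Q : List Passage} {y m : Passage} (h : (P ++ y :: Q).Nodup)
    (hm : m ∈ P ++ y :: Q) :
    m ∈ P ↔ (P ++ y :: Q).idxOf m < (P ++ y :: Q).idxOf y := by
  have h0 := idxOf_lt_iff_mem_right h hm
  have hinj := List.idxOf_inj hm (y := y)
  simp only [List.nodup_append', List.nodup_cons, List.disjoint_cons_right] at h
  obtain ⟨hP, ⟨hyQ, hQ⟩, hyP, hd⟩ := h
  constructor
  · intro h1
    have h2 : m ∉ Q := fun h2 => hd h1 h2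
    have h3 : m ≠ y := by rintro rfl; exact hyP h1
    have h4 := mt h0.2 h2
    have h5 := mt hinj.1 h3
    omega
  · intro h1
    rcases List.mem_append.1 hm with h2 | h2
    · exact h2
    · rcases List.mem_cons.1 h2 with rfl | h3
      · exact absurd h1 (lt_irrefl _)
      · have := h0.1 h3
        omega

/-! ### Labels with respect to curves made of arcs -/

theorem loop_walk {A C B : List Passage} {y : Crossing}
    (h : (A ++ (y, true) :: C ++ (y, false) :: B).Nodup) :
    Walk (fun m => if m ∈ C ∨ m = (y, false) then 1 else 0)
      (fun m => if m ∈ C ∨ m = (y, true) then 1 else 0) 0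
      (A ++ (y, true) :: C ++ (y, false) :: B) 0 := by
  simp only [List.append_assoc, List.cons_append, List.nodup_append', List.nodup_cons,
    List.disjoint_cons_right, List.mem_append, List.mem_cons, not_or,
    List.disjoint_append_right] at h
  obtain ⟨-, ⟨⟨h1, -, h2⟩, -, ⟨h3, -⟩, h4, h5⟩, h6, h7, h8, h9⟩ := h
  rw [List.append_assoc, walk_append]
  refine ⟨0, walk_const fun m hm => ?_, ?_, ?_⟩
  · have e1 : m ∉ C := fun h => h7 hm h
    have e2 : m ≠ (y, false) := by rintro rfl; exact h8 hm
    have e3 : m ≠ (y, true) := by rintro rfl; exact h6 hm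
    simp [e1, e2, e3]
  · simp [h1]
  · have hb : (if (y, true) ∈ C ∨ (y, true) = (y, true) then (1 : ℚ) else 0) = 1 := if_pos (Or.inr rfl)
    change Walk _ _ (if (y, true) ∈ C ∨ (y, true) = (y, true) then (1 : ℚ) else 0)
      (C ++ (y, false) :: B) 0
    rw [hb, walk_append]
    refine ⟨1, walk_const fun m hm => by simp [hm], by simp, ?_⟩
    have e : (if (y, false) ∈ C ∨ (y, false) = (y, true) then (1 : ℚ) else 0) = 0 := by simp [h4]
    change Walk _ _ (if (y, false) ∈ C ∨ (y, false) = (y, true) then (1 : ℚ) else 0) B 0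
    rw [e]
    refine walk_const fun m hm => ?_
    have e1 : m ∉ C := fun h => h5 h hm
    have e2 : m ≠ (y, false) := by rintro rfl; exact h3 hm
    have e3 : m ≠ (y, true) := by rintro rfl; exact h2 hm
    simp [e1, e2, e3]

namespace Arcs

variable {k : ℕ} {O U : ℤ → List Passage} {x : ℤ → ℤ → Crossing}

/-- The unit flow on the part of the knot from the overcrossing of `x a b` to its undercrossing: the
end of `O a`, all arcs in between, and the beginning of `U b`. Strict and weak inequalities
distinguish the edges before and after `x a b` itself. -/
theorem exists_loop_flow (A : Arcs k O U x) {a b : ℤ} (hab : a < b) (h : Crosses k a b) :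
    ∃ zi zo : Passage → ℚ, Walk zi zo 0 (segment k (fun l => O l ++ U l) 0) 0 ∧
      (∀ y, FlowAt zi zo y) ∧ (∀ y, y ≠ x a b → ∀ c, zi (y, c) = zo (y, c)) ∧ ∀ a' b', Crosses k a' b' →
        zi (x a' b', true) = (if (a < a' ∧ a' ≤ b) ∨
          (a' = a ∧ overPos O x a b < overPos O x a b') then 1 else 0) ∧
        zo (x a' b', true) = (if (a < a' ∧ a' ≤ b) ∨
          (a' = a ∧ overPos O x a b ≤ overPos O x a b') then 1 else 0) ∧
        zi (x a' b', false) = (if (a ≤ b' ∧ b' < b) ∨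
          (b' = b ∧ underPos U x a' b ≤ underPos U x a b) then 1 else 0) ∧
        zo (x a' b', false) = (if (a ≤ b' ∧ b' < b) ∨
          (b' = b ∧ underPos U x a' b < underPos U x a b) then 1 else 0) := by
  have h' := h
  obtain ⟨h1, h2, h3, h4, -⟩ := h'
  obtain ⟨n, rfl⟩ := Int.le.dest h1
  obtain ⟨d, hd⟩ := Int.le.dest (show 0 + (n : ℤ) + 1 ≤ b by omega)
  obtain ⟨e, he⟩ : ∃ e, k = n + (1 + (d + (1 + e))) := ⟨k - n - d - 2, by omega⟩
  rw [zero_add] at *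
  have hov := A.over_mem h
  have hun := A.under_mem h
  obtain ⟨P, P', hP⟩ := List.append_of_mem hov
  obtain ⟨Q, Q', hQ⟩ := List.append_of_mem hun
  obtain ⟨y, hy⟩ : ∃ y, y = x n b := ⟨_, rfl⟩
  rw [← hy] at hP hQ hov hun
  obtain ⟨C, hC⟩ : ∃ C, C = P' ++ U n ++ segment d (fun l => O l ++ U l) (n + 1) ++ O b ++ Q :=
    ⟨_, rfl⟩
  have hw : segment k (fun l => O l ++ U l) 0 = (segment n (fun l => O l ++ U l) 0 ++ P) ++
      (y, true) :: C ++ (y, false) :: (Q' ++ segment e (fun l => O l ++ U l) (b + 1)) := by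
    conv_lhs => rw [he]
    rw [segment_add, segment_add, segment_add, segment_add, hC]
    have e1 : (0 : ℤ) + n = n := zero_add _
    have e2 : (n : ℤ) + (1 : ℕ) = n + 1 := by simp
    have e3 : (n : ℤ) + 1 + d = b := hd
    have e4 : b + ((1 : ℕ) : ℤ) = b + 1 := by simp
    rw [e1, e2, e3, e4]
    have e5 : ∀ i, segment 1 (fun l => O l ++ U l) i = O i ++ U i := fun i => by simp [segment]
    rw [e5, e5, hP, hQ]
    simp
  have hnd := A.good.nodup
  rw [hw] at hnd
  refine ⟨_, _, hw ▸ loop_walk hnd, ?_, ?_, ?_⟩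
  · have hyC : ∀ b', (y, b') ∉ C := by
      simp only [List.append_assoc, List.cons_append, List.nodup_append', List.nodup_cons,
        List.disjoint_cons_right, List.mem_append, List.mem_cons, not_or] at hnd
      intro b'
      cases b' <;> tauto
    intro y'
    by_cases hyy : y' = y
    · subst hyy
      simp [FlowAt, hyC]
    · have e1 : ∀ c c' : Bool, (y', c) ≠ (y, c') := fun c c' e => hyy (congrArg Prod.fst e)
      simp [FlowAt, e1]
  · intro y' hyy c
    rw [← hy] at hyy
    have e1 : ∀ c c' : Bool, (y', c) ≠ (y, c') := fun c c' e => hyy (congrArg Prod.fst e)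
    simp [e1]
  · intro a' b' h'
    have hy' : y ∈ ({x a' b'} : Set Crossing) ↔ a' = n ∧ b' = b := by
      rw [hy, Set.mem_singleton_iff, A.crossing_inj h h']
      constructor <;> rintro ⟨rfl, rfl⟩ <;> exact ⟨rfl, rfl⟩
    rw [Set.mem_singleton_iff] at hy'
    have hto := A.over_mem h'
    have htu := A.under_mem h'
    have hOne : ∀ {l : ℤ}, 0 ≤ l → l < k → ((x a' b', true) ∈ O l ↔ a' = l) := fun h0 hl =>
      ⟨fun hm => A.eq_of_mem_over h'.1 h'.2.1 h0 hl hto hm, fun e => e ▸ hto⟩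
    have hUne : ∀ {l : ℤ}, 0 ≤ l → l < k → ((x a' b', false) ∈ U l ↔ b' = l) := fun h0 hl =>
      ⟨fun hm => A.eq_of_mem_under h'.2.2.1 h'.2.2.2.1 h0 hl htu hm, fun e => e ▸ htu⟩
    have hOf : ∀ l, (x a' b', false) ∉ O l := fun l hm => absurd (A.over_snd l _ hm) (by simp)
    have hUt : ∀ l, (x a' b', true) ∉ U l := fun l hm => absurd (A.under_snd l _ hm) (by simp)
    have hP' : (x a' b', true) ∈ P' ↔ a' = n ∧ overPos O x n b < overPos O x n b' := by
      constructor
      · intro hm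
        obtain rfl : a' = n := (hOne h1 h2).1 (by rw [hP]; simp [hm])
        refine ⟨rfl, ?_⟩
        have h5 := A.over_nodup n
        rw [hP] at h5 hto
        have := (idxOf_lt_iff_mem_right h5 hto).1 hm
        rwa [← hP, hy] at this
      · rintro ⟨rfl, hlt⟩
        have h5 := A.over_nodup n
        have hto2 := hto
        rw [hP] at h5 hto2
        refine (idxOf_lt_iff_mem_right h5 hto2).2 ?_
        rw [← hP, hy]
        exact hlt
    have hP'' : (x a' b', false) ∉ P' := fun hm => hOf n (by rw [hP]; simp [hm])
    have hQ1 : (x a' b', false) ∈ Q ↔ b' = b ∧ underPos U x a' b < underPos U x n b := by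
      constructor
      · intro hm
        obtain rfl : b' = b := (hUne h3 h4).1 (by rw [hQ]; simp [hm])
        refine ⟨rfl, ?_⟩
        have h5 := A.under_nodup b'
        rw [hQ] at h5 htu
        have := (idxOf_lt_iff_mem_left h5 htu).1 hm
        rwa [← hQ, hy] at this
      · rintro ⟨rfl, hlt⟩
        have h5 := A.under_nodup b'
        have htu2 := htu
        rw [hQ] at h5 htu2
        refine (idxOf_lt_iff_mem_left h5 htu2).2 ?_
        rw [← hQ, hy]
        exact hlt
    have hQ2 : (x a' b', true) ∉ Q := fun hm => hUt b (by rw [hQ]; simp [hm])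
    have hSt : (x a' b', true) ∈ segment d (fun l => O l ++ U l) (n + 1) ↔ n < a' ∧ a' < b := by
      rw [mem_segment]
      constructor
      · rintro ⟨l, h5, h6, hm⟩
        rcases List.mem_append.1 hm with hm | hm
        · obtain rfl := (hOne (by omega) (by omega)).1 hm
          exact ⟨by omega, by omega⟩
        · exact absurd hm (hUt l)
      · rintro ⟨h5, h6⟩
        exact ⟨a', by omega, by omega, List.mem_append_left _ hto⟩
    have hSf : (x a' b', false) ∈ segment d (fun l => O l ++ U l) (n + 1) ↔ n < b' ∧ b' < b := by
      rw [mem_segment]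
      constructor
      · rintro ⟨l, h5, h6, hm⟩
        rcases List.mem_append.1 hm with hm | hm
        · exact absurd hm (hOf l)
        · obtain rfl := (hUne (by omega) (by omega)).1 hm
          exact ⟨by omega, by omega⟩
      · rintro ⟨h5, h6⟩
        exact ⟨b', by omega, by omega, List.mem_append_right _ htu⟩
    have hCt : (x a' b', true) ∈ C ↔ (n < a' ∧ a' ≤ b) ∨
        (a' = n ∧ overPos O x n b < overPos O x n b') := by
      rw [hC]
      simp only [List.mem_append, hP', hUt, hSt, hOne h3 h4, hQ2, or_false]
      constructor
      · rintro ((h5 | h5) | h5)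
        exacts [Or.inr h5, Or.inl ⟨h5.1, h5.2.le⟩, Or.inl ⟨by omega, by omega⟩]
      · rintro (h5 | h5)
        · by_cases h6 : a' = b
          exacts [Or.inr h6, Or.inl (Or.inr ⟨h5.1, by omega⟩)]
        · exact Or.inl (Or.inl h5)
    have hCf : (x a' b', false) ∈ C ↔ (n ≤ b' ∧ b' < b) ∨
        (b' = b ∧ underPos U x a' b < underPos U x n b) := by
      rw [hC]
      simp only [List.mem_append, hP'', hUne h1 h2, hSf, hOf, hQ1, or_false, false_or]
      constructor
      · rintro ((h5 | h5) | h5)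
        exacts [Or.inl ⟨by omega, by omega⟩, Or.inl ⟨h5.1.le, h5.2⟩, Or.inr h5]
      · rintro (h5 | h5)
        · by_cases h6 : b' = n
          exacts [Or.inl (Or.inl h6), Or.inl (Or.inr ⟨by omega, h5.2⟩)]
        · exact Or.inr h5
    have hle1 : a' = n → (overPos O x n b ≤ overPos O x n b' ↔
        overPos O x n b < overPos O x n b' ∨ b' = b) := by
      rintro rfl
      rw [le_iff_lt_or_eq]
      refine or_congr Iff.rfl ?_
      have h5 := List.idxOf_inj (A.over_mem h) (y := (x n b', true))
      rw [overPos, overPos, h5, Prod.mk.injEq, ← hy, hy']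
      simp
    have hle2 : b' = b → (underPos U x a' b ≤ underPos U x n b ↔
        underPos U x a' b < underPos U x n b ∨ a' = n) := by
      rintro rfl
      rw [le_iff_lt_or_eq]
      refine or_congr Iff.rfl ?_
      have h5 := List.idxOf_inj (A.under_mem h) (y := (x a' b', false))
      rw [eq_comm, underPos, underPos, h5, Prod.mk.injEq, ← hy, hy']
      simp
    have hE : ∀ c : Bool, (x a' b', c) = (y, c) ↔ a' = n ∧ b' = b := fun c => by
      rw [Prod.mk.injEq, eq_comm (a := x a' b'), hy']
      simp
    refine ⟨?_, ?_, ?_, ?_⟩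
    · simp only [hCt, Prod.mk.injEq, Bool.true_eq_false, and_false, or_false]
    · simp only [hCt, hE]
      congr 1
      rw [eq_iff_iff, or_assoc]
      refine or_congr Iff.rfl ?_
      rw [← and_or_left]
      exact and_congr_right fun h => (hle1 h).symm
    · simp only [hCf, hE]
      congr 1
      rw [eq_iff_iff, or_assoc]
      refine or_congr Iff.rfl ?_
      rw [and_comm (a := a' = n), ← and_or_left]
      exact and_congr_right fun h => (hle2 h).symm
    · simp only [hCf, Prod.mk.injEq, Bool.false_eq_true, and_false, or_false]

end Arcs

/-- In the applications at most two passages of an arc change the label, namely where the arc meets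
a given curve; so a label depends only on which of them have been passed. -/
theorem walk_jumps {Li Lo : Passage → ℚ} {l : List Passage} (hl : l.Nodup) {P₁ P₂ : Passage}
    {d₁ d₂ s t : ℚ} (h : Walk Li Lo s l t)
    (hj : ∀ m ∈ l, Lo m = Li m + (if m = P₁ then d₁ else 0) + (if m = P₂ then d₂ else 0)) :
    (∀ m ∈ l, Li m = s + (if l.idxOf P₁ < l.idxOf m then d₁ else 0) +
      (if l.idxOf P₂ < l.idxOf m then d₂ else 0)) ∧
    t = s + (if P₁ ∈ l then d₁ else 0) + (if P₂ ∈ l then d₂ else 0) := by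
  induction l generalizing s with
  | nil => simpa using Eq.symm h
  | cons a l ih =>
    obtain ⟨h1, h2⟩ := h
    obtain ⟨hal, hnd⟩ := List.nodup_cons.1 hl
    obtain ⟨h3, h4⟩ := ih hnd h2 fun m hm => hj m (List.mem_cons_of_mem _ hm)
    have ha := hj a (by simp)
    have key : ∀ (P : Passage) (m : Passage), m ∈ l →
        ((a :: l).idxOf P < (a :: l).idxOf m ↔ a = P ∨ l.idxOf P < l.idxOf m) := by
      intro P m hm
      have e1 : a ≠ m := by rintro rfl; exact hal hm
      rw [List.idxOf_cons_ne _ e1]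
      by_cases hP : a = P
      · subst hP
        simp
      · rw [List.idxOf_cons_ne _ hP]
        simp [hP]
    have excl : ∀ (P : Passage) (m : Passage), m ∈ l → a = P → ¬ l.idxOf P < l.idxOf m := by
      rintro P m hm rfl
      have h5 := List.idxOf_lt_length_of_mem hm
      have h6 := List.idxOf_eq_length hal
      omega
    have k1 : ∀ (P : Passage) (d : ℚ) (m : Passage), m ∈ l →
        (if (a :: l).idxOf P < (a :: l).idxOf m then d else 0) =
          (if a = P then d else 0) + (if l.idxOf P < l.idxOf m then d else 0) := by
      intro P d m hm
      by_cases hP : a = P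
      · rw [if_pos ((key P m hm).2 (Or.inl hP)), if_pos hP, if_neg (excl P m hm hP), add_zero]
      · rw [if_neg hP, zero_add]
        simp only [key P m hm, hP, false_or]
    have k2 : ∀ (P : Passage) (d : ℚ), (if P ∈ a :: l then d else 0) =
        (if a = P then d else 0) + (if P ∈ l then d else 0) := by
      intro P d
      by_cases hP : a = P
      · subst hP
        simp [hal]
      · simp [hP, Ne.symm hP]
    constructor
    · intro m hm
      rcases List.mem_cons.1 hm with rfl | hm
      · simp [h1]
      · rw [h3 m hm, ha, h1, k1 P₁ d₁ m hm, k1 P₂ d₂ m hm]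
        ring
    · rw [h4, ha, h1, k2, k2]
      ring

/-- If every change of the label leads into `V`, the final label is in `V` whatever the order of the
crossings. With two values in `V` this says that an arc stays inside or outside of a curve. -/
theorem walk_mem {Li Lo : Passage → ℚ} {l : List Passage} {V : Set ℚ} {s t : ℚ}
    (h : Walk Li Lo s l t) (hs : s ∈ V) (hV : ∀ m ∈ l, Lo m = Li m ∨ Lo m ∈ V) : t ∈ V := by
  induction l generalizing s with
  | nil => exact (show s = t from h) ▸ hs
  | cons a l ih =>
    refine ih h.2 ?_ fun m hm => hV m (List.mem_cons_of_mem _ hm)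
    rcases hV a (by simp) with e | e
    · rw [e, h.1]; exact hs
    · exact e

theorem walk_segment {Li Lo : Passage → ℚ} {a : ℤ → List Passage} (n : ℕ) {i : ℤ} {s t : ℚ}
    (h : Walk Li Lo s (segment n a i) t) :
    ∃ S : ℤ → ℚ, S i = s ∧ S (i + n) = t ∧
      ∀ l, i ≤ l → l < i + n → Walk Li Lo (S l) (a l) (S (l + 1)) := by
  induction n generalizing t with
  | zero => exact ⟨fun _ => s, rfl, h, fun l h1 h2 => by simp at h2; omega⟩
  | succ n ih =>
    rw [segment_succ, walk_append] at h
    obtain ⟨r, h1, h2⟩ := h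
    obtain ⟨S, h3, h4, h5⟩ := ih h1
    refine ⟨fun l => if l = i + (n + 1 : ℕ) then t else S l, ?_, if_pos rfl, ?_⟩
    · simp only
      rw [if_neg (by omega), h3]
    · intro l h6 h7
      simp only
      rw [if_neg (by omega)]
      by_cases h8 : l = i + n
      · subst h8
        rw [if_pos (by push_cast; ring), h4]
        exact h2
      · rw [if_neg (by omega)]
        exact h5 l h6 (by omega)

/-- At a crossing through which a flow goes straight. -/
theorem LabelAt.straight {zi zo Li Lo : Passage → ℚ} {y : Crossing} (h : LabelAt zi zo Li Lo y)
    (hz : ∀ c, zi (y, c) = zo (y, c)) :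
    Lo (y, true) = Li (y, true) - sgn y * zi (y, false) ∧
      Lo (y, false) = Li (y, false) + sgn y * zi (y, true) ∧
      (sgn y = 1 → Li (y, true) = Li (y, false) + zi (y, true)) ∧
      (sgn y = -1 → Li (y, true) = Li (y, false) - zi (y, false)) := by
  have h1 := hz true
  have h2 := hz false
  unfold LabelAt at h
  rcases sgn_eq y with ⟨hy, hs⟩ | ⟨hy, hs⟩
  · rw [if_pos hy] at h
    rw [hs]
    refine ⟨by linarith, by linarith, fun _ => by linarith, fun h => by norm_num at h⟩
  · rw [if_neg (by rw [hy]; decide)] at h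
    rw [hs]
    refine ⟨by linarith, by linarith, fun h => by norm_num at h, fun _ => by linarith⟩

namespace Arcs

variable {k : ℕ} {O U : ℤ → List Passage} {x : ℤ → ℤ → Crossing}

theorem exists_labels (A : Arcs k O U x) {zi zo : Passage → ℚ} {s : ℚ}
    (hw : Walk zi zo s (segment k (fun l => O l ++ U l) 0) s) (hf : ∀ y, FlowAt zi zo y) :
    ∃ (Li Lo : Passage → ℚ) (S T : ℤ → ℚ), S k = S 0 ∧
      (∀ l : ℤ, 0 ≤ l → l < k → Walk Li Lo (S l) (O l) (T l) ∧ Walk Li Lo (T l) (U l) (S (l + 1))) ∧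
      ∀ a b, Crosses k a b → LabelAt zi zo Li Lo (x a b) := by
  obtain ⟨Li, Lo, t, h1, h2⟩ := A.good.jordan zi zo s hw fun y _ => hf y
  obtain ⟨S, h3, h4, h5⟩ := walk_segment k h1
  rw [zero_add] at h4 h5
  have h6 : ∀ l : ℤ, ∃ r, 0 ≤ l → l < k → Walk Li Lo (S l) (O l) r ∧ Walk Li Lo r (U l) (S (l + 1)) := by
    intro l
    by_cases hl : 0 ≤ l ∧ l < k
    · obtain ⟨r, h7⟩ := (walk_append _ _ _ _ _ _).1 (h5 l hl.1 hl.2)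
      exact ⟨r, fun _ _ => h7⟩
    · exact ⟨0, fun h h' => absurd ⟨h, h'⟩ hl⟩
  choose T hT using h6
  refine ⟨Li, Lo, S, T, h4.trans h3.symm, hT, fun a b hab => h2 _ ?_⟩
  exact mem_segment.2 ⟨a, hab.1, by have := hab.2.1; omega, List.mem_append_left _ (A.over_mem hab)⟩

/-- The alternatives d = 0 allow for arcs with fewer than two jumps; the corresponding index is then
a dummy. -/
theorem over_label (A : Arcs k O U x) {Li Lo : Passage → ℚ} {l : ℤ} (h0 : 0 ≤ l) (hl : l < k)
    {s t : ℚ} (h : Walk Li Lo s (O l) t) {b₁ b₂ : ℤ} {d₁ d₂ : ℚ} (hd₁ : Crosses k l b₁ ∨ d₁ = 0)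
    (hd₂ : Crosses k l b₂ ∨ d₂ = 0)
    (hj : ∀ b, Crosses k l b → Lo (x l b, true) = Li (x l b, true) + (if b = b₁ then d₁ else 0) +
      (if b = b₂ then d₂ else 0)) :
    (∀ b, Crosses k l b → Li (x l b, true) =
      s + (if overPos O x l b₁ < overPos O x l b then d₁ else 0) +
        (if overPos O x l b₂ < overPos O x l b then d₂ else 0)) ∧ t = s + d₁ + d₂ := by
  have key : ∀ b b' d, (Crosses k l b' ∨ d = (0 : ℚ)) → Crosses k l b →
      (if b = b' then d else 0) = if (x l b, true) = (x l b', true) then d else 0 := by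
    intro b b' d hd hb
    rcases hd with hd | rfl
    · simp only [Prod.mk.injEq, and_true, A.crossing_inj hb hd, true_and]
    · simp
  obtain ⟨h1, h2⟩ := walk_jumps (A.over_nodup l) (P₁ := (x l b₁, true)) (P₂ := (x l b₂, true))
    (d₁ := d₁) (d₂ := d₂) h (by
      intro m hm
      obtain ⟨b, hb, rfl⟩ := (A.mem_over_iff h0 hl m).1 hm
      rw [hj b hb, key b b₁ d₁ hd₁ hb, key b b₂ d₂ hd₂ hb])
  refine ⟨fun b hb => h1 _ (A.over_mem hb), ?_⟩
  have key2 : ∀ b' d, (Crosses k l b' ∨ d = (0 : ℚ)) →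
      (if (x l b', true) ∈ O l then d else 0) = d := by
    intro b' d hd
    rcases hd with hd | rfl
    · exact if_pos (A.over_mem hd)
    · simp
  rw [h2, key2 _ _ hd₁, key2 _ _ hd₂]

theorem under_label (A : Arcs k O U x) {Li Lo : Passage → ℚ} {l : ℤ} (h0 : 0 ≤ l) (hl : l < k)
    {s t : ℚ} (h : Walk Li Lo s (U l) t) {a₁ a₂ : ℤ} {d₁ d₂ : ℚ} (hd₁ : Crosses k a₁ l ∨ d₁ = 0)
    (hd₂ : Crosses k a₂ l ∨ d₂ = 0)
    (hj : ∀ a, Crosses k a l → Lo (x a l, false) = Li (x a l, false) +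
      (if a = a₁ then d₁ else 0) + (if a = a₂ then d₂ else 0)) :
    (∀ a, Crosses k a l → Li (x a l, false) =
      s + (if underPos U x a₁ l < underPos U x a l then d₁ else 0) +
        (if underPos U x a₂ l < underPos U x a l then d₂ else 0)) ∧ t = s + d₁ + d₂ := by
  have key : ∀ b b' d, (Crosses k b' l ∨ d = (0 : ℚ)) → Crosses k b l →
      (if b = b' then d else 0) = if (x b l, false) = (x b' l, false) then d else 0 := by
    intro b b' d hd hb
    rcases hd with hd | rfl
    · simp only [Prod.mk.injEq, and_true, A.crossing_inj hb hd]
    · simp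
  obtain ⟨h1, h2⟩ := walk_jumps (A.under_nodup l) (P₁ := (x a₁ l, false)) (P₂ := (x a₂ l, false))
    (d₁ := d₁) (d₂ := d₂) h (by
      intro m hm
      obtain ⟨b, hb, rfl⟩ := (A.mem_under_iff h0 hl m).1 hm
      rw [hj b hb, key b a₁ d₁ hd₁ hb, key b a₂ d₂ hd₂ hb])
  refine ⟨fun b hb => h1 _ (A.under_mem hb), ?_⟩
  have key2 : ∀ b' d, (Crosses k b' l ∨ d = (0 : ℚ)) →
      (if (x b' l, false) ∈ U l then d else 0) = d := by
    intro b' d hd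
    rcases hd with hd | rfl
    · exact if_pos (A.under_mem hd)
    · simp
  rw [h2, key2 _ _ hd₁, key2 _ _ hd₂]

end Arcs

/-- The change of the label along `O l` at `U 1`. -/
def underTail (U : ℤ → List Passage) (x : ℤ → ℤ → Crossing) (l : ℤ) : ℚ :=
  if 3 ≤ l ∧ underPos U x l 1 < underPos U x 0 1 then sgn (x l 1) else 0

/-- The change of the label along `U l` at `O 0`. -/
def overTail (k : ℕ) (O : ℤ → List Passage) (x : ℤ → ℤ → Crossing) (l : ℤ) : ℚ :=
  if l + 2 ≤ k ∧ overPos O x 0 1 < overPos O x 0 l then sgn (x 0 l) else 0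

/-- The labels of the faces with respect to the loop from the crossing of `O 0` and `U 1` to
itself: `S l` at the beginning of `O l`, and `T l` at the beginning of `U l`. -/
structure ArcLabels (k : ℕ) (O U : ℤ → List Passage) (x : ℤ → ℤ → Crossing) (S T : ℤ → ℚ) :
    Prop where
  start : S 2 = 0
  over_last : S k = 0
  over_mem : ∀ l : ℤ, 2 ≤ l → l ≤ k → S l = 0 ∨ S l = -sgn (x 0 1)
  under_mem : ∀ l : ℤ, 2 ≤ l → l < k → T l = 0 ∨ T l = -sgn (x 0 1)
  over_step : ∀ l : ℤ, 2 ≤ l → l < k → T l = S l - sgn (x l 0) - underTail U x l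
  under_step : ∀ l : ℤ, 2 ≤ l → l < k → S (l + 1) = T l + sgn (x 1 l) + overTail k O x l
  first : ∀ l : ℤ, 2 ≤ l → l + 2 ≤ k → overPos O x 0 1 < overPos O x 0 l →
    underPos U x 0 l < underPos U x 1 l →
    T l + sgn (x 0 l) = 0 ∨ T l + sgn (x 0 l) = -sgn (x 0 1)
  cross : ∀ a b : ℤ, 2 ≤ a → 2 ≤ b → Arcs.Crosses k a b →
    S a - (if overPos O x a 0 < overPos O x a b then sgn (x a 0) else 0) -
        (if overPos O x a 1 < overPos O x a b then underTail U x a else 0) =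
      T b + (if underPos U x 1 b < underPos U x a b then sgn (x 1 b) else 0) +
        (if underPos U x 0 b < underPos U x a b then overTail k O x b else 0)
  cross_over : ∀ l : ℤ, 2 ≤ l → l + 2 ≤ k → overPos O x 0 l < overPos O x 0 1 →
    T l + (if underPos U x 1 l < underPos U x 0 l then sgn (x 1 l) else 0) = 0
  cross_under : ∀ l : ℤ, 3 ≤ l → l < k → underPos U x 0 1 < underPos U x l 1 →
    S l - (if overPos O x l 0 < overPos O x l 1 then sgn (x l 0) else 0) = 0

namespace Arcs

variable {k : ℕ} {O U : ℤ → List Passage} {x : ℤ → ℤ → Crossing}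

/-- The curve from the crossing (0, 1) back to itself consists of parts of O 0, U 0, O 1, U 1 and
meets itself only there. So its left label is constant, and just two values occur next to it: 0
outside, where the knot arrives at O 0 and goes on to O 2, and minus the sign of the crossing
inside. -/
theorem exists_arcLabels (A : Arcs k O U x) : ∃ S T, ArcLabels k O U x S T := by
  have hk := A.three_le
  have h01 : Crosses k 0 1 := ⟨le_rfl, by omega, by omega, by omega, by omega⟩
  obtain ⟨zi, zo, hw, hf, hz, hv⟩ := A.exists_loop_flow (by norm_num) h01
  obtain ⟨Li, Lo, S, T, hS, hST, hl⟩ := A.exists_labels hw hf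
  have hne : ∀ {a b}, Crosses k a b → (a ≠ 0 ∨ b ≠ 1) → x a b ≠ x 0 1 := by
    intro a b hab h e
    rw [A.crossing_inj hab h01] at e
    omega
  -- the labels along the loop
  have str : ∀ {a b}, Crosses k a b → (a ≠ 0 ∨ b ≠ 1) →
      Lo (x a b, true) = Li (x a b, true) - sgn (x a b) * zi (x a b, false) ∧
      Lo (x a b, false) = Li (x a b, false) + sgn (x a b) * zi (x a b, true) ∧
      (sgn (x a b) = 1 → Li (x a b, true) = Li (x a b, false) + zi (x a b, true)) ∧
      (sgn (x a b) = -1 → Li (x a b, true) = Li (x a b, false) - zi (x a b, false)) :=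
    fun hab h => (hl _ _ hab).straight (hz _ (hne hab h))
  have zo0 : ∀ {a b}, Crosses k a b → 2 ≤ a → zi (x a b, true) = 0 := fun hab ha => by
    rw [(hv _ _ hab).1, if_neg (by omega)]
  have zo1 : ∀ {b}, Crosses k 1 b → zi (x 1 b, true) = 1 := fun hab => by
    rw [(hv _ _ hab).1, if_pos (by omega)]
  have zoo : ∀ {b}, Crosses k 0 b → zi (x 0 b, true) =
      if overPos O x 0 1 < overPos O x 0 b then 1 else 0 := fun hab => by
    rw [(hv _ _ hab).1]
    congr 1
    simp
  have zu2 : ∀ {a b}, Crosses k a b → 2 ≤ b → zi (x a b, false) = 0 := fun hab ha => by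
    rw [(hv _ _ hab).2.2.1, if_neg (by omega)]
  have zu0 : ∀ {a}, Crosses k a 0 → zi (x a 0, false) = 1 := fun hab => by
    rw [(hv _ _ hab).2.2.1, if_pos (by omega)]
  have zuu : ∀ {a}, Crosses k a 1 → a ≠ 0 → zi (x a 1, false) =
      if underPos U x a 1 < underPos U x 0 1 then 1 else 0 := fun hab ha => by
    rw [hz _ (hne hab (Or.inl ha)), (hv _ _ hab).2.2.2]
    congr 1
    simp
  obtain ⟨o1, o2⟩ := A.over_label le_rfl (by omega) (hST 0 le_rfl (by omega)).1 (b₁ := 1) (b₂ := 1)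
    (d₁ := Lo (x 0 1, true) - Li (x 0 1, true)) (d₂ := 0) (Or.inl h01) (Or.inr rfl) (by
      intro b hb
      by_cases h : b = 1
      · subst h; simp
      · have h2 : 2 ≤ b := by unfold Crosses at hb; omega
        rw [(str hb (Or.inr h)).1, zu2 hb h2]
        simp [h])
  obtain ⟨u1, u2⟩ := A.under_label le_rfl (by omega) (hST 0 le_rfl (by omega)).2 (a₁ := 0)
    (a₂ := 0) (d₁ := 0) (d₂ := 0) (Or.inr rfl) (Or.inr rfl) (by
      intro a ha
      have h2 : 2 ≤ a := by unfold Crosses at ha; omega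
      rw [(str ha (by omega)).2.1, zo0 ha h2]
      simp)
  obtain ⟨o3, o4⟩ := A.over_label zero_le_one (by omega) (hST 1 (by omega) (by omega)).1 (b₁ := 0)
    (b₂ := 0) (d₁ := 0) (d₂ := 0) (Or.inr rfl) (Or.inr rfl) (by
      intro b hb
      have h2 : 2 ≤ b := by unfold Crosses at hb; omega
      rw [(str hb (by omega)).1, zu2 hb h2]
      simp)
  obtain ⟨u3, u4⟩ := A.under_label zero_le_one (by omega) (hST 1 (by omega) (by omega)).2 (a₁ := 0)
    (a₂ := 0) (d₁ := Lo (x 0 1, false) - Li (x 0 1, false)) (d₂ := 0) (Or.inl h01) (Or.inr rfl) (by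
      intro a ha
      by_cases h : a = 0
      · subst h; simp
      · have h2 : 2 ≤ a := by unfold Crosses at ha; omega
        rw [(str ha (Or.inl h)).2.1, zo0 ha h2]
        simp [h])
  simp only [ite_self, add_zero, zero_add] at o1 o2 u1 u2 o3 o4 u3 u4
  have hvert := hl 0 1 h01
  have hv01 := hv 0 1 h01
  -- The corner of the curve: its left side is the outside if the crossing is positive and the
  -- inside if it is negative, and the knot leaves the curve with the label it came with.
  have hv2 : T 0 = S 0 + (1 - sgn (x 0 1)) / 2 ∧ S 2 = S 0 := by
    have e1 := o1 1 h01
    have e2 := u3 0 h01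
    simp only [lt_irrefl, if_false, add_zero] at e1 e2
    simp only [le_refl, lt_irrefl, and_false, and_true, or_false, or_true, if_true, if_false,
      zero_le_one] at hv01
    obtain ⟨v1, v2, v3, v4⟩ := hv01
    have h2 : (1 : ℤ) + 1 = 2 := rfl
    rw [h2] at u4
    unfold LabelAt at hvert
    rw [v1, v3, v2, v4] at hvert
    rcases sgn_eq (x 0 1) with ⟨hy, hs⟩ | ⟨hy, hs⟩
    · rw [if_pos hy] at hvert
      rw [hs]
      constructor <;> linarith
    · rw [if_neg (by rw [hy]; decide)] at hvert
      rw [hs]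
      constructor <;> linarith
  -- The left label `T 0` and the right label `T 0 - 1` of the curve are the two values, outside and
  -- inside.
  have hV : (T 0 = S 0 ∨ T 0 = S 0 - sgn (x 0 1)) ∧
      (T 0 - 1 = S 0 ∨ T 0 - 1 = S 0 - sgn (x 0 1)) := by
    rw [hv2.1]
    rcases sgn_eq (x 0 1) with ⟨-, hs⟩ | ⟨-, hs⟩ <;> rw [hs]
    · exact ⟨Or.inl (by ring), Or.inr (by ring)⟩
    · exact ⟨Or.inr (by ring), Or.inl (by ring)⟩
  -- the labels off the loop next to the loop
  have hVo : ∀ {l b}, 2 ≤ l → Crosses k l b → zi (x l b, false) = 1 →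
      Li (x l b, false) = T 0 → Lo (x l b, true) = S 0 ∨ Lo (x l b, true) = S 0 - sgn (x 0 1) := by
    intro l b h2 hc hzu hu
    obtain ⟨e1, e2, e3, e4⟩ := str hc (by omega)
    rw [zo0 hc h2] at e3
    rw [hzu] at e1 e4
    rcases sgn_eq (x l b) with ⟨-, hs⟩ | ⟨-, hs⟩
    · have : Lo (x l b, true) = T 0 - 1 := by rw [e1, e3 hs, hs, hu]; ring
      rw [this]; exact hV.2
    · have : Lo (x l b, true) = T 0 := by rw [e1, e4 hs, hs, hu]; ring
      rw [this]; exact hV.1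
  have hVu : ∀ {a l}, 2 ≤ l → Crosses k a l → zi (x a l, true) = 1 →
      Li (x a l, true) = T 0 → Lo (x a l, false) = S 0 ∨ Lo (x a l, false) = S 0 - sgn (x 0 1) := by
    intro a l h2 hc hzo ho
    obtain ⟨e1, e2, e3, e4⟩ := str hc (by omega)
    rw [zu2 hc h2] at e4
    rw [hzo] at e2 e3
    rcases sgn_eq (x a l) with ⟨-, hs⟩ | ⟨-, hs⟩
    · have : Lo (x a l, false) = T 0 := by rw [e2, hs, ← ho, e3 hs]; ring
      rw [this]; exact hV.1
    · have : Lo (x a l, false) = T 0 - 1 := by rw [e2, hs, ← ho, e4 hs]; ring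
      rw [this]; exact hV.2
  have hLo : ∀ {a}, Crosses k a 1 → underPos U x a 1 < underPos U x 0 1 →
      Li (x a 1, false) = T 0 := by
    intro a hc hlt
    rw [u3 a hc, if_neg (by omega), add_zero, o4, u2]
  have hLu : ∀ {b}, Crosses k 0 b → overPos O x 0 1 < overPos O x 0 b →
      Li (x 0 b, true) = T 0 := by
    intro b hc hlt
    rw [o1 b hc, if_pos hlt, o2]
  have hVu' : ∀ {a l}, 2 ≤ l → Crosses k a l → Lo (x a l, false) = Li (x a l, false) ∨
      (Lo (x a l, false) = S 0 ∨ Lo (x a l, false) = S 0 - sgn (x 0 1)) := by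
    intro a l h2 hc
    by_cases ha : 2 ≤ a
    · left
      rw [(str hc (by omega)).2.1, zo0 hc ha, mul_zero, add_zero]
    · have : a = 0 ∨ a = 1 := by unfold Crosses at hc; omega
      rcases this with rfl | rfl
      · by_cases hlt : overPos O x 0 1 < overPos O x 0 l
        · exact Or.inr (hVu h2 hc (by rw [zoo hc, if_pos hlt]) (hLu hc hlt))
        · left
          rw [(str hc (by omega)).2.1, zoo hc, if_neg hlt, mul_zero, add_zero]
      · refine Or.inr (hVu h2 hc (zo1 hc) ?_)
        rw [o3 l hc, u2]
  have ov : ∀ l : ℤ, 2 ≤ l → l < k → (∀ b, Crosses k l b → Li (x l b, true) =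
      S l + (if overPos O x l 0 < overPos O x l b then -sgn (x l 0) else 0) +
        (if overPos O x l 1 < overPos O x l b then -underTail U x l else 0)) ∧
      T l = S l + -sgn (x l 0) + -underTail U x l := by
    intro l h2 hlk
    refine A.over_label (by omega) hlk (hST l (by omega) hlk).1 (Or.inl ?_) ?_ ?_
    · unfold Crosses; omega
    · by_cases h3 : 3 ≤ l
      · left; unfold Crosses; omega
      · right
        rw [underTail, if_neg (by omega), neg_zero]
    · intro b hb
      rw [(str hb (by omega)).1]
      by_cases hb0 : b = 0
      · subst hb0
        rw [zu0 hb, if_pos rfl, if_neg (by norm_num)]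
        ring
      · rw [if_neg hb0]
        by_cases hb1 : b = 1
        · subst hb1
          have h3 : 3 ≤ l := by unfold Crosses at hb; omega
          rw [zuu hb (by omega), if_pos rfl, underTail]
          by_cases hlt : underPos U x l 1 < underPos U x 0 1
          · rw [if_pos hlt, if_pos ⟨h3, hlt⟩]; ring
          · rw [if_neg hlt, if_neg (by omega)]; ring
        · have hb2 : 2 ≤ b := by unfold Crosses at hb; omega
          rw [zu2 hb hb2, if_neg hb1]
          ring
  have un : ∀ l : ℤ, 2 ≤ l → l < k → (∀ a, Crosses k a l → Li (x a l, false) =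
      T l + (if underPos U x 1 l < underPos U x a l then sgn (x 1 l) else 0) +
        (if underPos U x 0 l < underPos U x a l then overTail k O x l else 0)) ∧
      S (l + 1) = T l + sgn (x 1 l) + overTail k O x l := by
    intro l h2 hlk
    refine A.under_label (by omega) hlk (hST l (by omega) hlk).2 (Or.inl ?_) ?_ ?_
    · unfold Crosses; omega
    · by_cases h3 : l + 2 ≤ k
      · left; unfold Crosses; omega
      · right
        rw [overTail, if_neg (by omega)]
    · intro a ha
      rw [(str ha (by omega)).2.1]
      by_cases ha1 : a = 1
      · subst ha1
        rw [zo1 ha, if_pos rfl, if_neg (by norm_num)]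
        ring
      · rw [if_neg ha1]
        by_cases ha0 : a = 0
        · subst ha0
          have h3 : l + 2 ≤ k := by unfold Crosses at ha; omega
          rw [zoo ha, if_pos rfl, overTail]
          by_cases hlt : overPos O x 0 1 < overPos O x 0 l
          · rw [if_pos hlt, if_pos ⟨h3, hlt⟩]; ring
          · rw [if_neg hlt, if_neg (by omega)]; ring
        · have ha2 : 2 ≤ a := by unfold Crosses at ha; omega
          rw [zo0 ha ha2, if_neg ha0]
          ring
  -- Every change of the label happens at the curve and leads to one of its sides, so the two values
  -- are never left.
  have hTV : ∀ l : ℤ, 2 ≤ l → l < k → (S l = S 0 ∨ S l = S 0 - sgn (x 0 1)) →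
      T l = S 0 ∨ T l = S 0 - sgn (x 0 1) := by
    intro l h2 hlk hSl
    refine walk_mem (V := {r | r = S 0 ∨ r = S 0 - sgn (x 0 1)}) (hST l (by omega) hlk).1 hSl ?_
    intro m hm
    obtain ⟨b, hb, rfl⟩ := (A.mem_over_iff (by omega) hlk m).1 hm
    by_cases hb0 : b = 0
    · subst hb0
      exact Or.inr (hVo h2 hb (zu0 hb) (u1 l hb))
    · by_cases hb1 : b = 1
      · subst hb1
        by_cases hlt : underPos U x l 1 < underPos U x 0 1
        · exact Or.inr (hVo h2 hb (by rw [zuu hb (by omega), if_pos hlt]) (hLo hb hlt))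
        · left
          rw [(str hb (by omega)).1, zuu hb (by omega), if_neg hlt, mul_zero, sub_zero]
      · left
        have hb2 : 2 ≤ b := by unfold Crosses at hb; omega
        rw [(str hb (by omega)).1, zu2 hb hb2, mul_zero, sub_zero]
  have hSV : ∀ l : ℤ, 2 ≤ l → l ≤ k → S l = S 0 ∨ S l = S 0 - sgn (x 0 1) := by
    intro l h2
    induction l, h2 using Int.leInduction with
    | base => exact fun _ => Or.inl hv2.2
    | succ l h2 ih =>
      intro hlk
      have h3 := hTV l h2 (by omega) (ih (by omega))
      refine walk_mem (V := {r | r = S 0 ∨ r = S 0 - sgn (x 0 1)})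
        (hST l (by omega) (by omega)).2 h3 ?_
      intro m hm
      obtain ⟨a, ha, rfl⟩ := (A.mem_under_iff (by omega) (by omega) m).1 hm
      exact hVu' h2 ha
  have nrm : ∀ r : ℚ, (r = S 0 ∨ r = S 0 - sgn (x 0 1)) → r - S 0 = 0 ∨ r - S 0 = -sgn (x 0 1) := by
    rintro r (h | h)
    · exact Or.inl (by linarith)
    · exact Or.inr (by linarith)
  have hsame : ∀ {a b}, Crosses k a b → (a ≠ 0 ∨ b ≠ 1) → zi (x a b, true) = 0 →
      zi (x a b, false) = 0 → Li (x a b, true) = Li (x a b, false) := by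
    intro a b hc h h1 h2
    obtain ⟨-, -, e3, e4⟩ := str hc h
    rcases sgn_eq (x a b) with ⟨-, hs⟩ | ⟨-, hs⟩
    · rw [e3 hs, h1, add_zero]
    · rw [e4 hs, h2, sub_zero]
  -- Labels are determined up to a constant; subtracting `S 0` makes the outside zero.
  refine ⟨fun l => S l - S 0, fun l => T l - S 0, ?_, ?_, ?_, ?_, ?_, ?_, ?_, ?_, ?_, ?_⟩
  · rw [hv2.2, sub_self]
  · rw [hS, sub_self]
  · exact fun l h2 hlk => nrm _ (hSV l h2 hlk)
  · exact fun l h2 hlk => nrm _ (hTV l h2 hlk (hSV l h2 hlk.le))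
  · intro l h2 hlk
    rw [(ov l h2 hlk).2]
    ring
  · intro l h2 hlk
    rw [(un l h2 hlk).2]
    ring
  · intro l h2 hlk hlt hlt2
    have hc : Crosses k 0 l := by unfold Crosses; omega
    have e1 := (un l h2 (by omega)).1 0 hc
    rw [if_neg (by omega), if_neg (lt_irrefl _), add_zero, add_zero] at e1
    have e2 := hVu h2 hc (by rw [zoo hc, if_pos hlt]) (hLu hc hlt)
    rw [(str hc (by omega)).2.1, e1, zoo hc, if_pos hlt, mul_one] at e2
    have e3 := nrm _ e2
    rwa [add_sub_right_comm] at e3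
  · intro a b ha hb hc
    have e1 := (ov a ha hc.2.1).1 b hc
    have e2 := (un b hb hc.2.2.2.1).1 a hc
    rw [hsame hc (by omega) (zo0 hc ha) (zu2 hc hb), e2] at e1
    have key : ∀ (p : Prop) [Decidable p] (d : ℚ), (if p then -d else 0) = -(if p then d else 0) := by
      intro p _ d
      split_ifs <;> simp
    rw [key, key] at e1
    linarith
  · intro l h2 hlk hlt
    have hc : Crosses k 0 l := by unfold Crosses; omega
    have e1 := (un l h2 (by omega)).1 0 hc
    rw [if_neg (lt_irrefl (underPos U x 0 l)), add_zero,
      ← hsame hc (by omega) (by rw [zoo hc, if_neg (by omega)]) (zu2 hc h2), o1 l hc,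
      if_neg (by omega), add_zero] at e1
    linarith
  · intro l h3 hlk hlt
    have hc : Crosses k l 1 := by unfold Crosses; omega
    have e1 := (ov l (by omega) hlk).1 1 hc
    have e2 := u3 l hc
    rw [if_pos hlt] at e2
    rw [if_neg (lt_irrefl (overPos O x l 1)), add_zero,
      hsame hc (by omega) (zo0 hc (by omega)) (by rw [zuu hc (by omega), if_neg (by omega)]), e2,
      ← u4] at e1
    have h2 : (1 : ℤ) + 1 = 2 := rfl
    rw [h2, hv2.2] at e1
    split_ifs at e1 ⊢ <;> linarith

end Arcs

namespace Arcs

variable {k : ℕ} {O U : ℤ → List Passage} {x : ℤ → ℤ → Crossing}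

/-- What the labels of the faces with respect to the sum of the loops of the crossings `(0, 1)` and
`(1, n)`, minus the loop of the crossing `(0, n)`, say about the arcs with index `n + 1`. -/
theorem triangle_labels (A : Arcs k O U x) {n : ℤ} (hn : 2 ≤ n) (hnk : n + 3 ≤ k)
    (hp : overPos O x 0 n < overPos O x 0 1) (hq : underPos U x 1 n < underPos U x 0 n)
    (h01 : sgn (x 0 1) = 1) (h1n : sgn (x 1 n) = 1) :
    (underPos U x (n + 1) 1 < underPos U x 0 1 → sgn (x (n + 1) 1) = 1 → sgn (x 0 n) = -1) ∧
    (underPos U x (n + 1) 1 < underPos U x 0 1 → sgn (x (n + 1) 1) = 1 →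
      overPos O x 0 (n + 1) < overPos O x 0 1 → overPos O x 1 (n + 1) < overPos O x 1 n →
      ¬ underPos U x 0 (n + 1) < underPos U x 1 (n + 1)) ∧
    (underPos U x 0 1 < underPos U x (n + 1) 1 → sgn (x 0 n) = -1 →
      overPos O x 0 1 < overPos O x 0 (n + 1) →
      ¬ underPos U x 0 (n + 1) < underPos U x 1 (n + 1)) := by
  have hk := A.three_le
  have c01 : Crosses k 0 1 := by unfold Crosses; omega
  have c0n : Crosses k 0 n := by unfold Crosses; omega
  have c1n : Crosses k 1 n := by unfold Crosses; omega
  have cn1 : Crosses k (n + 1) 1 := by unfold Crosses; omega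
  have c0m : Crosses k 0 (n + 1) := by unfold Crosses; omega
  have c1m : Crosses k 1 (n + 1) := by unfold Crosses; omega
  obtain ⟨zi1, zo1, hw1, hf1, hz1, hv1⟩ := A.exists_loop_flow (by norm_num) c01
  obtain ⟨zi2, zo2, hw2, hf2, hz2, hv2⟩ := A.exists_loop_flow (by omega) c0n
  obtain ⟨zi3, zo3, hw3, hf3, hz3, hv3⟩ := A.exists_loop_flow (by omega) c1n
  -- Most of the three curves cancels. What remains runs from the crossing (1, n) along O 1 and U 1
  -- to (0, 1), back along O 0 to (0, n) and back along U n: a triangle whose corners are the three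
  -- crossings.
  have hw := walk_sub (walk_sub hw1 hw2) (walk_neg hw3)
  rw [sub_zero, neg_zero, sub_zero] at hw
  obtain ⟨zi, hzi⟩ : ∃ zi, zi = fun m => zi1 m - zi2 m - -zi3 m := ⟨_, rfl⟩
  obtain ⟨zo, hzo⟩ : ∃ zo, zo = fun m => zo1 m - zo2 m - -zo3 m := ⟨_, rfl⟩
  rw [← hzi, ← hzo] at hw
  have hf : ∀ y, FlowAt zi zo y := by
    intro y
    have h1 := hf1 y
    have h2 := hf2 y
    have h3 := hf3 y
    simp only [FlowAt, hzi, hzo] at *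
    linarith
  have hinj : ∀ {a b a' b'}, Crosses k a b → Crosses k a' b' → ¬ (a = a' ∧ b = b') → x a b ≠ x a' b' :=
    fun h h' hne e => hne ((A.crossing_inj h h').1 e)
  have hz : ∀ {a b}, Crosses k a b → ¬ (a = 0 ∧ b = 1) → ¬ (a = 0 ∧ b = n) → ¬ (a = 1 ∧ b = n) →
      ∀ c, zi (x a b, c) = zo (x a b, c) := by
    intro a b h g1 g2 g3 c
    simp only [hzi, hzo]
    rw [hz1 _ (hinj h c01 g1), hz2 _ (hinj h c0n g2), hz3 _ (hinj h c1n g3)]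
  have zuv : ∀ {a b}, Crosses k a b → b ≠ 1 → b ≠ n → zi (x a b, false) = 0 := by
    intro a b h g1 g2
    simp only [hzi]
    rw [(hv1 _ _ h).2.2.1, (hv2 _ _ h).2.2.1, (hv3 _ _ h).2.2.1]
    have := h.2.2.1
    rcases lt_or_ge b 1 with h1 | h1
    · rw [if_pos (by omega), if_pos (by omega), if_neg (by omega)]; norm_num
    rcases lt_or_ge b n with h2 | h2
    · rw [if_neg (by omega), if_pos (by omega), if_pos (by omega)]; norm_num
    · rw [if_neg (by omega), if_neg (by omega), if_neg (by omega)]; norm_num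
  have zov : ∀ {a b}, Crosses k a b → 2 ≤ a → zi (x a b, true) = 0 := by
    intro a b h g1
    simp only [hzi]
    rw [(hv1 _ _ h).1, (hv2 _ _ h).1, (hv3 _ _ h).1]
    rw [if_neg (by omega)]
    by_cases h2 : a ≤ n
    · rw [if_pos (by omega), if_pos (by omega)]; norm_num
    · rw [if_neg (by omega), if_neg (by omega)]; norm_num
  obtain ⟨Li, Lo, S, T, hS, hST, hl⟩ := A.exists_labels hw hf
  have str : ∀ {a b}, Crosses k a b → ¬ (a = 0 ∧ b = 1) → ¬ (a = 0 ∧ b = n) → ¬ (a = 1 ∧ b = n) →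
      Lo (x a b, true) = Li (x a b, true) - sgn (x a b) * zi (x a b, false) ∧
      Lo (x a b, false) = Li (x a b, false) + sgn (x a b) * zi (x a b, true) ∧
      (sgn (x a b) = 1 → Li (x a b, true) = Li (x a b, false) + zi (x a b, true)) ∧
      (sgn (x a b) = -1 → Li (x a b, true) = Li (x a b, false) - zi (x a b, false)) :=
    fun h g1 g2 g3 => (hl _ _ h).straight (hz h g1 g2 g3)
  -- the labels along the arcs
  obtain ⟨o1, o2⟩ := A.over_label le_rfl (by omega) (hST 0 le_rfl (by omega)).1 (b₁ := 1) (b₂ := n)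
    (d₁ := Lo (x 0 1, true) - Li (x 0 1, true)) (d₂ := Lo (x 0 n, true) - Li (x 0 n, true))
    (Or.inl c01) (Or.inl c0n) (by
      intro b hb
      by_cases h : b = 1
      · subst h; rw [if_pos rfl, if_neg (by omega)]; ring
      · by_cases h' : b = n
        · subst h'; rw [if_pos rfl, if_neg h]; ring
        · rw [(str hb (by omega) (by omega) (by omega)).1, zuv hb h h', if_neg h, if_neg h']
          ring)
  obtain ⟨-, u2⟩ := A.under_label le_rfl (by omega) (hST 0 le_rfl (by omega)).2 (a₁ := 0)
    (a₂ := 0) (d₁ := 0) (d₂ := 0) (Or.inr rfl) (Or.inr rfl) (by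
      intro a ha
      have h2 : 2 ≤ a := by unfold Crosses at ha; omega
      rw [(str ha (by omega) (by omega) (by omega)).2.1, zov ha h2]
      simp)
  obtain ⟨o3, o4⟩ := A.over_label zero_le_one (by omega) (hST 1 (by omega) (by omega)).1 (b₁ := n)
    (b₂ := n) (d₁ := Lo (x 1 n, true) - Li (x 1 n, true)) (d₂ := 0) (Or.inl c1n) (Or.inr rfl) (by
      intro b hb
      have h2 : 2 ≤ b := by unfold Crosses at hb; omega
      by_cases h' : b = n
      · subst h'; simp
      · rw [(str hb (by omega) (by omega) (by omega)).1, zuv hb (by omega) h', if_neg h']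
        simp)
  obtain ⟨u3, u4⟩ := A.under_label zero_le_one (by omega) (hST 1 (by omega) (by omega)).2 (a₁ := 0)
    (a₂ := 0) (d₁ := Lo (x 0 1, false) - Li (x 0 1, false)) (d₂ := 0) (Or.inl c01) (Or.inr rfl) (by
      intro a ha
      by_cases h : a = 0
      · subst h; simp
      · have h2 : 2 ≤ a := by unfold Crosses at ha; omega
        rw [(str ha (by omega) (by omega) (by omega)).2.1, zov ha h2]
        simp [h])
  obtain ⟨u5, u6⟩ := A.under_label (l := n) (by omega) (by omega) (hST n (by omega) (by omega)).2
    (a₁ := 0) (a₂ := 1) (d₁ := Lo (x 0 n, false) - Li (x 0 n, false))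
    (d₂ := Lo (x 1 n, false) - Li (x 1 n, false)) (Or.inl c0n) (Or.inl c1n) (by
      intro a ha
      by_cases h : a = 0
      · subst h; simp
      · by_cases h' : a = 1
        · subst h'; simp
        · have h2 : 2 ≤ a := by unfold Crosses at ha; omega
          rw [(str ha (by omega) (by omega) (by omega)).2.1, zov ha h2]
          simp [h, h'])
  obtain ⟨o7, o8⟩ := A.over_label (l := n + 1) (by omega) (by omega)
    (hST (n + 1) (by omega) (by omega)).1 (b₁ := 1) (b₂ := 1)
    (d₁ := Lo (x (n + 1) 1, true) - Li (x (n + 1) 1, true)) (d₂ := 0) (Or.inl cn1) (Or.inr rfl) (by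
      intro b hb
      by_cases h : b = 1
      · subst h; simp
      · rw [(str hb (by omega) (by omega) (by omega)).1,
          zuv hb h (by unfold Crosses at hb; omega)]
        simp [h])
  obtain ⟨u7, -⟩ := A.under_label (l := n + 1) (by omega) (by omega)
    (hST (n + 1) (by omega) (by omega)).2
    (a₁ := 0) (a₂ := 1) (d₁ := Lo (x 0 (n + 1), false) - Li (x 0 (n + 1), false))
    (d₂ := Lo (x 1 (n + 1), false) - Li (x 1 (n + 1), false)) (Or.inl c0m) (Or.inl c1m) (by
      intro a ha
      by_cases h : a = 0
      · subst h; simp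
      · by_cases h' : a = 1
        · subst h'; simp
        · have h2 : 2 ≤ a := by unfold Crosses at ha; omega
          rw [(str ha (by omega) (by omega) (by omega)).2.1, zov ha h2]
          simp [h, h'])
  simp only [ite_self, add_zero, zero_add] at o2 u2 o3 o4 u3 u4 o7 o8
  -- the labels at the three corners
  have one {y : Crossing} (h : sgn y = 1) : y.2 = 1 := by
    rcases sgn_eq y with e | e
    · exact e.1
    · rw [e.2] at h; norm_num at h
  have v01 : zi (x 0 1, true) = -1 ∧ zo (x 0 1, true) = 0 ∧ zi (x 0 1, false) = 1 ∧
      zo (x 0 1, false) = 0 := by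
    simp only [hzi, hzo]
    obtain ⟨a1, a2, a3, a4⟩ := hv1 _ _ c01
    obtain ⟨b1, b2, b3, b4⟩ := hv2 _ _ c01
    obtain ⟨d1, d2, d3, d4⟩ := hv3 _ _ c01
    rw [a1, a2, a3, a4, b1, b2, b3, b4, d1, d2, d3, d4]
    refine ⟨?_, ?_, ?_, ?_⟩
    · rw [if_neg (by omega), if_pos (by omega), if_neg (by omega)]; norm_num
    · rw [if_pos (by omega), if_pos (by omega), if_neg (by omega)]; norm_num
    · rw [if_pos (by omega), if_pos (by omega), if_pos (by omega)]; norm_num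
    · rw [if_neg (by omega), if_pos (by omega), if_pos (by omega)]; norm_num
  have v1n : zi (x 1 n, true) = 0 ∧ zo (x 1 n, true) = 1 ∧ zi (x 1 n, false) = 0 ∧
      zo (x 1 n, false) = -1 := by
    simp only [hzi, hzo]
    obtain ⟨a1, a2, a3, a4⟩ := hv1 _ _ c1n
    obtain ⟨b1, b2, b3, b4⟩ := hv2 _ _ c1n
    obtain ⟨d1, d2, d3, d4⟩ := hv3 _ _ c1n
    rw [a1, a2, a3, a4, b1, b2, b3, b4, d1, d2, d3, d4]
    refine ⟨?_, ?_, ?_, ?_⟩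
    · rw [if_pos (by omega), if_pos (by omega), if_neg (by omega)]; norm_num
    · rw [if_pos (by omega), if_pos (by omega), if_pos (by omega)]; norm_num
    · rw [if_neg (by omega), if_pos (by omega), if_pos (by omega)]; norm_num
    · rw [if_neg (by omega), if_pos (by omega), if_neg (by omega)]; norm_num
  have v0n : zi (x 0 n, true) = 0 ∧ zo (x 0 n, true) = -1 ∧ zi (x 0 n, false) = -1 ∧
      zo (x 0 n, false) = 0 := by
    simp only [hzi, hzo]
    obtain ⟨a1, a2, a3, a4⟩ := hv1 _ _ c0n
    obtain ⟨b1, b2, b3, b4⟩ := hv2 _ _ c0n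
    obtain ⟨d1, d2, d3, d4⟩ := hv3 _ _ c0n
    rw [a1, a2, a3, a4, b1, b2, b3, b4, d1, d2, d3, d4]
    refine ⟨?_, ?_, ?_, ?_⟩
    · rw [if_neg (by omega), if_neg (by omega), if_neg (by omega)]; norm_num
    · rw [if_neg (by omega), if_pos (by omega), if_neg (by omega)]; norm_num
    · rw [if_neg (by omega), if_pos (by omega), if_neg (by omega)]; norm_num
    · rw [if_neg (by omega), if_neg (by omega), if_neg (by omega)]; norm_num
  have l01 := hl _ _ c01
  have l1n := hl _ _ c1n
  have l0n := hl _ _ c0n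
  unfold LabelAt at l01 l1n l0n
  rw [if_pos (one h01), v01.1, v01.2.2.2] at l01
  rw [if_pos (one h1n), v1n.1, v1n.2.2.2] at l1n
  rw [v0n.1, v0n.2.1, v0n.2.2.1, v0n.2.2.2] at l0n
  have e1 := o1 1 c01
  rw [if_neg (lt_irrefl _), if_pos hp] at e1
  have e2 := o1 n c0n
  rw [if_neg (by omega), if_neg (lt_irrefl _)] at e2
  have e3 := o3 n c1n
  rw [if_neg (lt_irrefl _)] at e3
  have e4 := u3 0 c01
  rw [if_neg (lt_irrefl _)] at e4
  have e5 := u5 0 c0n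
  rw [if_neg (lt_irrefl _), if_pos hq] at e5
  have e6 := u5 1 c1n
  rw [if_neg (by omega), if_neg (lt_irrefl _)] at e6
  have hT1 : T 1 = S 1 + 1 := by linarith
  -- The label with which O (n + 1) begins differs from that at the beginning of O 1 exactly if the
  -- third corner is negative.
  have hs : S (n + 1) = S 1 + (1 - sgn (x 0 n)) / 2 := by
    rcases sgn_eq (x 0 n) with ⟨hy, hd⟩ | ⟨hy, hd⟩
    · rw [if_pos hy] at l0n
      rw [hd]; linarith
    · rw [if_neg (by rw [hy]; decide)] at l0n
      rw [hd]; linarith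
  have vn1 : zi (x (n + 1) 1, false) =
      if underPos U x (n + 1) 1 < underPos U x 0 1 then 1 else 0 := by
    rw [hz cn1 (by omega) (by omega) (by omega)]
    simp only [hzo]
    rw [(hv1 _ _ cn1).2.2.2, (hv2 _ _ cn1).2.2.2, (hv3 _ _ cn1).2.2.2]
    by_cases h : underPos U x (n + 1) 1 < underPos U x 0 1
    · rw [if_pos h, if_pos (by omega), if_pos (by omega), if_pos (by omega)]; norm_num
    · rw [if_neg h, if_neg (by omega), if_pos (by omega), if_pos (by omega)]; norm_num
  have s1 := str cn1 (by omega) (by omega) (by omega)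
  rw [zov cn1 (by omega), vn1] at s1
  have e7 := o7 1 cn1
  rw [if_neg (lt_irrefl _)] at e7
  have e8 := u3 (n + 1) cn1
  -- O (n + 1) meets U 1 on a side of the triangle. By the sign it arrives there with the left label
  -- `T 1`, which is `S 1 + 1`; this excludes a positive third corner.
  have first : underPos U x (n + 1) 1 < underPos U x 0 1 → sgn (x (n + 1) 1) = 1 →
      sgn (x 0 n) = -1 := by
    intro h g
    rw [if_neg (by omega)] at e8
    have := s1.2.2.1 g
    linarith
  have v0m : zi (x 0 (n + 1), true) =
      (if overPos O x 0 1 < overPos O x 0 (n + 1) then 1 else 0) -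
        if overPos O x 0 n < overPos O x 0 (n + 1) then 1 else 0 := by
    simp only [hzi]
    rw [(hv1 _ _ c0m).1, (hv2 _ _ c0m).1, (hv3 _ _ c0m).1, if_neg (c := _ ∨ (0 : ℤ) = 1 ∧ _) (by omega)]
    simp
  have v1m : zi (x 1 (n + 1), true) =
      if overPos O x 1 n < overPos O x 1 (n + 1) then 1 else 0 := by
    simp only [hzi]
    rw [(hv1 _ _ c1m).1, (hv2 _ _ c1m).1, (hv3 _ _ c1m).1, if_pos (by omega),
      if_pos (by omega)]
    simp
  have s0 := str c0m (by omega) (by omega) (by omega)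
  have s2 := str c1m (by omega) (by omega) (by omega)
  rw [zuv c0m (by omega) (by omega), v0m] at s0
  rw [zuv c1m (by omega) (by omega), v1m] at s2
  have e9 := o1 (n + 1) c0m
  have e10 := u7 0 c0m
  have e11 := o3 (n + 1) c1m
  have e12 := u7 1 c1m
  refine ⟨first, ?_, ?_⟩
  · intro h g g1 g2 g3
    rw [first h g] at hs
    rw [if_pos h, g] at s1
    rw [if_neg (by omega : ¬ overPos O x 0 1 < overPos O x 0 (n + 1))] at s0 e9
    rw [if_neg (by omega : ¬ overPos O x 1 n < overPos O x 1 (n + 1))] at s2 e11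
    rw [if_neg (lt_irrefl _), if_neg (by omega)] at e10
    rw [if_neg (lt_irrefl _), if_pos g3] at e12
    have h2 : Li (x 1 (n + 1), true) = Li (x 1 (n + 1), false) := by
      rcases sgn_eq (x 1 (n + 1)) with ⟨-, hd⟩ | ⟨-, hd⟩
      · rw [s2.2.2.1 hd]; ring
      · rw [s2.2.2.2 hd]; ring
    split_ifs at s0 e9
    · rcases sgn_eq (x 0 (n + 1)) with ⟨-, hd⟩ | ⟨-, hd⟩
      · have := s0.2.2.1 hd
        rcases sgn_eq (x 0 n) with ⟨hy, hd⟩ | ⟨hy, hd⟩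
        · rw [if_pos hy] at l0n
          linarith
        · rw [if_neg (by rw [hy]; decide)] at l0n
          linarith
      · rw [hd] at s0
        linarith [s0.2.1]
    · have h3 : Li (x 0 (n + 1), true) = Li (x 0 (n + 1), false) := by
        rcases sgn_eq (x 0 (n + 1)) with ⟨-, hd⟩ | ⟨-, hd⟩
        · rw [s0.2.2.1 hd]; ring
        · rw [s0.2.2.2 hd]; ring
      rw [if_neg (by have := first h g; intro h; rw [sgn, h] at this; norm_num at this)] at l0n
      linarith
  · intro h g g1 g2
    rw [g] at hs
    rw [if_neg (by omega)] at s1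
    rw [if_pos g1, if_pos (by omega)] at s0 e9
    rw [if_neg (lt_irrefl _), if_neg (by omega)] at e10
    have h3 : Li (x 0 (n + 1), true) = Li (x 0 (n + 1), false) := by
      rcases sgn_eq (x 0 (n + 1)) with ⟨-, hd⟩ | ⟨-, hd⟩
      · rw [s0.2.2.1 hd]; ring
      · rw [s0.2.2.2 hd]; ring
    linarith

end Arcs

/-! ### Rigidity: signs and orders by induction on the distance of the arcs -/

/-- All crossings between arcs that are at most about `r` arcs apart have the signs and the
positions that they have in the standard diagram of a positive torus knot. -/
structure Rigid (k : ℕ) (O U : ℤ → List Passage) (x : ℤ → ℤ → Crossing) (r : ℤ) : Prop where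
  arcs : Arcs k O U x
  le : r + 1 ≤ k
  sgn_next : ∀ i, sgn (x i (i + 1)) = 1
  sgn_prev : ∀ i, sgn (x (i + 2) i) = 1
  sgn_back : ∀ i j : ℤ, i + 2 ≤ j → j + 1 ≤ i + r → sgn (x j i) = 1
  sgn_forth : ∀ i j : ℤ, i + 1 ≤ j → j + 2 ≤ i + r → sgn (x i j) = 1
  over_forth : ∀ i j : ℤ, i + 2 ≤ j → j + 1 ≤ i + r → overPos O x i j < overPos O x i (i + 1)
  under_forth : ∀ i j : ℤ, i + 2 ≤ j → j + 1 ≤ i + r → underPos U x (j - 1) j < underPos U x i j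
  over_back : ∀ i j : ℤ, i + 2 ≤ j → j + 2 ≤ i + r → overPos O x j i < overPos O x j (j + 1)
  under_back : ∀ i j : ℤ, i + 2 ≤ j → j + 2 ≤ i + r → underPos U x (i - 1) i < underPos U x j i

namespace Rigid

variable {k : ℕ} {O U : ℤ → List Passage} {x : ℤ → ℤ → Crossing} {r : ℤ}

theorem shift (h : Rigid k O U x r) (n : ℤ) :
    Rigid k (fun i => O (n + i)) (fun i => U (n + i)) (fun i j => x (n + i) (n + j)) r where
  arcs := h.arcs.shift n
  le := h.le
  sgn_next i := by rw [← add_assoc]; exact h.sgn_next _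
  sgn_prev i := by rw [← add_assoc]; exact h.sgn_prev _
  sgn_back i j h1 h2 := h.sgn_back _ _ (by omega) (by omega)
  sgn_forth i j h1 h2 := h.sgn_forth _ _ (by omega) (by omega)
  over_forth i j h1 h2 := by
    have := h.over_forth (n + i) (n + j) (by omega) (by omega)
    rwa [add_assoc] at this
  under_forth i j h1 h2 := by
    have := h.under_forth (n + i) (n + j) (by omega) (by omega)
    rwa [add_sub_assoc] at this
  over_back i j h1 h2 := by
    have := h.over_back (n + i) (n + j) (by omega) (by omega)
    rwa [add_assoc] at this
  under_back i j h1 h2 := by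
    have := h.under_back (n + i) (n + j) (by omega) (by omega)
    rwa [add_sub_assoc] at this

theorem dual (h : Rigid k O U x r) :
    Rigid k (fun i => ((U (-i)).map flipPassage).reverse)
      (fun i => ((O (-i)).map flipPassage).reverse) (fun i j => x (-j) (-i)) r where
  arcs := h.arcs.dual
  le := h.le
  sgn_next i := by
    have := h.sgn_next (-(i + 1))
    rwa [neg_add, neg_add_cancel_right, ← neg_add] at this
  sgn_prev i := by
    have := h.sgn_prev (-(i + 2))
    rwa [neg_add, neg_add_cancel_right, ← neg_add] at this
  sgn_back i j h1 h2 := h.sgn_back _ _ (by omega) (by omega)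
  sgn_forth i j h1 h2 := h.sgn_forth _ _ (by omega) (by omega)
  over_forth i j h1 h2 := by
    have h3 := h.le
    rw [h.arcs.overPos_dual_lt (by omega) (by omega) (by omega) (by omega)]
    have := h.under_forth (-j) (-i) (by omega) (by omega)
    rwa [show -i - 1 = -(i + 1) by ring] at this
  under_forth i j h1 h2 := by
    have h3 := h.le
    rw [h.arcs.underPos_dual_lt (by omega) (by omega) (by omega) (by omega)]
    have := h.over_forth (-j) (-i) (by omega) (by omega)
    rwa [show -j + 1 = -(j - 1) by ring] at this
  over_back i j h1 h2 := by
    have h3 := h.le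
    rw [← h.arcs.dual.overPos_add_right _ i,
      h.arcs.overPos_dual_lt (by omega) (by omega) (by omega) (by omega)]
    have := h.under_back (-j) (-i) (by omega) (by omega)
    rw [show -j - 1 = -(j + 1) by ring, ← sub_add_cancel (-i) (k : ℤ), h.arcs.underPos_add_left,
      show -i - (k : ℤ) = -(i + k) by ring] at this
    exact this
  under_back i j h1 h2 := by
    have h3 := h.le
    rw [← sub_add_cancel j (k : ℤ), h.arcs.dual.underPos_add_left,
      h.arcs.underPos_dual_lt (by omega) (by omega) (by omega) (by omega)]
    have := h.over_back (-j) (-i) (by omega) (by omega)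
    rw [show -i + 1 = -(i - 1) by ring, ← h.arcs.overPos_add_right _ (-j),
      show -j + (k : ℤ) = -(j - k) by ring] at this
    exact this

variable {S T : ℤ → ℚ}

/-- As far as rigidity is known, each O l enters the curve once, over U 0, and the following U l
leaves it once, under O 1; neither meets the parts of O 0 and U 1 on the curve, by `over_forth` and
`under_back`. -/
theorem labels_forward (h : Rigid k O U x r) (hL : ArcLabels k O U x S T) (l : ℤ) (h2 : 2 ≤ l) :
    (l ≤ r → S l = 0) ∧ (l + 1 ≤ r → T l = -1) := by
  have hr := h.le
  have key : ∀ l : ℤ, 2 ≤ l → l + 1 ≤ r → S l = 0 → T l = -1 := by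
    intro l h2 h3 h4
    rw [hL.over_step l h2 (by omega), h4, h.sgn_back 0 l (by omega) (by omega), underTail, if_neg]
    · norm_num
    · rintro ⟨h5, h6⟩
      have := h.under_back 1 l (by omega) (by omega)
      rw [sub_self] at this
      omega
  have key2 : l ≤ r → S l = 0 := by
    induction l, h2 using Int.leInduction with
    | base => exact fun _ => hL.start
    | succ l h2 ih =>
      intro h3
      rw [hL.under_step l h2 (by omega), key l h2 h3 (ih (by omega)),
        h.sgn_forth 1 l (by omega) (by omega), overTail, if_neg]
      · norm_num
      · rintro ⟨h5, h6⟩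
        have := h.over_forth 0 l (by omega) (by omega)
        rw [zero_add] at this
        omega
  exact ⟨key2, fun h3 => key l h2 h3 (key2 (by omega))⟩

/-- The same computation from the other end, where the knot returns to O 0 from outside. The index k
- n stands for -n, so periodicity brings the crossings into the range of `Rigid`. -/
theorem labels_backward (h : Rigid k O U x r) (hL : ArcLabels k O U x S T) (n : ℕ)
    (h1 : n + 2 ≤ r) : S (k - n) = 0 := by
  have hr := h.le
  induction n with
  | zero => simpa using hL.over_last
  | succ n ih =>
    have e : (k : ℤ) - (n + 1 : ℕ) + 1 = k - n := by push_cast; ring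
    have e' : (k : ℤ) - (n + 1 : ℕ) = -(n + 1) + k := by push_cast; ring
    have h3 := hL.under_step (k - (n + 1 : ℕ)) (by push_cast at *; omega) (by push_cast; omega)
    have h4 := hL.over_step (k - (n + 1 : ℕ)) (by push_cast at *; omega) (by push_cast; omega)
    push_cast at h1
    rw [e, ih (by omega), overTail, if_neg, e', h.arcs.crossing_add_right,
      h.sgn_back (-(n + 1)) 1 (by omega) (by omega)] at h3
    · rw [e', h.arcs.crossing_add_left, h.sgn_forth (-(n + 1)) 0 (by omega) (by omega), underTail,
        if_neg] at h4
      · rw [e']; linarith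
      · rintro ⟨h5, h6⟩
        rw [h.arcs.underPos_add_left] at h6
        have := h.under_forth (-(n + 1)) 1 (by omega) (by omega)
        rw [sub_self] at this
        omega
    · rintro ⟨h5, h6⟩
      rw [e', h.arcs.overPos_add_right] at h6
      have := h.over_back (-(n + 1)) 0 (by omega) (by omega)
      rw [zero_add] at this
      omega

/-- O 0 meets U l before it joins the curve, thus outside, whereas U l begins inside. So U l must
have left under O 1 before. -/
theorem under_lt (h : Rigid k O U x r) {l : ℤ} (h2 : 2 ≤ l) (h3 : l + 1 ≤ r) :
    underPos U x 1 l < underPos U x 0 l := by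
  have hr := h.le
  obtain ⟨S, T, hL⟩ := h.arcs.exists_arcLabels
  have h4 := h.over_forth 0 l (by omega) (by omega)
  rw [zero_add] at h4
  have h5 := hL.cross_over l h2 (by omega) h4
  rw [(h.labels_forward hL l h2).2 h3] at h5
  by_contra h6
  rw [if_neg h6] at h5
  norm_num at h5

/-- Consider the curve of the crossing (c, c + 1). By `hp` the overpass O 0 has entered it over U c
when it meets U r, which begins inside and would be outside after passing under O (c + 1). -/
theorem under_lt_of (h : Rigid k O U x r) {c : ℤ} (h1 : 1 ≤ c) (h2 : c + 2 ≤ r) (hr : r + 2 ≤ k)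
    (hp : overPos O x 0 c < overPos O x 0 r) : underPos U x 0 r < underPos U x (c + 1) r := by
  have g := h.shift c
  obtain ⟨S, T, hL⟩ := g.arcs.exists_arcLabels
  obtain ⟨n, rfl⟩ := Int.eq_ofNat_of_zero_le (by omega : 0 ≤ c)
  have e : ∀ y, x k y = x 0 y := fun y => by
    have := h.arcs.crossing_add_left 0 y
    rwa [zero_add] at this
  have e2 : O k = O 0 := by
    have := h.arcs.over_add 0
    rwa [zero_add] at this
  have h5 := hL.cross (k - n) (r - n) (by omega) (by omega) (by unfold Arcs.Crosses; omega)
  rw [g.labels_backward hL n h2, (g.labels_forward hL (r - n) (by omega)).2 (by omega), underTail,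
    if_neg (c := _ ∧ _), overTail, if_neg (c := _ ∧ _)] at h5
  · simp only [overPos, underPos] at h5 hp ⊢
    simp only [add_sub_cancel, add_zero] at h5
    rw [e, e, e2, if_pos hp, h.sgn_forth 0 n (by omega) (by omega), ite_self, ite_self,
      h.sgn_forth (n + 1) r (by omega) (by omega)] at h5
    have h6 := h.arcs.underPos_inj (i := 0) (i' := n + 1) (j := r) (by omega) (by omega) (by omega)
    simp only [underPos] at h6
    by_contra h7
    rw [if_pos (by omega)] at h5
    norm_num at h5
  · rintro ⟨-, h6⟩
    have := g.over_forth 0 (r - n) (by omega) (by omega)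
    rw [zero_add] at this
    omega
  · rintro ⟨-, h6⟩
    have := g.under_forth (-n) 1 (by omega) (by omega)
    rw [← g.arcs.underPos_add_left (-n), show -(n : ℤ) + k = k - n by ring, sub_self] at this
    omega

/-- O 0 meets the curve of the crossing (c, c + 1) twice, in U c and, by `hq`, in U (c + 1). As
there are only two labels, the two changes cancel. -/
theorem sgn_eq_neg (h : Rigid k O U x r) {c : ℤ} (h1 : 1 ≤ c) (h2 : c + 3 ≤ k)
    (hq : underPos U x 0 (c + 1) < underPos U x c (c + 1)) :
    sgn (x 0 c) = - sgn (x 0 (c + 1)) := by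
  have g := h.shift c
  obtain ⟨S, T, hL⟩ := g.arcs.exists_arcLabels
  have h3 := hL.over_step (k - c) (by omega) (by omega)
  have h4 := hL.over_mem (k - c) (by omega) (by omega)
  have h5 := hL.under_mem (k - c) (by omega) (by omega)
  simp only [underPos, underTail] at h3 hq
  simp only [add_sub_cancel, add_zero] at h3 h4 h5
  have e : ∀ y, x k y = x 0 y := fun y => by
    have := h.arcs.crossing_add_left 0 y
    rwa [zero_add] at this
  rw [e, e, if_pos ⟨by omega, hq⟩] at h3
  rw [h.sgn_next c] at h4 h5
  rcases sgn_eq (x 0 c) with ⟨-, h6⟩ | ⟨-, h6⟩ <;>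
    rcases sgn_eq (x 0 (c + 1)) with ⟨-, h7⟩ | ⟨-, h7⟩ <;>
    rcases h4 with h4 | h4 <;> rcases h5 with h5 | h5 <;> rw [h6, h7] at h3 ⊢ <;> linarith

/-- O 0 meets U (c + 1) where it has left the curve of the crossing (c, c + 1), thus outside; it
begins outside and enters over U c, so U c comes later. -/
theorem over_lt (h : Rigid k O U x r) {c : ℤ} (h1 : 1 ≤ c) (h2 : c + 2 ≤ r) :
    overPos O x 0 (c + 1) < overPos O x 0 c := by
  have hr := h.le
  have g := h.shift c
  obtain ⟨S, T, hL⟩ := g.arcs.exists_arcLabels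
  obtain ⟨n, rfl⟩ := Int.eq_ofNat_of_zero_le (by omega : 0 ≤ c)
  have e : ∀ y, x k y = x 0 y := fun y => by
    have := h.arcs.crossing_add_left 0 y
    rwa [zero_add] at this
  have e2 : O k = O 0 := by
    have := h.arcs.over_add 0
    rwa [zero_add] at this
  have h4 := h.under_forth 0 (n + 1) (by omega) (by omega)
  have h5 := hL.cross_under (k - n) (by omega) (by omega) (by
    simp only [underPos] at h4 ⊢
    simp only [add_sub_cancel, add_zero]
    rw [e]
    rwa [add_sub_cancel_right] at h4)
  rw [g.labels_backward hL n h2] at h5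
  have h6 := h.arcs.overPos_inj (i := 0) (j := n) (j' := n + 1) (by omega) (by omega) (by omega)
  simp only [overPos] at h5 h6 ⊢
  simp only [add_sub_cancel, add_zero] at h5
  rw [e, e, e2, h.sgn_forth 0 n (by omega) (by omega)] at h5
  by_contra h7
  rw [if_pos (by omega)] at h5
  norm_num at h5

end Rigid

namespace Rigid

variable {k : ℕ} {O U : ℤ → List Passage} {x : ℤ → ℤ → Crossing} {r : ℤ}

/-- Consequences of the wrong order of U 1 and U r on O 0, to be refuted in `last`. They come from
the curves of the crossings (1, 2) and (r - 2, r - 1), and then of (r - 1, r). -/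
theorem under_lt_and_sgn_eq_neg (h : Rigid k O U x r) (h3 : 3 ≤ r) (hr : r + 2 ≤ k)
    (hp : overPos O x 0 1 < overPos O x 0 r) :
    underPos U x 0 r < underPos U x 1 r ∧ sgn (x 0 (r - 1)) = -sgn (x 0 r) := by
  have h1 := (h.shift 1).under_lt (l := r - 1) (by omega) (by omega)
  simp only [underPos, add_sub_cancel, add_zero] at h1
  have h2 := h.under_lt_of (c := 1) le_rfl (by omega) hr hp
  have h4 : underPos U x 0 r < underPos U x (r - 1) r := by
    rcases eq_or_lt_of_le h3 with rfl | h3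
    · exact h2
    · have h5 := h.over_forth 0 (r - 2) (by omega) (by omega)
      rw [zero_add] at h5
      have h6 := h.under_lt_of (c := r - 2) (by omega) (by omega) hr (h5.trans hp)
      rwa [show r - 2 + 1 = r - 1 by ring] at h6
  have h5 := h.sgn_eq_neg (c := r - 1) (by omega) (by omega) (by rwa [sub_add_cancel])
  rw [sub_add_cancel] at h5
  simp only [underPos] at h2 ⊢
  exact ⟨h2.trans h1, h5⟩

/-- The triangle with n = r - 1: its hypotheses concern arcs of smaller distance and are supplied by
rigidity up to `r`. -/
theorem triangle (h : Rigid k O U x r) (h3 : 3 ≤ r) (hr : r + 2 ≤ k) :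
    (underPos U x r 1 < underPos U x 0 1 → sgn (x 0 (r - 1)) = -1) ∧
    (underPos U x r 1 < underPos U x 0 1 → overPos O x 0 r < overPos O x 0 1 →
      ¬ underPos U x 0 r < underPos U x 1 r) ∧
    (underPos U x 0 1 < underPos U x r 1 → sgn (x 0 (r - 1)) = -1 →
      overPos O x 0 1 < overPos O x 0 r → ¬ underPos U x 0 r < underPos U x 1 r) := by
  have h4 := h.over_forth 0 (r - 1) (by omega) (by omega)
  have h5 := h.sgn_next 0
  rw [zero_add] at h4 h5
  obtain ⟨t1, t2, t3⟩ := h.arcs.triangle_labels (n := r - 1) (by omega) (by omega) h4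
    (h.under_lt (by omega) (by omega)) h5 (h.sgn_forth 1 (r - 1) (by omega) (by omega))
  rw [sub_add_cancel] at t1 t2 t3
  have h6 := h.sgn_back 1 r (by omega) (by omega)
  have h7 := (h.shift 1).over_lt (c := r - 2) (by omega) (by omega)
  simp only [overPos, show 1 + (r - 2 + 1) = r by ring, show 1 + (r - 2) = r - 1 by ring,
    add_zero] at h7
  exact ⟨fun g => t1 g h6, fun g g1 => t2 g h6 g1 h7, t3⟩

/-- Otherwise O r would meet the curve of (0, 1) both in U 0 and in U 1 and end outside of it. Then
either order of U 1 and U r on O 0 is impossible, one by the labels and the other by the triangle.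
-/
theorem under_lt_last (h : Rigid k O U x r) (h3 : 3 ≤ r) (hr : r + 2 ≤ k) :
    underPos U x 0 1 < underPos U x r 1 := by
  by_contra hlt
  have hne := h.arcs.underPos_inj (i := r - k) (i' := 0) (j := 1) (by omega) (by omega) (by omega)
  rw [← h.arcs.underPos_add_left, sub_add_cancel] at hne
  replace hlt : underPos U x r 1 < underPos U x 0 1 := by omega
  obtain ⟨t1, t2, -⟩ := h.triangle h3 hr
  obtain ⟨S, T, hL⟩ := h.arcs.exists_arcLabels
  have e01 := h.sgn_next 0
  rw [zero_add] at e01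
  have hS := (h.labels_forward hL r (by omega)).1 le_rfl
  have hT := hL.over_step r (by omega) (by omega)
  have hTm := hL.under_mem r (by omega) (by omega)
  rw [e01] at hTm
  rw [hS, underTail, if_pos ⟨h3, hlt⟩, h.sgn_back 1 r (by omega) (by omega)] at hT
  have hT0 : T r = 0 := by
    rcases sgn_eq (x r 0) with ⟨-, e⟩ | ⟨-, e⟩ <;> rw [e] at hT
    · rcases hTm with h | h <;> linarith
    · linarith
  by_cases hp : overPos O x 0 1 < overPos O x 0 r
  · obtain ⟨h4, h5⟩ := h.under_lt_and_sgn_eq_neg h3 hr hp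
    have h6 := hL.first r (by omega) hr hp h4
    rw [t1 hlt] at h5
    rw [hT0, e01] at h6
    rcases h6 with h6 | h6 <;> linarith
  · have hS1 := hL.under_step r (by omega) (by omega)
    rw [hT0, overTail, if_neg (by omega)] at hS1
    have hSm := hL.over_mem (r + 1) (by omega) (by omega)
    have hne := h.arcs.overPos_inj (i := 0) (j := 1) (j' := r) (by omega) (by omega) (by omega)
    have h4 := hL.cross_over r (by omega) hr (by omega)
    have hne2 := h.arcs.underPos_inj (i := 0) (i' := 1) (j := r) (by omega) (by omega) (by omega)
    refine t2 hlt (by omega) ?_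
    by_contra h5
    rw [if_pos (by omega), hT0] at h4
    rcases sgn_eq (x 1 r) with ⟨-, e⟩ | ⟨-, e⟩ <;> rw [e] at h4 <;> norm_num at h4

/-- By `under_lt_last` the overpass O r meets the curve of (0, 1) only in U 0, so it enters there,
which gives the first sign. The triangle excludes the wrong order on O 0, and then U r meets the
curve only under O 1 and has to leave there, which gives the other sign. -/
theorem last (h : Rigid k O U x r) (h3 : 3 ≤ r) (hr : r + 2 ≤ k) :
    sgn (x r 0) = 1 ∧ overPos O x 0 r < overPos O x 0 1 ∧ sgn (x 1 r) = 1 := by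
  have hlt := h.under_lt_last h3 hr
  obtain ⟨-, -, t3⟩ := h.triangle h3 hr
  obtain ⟨S, T, hL⟩ := h.arcs.exists_arcLabels
  have e01 := h.sgn_next 0
  rw [zero_add] at e01
  have hS := (h.labels_forward hL r (by omega)).1 le_rfl
  have hT := hL.over_step r (by omega) (by omega)
  have hTm := hL.under_mem r (by omega) (by omega)
  rw [e01] at hTm
  rw [hS, underTail, if_neg (by omega)] at hT
  have h1 : sgn (x r 0) = 1 := by
    rcases sgn_eq (x r 0) with ⟨-, e⟩ | ⟨-, e⟩ <;> rw [e] at hT ⊢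
    rcases hTm with h | h <;> linarith
  rw [h1] at hT
  have hp : overPos O x 0 r < overPos O x 0 1 := by
    have hne := h.arcs.overPos_inj (i := 0) (j := 1) (j' := r) (by omega) (by omega) (by omega)
    by_contra hp
    replace hp : overPos O x 0 1 < overPos O x 0 r := by omega
    obtain ⟨h4, h5⟩ := h.under_lt_and_sgn_eq_neg h3 hr hp
    have h6 := hL.first r (by omega) hr hp h4
    rw [e01, hT] at h6
    refine t3 hlt ?_ hp h4
    rcases sgn_eq (x 0 r) with ⟨-, e⟩ | ⟨-, e⟩ <;> rw [e] at h5 h6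
    · exact h5
    · rcases h6 with h | h <;> linarith
  refine ⟨h1, hp, ?_⟩
  have hS1 := hL.under_step r (by omega) (by omega)
  have hSm := hL.over_mem (r + 1) (by omega) (by omega)
  rw [hT, overTail, if_neg (by omega)] at hS1
  rw [e01] at hSm
  rcases sgn_eq (x 1 r) with ⟨-, e⟩ | ⟨-, e⟩ <;> rw [e] at hS1 ⊢
  rcases hSm with h | h <;> linarith

theorem succ (h : Rigid k O U x r) (h3 : 3 ≤ r) (hr : r + 2 ≤ k) : Rigid k O U x (r + 1) where
  arcs := h.arcs
  le := by omega
  sgn_next := h.sgn_next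
  sgn_prev := h.sgn_prev
  sgn_back i j h1 h2 := by
    rcases lt_or_eq_of_le h2 with h2 | h2
    · exact h.sgn_back i j h1 (by omega)
    · obtain rfl : j = i + r := by omega
      have := ((h.shift i).last h3 hr).1
      rwa [add_zero] at this
  sgn_forth i j h1 h2 := by
    rcases lt_or_eq_of_le h2 with h2 | h2
    · exact h.sgn_forth i j h1 (by omega)
    · obtain rfl : j = i - 1 + r := by omega
      have := ((h.shift (i - 1)).last h3 hr).2.2
      rwa [sub_add_cancel] at this
  over_forth i j h1 h2 := by
    rcases lt_or_eq_of_le h2 with h2 | h2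
    · exact h.over_forth i j h1 (by omega)
    · obtain rfl : j = i + r := by omega
      have := ((h.shift i).last h3 hr).2.1
      simp only [overPos, add_zero] at this ⊢
      exact this
  under_forth i j h1 h2 := by
    rcases lt_or_eq_of_le h2 with h2 | h2
    · exact h.under_forth i j h1 (by omega)
    · obtain rfl : i = j - r := by omega
      have := ((h.shift j).dual.last h3 hr).2.1
      rw [(h.shift j).arcs.overPos_dual_lt (by omega) (by omega) (by omega) (by omega)] at this
      simp only [underPos, neg_zero, add_zero, ← sub_eq_add_neg] at this ⊢
      exact this
  over_back i j h1 h2 := by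
    rcases lt_or_eq_of_le h2 with h2 | h2
    · exact h.over_back i j h1 (by omega)
    · obtain rfl : i = j + 1 - r := by omega
      have := (h.shift (j + 1)).dual.under_lt_last h3 hr
      -- The index `r` is replaced by r - k, to bring both crossings into the range in which
      -- positions on the dual arcs can be compared.
      rw [← sub_add_cancel r (k : ℤ), (h.shift (j + 1)).arcs.dual.underPos_add_left,
        (h.shift (j + 1)).arcs.underPos_dual_lt (by omega) (by omega) (by omega) (by omega),
        show -(r - (k : ℤ)) = -r + k by ring, (h.shift (j + 1)).arcs.overPos_add_right] at this
      simp only [overPos, neg_zero, add_zero, ← sub_eq_add_neg, add_sub_cancel_right] at this ⊢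
      exact this
  under_back i j h1 h2 := by
    rcases lt_or_eq_of_le h2 with h2 | h2
    · exact h.under_back i j h1 (by omega)
    · obtain rfl : j = i - 1 + r := by omega
      have := (h.shift (i - 1)).under_lt_last h3 hr
      simp only [underPos, add_zero, sub_add_cancel] at this ⊢
      exact this

/-- The start of the induction, without a triangle. If U 2 came after U 1 on O 0, it would meet the
curve of (0, 1) in O 1 and O 0, which makes (0, 2) negative and puts O 1 first on U 2. With respect
to the curve of (1, 2) the overpass O 0 would then begin with the label 1, which is not among 0 and
-1. -/
theorem over_lt_next (h : Rigid k O U x 2) (hk : 4 ≤ k) :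
    overPos O x 0 2 < overPos O x 0 1 := by
  obtain ⟨S, T, hL⟩ := h.arcs.exists_arcLabels
  have e01 := h.sgn_next 0
  have e20 := h.sgn_prev 0
  have e12 := h.sgn_next 1
  rw [zero_add] at e01 e20
  rw [one_add_one_eq_two] at e12
  have hT := hL.over_step 2 le_rfl (by omega)
  rw [hL.start, e20, underTail, if_neg (by omega)] at hT
  have hS1 := hL.under_step 2 le_rfl (by omega)
  have hSm := hL.over_mem 3 (by omega) (by omega)
  have hne := h.arcs.overPos_inj (i := 0) (j := 1) (j' := 2) (by omega) (by omega) (by omega)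
  have hne2 := h.arcs.underPos_inj (i := 0) (i' := 1) (j := 2) (by omega) (by omega) (by omega)
  by_contra hp
  rw [hT, e12, overTail, if_pos ⟨by omega, by omega⟩] at hS1
  rw [e01] at hSm
  have h02 : sgn (x 0 2) = -1 := by
    rcases sgn_eq (x 0 2) with ⟨-, e⟩ | ⟨-, e⟩ <;> rw [e] at hS1 ⊢
    have h3 : (2 : ℤ) + 1 = 3 := rfl
    rw [h3] at hS1
    rcases hSm with h | h <;> linarith
  have hq : underPos U x 1 2 < underPos U x 0 2 := by
    by_contra hq
    have := hL.first 2 le_rfl (by omega) (by omega) (by omega)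
    rw [hT, h02, e01] at this
    norm_num at this
  have g := h.shift 1
  obtain ⟨S', T', hL'⟩ := g.arcs.exists_arcLabels
  have e : ∀ y, x k y = x 0 y := fun y => by
    have := h.arcs.crossing_add_left 0 y
    rwa [zero_add] at this
  have e2 : O k = O 0 := by
    have := h.arcs.over_add 0
    rwa [zero_add] at this
  have h5 := hL'.cross_under (k - 1) (by omega) (by omega) (by
    simp only [underPos, add_sub_cancel, add_zero, one_add_one_eq_two] at hq ⊢
    rwa [e])
  have h6 := hL'.over_mem (k - 1) (by omega) (by omega)
  simp only [overPos, add_sub_cancel, add_zero, one_add_one_eq_two] at h5 h6 hp hne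
  rw [e, e, e2, if_pos (by omega), e01] at h5
  rw [e12] at h6
  rcases h6 with h | h <;> rw [h] at h5 <;> norm_num at h5

theorem three (h : Rigid k O U x 2) (hk : 4 ≤ k) : Rigid k O U x 3 where
  arcs := h.arcs
  le := by omega
  sgn_next := h.sgn_next
  sgn_prev := h.sgn_prev
  sgn_back i j h1 h2 := by
    obtain rfl : j = i + 2 := by omega
    exact h.sgn_prev i
  sgn_forth i j h1 h2 := by
    obtain rfl : j = i + 1 := by omega
    exact h.sgn_next i
  over_forth i j h1 h2 := by
    obtain rfl : j = i + 2 := by omega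
    have := (h.shift i).over_lt_next hk
    simp only [overPos, add_zero] at this ⊢
    exact this
  under_forth i j h1 h2 := by
    obtain rfl : i = j - 2 := by omega
    have := (h.shift j).dual.over_lt_next hk
    rw [(h.shift j).arcs.overPos_dual_lt (by omega) (by omega) (by omega) (by omega)] at this
    simp only [underPos, neg_zero, add_zero, ← sub_eq_add_neg] at this ⊢
    exact this
  over_back i j h1 h2 := by omega
  under_back i j h1 h2 := by omega

theorem top (h : Rigid k O U x 2) : Rigid k O U x (k - 1) := by
  have h3 := h.arcs.three_le
  rcases eq_or_lt_of_le h3 with rfl | hk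
  · exact h
  · have key : ∀ r : ℤ, 3 ≤ r → r + 1 ≤ k → Rigid k O U x r := by
      intro r hr
      induction r, hr using Int.leInduction with
      | base => exact fun _ => h.three hk
      | succ r hr ih => exact fun hrk => (ih (by omega)).succ hr (by omega)
    exact key _ (by omega) (by omega)

/-- The order of the crossings on the arcs. -/
theorem over_succ_lt (h : Rigid k O U x (k - 1)) {i j : ℤ} (h1 : i + 1 ≤ j)
    (h2 : j + 1 ≤ i + k - 2) : overPos O x i (j + 1) < overPos O x i j := by
  have := (h.shift i).over_lt (c := j - i) (by omega) (by omega)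
  simp only [overPos, add_zero, show i + (j - i + 1) = j + 1 by ring, add_sub_cancel] at this ⊢
  exact this

theorem under_succ_lt (h : Rigid k O U x (k - 1)) {i j : ℤ} (h1 : i + 2 ≤ j)
    (h2 : j ≤ i + k - 2) : underPos U x (i + 1) j < underPos U x i j := by
  have := (h.shift i).under_lt (l := j - i) (by omega) (by omega)
  simp only [underPos, add_zero, add_sub_cancel] at this ⊢
  exact this

theorem sgn_eq_one (h : Rigid k O U x (k - 1)) {i j : ℤ} (h1 : i + 1 ≤ j)
    (h2 : j ≤ i + k - 2) : sgn (x i j) = 1 := by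
  rcases lt_or_eq_of_le h2 with h2 | rfl
  · exact h.sgn_forth i j h1 (by omega)
  · have := h.sgn_prev (i - 2)
    rw [sub_add_cancel, ← h.arcs.crossing_add_right] at this
    rwa [show i + (k : ℤ) - 2 = i - 2 + k by ring]

end Rigid

/-! ### The code of the standard torus diagram -/

theorem traverseBraid_append (β γ : List (ℕ × ℤˣ)) (n j : ℕ) :
    traverseBraid (β ++ γ) n j =
      ((traverseBraid β n j).1 ++ (traverseBraid γ (n + β.length) (traverseBraid β n j).2).1,
        (traverseBraid γ (n + β.length) (traverseBraid β n j).2).2) := by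
  induction β generalizing n j with
  | nil => simp [traverseBraid]
  | cons a β ih =>
    obtain ⟨i, ε⟩ := a
    have e : n + (β.length + 1) = n + 1 + β.length := by ring
    simp only [List.cons_append, traverseBraid, List.length_cons, e]
    split_ifs <;> simp [ih]

/-- The strand that starts to the left of all crossings goes on straight. -/
theorem traverseBraid_range'_of_lt (ε : ℤˣ) (m : ℕ) {i j : ℕ} (n : ℕ) (h : j < i) :
    traverseBraid ((List.range' i m).map fun i => (i, ε)) n j = ([], j) := by
  induction m generalizing i n with
  | zero => rfl
  | succ m ih =>
    rw [List.range'_succ, List.map_cons, traverseBraid, if_neg (by omega), if_neg (by omega),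
      ih _ (by omega)]

theorem traverseBraid_range'_self (ε : ℤˣ) (m i n : ℕ) :
    traverseBraid ((List.range' i m).map fun i => (i, ε)) n i =
      ((List.range m).map fun t => ((n + t, ε), decide (ε = 1)), i + m) := by
  induction m generalizing i n with
  | zero => rfl
  | succ m ih =>
    rw [List.range'_succ, List.map_cons, traverseBraid, if_pos rfl, ih, List.range_succ_eq_map]
    simp only [List.map_cons, List.map_map, add_zero, Function.comp_def, Nat.succ_eq_add_one,
      Prod.mk.injEq, List.cons.injEq, true_and]
    exact ⟨List.map_congr_left fun t _ => by rw [add_right_comm, add_assoc], by ring⟩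

theorem traverseBraid_range'_of_gt (ε : ℤˣ) {m d : ℕ} (i n : ℕ) (h : d < m) :
    traverseBraid ((List.range' i m).map fun i => (i, ε)) n (i + d + 1) =
      ([((n + d, ε), decide (ε = -1))], i + d) := by
  induction d generalizing i n m with
  | zero =>
    obtain ⟨m, rfl⟩ := Nat.exists_eq_succ_of_ne_zero h.ne'
    rw [List.range'_succ, List.map_cons, traverseBraid, if_neg (by omega), if_pos (by omega),
      traverseBraid_range'_of_lt _ _ _ (by omega)]
    rfl
  | succ d ih =>
    obtain ⟨m, rfl⟩ := Nat.exists_eq_succ_of_ne_zero (show m ≠ 0 by omega)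
    rw [List.range'_succ, List.map_cons, traverseBraid, if_neg (by omega), if_neg (by omega)]
    have := ih (m := m) (i + 1) (n + 1) (by omega)
    rw [show i + 1 + d + 1 = i + (d + 1) + 1 by ring] at this
    rw [this, show i + 1 + d = i + (d + 1) by ring, show n + 1 + d = n + (d + 1) by ring]

/-- The position of the knot after it has run through `τ` factors of a standard torus braid on
`m + 1` strands. -/
def torusPosition (m τ : ℕ) : ℕ := if τ % (m + 1) = 0 then 0 else m + 1 - τ % (m + 1)

/-- The passages in the factor with number `f`, after `τ` factors. -/
def torusStep (m : ℕ) (ε : ℤˣ) (f τ : ℕ) : List Passage :=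
  if τ % (m + 1) = 0 then (List.range m).map fun t => ((f * m + t, ε), decide (ε = 1))
  else [((f * m + (m - τ % (m + 1)), ε), decide (ε = -1))]

/-- One factor σ₁ ⋯ σ_m carries the leftmost strand across all others to the position m and moves
each other strand one place to the left. So the position along the knot has period m + 1. -/
theorem traverseBraid_factor (m : ℕ) (ε : ℤˣ) (f τ : ℕ) :
    traverseBraid ((List.range m).map fun i => (i, ε)) (f * m) (torusPosition m τ) =
      (torusStep m ε f τ, torusPosition m (τ + 1)) := by
  have h1 : (τ + 1) % (m + 1) = if τ % (m + 1) = m then 0 else τ % (m + 1) + 1 := by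
    rw [Nat.add_mod_eq_ite]
    have : τ % (m + 1) < m + 1 := Nat.mod_lt _ (Nat.succ_pos m)
    rcases Nat.eq_zero_or_pos m with rfl | hm
    · simp [Nat.mod_one]
    · rw [Nat.mod_eq_of_lt (show 1 < m + 1 by omega)]
      split_ifs <;> omega
  have h2 : τ % (m + 1) < m + 1 := Nat.mod_lt _ (Nat.succ_pos m)
  rw [List.range_eq_range']
  by_cases h : τ % (m + 1) = 0
  · rw [torusPosition, if_pos h, torusStep, if_pos h, traverseBraid_range'_self, torusPosition, h1, h]
    congr 1
    split_ifs at * <;> omega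
  · have e : m + 1 - τ % (m + 1) = 0 + (m - τ % (m + 1)) + 1 := by omega
    rw [torusPosition, if_neg h, torusStep, if_neg h, e, traverseBraid_range'_of_gt _ _ _ (by omega),
      torusPosition, h1]
    congr 1
    split_ifs at * <;> omega

theorem traverseBraid_replicate (m : ℕ) (ε : ℤˣ) (q f τ : ℕ) :
    traverseBraid (List.replicate q ((List.range m).map fun i => (i, ε))).flatten (f * m)
        (torusPosition m τ) =
      ((List.range q).flatMap fun s => torusStep m ε (f + s) (τ + s), torusPosition m (τ + q)) := by
  induction q generalizing f τ with
  | zero => rfl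
  | succ q ih =>
    have e : f * m + m = (f + 1) * m := by ring
    rw [List.replicate_succ, List.flatten_cons, traverseBraid_append, traverseBraid_factor]
    simp only [List.length_map, List.length_range]
    rw [e, ih, List.range_succ_eq_map]
    simp only [List.flatMap_cons, List.flatMap_map, add_zero, Nat.succ_eq_add_one, add_assoc,
      add_comm 1]

theorem flatMap_range_mul {α : Type*} (m n : ℕ) (f : ℕ → List α) :
    (List.range (m * n)).flatMap f =
      (List.range m).flatMap fun c => (List.range n).flatMap fun s => f (c * n + s) := by
  induction m with
  | zero => simp
  | succ m ih =>
    rw [Nat.succ_mul, List.range_add, List.range_succ]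
    simp [ih, List.flatMap_map]

theorem traverseClosedBraid_replicate (m : ℕ) (ε : ℤˣ) (q c τ : ℕ) :
    traverseClosedBraid (List.replicate q ((List.range m).map fun i => (i, ε))).flatten c
        (torusPosition m τ) =
      (List.range c).flatMap fun l => (List.range q).flatMap fun s =>
        torusStep m ε s (τ + (l * q + s)) := by
  induction c generalizing τ with
  | zero => rfl
  | succ c ih =>
    have := traverseBraid_replicate m ε q 0 τ
    rw [zero_mul] at this
    rw [traverseClosedBraid, this]
    simp only
    rw [ih, List.range_succ_eq_map]
    simp only [List.flatMap_cons, List.flatMap_map, zero_mul, zero_add, Nat.succ_eq_add_one]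
    congr 1
    refine List.flatMap_congr fun l _ => List.flatMap_congr fun s _ => ?_
    congr 1
    ring

/-- The arcs with index `a` of a diagram in which all arcs run across each other as in the
standard diagram of a torus knot. -/
def twist (m : ℕ) (b : Bool) (y : ℤ → ℕ → Crossing) (a : ℤ) : List Passage :=
  ((List.range m).map fun t => (y a t, b)) ++
    (List.range m).map fun t : ℕ => (y (a - 1 - t) (m - 1 - t), !b)

/-- The knot makes (m + 1)(m + 2) steps, one factor each. Regrouped into m + 2 blocks of m + 1
steps, a block consists of one step across a whole factor and m steps through single crossings of
the other kind, which are an overpass and an underpass or conversely. -/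
theorem traverseClosedBraid_torus (m : ℕ) (ε : ℤˣ) :
    traverseClosedBraid (List.replicate (m + 2) ((List.range m).map fun i => (i, ε))).flatten
        (m + 1) 0 =
      segment (m + 2) (twist m (decide (ε = 1))
        fun a t => (((-a) % ((m + 2 : ℕ) : ℤ)).toNat * m + t, ε)) 0 := by
  have h0 : torusPosition m 0 = 0 := by simp [torusPosition]
  have h := traverseClosedBraid_replicate m ε (m + 2) (m + 1) 0
  rw [h0] at h
  rw [h]
  have h1 : ∀ l ∈ List.range (m + 1), ((List.range (m + 2)).flatMap fun s =>
      torusStep m ε s (0 + (l * (m + 2) + s))) = (List.range (m + 2)).flatMap fun s =>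
      (fun τ => torusStep m ε (τ % (m + 2)) τ) (l * (m + 2) + s) := by
    intro l _
    refine List.flatMap_congr fun s hs => ?_
    have := List.mem_range.1 hs
    simp only [zero_add]
    rw [Nat.mul_add_mod_of_lt this]
  rw [List.flatMap_congr h1,
    ← flatMap_range_mul (m + 1) (m + 2) (fun τ => torusStep m ε (τ % (m + 2)) τ), mul_comm,
    flatMap_range_mul, segment]
  refine List.flatMap_congr fun a _ => ?_
  have hε : decide (ε = -1) = !decide (ε = 1) := by
    rcases Int.units_eq_one_or ε with rfl | rfl <;> decide
  -- Since m + 1 ≡ -1 modulo m + 2, the block with number a begins in the factor -a.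
  have hmod : ∀ t : ℕ, (a * (m + 1) + t) % (m + 2) = ((t - (a : ℤ)) % ((m + 2 : ℕ) : ℤ)).toNat := by
    intro t
    zify
    rw [Int.toNat_of_nonneg (Int.emod_nonneg _ (by omega))]
    refine (Int.modEq_iff_dvd.2 ⟨-a, ?_⟩ : _ ≡ _ [ZMOD _])
    ring
  rw [List.range_succ_eq_map, List.flatMap_cons, List.flatMap_map, twist, hmod, torusStep,
    if_pos (by simp)]
  have e : ∀ t ∈ List.range m, torusStep m ε ((a * (m + 1) + t.succ) % (m + 2))
      (a * (m + 1) + t.succ) = [(((((-(0 + (a : ℤ) - 1 - t)) % ((m + 2 : ℕ) : ℤ)).toNat * m +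
        (m - 1 - t), ε) : Crossing), !decide (ε = 1))] := by
    intro t ht
    have := List.mem_range.1 ht
    rw [torusStep, Nat.mul_add_mod_of_lt (by omega), if_neg (by omega), hmod, hε,
      show (t.succ : ℤ) - a = -(0 + (a : ℤ) - 1 - t) by push_cast; ring,
      show m - t.succ = m - 1 - t by omega]
  rw [List.flatMap_congr e, ← List.map_eq_flatMap]
  simp

/-! ### The common sign, and comparison with the torus diagram -/

namespace Arcs

variable {k : ℕ} {O U : ℤ → List Passage} {x : ℤ → ℤ → Crossing}

theorem mirror (A : Arcs k O U x) :
    Arcs k (fun i => (O i).map mirrorPassage) (fun i => (U i).map mirrorPassage)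
      (fun i j => ((x i j).1, -(x i j).2)) where
  three_le := A.three_le
  over_add i := by rw [A.over_add]
  under_add i := by rw [A.under_add]
  crossing_add_left i j := by rw [A.crossing_add_left]
  crossing_add_right i j := by rw [A.crossing_add_right]
  mem_over i m := by
    rw [mem_map_of_involutive mirrorPassage_involutive, A.mem_over]
    constructor
    · rintro ⟨j, h1, h2, h3⟩
      exact ⟨j, h1, h2, by rw [← mirrorPassage_involutive m, h3]; rfl⟩
    · rintro ⟨j, h1, h2, rfl⟩
      exact ⟨j, h1, h2, by simp [mirrorPassage]⟩
  mem_under i m := by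
    rw [mem_map_of_involutive mirrorPassage_involutive, A.mem_under]
    constructor
    · rintro ⟨j, h1, h2, h3⟩
      exact ⟨j, h1, h2, by rw [← mirrorPassage_involutive m, h3]; rfl⟩
    · rintro ⟨j, h1, h2, rfl⟩
      exact ⟨j, h1, h2, by simp [mirrorPassage]⟩
  good := by
    have := A.good.mirror
    simpa only [segment, List.map_flatMap, List.map_append] using this

theorem idxOf_map_mirror (l : List Passage) (y : Crossing) (b : Bool) :
    (l.map mirrorPassage).idxOf ((y.1, -y.2), b) = l.idxOf (y, b) := by
  have : (((y.1, -y.2), b) : Passage) = mirrorPassage (y, b) := rfl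
  rw [this]
  induction l with
  | nil => rfl
  | cons a l ih =>
    simp only [List.map_cons, List.idxOf_cons, ih, mirrorPassage_involutive.injective.eq_iff, beq_eq_decide]

/-- O 2 begins outside the curve of (0, 1) and meets it exactly once, in U 0; so it ends inside, and
this fixes the sign. -/
theorem sgn_prev_eq (A : Arcs k O U x) : sgn (x 2 0) = sgn (x 0 1) := by
  have hk := A.three_le
  obtain ⟨S, T, hL⟩ := A.exists_arcLabels
  have h1 := hL.over_step 2 le_rfl (by omega)
  have h2 := hL.under_mem 2 le_rfl (by omega)
  rw [hL.start, underTail, if_neg (by omega)] at h1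
  rcases sgn_eq (x 2 0) with ⟨-, e⟩ | ⟨-, e⟩ <;> rcases sgn_eq (x 0 1) with ⟨-, e'⟩ | ⟨-, e'⟩ <;>
    rw [e] at h1 ⊢ <;> rw [e'] at h2 ⊢ <;> rcases h2 with h2 | h2 <;> linarith

/-- U (k - 1) ends outside the curve of (0, 1) and meets it exactly once, in O 1. This gives the
sign of the crossing (1, -1), which is that of (-1, 0) by the shifted `sgn_prev_eq`. -/
theorem sgn_next_eq (A : Arcs k O U x) : sgn (x (-1) 0) = sgn (x 0 1) := by
  have hk := A.three_le
  obtain ⟨S, T, hL⟩ := A.exists_arcLabels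
  have h1 := hL.under_step (k - 1) (by omega) (by omega)
  have h2 := hL.under_mem (k - 1) (by omega) (by omega)
  rw [sub_add_cancel, hL.over_last, overTail, if_neg (by omega)] at h1
  have h3 := (A.shift (-1)).sgn_prev_eq
  norm_num at h3
  have h4 := A.crossing_add_right 1 (-1)
  rw [show (-1 : ℤ) + k = k - 1 by ring] at h4
  rw [← h3, ← h4]
  rcases sgn_eq (x 1 (k - 1)) with ⟨-, e⟩ | ⟨-, e⟩ <;>
    rcases sgn_eq (x 0 1) with ⟨-, e'⟩ | ⟨-, e'⟩ <;>
    rw [e] at h1 ⊢ <;> rw [e'] at h2 ⊢ <;> rcases h2 with h2 | h2 <;> linarith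

theorem sgn_eq_sgn (A : Arcs k O U x) (i : ℤ) : sgn (x i (i + 1)) = sgn (x 0 1) := by
  have key : ∀ i, sgn (x i (i + 1)) = sgn (x (i + 1) (i + 1 + 1)) := by
    intro i
    have := (A.shift (i + 1)).sgn_next_eq
    simpa only [add_zero, add_neg_cancel_right] using this
  induction i using Int.induction_on with
  | zero => rfl
  | succ i ih => rw [← key, ih]
  | pred i ih =>
    rw [key, sub_add_cancel]
    exact ih

theorem rigid (A : Arcs k O U x) (h : sgn (x 0 1) = 1) : Rigid k O U x (k - 1) := by
  refine Rigid.top ⟨A, by have := A.three_le; omega, fun i => (A.sgn_eq_sgn i).trans h, fun i => ?_,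
    ?_, ?_, ?_, ?_, ?_, ?_⟩
  · have := (A.shift i).sgn_prev_eq
    rw [add_zero] at this
    rw [this, A.sgn_eq_sgn, h]
  -- For r = 2 the other conditions of `Rigid` are empty.
  all_goals intro i j h1 h2; omega

/-- All crossings have the same sign, and their order on the arcs is determined. -/
theorem exists_sign_order (A : Arcs k O U x) : ∃ ε : ℤˣ,
    (∀ i j : ℤ, i + 1 ≤ j → j ≤ i + k - 2 → (x i j).2 = ε) ∧
    (∀ i j : ℤ, i + 1 ≤ j → j + 1 ≤ i + k - 2 → overPos O x i (j + 1) < overPos O x i j) ∧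
    ∀ i j : ℤ, i + 2 ≤ j → j ≤ i + k - 2 → underPos U x (i + 1) j < underPos U x i j := by
  have one {y : Crossing} (h : sgn y = 1) : y.2 = 1 := by
    rcases sgn_eq y with e | e
    · exact e.1
    · rw [e.2] at h; norm_num at h
  rcases sgn_eq (x 0 1) with ⟨-, h⟩ | ⟨h', h⟩
  · have h := A.rigid h
    exact ⟨1, fun i j h1 h2 => one (h.sgn_eq_one h1 h2), fun i j => h.over_succ_lt,
      fun i j => h.under_succ_lt⟩
  -- Reflection changes all signs and keeps the order along the arcs, so the negative case reduces
  -- to the positive one.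
  · have h := A.mirror.rigid (by simp [sgn, h'])
    refine ⟨-1, fun i j h1 h2 => ?_, fun i j h1 h2 => ?_, fun i j h1 h2 => ?_⟩
    · have := one (h.sgn_eq_one h1 h2)
      exact neg_eq_iff_eq_neg.1 this
    · have := h.over_succ_lt h1 h2
      simpa only [overPos, idxOf_map_mirror] using this
    · have := h.under_succ_lt h1 h2
      simpa only [underPos, idxOf_map_mirror] using this

end Arcs

theorem eq_map_range {l : List Passage} (hl : l.Nodup) {m : ℕ} {f : ℕ → Passage}
    (hf : ∀ a, a ∈ l ↔ ∃ t < m, f t = a)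
    (h : ∀ t, t + 1 < m → l.idxOf (f t) < l.idxOf (f (t + 1))) : l = (List.range m).map f := by
  have hmono : ∀ s t, s < t → t < m → l.idxOf (f s) < l.idxOf (f t) := by
    intro s t hst
    induction t, hst using Nat.le_induction with
    | base => exact h s
    | succ t _ ih => exact fun ht => (ih (by omega)).trans (h t ht)
  have h1 : l.Pairwise fun a b => l.idxOf a < l.idxOf b := by
    rw [List.pairwise_iff_getElem]
    intro i j hi hj hij
    rwa [hl.idxOf_getElem, hl.idxOf_getElem]
  have h2 : ((List.range m).map f).Pairwise fun a b => l.idxOf a < l.idxOf b := by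
    rw [List.pairwise_map, List.pairwise_iff_getElem]
    intro i j hi hj hij
    simp only [List.getElem_range]
    exact hmono i j hij (by simpa using hj)
  have h3 : ((List.range m).map f).Nodup :=
    h2.imp fun {a b} hab => by rintro rfl; exact lt_irrefl _ hab
  have h4 : l.Perm ((List.range m).map f) := by
    rw [List.perm_ext_iff_of_nodup hl h3]
    intro a
    rw [hf]
    simp
  exact h4.eq_of_pairwise (fun a b _ _ hab hba => absurd hab hba.asymm) h1 h2

/-- A bijection between finite sets of natural numbers extends to a permutation of all of them; a
permutation of the numbers alone keeps the signs. -/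
theorem exists_rename {ι : Type*} [Fintype ι] {y y' : ι → Crossing} (ε : ℤˣ)
    (hy : Function.Injective y) (hy' : Function.Injective y') (hε : ∀ i, (y i).2 = ε)
    (hε' : ∀ i, (y' i).2 = ε) :
    ∃ f : Crossing ≃ Crossing, (∀ z, (f z).2 = z.2) ∧ ∀ i, f (y i) = y' i := by
  classical
  have key : ∀ {y : ι → Crossing}, Function.Injective y → (∀ i, (y i).2 = ε) →
      Function.Injective fun i => (y i).1 := fun hy hε i j hij =>
    hy (Prod.ext hij ((hε i).trans (hε j).symm))
  let e := Fintype.equivFin ι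
  have := Equiv.Perm.isMultiplyPretransitive ℕ (Fintype.card ι)
  obtain ⟨g, hg⟩ := MulAction.exists_smul_eq (Equiv.Perm ℕ)
    (e.symm.toEmbedding.trans ⟨_, key hy hε⟩) (e.symm.toEmbedding.trans ⟨_, key hy' hε'⟩)
  refine ⟨g.prodCongr (Equiv.refl _), fun z => rfl, fun i => Prod.ext ?_ ?_⟩
  · have := DFunLike.congr_fun hg (e i)
    simpa using this
  · exact (hε i).trans (hε' i).symm

theorem sameCode_twist {k m : ℕ} (hk : 0 < k) (b : Bool) {y y' : ℤ → ℕ → Crossing} (ε : ℤˣ)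
    (hp : ∀ a t, y (a + k) t = y a t) (hp' : ∀ a t, y' (a + k) t = y' a t)
    (hε : ∀ a t, t < m → (y a t).2 = ε) (hε' : ∀ a t, t < m → (y' a t).2 = ε)
    (hy : ∀ (a a' : ℤ) (t t' : ℕ), 0 ≤ a → a < k → 0 ≤ a' → a' < k → t < m → t' < m → y a t = y a' t' →
      a = a' ∧ t = t')
    (hy' : ∀ (a a' : ℤ) (t t' : ℕ), 0 ≤ a → a < k → 0 ≤ a' → a' < k → t < m → t' < m → y' a t = y' a' t' →
      a = a' ∧ t = t') :
    SameCode (segment k (twist m b y) 0 : List Passage) (segment k (twist m b y') 0 : List Passage) := by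
  have inj : ∀ {y : ℤ → ℕ → Crossing}, (∀ (a a' : ℤ) (t t' : ℕ), 0 ≤ a → a < k → 0 ≤ a' → a' < k → t < m →
      t' < m → y a t = y a' t' → a = a' ∧ t = t') →
      Function.Injective fun i : Fin k × Fin m => y (i.1 : ℕ) i.2 := by
    rintro y hy ⟨i, t⟩ ⟨i', t'⟩ h
    obtain ⟨h1, h2⟩ := hy _ _ _ _ (by omega) (by omega) (by omega) (by omega) t.2 t'.2 h
    exact Prod.ext (Fin.ext (by simpa using h1)) (Fin.ext h2)
  obtain ⟨f, hf, hfy⟩ := exists_rename ε (inj hy) (inj hy') (fun i => hε _ _ i.2.2)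
    fun i => hε' _ _ i.2.2
  have hf' : ∀ a t, t < m → f (y a t) = y' a t := by
    intro a t ht
    obtain ⟨n, h1, h2⟩ := exists_window (k := k) (by omega) 0 a
    have h3 := periodic_mul (a := fun a => y a t) (fun a => hp a t) a n
    have h4 := periodic_mul (a := fun a => y' a t) (fun a => hp' a t) a n
    rw [← h3, ← h4]
    obtain ⟨c, hc⟩ := Int.eq_ofNat_of_zero_le h1
    have h5 : c < k := by omega
    rw [hc]
    exact hfy (⟨c, h5⟩, ⟨t, ht⟩)
  refine ⟨f, hf, ?_⟩
  rw [Cycle.map_coe, segment, segment, List.map_flatMap]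
  congr 1
  refine List.flatMap_congr fun a _ => ?_
  rw [twist, twist, List.map_append, List.map_map, List.map_map]
  congr 1
  · refine List.map_congr_left fun t ht => ?_
    exact Prod.ext (hf' _ _ (List.mem_range.1 ht)) rfl
  · refine List.map_congr_left fun t ht => ?_
    have := List.mem_range.1 ht
    exact Prod.ext (hf' _ _ (by omega)) rfl

namespace Arcs

variable {k m : ℕ} {O U : ℤ → List Passage} {x : ℤ → ℤ → Crossing}

theorem over_eq (A : Arcs (m + 2) O U x)
    (h : ∀ i j : ℤ, i + 1 ≤ j → j + 1 ≤ i + (m + 2 : ℕ) - 2 →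
      overPos O x i (j + 1) < overPos O x i j) (i : ℤ) :
    O i = (List.range m).map fun t : ℕ => (x i (i + m - t), true) := by
  refine eq_map_range (A.over_nodup i) (fun a => ?_) fun t ht => ?_
  · rw [A.mem_over]
    constructor
    · rintro ⟨j, h1, h2, rfl⟩
      push_cast at h2
      refine ⟨(i + m - j).toNat, by omega, ?_⟩
      rw [Int.toNat_of_nonneg (by omega), sub_sub_cancel]
    · rintro ⟨t, ht, rfl⟩
      exact ⟨_, by omega, by push_cast; omega, rfl⟩
  · have := h i (i + m - (t + 1 : ℕ)) (by push_cast; omega) (by push_cast; omega)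
    rwa [show i + (m : ℤ) - (t + 1 : ℕ) + 1 = i + m - t by push_cast; ring] at this

theorem under_eq (A : Arcs (m + 2) O U x)
    (h : ∀ i j : ℤ, i + 2 ≤ j → j ≤ i + (m + 2 : ℕ) - 2 →
      underPos U x (i + 1) j < underPos U x i j) (j : ℤ) :
    U j = (List.range m).map fun t : ℕ => (x (j - 1 - t) j, false) := by
  refine eq_map_range (A.under_nodup j) (fun a => ?_) fun t ht => ?_
  · rw [A.mem_under]
    constructor
    · rintro ⟨i, h1, h2, rfl⟩
      push_cast at h2
      refine ⟨(j - 1 - i).toNat, by omega, ?_⟩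
      rw [Int.toNat_of_nonneg (by omega), sub_sub_cancel]
    · rintro ⟨t, ht, rfl⟩
      exact ⟨_, by omega, by push_cast; omega, rfl⟩
  · have := h (j - 1 - (t + 1 : ℕ)) j (by push_cast; omega) (by push_cast; omega)
    rwa [show j - 1 - ((t + 1 : ℕ) : ℤ) + 1 = j - 1 - t by push_cast; ring] at this

theorem eq_of_crossing_eq (A : Arcs k O U x) {i j j' : ℤ} (h1 : i + 1 ≤ j) (h2 : j ≤ i + k - 2)
    (h1' : i + 1 ≤ j') (h2' : j' ≤ i + k - 2) (h : x i j = x i j') : j = j' := by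
  rcases lt_trichotomy j j' with hlt | rfl | hlt
  · exact absurd (by rw [overPos, h, overPos]) (A.overPos_inj h1 hlt h2')
  · rfl
  · exact absurd (by rw [overPos, ← h, overPos]) (A.overPos_inj h1' hlt h2)

theorem eq_of_crossing_eq' (A : Arcs k O U x) {i i' j : ℤ} (h1 : i + 1 ≤ j) (h2 : j ≤ i + k - 2)
    (h1' : i' + 1 ≤ j) (h2' : j ≤ i' + k - 2) (h : x i j = x i' j) : i = i' := by
  rcases lt_trichotomy i i' with hlt | rfl | hlt
  · exact absurd (by rw [underPos, h, underPos]) (A.underPos_inj h1' hlt h2)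
  · rfl
  · exact absurd (by rw [underPos, ← h, underPos]) (A.underPos_inj h1 hlt h2')

end Arcs

/-- The leftmost strand of the negative torus braid starts with an underpass, so for negative sign
the knot has to be cut before its underpasses. -/
theorem segment_isRotated_under {k : ℕ} {O U : ℤ → List Passage} (hk : 0 < k)
    (hO : ∀ i, O (i + k) = O i) :
    segment k (fun l => O l ++ U l) 0 ~r segment k (fun l => U l ++ O (l + 1)) 0 := by
  have key : ∀ n : ℕ, O 0 ++ segment n (fun l => U l ++ O (l + 1)) 0 =
      segment n (fun l => O l ++ U l) 0 ++ O n := by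
    intro n
    induction n with
    | zero => simp [segment]
    | succ n ih =>
      rw [segment_succ, segment_succ, ← List.append_assoc, ih]
      simp
  have h0 := hO 0
  rw [zero_add] at h0
  obtain ⟨n, rfl⟩ := Nat.exists_eq_succ_of_ne_zero hk.ne'
  have h := key (n + 1)
  rw [h0, segment_succ' n fun l => O l ++ U l, List.append_assoc, List.append_assoc,
    List.append_cancel_left_eq, ← List.append_assoc] at h
  rw [Nat.succ_eq_add_one, h, segment_succ', List.append_assoc]
  exact List.isRotated_append

theorem torusName_inj {m : ℕ} (ε : ℤˣ) {a a' : ℤ} {t t' : ℕ} (h0 : 0 ≤ a) (h1 : a < (m + 2 : ℕ))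
    (h0' : 0 ≤ a') (h1' : a' < (m + 2 : ℕ)) (ht : t < m) (ht' : t' < m)
    (h : (((-a % ((m + 2 : ℕ) : ℤ)).toNat * m + t, ε) : Crossing) =
      ((-a' % ((m + 2 : ℕ) : ℤ)).toNat * m + t', ε)) : a = a' ∧ t = t' := by
  have h2 := congrArg Prod.fst h
  simp only at h2
  have h3 : t = t' := by
    have := congrArg (· % m) h2
    simpa only [Nat.mul_add_mod_of_lt ht, Nat.mul_add_mod_of_lt ht'] using this
  subst h3
  refine ⟨?_, rfl⟩
  have h4 := Nat.eq_of_mul_eq_mul_right (by omega) (Nat.add_right_cancel h2)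
  have h5 : -a ≡ -a' [ZMOD ((m + 2 : ℕ) : ℤ)] := by
    have e1 := Int.emod_nonneg (-a) (b := ((m + 2 : ℕ) : ℤ)) (by omega)
    have e2 := Int.emod_nonneg (-a') (b := ((m + 2 : ℕ) : ℤ)) (by omega)
    unfold Int.ModEq
    omega
  have h6 := h5.neg
  rw [neg_neg, neg_neg] at h6
  unfold Int.ModEq at h6
  rwa [Int.emod_eq_of_lt h0 h1, Int.emod_eq_of_lt h0' h1'] at h6

theorem closedBraidCode_torusBraid {m : ℕ} {q : ℤ} {ε : ℤˣ} (hq : q.natAbs = m + 2)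
    (hε : (if 0 ≤ q then (1 : ℤˣ) else -1) = ε) :
    closedBraidCode (m + 2 - 1) (torusBraid (m + 2 - 1) q) =
      (segment (m + 2) (twist m (decide (ε = 1))
        fun a t => (((-a) % ((m + 2 : ℕ) : ℤ)).toNat * m + t, ε)) 0 : List Passage) := by
  rw [← traverseClosedBraid_torus, closedBraidCode, torusBraid, hq, hε]
  rfl

/-- Diagrams cut into arcs that cross each other as often as possible are standard diagrams of
torus knots. -/
theorem Arcs.sameCode {m : ℕ} {O U : ℤ → List Passage} {x : ℤ → ℤ → Crossing}
    (A : Arcs (m + 2) O U x) :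
    ∃ ε : ℤˣ, SameCode (segment (m + 2) (fun l => O l ++ U l) 0 : List Passage)
      (segment (m + 2) (twist m (decide (ε = 1))
        fun a t => (((-a) % ((m + 2 : ℕ) : ℤ)).toNat * m + t, ε)) 0 : List Passage) := by
  obtain ⟨ε, h1, h2, h3⟩ := A.exists_sign_order
  have hO := A.over_eq h2
  have hU := A.under_eq h3
  have hk : 0 < m + 2 := by omega
  have hp : ∀ a t, ((((-(a + ((m + 2 : ℕ) : ℤ))) % ((m + 2 : ℕ) : ℤ)).toNat * m + t, ε) : Crossing) =
      (((-a) % ((m + 2 : ℕ) : ℤ)).toNat * m + t, ε) := by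
    intro a t
    rw [neg_add, ← sub_eq_add_neg, Int.sub_emod_right]
  refine ⟨ε, ?_⟩
  rcases Int.units_eq_one_or ε with rfl | rfl
  · have e : (fun l => O l ++ U l) = twist m (decide ((1 : ℤˣ) = 1)) fun a t => x a (a + m - t) := by
      funext a
      simp only
      rw [hO, hU, twist]
      congr 1
      refine List.map_congr_left fun t ht => ?_
      have := List.mem_range.1 ht
      rw [show a - 1 - t + (m : ℤ) - ((m - 1 - t : ℕ) : ℤ) = a by omega]
      rfl
    rw [e]
    refine sameCode_twist hk _ 1 (fun a t => ?_) hp (fun a t ht => ?_) (fun a t _ => rfl) ?_ ?_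
    · rw [A.crossing_add_left, ← A.crossing_add_right a (a + m - t)]
      congr 1
      ring
    · exact h1 _ _ (by omega) (by push_cast; omega)
    · intro a a' t t' g1 g2 g3 g4 ht ht' h
      replace h : x a (a + m - t) = x a' (a' + m - t') := h
      have e1 := A.mem_over' (i := a) (j := a + m - t) (by omega) (by push_cast; omega)
      have e2 := A.mem_over' (i := a') (j := a' + m - t') (by omega) (by push_cast; omega)
      rw [← h] at e2
      obtain rfl := A.eq_of_mem_over g1 g2 g3 g4 e1 e2
      have := A.eq_of_crossing_eq (by omega) (by push_cast; omega) (by omega) (by push_cast; omega) h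
      exact ⟨rfl, by omega⟩
    · intro a a' t t' g1 g2 g3 g4 ht ht' h
      exact torusName_inj 1 g1 g2 g3 g4 ht ht' h
  -- In the negative case the underpass gives the first half of the block, so the crossings are
  -- named by their underpass `a` instead of their overpass.
  · have e : (fun l => U l ++ O (l + 1)) =
        twist m (decide ((-1 : ℤˣ) = 1)) fun a t => x (a - 1 - t) a := by
      funext a
      rw [hO, hU, twist]
      congr 1
      refine List.map_congr_left fun t ht => ?_
      have := List.mem_range.1 ht
      rw [← A.crossing_add_left (a - 1 - t - 1 - ((m - 1 - t : ℕ) : ℤ)), ← A.crossing_add_right _ (a - 1 - t),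
        show a - 1 - t - 1 - ((m - 1 - t : ℕ) : ℤ) + (m + 2 : ℕ) = a + 1 by omega,
        show a - 1 - t + ((m + 2 : ℕ) : ℤ) = a + 1 + m - t by push_cast; ring]
      rfl
    rw [Cycle.coe_eq_coe.2 (segment_isRotated_under hk A.over_add), e]
    refine sameCode_twist hk _ (-1) (fun a t => ?_) hp (fun a t ht => ?_) (fun a t _ => rfl) ?_ ?_
    · rw [A.crossing_add_right, ← A.crossing_add_left (a - 1 - t)]
      congr 1
      ring
    · exact h1 _ _ (by omega) (by push_cast; omega)
    · intro a a' t t' g1 g2 g3 g4 ht ht' h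
      replace h : x (a - 1 - t) a = x (a' - 1 - t') a' := h
      have e1 := A.mem_under' (i := a - 1 - t) (j := a) (by omega) (by push_cast; omega)
      have e2 := A.mem_under' (i := a' - 1 - t') (j := a') (by omega) (by push_cast; omega)
      rw [← h] at e2
      obtain rfl := A.eq_of_mem_under g1 g2 g3 g4 e1 e2
      have := A.eq_of_crossing_eq' (by omega) (by push_cast; omega) (by omega) (by push_cast; omega) h
      exact ⟨rfl, by omega⟩
    · intro a a' t t' g1 g2 g3 g4 ht ht' h
      exact torusName_inj (-1) g1 g2 g3 g4 ht ht' h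

end KnotTheory

theorem theorem3p1 (D : KnotTheory.KnotDiagram)
    (hmin : D.IsCrossingMinimal)
    (hnontrivial : D.IsNontrivial)
    (hcb : (D.crossingNumber : ℤ) = (D.overpassNumber : ℤ) * ((D.overpassNumber : ℤ) - 2)) :
    (D.IsStandardTorusDiagram (D.overpassNumber - 1) (D.overpassNumber : ℤ) ∨
      D.IsStandardTorusDiagram (D.overpassNumber - 1) (-(D.overpassNumber : ℤ))) ∧
    (D.IsTorusKnot (D.overpassNumber - 1) (D.overpassNumber : ℤ) ∨
      D.IsTorusKnot (D.overpassNumber - 1) (-(D.overpassNumber : ℤ))) := by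
  -- The statement on the knot follows from that on the diagram, as `D` itself is then a standard
  -- diagram of its knot.
  suffices h : D.IsStandardTorusDiagram (D.overpassNumber - 1) (D.overpassNumber : ℤ) ∨
      D.IsStandardTorusDiagram (D.overpassNumber - 1) (-(D.overpassNumber : ℤ)) from
    ⟨h, h.imp (fun h => ⟨D, h, Relation.EqvGen.refl _⟩) fun h => ⟨D, h, Relation.EqvGen.refl _⟩⟩
  obtain ⟨O, U, x, A, hw⟩ := D.exists_arcs hmin hnontrivial hcb
  unfold KnotTheory.KnotDiagram.IsStandardTorusDiagram
  rw [hw]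
  generalize D.overpassNumber = k at A ⊢
  obtain ⟨m, rfl⟩ := Nat.exists_eq_add_of_le' (show 2 ≤ k by have := A.three_le; omega)
  obtain ⟨ε, h⟩ := A.sameCode
  rcases Int.units_eq_one_or ε with rfl | rfl
  · left
    rwa [KnotTheory.closedBraidCode_torusBraid (ε := 1) (by omega) (if_pos (by omega))]
  · right
    rwa [KnotTheory.closedBraidCode_torusBraid (ε := -1) (by omega) (if_neg (by omega))]
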